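/- **Setting.** Let $\mathsf{G}$ be a type-1 bilinear group generator: on input $1^\lambda$ it outputs (the polynomial-size description of) $\mathcal{G}=(p,\mathbb{G},\mathbb{G}_T,e)$ with $\mathbb{G},\mathbb{G}_T$ groups of prime order $p\neq 2$, with uniquely represented elements and polynomial-time group operations, and $e:\mathbb{G}\times\mathbb{G}\to\mathbb{G}_T$ a polynomial-time computable map with $e(u^a,v^b)=e(u,v)^{ab}$ and $e(u,v)\ne 1$ for $u,v\neq 1$. Write $\mathbb{G}^*=\mathbb{G}\setminus\{1\}$, $\mathbb{Z}_p^*=\mathbb{Z}_p\setminus\{0\}$. Let $T=T(\lambda)$ be polynomially bounded, $[T]=\{1,\dots,T\}$. PPT means probabilistic polynomial time; all probabilities are over the generation of $\mathcal{G}$ and all other random choices. **1-MSDH-2 assumption over $\mathsf{G}$.** For $\mathcal{G}\leftarrow\mathsf{G}(1^\lambda)$ and uniform $g\in\mathbb{G}^*$, $a,b,x\in\mathbb{Z}_p^*$, every PPT adversary which is given $(\mathcal{G},g,g^x,g^{x^2},g^b,g^{bx},g^{bx^2},g^a,g^{abx})$ has only negligible probability (in $\lambda$) of outputting a tuple $(w,P,h^{1/(x+w)},h^{a/(x\cdot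 P(x))})$ with $h\in\mathbb{G}^*$, $w\in\mathbb{Z}_p^*$, $P\in\mathbb{Z}_p[X]$ of degree at most $1$, $X+w$ and $P(X)$ relatively prime, $x+w\neq0$ and $P(x)\ne 0$. **The scheme $\mathsf{SAS_{LLY}}$.** Public parameters are $\mathcal{G}\leftarrow\mathsf{G}(1^\lambda)$, $T$, a uniform $g\in\mathbb{G}^*$, and hash functions $H_1:[T]\to\mathbb{G}$, $H_2:[T]\to\mathbb{G}^*$, $H_3:[T]\times\{0,1\}^*\to\mathbb{Z}_p$. Key generation: $\mathsf{sk}=x$ uniform in $\mathbb{Z}_p^*$, $\mathsf{vk}=g^x$. The signature on $m\in\{0,1\}^*$ in period $t\in[T]$ is $(E,t)$ with $E=H_1(t)^{\mathsf{sk}}H_2(t)^{m'\mathsf{sk}}$, $m'=H_3(t,m)$; it is valid if $e(E,g)=e(H_1(t)H_2(t)^{m'},\mathsf{vk})$. Valid signatures $(E_i,t)$ of the same period under pairwise distinct keys are aggregated to $(\prod_iE_i,t)$. An aggregate signature $(E',t)$, $t\in[T]$, is accepted for $(\mathsf{vk}_1,\dots,\mathsf{vk}_r)$, $(m_1,\dots,m_r)$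 if the $\mathsf{vk}_i$ are pairwise distinct and $e(E',g)=e\big(H_1(t),\prod_i\mathsf{vk}_i\big)\cdot e\big(H_2(t),\prod_i\mathsf{vk}_i^{H_3(t,m_i)}\big)$. **EUF-CMA game in the certified-key model and the random oracle model.** The challenger generates public parameters and a key pair $(\mathsf{vk}^*,\mathsf{sk}^*)$, sets $Q=L=\emptyset$, $t_{ctr}=1$, and gives the public parameters and $\mathsf{vk}^*$ to the adversary, who has access, throughout the game, to: the random oracles $H_1,H_2,H_3$ (independent uniformly random functions); a certification oracle, which on $(\mathsf{vk},\mathsf{sk})$ adds $\mathsf{vk}$ to $L$ and accepts if this is a possible output of key generation, and rejects otherwise; and a signing oracle, which returns $\bot$ if $t_{ctr}\notin[T]$, and otherwise on "skip" increases $t_{ctr}$ by one, and on ("sign", $m$) adds $m$ to $Q$, returns a signature on $m$ under $\mathsf{sk}^*$ in period $t_{ctr}$, and increases $t_{ctr}$ by one. The adversary wins if it outputs keys $\mathsf{vk}_1,\dots,\mathsf{vk}_r$, messages $m_1,\dots,m_r$ and an aggregate signature that is accepted, such that $\mathsf{vk}_j\in L$ for all $j$ with $\mathsf{vk}_j\neq\mathsf{vk}^*$,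 and $\mathsf{vk}_{j}=\mathsf{vk}^*$, $m_{j}\notin Q$ for some $j$. **Corollary 1.** If the 1-MSDH-2 assumption over $\mathsf{G}$ holds, then, in the random oracle model, $\mathsf{SAS_{LLY}}$ over $\mathsf{G}$ is EUF-CMA secure in the certified-key model: every PPT adversary wins the game above with probability negligible in $\lambda$ only. -/

import Mathlib

namespace SynchAgg

/-! ### Data and probabilistic programs with a step count -/

/-- The objects that programs work on: binary trees whose leaves are bit strings. -/
inductive Data : Type
  | str (s : List Bool)
  | pair (a b : Data)

namespace Data

/-- The length of a datum (number of bits and nodes). -/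
def size : Data → ℕ
  | str s => s.length + 1
  | pair a b => a.size + b.size + 1

/-- The empty string; it serves as `⊥`, as "false", and as the number `0`. -/
def bot : Data := str []

/-- A natural number in binary, least significant bit first, without superfluous bits. -/
def num (n : ℕ) : Data := str n.bits

/-- The number that a bit string denotes in binary (least significant bit first). -/
def toNat : Data → ℕ
  | str s => s.foldr Nat.bit 0
  | pair _ _ => 0

/-- The unary string `1ⁿ`. -/
def ones (n : ℕ) : Data := str (List.replicate n true)

/-- Truth values: `1` and the empty string. -/
def ofBool (b : Bool) : Data := if b then str [true] else bot

/-- A tuple or list as one datum. -/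
def ofList : List Data → Data
  | [] => bot
  | a :: l => pair a (ofList l)

open Classical in
/-- The object with code `d`, if there is one (`enc` is an injective coding). -/
noncomputable def decode {α : Type} (enc : α → Data) (d : Data) : Option α :=
  if h : ∃ a, enc a = d then some h.choose else none

end Data

/-- Elementary deterministic operations. -/
inductive Op : Type
  | id | fst | snd | isPair | eq
  | head | tail | cons
  | add | sub | mul | div | mod | lt

open Classical in
/-- The effect of an elementary operation; binary operations act on a pair, arithmetic is that of
natural numbers in binary, and ill-formed arguments give `⊥` or are read as `0`. -/
noncomputable def Op.eval : Op → Data → Data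
  | .id, x => x
  | .fst, .pair a _ => a
  | .snd, .pair _ b => b
  | .isPair, .pair _ _ => Data.ofBool true
  | .eq, .pair a b => Data.ofBool (decide (a = b))
  | .head, .str (c :: _) => Data.ofBool c
  | .tail, .str (_ :: s) => .str s
  | .cons, .pair a (.str s) => .str (decide (a ≠ Data.bot) :: s)
  | .add, .pair a b => Data.num (a.toNat + b.toNat)
  | .sub, .pair a b => Data.num (a.toNat - b.toNat)
  | .mul, .pair a b => Data.num (a.toNat * b.toNat)
  | .div, .pair a b => Data.num (a.toNat / b.toNat)
  | .mod, .pair a b => Data.num (a.toNat % b.toNat)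
  | .lt, .pair a b => Data.ofBool (decide (a.toNat < b.toNat))
  | _, _ => Data.bot

/-- Probabilistic programs; each maps an input datum to a (random) output datum. -/
inductive Prog : Type
  /-- an elementary operation -/
  | op (o : Op)
  /-- a constant output -/
  | const (d : Data)
  /-- first `f`, then `g` on its output -/
  | seq (f g : Prog)
  /-- `x ↦ (f x, g x)` -/
  | fork (f g : Prog)
  /-- if the output of `t` is not `⊥` then `f`, else `g` -/
  | cond (t f g : Prog)
  /-- while the output of `t` is not `⊥`, replace `x` by `f x` -/
  | loop (t f : Prog)
  /-- a uniformly random number below the input number (`0` if that is `0`) -/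
  | sample

/-- Randomized computations with a time budget: from the budget available to a result and the
budget left, or to failure if the budget is exceeded. -/
abbrev Timed : Type → Type := StateT ℕ (OptionT PMF)

/-- Spend `k` units of time. -/
noncomputable def tick (k : ℕ) : Timed Unit := fun b =>
  if k ≤ b then pure ((), b - k) else failure

open Classical in
/-- At most `n` tests of a loop with test `t` and body `f`. -/
noncomputable def whileLoop (t f : Data → Timed Data) : ℕ → Data → Timed Data
  | 0, _ => fun _ => failure
  | n + 1, x => do
    tick (1 + x.size)
    let c ← t x
    if c = Data.bot then pure x
    else do
      let y ← f x
      whileLoop t f n y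

/-- A uniformly random number below `n` (`0` if `n = 0`). -/
noncomputable def uniformBelow (n : ℕ) : PMF ℕ :=
  PMF.uniformOfFinset (insert 0 (Finset.range n)) (Finset.insert_nonempty _ _)

open Classical in
/-- The execution of a program. Every step costs at least `1`, and at least the length of what it
reads and writes (logarithmic cost), so that polynomial time is what it is for Turing machines.
A loop can be tested at most `b` times with budget `b`, so the bound `b + 1` never matters. -/
noncomputable def Prog.run : Prog → Data → Timed Data
  | .op o, x => do
    tick (1 + x.size + (o.eval x).size)
    pure (o.eval x)
  | .const d, x => do
    tick (1 + x.size + d.size)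
    pure d
  | .seq f g, x => do
    let y ← f.run x
    g.run y
  | .fork f g, x => do
    tick (1 + x.size)
    let y ← f.run x
    let z ← g.run x
    pure (Data.pair y z)
  | .cond t f g, x => do
    tick (1 + x.size)
    let c ← t.run x
    if c = Data.bot then g.run x else f.run x
  | .loop t f, x => do
    let b ← get
    whileLoop t.run f.run (b + 1) x
  | .sample, x => do
    let n : ℕ ← (StateT.lift (OptionT.lift (uniformBelow x.toNat)) : Timed ℕ)
    tick (1 + x.size + (Data.num n).size)
    pure (Data.num n)

/-- The output of a program that is stopped, without output, after `b` units of time. -/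
noncomputable def Prog.output (c : Prog) (b : ℕ) (x : Data) : PMF (Option Data) :=
  ((c.run x).run' b).run

/-- Negligible functions: `f(n)` tends to `0` faster than every `1 / n ^ c`. -/
def Negligible (f : ℕ → ℝ) : Prop :=
  Asymptotics.SuperpolynomialDecay Filter.atTop (fun n : ℕ => (n : ℝ)) f

/-! ### Bilinear groups of type 1 -/

/-- A type-1 bilinear group `(p, 𝔾, 𝔾_T, e)`, with a representation of the group elements. -/
structure PairingGroup : Type 1 where
  p : ℕ
  prime : p.Prime
  G : Type
  GT : Type
  [groupG : CommGroup G]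
  [groupGT : CommGroup GT]
  card_G : Nat.card G = p
  card_GT : Nat.card GT = p
  e : G → G → GT
  bilinear : ∀ (u v : G) (a b : ℕ), e (u ^ a) (v ^ b) = e u v ^ (a * b)
  nondegenerate : ∀ u v : G, u ≠ 1 → v ≠ 1 → e u v ≠ 1
  enc : G → Data
  enc_injective : Function.Injective enc
  encT : GT → Data
  encT_injective : Function.Injective encT

namespace PairingGroup

attribute [instance] groupG groupGT

instance (𝒢 : PairingGroup) : Fact 𝒢.p.Prime := ⟨𝒢.prime⟩

instance (𝒢 : PairingGroup) : Finite 𝒢.G :=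
  Nat.finite_of_card_ne_zero (by rw [𝒢.card_G]; exact 𝒢.prime.ne_zero)

noncomputable instance (𝒢 : PairingGroup) : Fintype 𝒢.G := Fintype.ofFinite _

/-- `𝔾* = 𝔾 ∖ {1}`. -/
abbrev Gstar (𝒢 : PairingGroup) : Type := {u : 𝒢.G // u ≠ 1}

noncomputable instance (𝒢 : PairingGroup) : Fintype 𝒢.Gstar := Fintype.ofFinite _

instance (𝒢 : PairingGroup) : Nonempty 𝒢.Gstar := by
  have h : Nontrivial 𝒢.G := by
    rw [← Finite.one_lt_card_iff_nontrivial, 𝒢.card_G]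
    exact 𝒢.prime.one_lt
  obtain ⟨u, hu⟩ := exists_ne (1 : 𝒢.G)
  exact ⟨⟨u, hu⟩⟩

/-- `u ^ a` for an exponent `a ∈ ℤ_p`. -/
def exp (𝒢 : PairingGroup) (u : 𝒢.G) (a : ZMod 𝒢.p) : 𝒢.G := u ^ a.val

/-- Elements of `ℤ_p` are represented by their residues in `{0, …, p - 1}`. -/
def encZ (𝒢 : PairingGroup) (a : ZMod 𝒢.p) : Data := Data.num a.val

end PairingGroup

/-- A generator of type-1 bilinear groups. On the security parameter `n` it draws a description `d`,
which determines the group `grp d`. Descriptions have polynomial length, and the group operations and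
the pairing are computed in polynomial time. -/
structure BilinearGenerator : Type 1 where
  gen : ℕ → PMF Data
  grp : Data → PairingGroup
  bound : Polynomial ℕ
  mulProg : Prog
  mulTProg : Prog
  pairProg : Prog
  size_desc : ∀ n, ∀ d ∈ (gen n).support, d.size ≤ bound.eval n
  size_p : ∀ n, ∀ d ∈ (gen n).support, (Data.num (grp d).p).size ≤ bound.eval n
  mul_spec : ∀ n, ∀ d ∈ (gen n).support, ∀ u v : (grp d).G,
    mulProg.output (bound.eval n)
      (.pair (Data.ofList [Data.ones n, Data.num (grp d).p, d])
        (.pair ((grp d).enc u) ((grp d).enc v))) =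
      PMF.pure (some ((grp d).enc (u * v)))
  mulT_spec : ∀ n, ∀ d ∈ (gen n).support, ∀ u v : (grp d).GT,
    mulTProg.output (bound.eval n)
      (.pair (Data.ofList [Data.ones n, Data.num (grp d).p, d])
        (.pair ((grp d).encT u) ((grp d).encT v))) =
      PMF.pure (some ((grp d).encT (u * v)))
  pair_spec : ∀ n, ∀ d ∈ (gen n).support, ∀ u v : (grp d).G,
    pairProg.output (bound.eval n)
      (.pair (Data.ofList [Data.ones n, Data.num (grp d).p, d])
        (.pair ((grp d).enc u) ((grp d).enc v))) =
      PMF.pure (some ((grp d).encT ((grp d).e u v)))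

/-- The data `(1ⁿ, p, d)` through which a generated group is made public. -/
def BilinearGenerator.params (Gen : BilinearGenerator) (n : ℕ) (d : Data) : Data :=
  Data.ofList [Data.ones n, Data.num (Gen.grp d).p, d]

/-! ### The 1-MSDH-2 assumption -/

/-- `out` is a tuple `(w, P, h^{1/(x+w)}, h^{a/(x P(x))})` as the adversary has to find it, where `P`
is given by its coefficients of degree `0` and `1`. -/
def MSDHSolution (𝒢 : PairingGroup) (a x : ZMod 𝒢.p) (out : Data) : Prop :=
  ∃ (w : ZMod 𝒢.p) (P : Polynomial (ZMod 𝒢.p)) (h : 𝒢.G),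
    w ≠ 0 ∧ P.degree ≤ 1 ∧ h ≠ 1 ∧ IsCoprime (Polynomial.X + Polynomial.C w) P ∧
    x + w ≠ 0 ∧ x * P.eval x ≠ 0 ∧
    out = Data.ofList [𝒢.encZ w, .pair (𝒢.encZ (P.coeff 0)) (𝒢.encZ (P.coeff 1)),
      𝒢.enc (𝒢.exp h (x + w)⁻¹), 𝒢.enc (𝒢.exp h (a * (x * P.eval x)⁻¹))]

open Classical in
/-- The 1-MSDH-2 experiment with adversary `B` stopped after time `b`. -/
noncomputable def msdhGame (Gen : BilinearGenerator) (n : ℕ) (B : Prog) (b : ℕ) : PMF Bool := do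
  let d ← Gen.gen n
  let 𝒢 := Gen.grp d
  let g ← PMF.uniformOfFintype 𝒢.Gstar
  let α ← PMF.uniformOfFintype (ZMod 𝒢.p)ˣ
  let β ← PMF.uniformOfFintype (ZMod 𝒢.p)ˣ
  let ξ ← PMF.uniformOfFintype (ZMod 𝒢.p)ˣ
  let pow : ZMod 𝒢.p → Data := fun c => 𝒢.enc (𝒢.exp g.1 c)
  let a : ZMod 𝒢.p := α
  let β' : ZMod 𝒢.p := β
  let x : ZMod 𝒢.p := ξ
  let out ← B.output b (Data.ofList [Gen.params n d, 𝒢.enc g.1, pow x, pow (x ^ 2),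
    pow β', pow (β' * x), pow (β' * x ^ 2), pow a, pow (a * β' * x)])
  match out with
  | none => pure false
  | some o => pure (decide (MSDHSolution 𝒢 a x o))

/-- The 1-MSDH-2 assumption over `Gen`: every probabilistic polynomial-time adversary (a program `B`
with a polynomial time bound `q`) succeeds with negligible probability only. -/
def MSDH (Gen : BilinearGenerator) : Prop :=
  ∀ (B : Prog) (q : Polynomial ℕ), Negligible fun n => (msdhGame Gen n B (q.eval n) true).toReal

/-! ### Random oracles -/

/-- Hash functions that are modelled as random oracles: `q` is answered by an element of `Ans q` with
distribution `dist q`, independently for different `q`. -/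
structure HashFamily : Type 1 where
  Query : Type
  Ans : Query → Type
  dist : ∀ q, PMF (Ans q)
  encQuery : Query → Data
  encAns : ∀ q, Ans q → Data

namespace HashFamily

/-- The hash values chosen so far. -/
def Table (H : HashFamily) : Type := ∀ q, Option (H.Ans q)

/-- Randomized computations with access to the random oracles. -/
abbrev RO (H : HashFamily) : Type → Type := StateT H.Table PMF

open Classical in
/-- A hash value: the old one if `q` has been asked before, and a fresh random one otherwise. -/
noncomputable def query (H : HashFamily) (q : H.Query) : H.RO (H.Ans q) := fun tbl =>
  match tbl q with
  | some y => pure (y, tbl)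
  | none => do
    let y ← H.dist q
    pure (y, Function.update tbl q (some y))

end HashFamily

/-! ### Synchronized aggregate signature schemes -/

/-- The time periods `[T] = {1, …, T}`. -/
abbrev Period (T : ℕ) : Type := {t : ℕ // 1 ≤ t ∧ t ≤ T}

/-- Messages are arbitrary bit strings. -/
abbrev Msg : Type := List Bool

/-- The algorithms of a synchronized aggregate signature scheme in the random oracle model, for a
fixed security parameter and `T` periods, and the representation of its objects as data. A list of
verification keys and a list of messages of the same length are given as a list of pairs. -/
structure SAS (T : ℕ) : Type 1 where
  PP : Type
  hash : PP → HashFamily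
  VK : PP → Type
  SK : PP → Type
  Sig : PP → Type
  AggSig : PP → Type
  setup : PMF PP
  keyGen : ∀ pp, PMF (VK pp × SK pp)
  sign : ∀ pp, SK pp → Period T → Msg → (hash pp).RO (Sig pp)
  verify : ∀ pp, VK pp → Msg → Sig pp → (hash pp).RO Bool
  aggregate : ∀ pp, List (VK pp × Msg × Sig pp) → (hash pp).RO (Option (AggSig pp))
  aggVerify : ∀ pp, List (VK pp × Msg) → AggSig pp → (hash pp).RO Bool
  encPP : PP → Data
  encVK : ∀ pp, VK pp → Data
  encSK : ∀ pp, SK pp → Data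
  encSig : ∀ pp, Sig pp → Data
  encAggSig : ∀ pp, AggSig pp → Data

namespace SAS

variable {T : ℕ}

/-- What the adversary can do: query a random oracle, submit a key pair for certification, let a
period pass, ask for a signature in the current period, and output a forgery. -/
inductive Action (S : SAS T) (pp : S.PP) : Type
  | hash (q : (S.hash pp).Query)
  | cert (vk sk : Data)
  | skip
  | sign (m : Msg)
  | output (f : Data)

/-- Actions as data. -/
def encAction (S : SAS T) (pp : S.PP) : S.Action pp → Data
  | .hash q => .pair (Data.num 0) ((S.hash pp).encQuery q)
  | .cert vk sk => .pair (Data.num 1) (.pair vk sk)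
  | .skip => .pair (Data.num 2) Data.bot
  | .sign m => .pair (Data.num 3) (.str m)
  | .output f => .pair (Data.num 4) f

/-- Forgeries `((vk₁, m₁), …, (vk_r, m_r), Σ)` as data. -/
def encForgery (S : SAS T) (pp : S.PP) (f : List (S.VK pp × Msg) × S.AggSig pp) : Data :=
  .pair (Data.ofList (f.1.map fun x => .pair (S.encVK pp x.1) (.str x.2))) (S.encAggSig pp f.2)

/-- The state of the challenger: the hash values chosen so far, the set `L` of certified keys, the
set `Q` of signed messages, and the current period `t_ctr`. -/
structure GameState (S : SAS T) (pp : S.PP) : Type where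
  table : (S.hash pp).Table
  L : Set (S.VK pp)
  Q : Set Msg
  tctr : ℕ

open Classical in
/-- The certification oracle. A key pair is valid if it is a possible output of `keyGen`. -/
noncomputable def certOracle (S : SAS T) (pp : S.PP) (dvk dsk : Data) (s : S.GameState pp) :
    Data × S.GameState pp :=
  match Data.decode (S.encVK pp) dvk, Data.decode (S.encSK pp) dsk with
  | some vk, some sk =>
    if (vk, sk) ∈ (S.keyGen pp).support then
      (Data.ofBool true, { s with L := insert vk s.L })
    else (Data.ofBool false, s)
  | _, _ => (Data.ofBool false, s)

/-- The instruction "skip" of the signing oracle. -/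
def skipOracle (S : SAS T) (pp : S.PP) (s : S.GameState pp) : Data × S.GameState pp :=
  if 1 ≤ s.tctr ∧ s.tctr ≤ T then (Data.bot, { s with tctr := s.tctr + 1 }) else (Data.bot, s)

/-- The instruction "sign" of the signing oracle. -/
noncomputable def signOracle (S : SAS T) (pp : S.PP) (sk : S.SK pp) (m : Msg)
    (s : S.GameState pp) : PMF (Data × S.GameState pp) :=
  if ht : 1 ≤ s.tctr ∧ s.tctr ≤ T then do
    let r ← (S.sign pp sk ⟨s.tctr, ht⟩ m).run s.table
    pure (S.encSig pp r.1,
      { s with table := r.2, Q := insert m s.Q, tctr := s.tctr + 1 })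
  else pure (Data.bot, s)

/-- A query to the random oracles. -/
noncomputable def hashOracle (S : SAS T) (pp : S.PP) (q : (S.hash pp).Query)
    (s : S.GameState pp) : PMF (Data × S.GameState pp) := do
  let r ← ((S.hash pp).query q).run s.table
  pure ((S.hash pp).encAns q r.1, { s with table := r.2 })

open Classical in
/-- The winning condition for the final output `d` of the adversary. -/
noncomputable def judge (S : SAS T) (pp : S.PP) (vk : S.VK pp) (d : Data)
    (s : S.GameState pp) : PMF Bool :=
  match Data.decode (S.encForgery pp) d with
  | none => pure false
  | some f => do
    let r ← (S.aggVerify pp f.1 f.2).run s.table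
    pure (decide (r.1 = true ∧ (∀ x ∈ f.1, x.1 ≠ vk → x.1 ∈ s.L) ∧
      ∃ x ∈ f.1, x.1 = vk ∧ x.2 ∉ s.Q))

/-- The interaction of the adversary `A` with the oracles. `A` is given by its next-message program:
in every activation it gets its own state and the last answer, and within time `b` it has to return
its new state and its next action. After `k` activations it is stopped and has lost. An ill-formed
request is answered by `⊥`. -/
noncomputable def interact (S : SAS T) (pp : S.PP) (vk : S.VK pp) (sk : S.SK pp)
    (A : Prog) (b : ℕ) : (k : ℕ) → (st ans : Data) → S.GameState pp → PMF Bool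
  | 0, _, _, _ => pure false
  | k + 1, st, ans, s => do
    let out ← A.output b (.pair st ans)
    match out with
    | some (.pair st' act) =>
      match Data.decode (S.encAction pp) act with
      | none => interact S pp vk sk A b k st' Data.bot s
      | some (.hash q) => do
        let r ← S.hashOracle pp q s
        interact S pp vk sk A b k st' r.1 r.2
      | some (.cert dvk dsk) =>
        interact S pp vk sk A b k st' (S.certOracle pp dvk dsk s).1 (S.certOracle pp dvk dsk s).2
      | some .skip => interact S pp vk sk A b k st' (S.skipOracle pp s).1 (S.skipOracle pp s).2
      | some (.sign m) => do
        let r ← S.signOracle pp sk m s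
        interact S pp vk sk A b k st' r.1 r.2
      | some (.output d) => S.judge pp vk d s
    | _ => pure false

/-- The unforgeability game in the certified-key model and the random oracle model, against an
adversary `A` with at most `b` activations of time at most `b` each. The first activation gets the
public parameters and the challenge key. -/
noncomputable def eufGame (S : SAS T) (A : Prog) (b : ℕ) : PMF Bool := do
  let pp ← S.setup
  let kp ← S.keyGen pp
  S.interact pp kp.1 kp.2 A b b Data.bot (.pair (S.encPP pp) (S.encVK pp kp.1))
    { table := fun _ => none, L := ∅, Q := ∅, tctr := 1 }

end SAS

/-- EUF-CMA security in the certified-key model and the random oracle model: every probabilistic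
polynomial-time adversary (a program `A` with a polynomial time bound `q`) has negligible advantage. -/
def EUFCMA {T : ℕ → ℕ} (S : ∀ n, SAS (T n)) : Prop :=
  ∀ (A : Prog) (q : Polynomial ℕ), Negligible fun n => ((S n).eufGame A (q.eval n) true).toReal

/-! ### The scheme of Lee et al. -/

namespace LLY

/-- The arguments of `H₁ : [T] → 𝔾`, `H₂ : [T] → 𝔾*` and `H₃ : [T] × {0,1}* → ℤ_p`. -/
inductive HashQuery (T : ℕ) : Type
  | h1 (t : Period T)
  | h2 (t : Period T)
  | h3 (t : Period T) (m : Msg)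

/-- The ranges of the hash functions. -/
abbrev HashAns (𝒢 : PairingGroup) {T : ℕ} : HashQuery T → Type
  | .h1 _ => 𝒢.G
  | .h2 _ => 𝒢.Gstar
  | .h3 _ _ => ZMod 𝒢.p

/-- The hash functions, as random oracles. -/
noncomputable def hash (𝒢 : PairingGroup) (T : ℕ) : HashFamily where
  Query := HashQuery T
  Ans := HashAns 𝒢
  dist
    | .h1 _ => PMF.uniformOfFintype 𝒢.G
    | .h2 _ => PMF.uniformOfFintype 𝒢.Gstar
    | .h3 _ _ => PMF.uniformOfFintype (ZMod 𝒢.p)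
  encQuery
    | .h1 t => .pair (Data.num 1) (Data.num t.1)
    | .h2 t => .pair (Data.num 2) (Data.num t.1)
    | .h3 t m => .pair (Data.num 3) (.pair (Data.num t.1) (.str m))
  encAns
    | .h1 _, u => 𝒢.enc u
    | .h2 _, u => 𝒢.enc u.1
    | .h3 _ _, z => 𝒢.encZ z

noncomputable def H1 (𝒢 : PairingGroup) {T : ℕ} (t : Period T) : (hash 𝒢 T).RO 𝒢.G :=
  (hash 𝒢 T).query (.h1 t)

noncomputable def H2 (𝒢 : PairingGroup) {T : ℕ} (t : Period T) : (hash 𝒢 T).RO 𝒢.Gstar :=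
  (hash 𝒢 T).query (.h2 t)

noncomputable def H3 (𝒢 : PairingGroup) {T : ℕ} (t : Period T) (m : Msg) :
    (hash 𝒢 T).RO (ZMod 𝒢.p) :=
  (hash 𝒢 T).query (.h3 t m)

/-- `x ←$ ℤ_p*`, `X ← g^x`. -/
noncomputable def keyGen (𝒢 : PairingGroup) (g : 𝒢.G) : PMF (𝒢.G × (ZMod 𝒢.p)ˣ) := do
  let x ← PMF.uniformOfFintype (ZMod 𝒢.p)ˣ
  pure (𝒢.exp g (x : ZMod 𝒢.p), x)

/-- `E ← H₁(t)^sk · H₂(t)^(m' sk)` with `m' = H₃(t, m)`. -/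
noncomputable def sign (𝒢 : PairingGroup) {T : ℕ} (sk : (ZMod 𝒢.p)ˣ) (t : Period T) (m : Msg) :
    (hash 𝒢 T).RO (𝒢.G × Period T) := do
  let m' ← H3 𝒢 t m
  let F ← H1 𝒢 t
  let B ← H2 𝒢 t
  pure (𝒢.exp F sk * 𝒢.exp B.1 (m' * sk), t)

open Classical in
noncomputable def verify (𝒢 : PairingGroup) {T : ℕ} (g : 𝒢.G) (vk : 𝒢.G) (m : Msg)
    (σ : 𝒢.G × Period T) : (hash 𝒢 T).RO Bool := do
  let m' ← H3 𝒢 σ.2 m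
  let F ← H1 𝒢 σ.2
  let B ← H2 𝒢 σ.2
  pure (decide (𝒢.e σ.1 g = 𝒢.e (F * 𝒢.exp B.1 m') vk))

open Classical in
/-- The product of the signatures, if they are valid, of the same period, and under different keys. -/
noncomputable def aggregate (𝒢 : PairingGroup) {T : ℕ} (g : 𝒢.G) :
    List (𝒢.G × Msg × (𝒢.G × Period T)) → (hash 𝒢 T).RO (Option (𝒢.G × Period T))
  | [] => pure none
  | x :: l => do
    if (∃ y ∈ l, y.2.2.2 ≠ x.2.2.2) ∨ ¬ ((x :: l).map fun y => y.1).Nodup then pure none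
    else do
      let v ← (x :: l).mapM fun y => verify 𝒢 g y.1 y.2.1 y.2.2
      if ∃ c ∈ v, c = false then pure none
      else pure (some (((x :: l).map fun y => y.2.2.1).prod, x.2.2.2))

open Classical in
/-- The keys are different, and `e(E', g) = e(H₁(t), ∏ vkᵢ) · e(H₂(t), ∏ vkᵢ^(mᵢ'))` with
`mᵢ' = H₃(t, mᵢ)`. -/
noncomputable def aggVerify (𝒢 : PairingGroup) {T : ℕ} (g : 𝒢.G) (l : List (𝒢.G × Msg))
    (Sg : 𝒢.G × Period T) : (hash 𝒢 T).RO Bool := do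
  if ¬ (l.map fun y => y.1).Nodup then pure false
  else do
    let ms ← l.mapM fun y => H3 𝒢 Sg.2 y.2
    let F ← H1 𝒢 Sg.2
    let B ← H2 𝒢 Sg.2
    pure (decide (𝒢.e Sg.1 g =
      𝒢.e F (l.map fun y => y.1).prod *
        𝒢.e B.1 (List.zipWith (fun y m' => 𝒢.exp y.1 m') l ms).prod))

/-- The public parameters apart from the hash functions: the description of the group, and `g ∈ 𝔾*`. -/
abbrev PP (Gen : BilinearGenerator) : Type := Σ d : Data, (Gen.grp d).Gstar

noncomputable def setup (Gen : BilinearGenerator) (n : ℕ) : PMF (PP Gen) := do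
  let d ← Gen.gen n
  let g ← PMF.uniformOfFintype (Gen.grp d).Gstar
  pure ⟨d, g⟩

end LLY

/-- The synchronized aggregate signature scheme of Lee et al. over `Gen`, for the security parameter
`n` and `T` periods. -/
noncomputable def sasLLY (Gen : BilinearGenerator) (n T : ℕ) : SAS T where
  PP := LLY.PP Gen
  hash pp := LLY.hash (Gen.grp pp.1) T
  VK pp := (Gen.grp pp.1).G
  SK pp := (ZMod (Gen.grp pp.1).p)ˣ
  Sig pp := (Gen.grp pp.1).G × Period T
  AggSig pp := (Gen.grp pp.1).G × Period T
  setup := LLY.setup Gen n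
  keyGen pp := LLY.keyGen (Gen.grp pp.1) pp.2.1
  sign pp := LLY.sign (Gen.grp pp.1)
  verify pp := LLY.verify (Gen.grp pp.1) pp.2.1
  aggregate pp := LLY.aggregate (Gen.grp pp.1) pp.2.1
  aggVerify pp := LLY.aggVerify (Gen.grp pp.1) pp.2.1
  encPP pp := Data.ofList [Gen.params n pp.1, Data.ones T, (Gen.grp pp.1).enc pp.2.1]
  encVK pp := (Gen.grp pp.1).enc
  encSK pp x := (Gen.grp pp.1).encZ (x : ZMod (Gen.grp pp.1).p)
  encSig pp σ := .pair ((Gen.grp pp.1).enc σ.1) (Data.num σ.2.1)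
  encAggSig pp σ := .pair ((Gen.grp pp.1).enc σ.1) (Data.num σ.2.1)

end SynchAgg

/-! Given `g`, `g ^ x` and `g ^ a` from an instance, the reduction plays the game with generator `γ
= g ^ x` and challenge key `vk = g`, so that the unknown signing key is `1 / x`. Put `h = g ^ a`. It
suffices to find `R = h ^ (1 / x)`: with `P = 1` and a nonzero shift `w` such that `x + w ≠ 0`, the
base `g ^ (x + w)` has the two required powers `g` and `h * R ^ w` (`msdhSolution_solution`). The
other elements of the instance are not used.

Outside one guessed period `ts` the hash values are known powers of `γ`, `H₁(t) = γ ^ r` and `H₂(t)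
= γ ^ s`, and `vk ^ (r + s m')` is the signature. In the period `ts` the simulator sets `H₂(ts) = h
^ sh` and `H₁(ts) = γ ^ r * h ^ (-sh * mh)`, where `mh` is planted as the value of `H₃` for one
message, guessed through the place `js` of its hash query. For this message the powers of `h` cancel
and `vk ^ r` is the signature. No other signature is needed, because there is at most one per
period. An accepted forgery in period `ts` equals `H₁ ^ (sk + X) * H₂ ^ (sk z + Y)`, where `X` and
`Y` come from the certified secret keys. Removal of the known factors leaves `h ^ (sk * sh * (z -
mh))`, which gives `R` if `z ≠ mh` (`extract_eq`).

If a signature was issued in period `ts`, then `z = mh` means that two messages have the same hash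
value, since the forged message was never signed. If none was issued, a place `js` behind the end of
the table leaves `mh` independent of everything the adversary sees, and `z ≠ mh` holds with
probability at least `1 / 2`. Hence a winning forgery is covered by some pair `(ts, js)` or comes
with a collision (`one_le_unionPay`).

That the simulation is perfect for right guesses is proved by coupling. The actual game is first
replaced by a game on exponents, `gameVal` (`ev_interact_le`). It does not know `mh` and `sh`;
`evGuess` draws them conditionally on the table of hash values. A query of the game followed by this
draw has the same distribution as the draw followed by a query of the simulator (`ask_evGuess`), and
induction over the activations gives `gameVal_guessPay_le`.

Collisions have probability of order (number of queries)² / `p` (`gameVal_collision_le`). Nothing is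
assumed on the size of `p`, so the smallness of `1 / p` has to come from the assumption itself: an
adversary that bets on `x = 1` succeeds with probability at least `1 / p` on average
(`exists_inv_order_le`).

It remains to write the reduction as a program. `wp` is the expected value that a program achieves
within a time budget, and only lower bounds for it are needed. `Comp` expresses that one program
maps a whole family of data to another in polynomial time; its closure properties yield the step of
the simulator (`comp_step`) and then the loop (`exists_simulator`). The function `T` need not be
computable, so the reduction guesses its value as well (`exists_reduction`). All losses are
polynomial factors. -/

namespace SynchAgg

open scoped ENNReal

/-! ### Expectations of extended nonnegative functions -/

/-- The expectation of `f` under `μ`. -/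
noncomputable def ev {α : Type*} (μ : PMF α) (f : α → ℝ≥0∞) : ℝ≥0∞ := ∑' a, μ a * f a

section ev

variable {α β : Type*}

@[simp] theorem ev_pure (a : α) (f : α → ℝ≥0∞) : ev (PMF.pure a) f = f a := by
  unfold ev
  rw [tsum_eq_single a]
  · simp
  · intro b hb; simp [PMF.pure_apply, hb]

theorem ev_bind (μ : PMF α) (k : α → PMF β) (f : β → ℝ≥0∞) :
    ev (μ.bind k) f = ev μ fun a => ev (k a) f := by
  unfold ev
  simp only [PMF.bind_apply, ← ENNReal.tsum_mul_right, ← ENNReal.tsum_mul_left]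
  rw [ENNReal.tsum_comm]
  simp only [mul_assoc]

theorem ev_map (μ : PMF α) (k : α → β) (f : β → ℝ≥0∞) :
    ev (μ.map k) f = ev μ fun a => f (k a) := by
  rw [PMF.map, ev_bind]; simp

/-- The restriction to the support is what brings the length bounds for possible outputs into the
estimates. -/
theorem ev_mono_of_support {μ : PMF α} {f g : α → ℝ≥0∞} (h : ∀ a ∈ μ.support, f a ≤ g a) :
    ev μ f ≤ ev μ g := by
  refine ENNReal.tsum_le_tsum fun a => ?_
  by_cases ha : a ∈ μ.support
  · exact mul_le_mul_right (h a ha) _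
  · rw [PMF.mem_support_iff, not_not] at ha
    simp [ha]

theorem ev_mono {μ : PMF α} {f g : α → ℝ≥0∞} (h : ∀ a, f a ≤ g a) : ev μ f ≤ ev μ g :=
  ev_mono_of_support fun a _ => h a

theorem ev_add (μ : PMF α) (f g : α → ℝ≥0∞) : ev μ (fun a => f a + g a) = ev μ f + ev μ g := by
  simp only [ev, mul_add, ENNReal.tsum_add]

@[simp] theorem ev_const (μ : PMF α) (c : ℝ≥0∞) : ev μ (fun _ => c) = c := by
  simp [ev, ENNReal.tsum_mul_right, PMF.tsum_coe]

theorem ev_mul_left (μ : PMF α) (c : ℝ≥0∞) (f : α → ℝ≥0∞) :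
    ev μ (fun a => c * f a) = c * ev μ f := by
  simp only [ev, ← ENNReal.tsum_mul_left]
  exact tsum_congr fun a => by ring

theorem ev_comm (μ : PMF α) (ν : PMF β) (f : α → β → ℝ≥0∞) :
    ev μ (fun a => ev ν (f a)) = ev ν fun b => ev μ fun a => f a b := by
  simp only [ev, ← ENNReal.tsum_mul_left]
  rw [ENNReal.tsum_comm]
  exact tsum_congr fun b => tsum_congr fun a => by ring

theorem ev_uniformOfFintype [Fintype α] [Nonempty α] (f : α → ℝ≥0∞) :
    ev (PMF.uniformOfFintype α) f = (Fintype.card α : ℝ≥0∞)⁻¹ * ∑ a, f a := by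
  simp [ev, tsum_fintype, Finset.mul_sum]

theorem ev_uniform_equiv [Fintype α] [Nonempty α] [Fintype β] [Nonempty β] (e : α ≃ β)
    (f : β → ℝ≥0∞) :
    ev (PMF.uniformOfFintype α) (fun a => f (e a)) = ev (PMF.uniformOfFintype β) f := by
  rw [ev_uniformOfFintype, ev_uniformOfFintype, Fintype.card_congr e, Equiv.sum_comp e]

theorem ev_uniformBelow {n : ℕ} (hn : 0 < n) (f : ℕ → ℝ≥0∞) :
    ev (uniformBelow n) f = (n : ℝ≥0∞)⁻¹ * ∑ i ∈ Finset.range n, f i := by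
  have hs : insert 0 (Finset.range n) = Finset.range n :=
    Finset.insert_eq_of_mem (Finset.mem_range.2 hn)
  unfold ev uniformBelow
  rw [tsum_eq_sum (s := Finset.range n)]
  · rw [Finset.mul_sum]
    refine Finset.sum_congr rfl fun i hi => ?_
    rw [PMF.uniformOfFinset_apply, hs, if_pos hi, Finset.card_range]
  · intro i hi
    rw [PMF.uniformOfFinset_apply, hs, if_neg hi, zero_mul]

/-- A guess among `n` possibilities is right with probability `1 / n`; this is how every guess of
the reduction is paid for, by a factor `n`. -/
theorem le_ev_uniformBelow {n i : ℕ} (hi : i < n) (f : ℕ → ℝ≥0∞) :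
    f i ≤ n * ev (uniformBelow n) f := by
  have hn : (n : ℝ≥0∞) ≠ 0 := by
    simp only [ne_eq, Nat.cast_eq_zero]; omega
  rw [ev_uniformBelow (by omega), ← mul_assoc, ENNReal.mul_inv_cancel hn (ENNReal.natCast_ne_top n),
    one_mul]
  exact Finset.single_le_sum (f := f) (fun _ _ => zero_le) (Finset.mem_range.2 hi)

theorem apply_eq_ev [DecidableEq α] (μ : PMF α) (a : α) :
    μ a = ev μ fun b => if b = a then 1 else 0 := by
  unfold ev
  rw [tsum_eq_single a]
  · simp
  · intro b hb; simp [hb]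

end ev

/-! ### Weakest preconditions of timed computations -/

/-- The expected value of `F` at the result and the remaining budget (`0` for a failure). -/
noncomputable def twp {α : Type} (m : Timed α) (b : ℕ) (F : α → ℕ → ℝ≥0∞) : ℝ≥0∞ :=
  ev (m b).run fun o => o.elim 0 fun y => F y.1 y.2

section twp

variable {α β : Type}

theorem twp_pure (a : α) (b : ℕ) (F : α → ℕ → ℝ≥0∞) : twp (pure a) b F = F a b :=
  ev_pure (some (a, b)) _

theorem twp_bind (m : Timed α) (k : α → Timed β) (b : ℕ) (F : β → ℕ → ℝ≥0∞) :
    twp (m >>= k) b F = twp m b fun a r => twp (k a) r F := by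
  unfold twp
  have : (((m >>= k) b).run : PMF (Option (β × ℕ))) =
      (m b).run.bind fun o => match o with
        | some y => (k y.1 y.2).run
        | none => PMF.pure none := by
    show PMF.bind (m b) _ = PMF.bind (m b) _
    congr 1
    funext o
    cases o <;> rfl
  rw [this, ev_bind]
  congr 1
  funext o
  cases o <;> simp

theorem twp_tick (k b : ℕ) (F : Unit → ℕ → ℝ≥0∞) :
    twp (tick k) b F = if k ≤ b then F () (b - k) else 0 := by
  unfold twp tick
  split_ifs with h
  · exact ev_pure (some ((), b - k)) _
  · exact ev_pure none _

theorem twp_failure (b : ℕ) (F : α → ℕ → ℝ≥0∞) :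
    twp (fun _ => failure) b F = 0 :=
  ev_pure none _

theorem twp_get (b : ℕ) (F : ℕ → ℕ → ℝ≥0∞) : twp (get : Timed ℕ) b F = F b b :=
  ev_pure (some (b, b)) _

theorem twp_lift (μ : PMF α) (b : ℕ) (F : α → ℕ → ℝ≥0∞) :
    twp (StateT.lift (OptionT.lift μ) : Timed α) b F = ev μ fun a => F a b := by
  unfold twp
  have : (((StateT.lift (OptionT.lift μ) : Timed α) b).run : PMF (Option (α × ℕ))) =
      μ.bind fun a => PMF.pure (some (a, b)) := by
    show PMF.bind (PMF.bind μ fun a => PMF.pure (some a)) _ = _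
    rw [PMF.bind_bind]
    congr 1
    funext a
    rw [PMF.pure_bind]
    rfl
  rw [this, ev_bind]
  simp

theorem twp_mono {m : Timed α} {b : ℕ} {F G : α → ℕ → ℝ≥0∞} (h : ∀ a r, F a r ≤ G a r) :
    twp m b F ≤ twp m b G :=
  ev_mono fun o => by cases o <;> simp [h]

/-- More budget does not hurt, and what is added is left over. -/
def BudgetMono (m : Timed α) : Prop :=
  ∀ b k F, twp m b (fun a r => F a (r + k)) ≤ twp m (b + k) F

theorem BudgetMono.pure (a : α) : BudgetMono (pure a : Timed α) := fun b k F => by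
  simp [twp_pure]

theorem BudgetMono.tick (j : ℕ) : BudgetMono (tick j) := fun b k F => by
  rw [twp_tick, twp_tick]
  split_ifs with h1 h2
  · rw [show b + k - j = b - j + k by omega]
  · omega
  · exact zero_le
  · exact le_rfl

theorem BudgetMono.bind {m : Timed α} {f : α → Timed β} (hm : BudgetMono m)
    (hf : ∀ a, BudgetMono (f a)) : BudgetMono (m >>= f) := fun b k F => by
  rw [twp_bind, twp_bind]
  exact (twp_mono fun a r => hf a r k F).trans (hm b k fun a r => twp (f a) r F)

theorem BudgetMono.lift (μ : PMF α) : BudgetMono (StateT.lift (OptionT.lift μ) : Timed α) :=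
  fun b k F => by rw [twp_lift, twp_lift]

theorem whileLoop_zero (t f : Data → Timed Data) (x : Data) :
    whileLoop t f 0 x = fun _ => failure := rfl

open Classical in
theorem whileLoop_succ (t f : Data → Timed Data) (n : ℕ) (x : Data) :
    whileLoop t f (n + 1) x = (do
      tick (1 + x.size)
      let c ← t x
      if c = Data.bot then pure x
      else do
        let y ← f x
        whileLoop t f n y) := rfl

theorem BudgetMono.whileLoop {t f : Data → Timed Data} (ht : ∀ x, BudgetMono (t x))
    (hf : ∀ x, BudgetMono (f x)) : ∀ n x, BudgetMono (whileLoop t f n x)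
  | 0, x => fun b k F => by
    rw [whileLoop_zero, twp_failure, twp_failure]
  | n + 1, x => by
    rw [whileLoop_succ]
    refine (BudgetMono.tick _).bind fun _ => (ht x).bind fun c => ?_
    split_ifs
    · exact BudgetMono.pure _
    · exact (hf x).bind fun y => BudgetMono.whileLoop ht hf n y

/-- The number of permitted tests is tied to the budget at the start of a loop, so a change of
budget changes this number too. Monotonicity in it separates the two effects. -/
theorem twp_whileLoop_mono_fuel (t f : Data → Timed Data) :
    ∀ n x b F, twp (whileLoop t f n x) b F ≤ twp (whileLoop t f (n + 1) x) b F
  | 0, x, b, F => by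
    rw [whileLoop_zero, twp_failure]; exact zero_le
  | n + 1, x, b, F => by
    rw [whileLoop_succ t f n, whileLoop_succ t f (n + 1)]
    simp only [twp_bind]
    refine twp_mono fun _ r => twp_mono fun c r => ?_
    split_ifs
    · exact le_rfl
    · simp only [twp_bind]
      exact twp_mono fun y r => twp_whileLoop_mono_fuel t f n y r F

theorem twp_whileLoop_mono (t f : Data → Timed Data) {n n' : ℕ} (h : n ≤ n') (x : Data) (b : ℕ)
    (F : Data → ℕ → ℝ≥0∞) : twp (whileLoop t f n x) b F ≤ twp (whileLoop t f n' x) b F := by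
  induction n', h using Nat.le_induction with
  | base => exact le_rfl
  | succ n' _ ih => exact ih.trans (twp_whileLoop_mono_fuel t f n' x b F)

theorem BudgetMono.run : ∀ (c : Prog) (x : Data), BudgetMono (c.run x)
  | .op o, x => (BudgetMono.tick _).bind fun _ => BudgetMono.pure _
  | .const d, x => (BudgetMono.tick _).bind fun _ => BudgetMono.pure _
  | .seq f g, x => (BudgetMono.run f x).bind fun y => BudgetMono.run g y
  | .fork f g, x => (BudgetMono.tick _).bind fun _ => (BudgetMono.run f x).bind fun y =>
      (BudgetMono.run g x).bind fun z => BudgetMono.pure _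
  | .cond t f g, x => (BudgetMono.tick _).bind fun _ => (BudgetMono.run t x).bind fun c => by
      split_ifs
      · exact BudgetMono.run g x
      · exact BudgetMono.run f x
  | .loop t f, x => fun b k F => by
      simp only [Prog.run]
      rw [twp_bind, twp_get, twp_bind, twp_get]
      -- A larger budget also permits more tests: first the budget is raised, then the number of
      -- tests.
      exact (BudgetMono.whileLoop (BudgetMono.run t) (BudgetMono.run f) _ _ b k F).trans
        (twp_whileLoop_mono _ _ (by omega) _ _ _)
  | .sample, x => (BudgetMono.lift _).bind fun n => (BudgetMono.tick _).bind fun _ =>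
      BudgetMono.pure _

/-- All results of `m` with budget `b` satisfy `P`. -/
def Always (m : Timed α) (b : ℕ) (P : α → ℕ → Prop) : Prop :=
  ∀ F : α → ℕ → ℝ≥0∞, (∀ a r, P a r → F a r = 0) → twp m b F = 0

theorem Always.pure {a : α} {b : ℕ} {P : α → ℕ → Prop} (h : P a b) :
    Always (pure a) b P := fun F hF => by rw [twp_pure, hF _ _ h]

theorem Always.bind {m : Timed α} {f : α → Timed β} {b : ℕ} {P : α → ℕ → Prop}
    {Q : β → ℕ → Prop} (hm : Always m b P) (hf : ∀ a r, P a r → Always (f a) r Q) :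
    Always (m >>= f) b Q := fun F hF => by
  rw [twp_bind]
  exact hm _ fun a r har => hf a r har F hF

theorem Always.tick (k b : ℕ) : Always (tick k) b fun _ r => r + k = b := fun F hF => by
  rw [twp_tick]
  split_ifs with h
  · exact hF _ _ (by omega)
  · rfl

theorem Always.mono {m : Timed α} {b : ℕ} {P Q : α → ℕ → Prop} (hm : Always m b P)
    (h : ∀ a r, P a r → Q a r) : Always m b Q := fun F hF => hm F fun a r har => hF a r (h a r har)

theorem Always.failure {b : ℕ} {P : α → ℕ → Prop} : Always (fun _ => failure : Timed α) b P :=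
  fun F _ => twp_failure b F

theorem Always.get {b : ℕ} : Always (get : Timed ℕ) b fun a r => a = b ∧ r = b := fun F hF => by
  rw [twp_get, hF _ _ ⟨rfl, rfl⟩]

theorem Always.lift {μ : PMF α} {b : ℕ} :
    Always (StateT.lift (OptionT.lift μ) : Timed α) b fun _ r => r = b := fun F hF => by
  rw [twp_lift]
  simp [hF _ _ rfl]

/-- Every test is charged for the datum that it reads, and the final datum is read by the last test;
so the time used covers its length. -/
theorem Always.whileLoop {t f : Data → Timed Data}
    (ht : ∀ x b, Always (t x) b fun _ r => r ≤ b) (hf : ∀ x b, Always (f x) b fun _ r => r ≤ b) :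
    ∀ n x b, Always (whileLoop t f n x) b fun y r => y.size + r ≤ b ∧ x.size + r ≤ b
  | 0, x, b => Always.failure
  | n + 1, x, b => by
    rw [whileLoop_succ]
    refine (Always.tick _ _).bind fun _ r hr => (ht x r).bind fun c r' hr' => ?_
    split_ifs
    · exact Always.pure ⟨by omega, by omega⟩
    · refine (hf x r').bind fun y r'' hr'' => (Always.whileLoop ht hf n y r'').mono ?_
      rintro z s ⟨h1, h2⟩
      constructor <;> omega

/-- The time used is at least the length of the input and of the output. -/
theorem Always.run : ∀ (c : Prog) (x : Data) (b : ℕ),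
    Always (c.run x) b fun y r => y.size + r ≤ b ∧ x.size + r ≤ b
  | .op o, x, b => (Always.tick _ _).bind fun _ r hr => Always.pure ⟨by omega, by omega⟩
  | .const d, x, b => (Always.tick _ _).bind fun _ r hr => Always.pure ⟨by omega, by omega⟩
  | .seq f g, x, b => (Always.run f x b).bind fun y r hr => (Always.run g y r).mono
      fun z s hs => ⟨by omega, by omega⟩
  | .fork f g, x, b => (Always.tick _ _).bind fun _ r hr => (Always.run f x r).bind fun y s hs =>
      (Always.run g x s).bind fun z u hu => Always.pure (by
        simp only [Data.size]; constructor <;> omega)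
  | .cond t f g, x, b => (Always.tick _ _).bind fun _ r hr => (Always.run t x r).bind
      fun c s hs => by
        split_ifs
        · exact (Always.run g x s).mono fun z u hu => ⟨by omega, by omega⟩
        · exact (Always.run f x s).mono fun z u hu => ⟨by omega, by omega⟩
  | .loop t f, x, b => Always.get.bind fun a r h => (Always.whileLoop
      (fun x b => (Always.run t x b).mono fun _ _ h => by omega)
      (fun x b => (Always.run f x b).mono fun _ _ h => by omega) _ x r).mono
        fun y s hs => by rw [h.2] at hs; exact hs
  | .sample, x, b => Always.lift.bind fun n r hr => (Always.tick _ _).bind fun _ s hs =>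
      Always.pure ⟨by omega, by omega⟩

end twp

/-! ### Weakest preconditions of programs -/

/-- The expected value of `F` at the output of `c` on `x` with time budget `k`. -/
noncomputable def wp (k : ℕ) (c : Prog) (x : Data) (F : Data → ℝ≥0∞) : ℝ≥0∞ :=
  twp (c.run x) k fun y _ => F y

/-- Exceeding the budget has value `0` in `wp`; hence the condition on `F none`. -/
theorem ev_output (c : Prog) (k : ℕ) (x : Data) (F : Option Data → ℝ≥0∞) (hF : F none = 0) :
    ev (c.output k x) F = wp k c x fun y => F (some y) := by
  unfold wp twp Prog.output
  have : ((c.run x).run' k).run = ((c.run x k).run).map (Option.map Prod.fst) := by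
    show ((fun y : Data × ℕ => y.1) <$> (c.run x k) : OptionT PMF Data) = _
    rw [map_eq_pure_bind]
    show PMF.bind (c.run x k) _ = PMF.bind (c.run x k) _
    congr 1
    funext o
    cases o <;> rfl
  rw [this, ev_map]
  congr 1
  funext o
  cases o <;> simp [hF]

theorem wp_mono {k : ℕ} {c : Prog} {x : Data} {F G : Data → ℝ≥0∞} (h : ∀ y, F y ≤ G y) :
    wp k c x F ≤ wp k c x G := twp_mono fun a _ => h a

theorem wp_mono_budget {k k' : ℕ} (h : k ≤ k') (c : Prog) (x : Data) (F : Data → ℝ≥0∞) :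
    wp k c x F ≤ wp k' c x F := by
  obtain ⟨j, rfl⟩ := Nat.exists_eq_add_of_le h
  exact BudgetMono.run c x k j fun y _ => F y

/-- The budget is split in advance into `k` for `c` and `j` for what follows. Whatever `c` leaves of
`k` only helps, by `BudgetMono.run`. All rules for composite programs rest on this. -/
theorem twp_run_add (k j : ℕ) (c : Prog) (x : Data) (F : Data → ℕ → ℝ≥0∞) (G : Data → ℝ≥0∞)
    (h : ∀ y r, j ≤ r → G y ≤ F y r) : wp k c x G ≤ twp (c.run x) (k + j) F :=
  (twp_mono fun y r => h y (r + j) (by omega)).trans (BudgetMono.run c x k j F)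

theorem twp_tick_bind {α : Type} (a b : ℕ) (m : Timed α) (F : α → ℕ → ℝ≥0∞) :
    twp (do tick a; m) (a + b) F = twp m b F := by
  rw [twp_bind, twp_tick, if_pos (by omega), Nat.add_sub_cancel_left]

theorem wp_seq (k j : ℕ) (f g : Prog) (x : Data) (F : Data → ℝ≥0∞) :
    wp k f x (fun y => wp j g y F) ≤ wp (k + j) (.seq f g) x F := by
  show _ ≤ twp (f.run x >>= g.run) _ _
  rw [twp_bind]
  exact twp_run_add _ _ _ _ _ _ fun y r hr => wp_mono_budget hr g y F

theorem wp_op (o : Op) (x : Data) (F : Data → ℝ≥0∞) :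
    wp (1 + x.size + (o.eval x).size) (.op o) x F = F (o.eval x) := by
  show twp (do tick _; pure _) _ _ = _
  have := twp_tick_bind (1 + x.size + (o.eval x).size) 0 (pure (o.eval x)) fun y _ => F y
  rw [Nat.add_zero] at this
  rw [this, twp_pure]

theorem wp_const (d x : Data) (F : Data → ℝ≥0∞) :
    wp (1 + x.size + d.size) (.const d) x F = F d := by
  show twp (do tick _; pure _) _ _ = _
  have := twp_tick_bind (1 + x.size + d.size) 0 (pure d) fun y _ => F y
  rw [Nat.add_zero] at this
  rw [this, twp_pure]

theorem wp_fork (k j : ℕ) (f g : Prog) (x : Data) (F : Data → ℝ≥0∞) :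
    wp k f x (fun y => wp j g x fun z => F (.pair y z)) ≤
      wp (1 + x.size + (k + j)) (.fork f g) x F := by
  show _ ≤ twp (do tick _; _) _ _
  rw [twp_tick_bind, twp_bind]
  refine twp_run_add _ _ _ _ _ _ fun y r hr => ?_
  rw [twp_bind]
  simp only [twp_pure]
  exact wp_mono_budget hr g x fun z => F (.pair y z)

open Classical in
theorem wp_cond (k j : ℕ) (t f g : Prog) (x : Data) (F : Data → ℝ≥0∞) :
    wp k t x (fun c => if c = Data.bot then wp j g x F else wp j f x F) ≤
      wp (1 + x.size + (k + j)) (.cond t f g) x F := by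
  show _ ≤ twp (do tick _; _) _ _
  rw [twp_tick_bind, twp_bind]
  refine twp_run_add _ _ _ _ _ _ fun y r hr => ?_
  split_ifs
  · exact wp_mono_budget hr g x F
  · exact wp_mono_budget hr f x F

-- One unrolling of the loop: `k` pays for the test, `j` for the body, and `i` for all later rounds.
open Classical in
theorem wp_loop (k j i : ℕ) (t f : Prog) (x : Data) (F : Data → ℝ≥0∞) :
    wp k t x (fun c => if c = Data.bot then F x else
      wp j f x fun y => wp i (.loop t f) y F) ≤
      wp (1 + x.size + (k + (j + i))) (.loop t f) x F := by
  have hl : ∀ b y, wp b (.loop t f) y F = twp (whileLoop t.run f.run (b + 1) y) b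
      fun y _ => F y := fun b y => by
    show twp (get >>= _) _ _ = _
    rw [twp_bind, twp_get]
  rw [hl _ x, whileLoop_succ, twp_tick_bind, twp_bind]
  refine twp_run_add _ _ _ _ _ _ fun y r hr => ?_
  split_ifs
  · rw [twp_pure]
  · rw [twp_bind]
    obtain ⟨s, rfl⟩ := Nat.exists_eq_add_of_le hr
    rw [show j + i + s = j + (i + s) by ring]
    refine twp_run_add _ _ _ _ _ _ fun z r hr => ?_
    rw [hl]
    obtain ⟨u, rfl⟩ := Nat.exists_eq_add_of_le (show i ≤ r by omega)
    -- As a program with budget `i` the remaining loop may test `i + 1` times. Inside the unrolled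
    -- loop it inherits the number of tests of the whole loop, which is at least as large.
    refine (twp_whileLoop_mono _ _ (n' := 1 + x.size + (k + (j + i))) (by omega) _ _ _).trans ?_
    exact BudgetMono.whileLoop (BudgetMono.run t) (BudgetMono.run f) _ z i u fun y _ => F y

theorem wp_sample (x : Data) (k : ℕ) (hk : ∀ n ∈ (uniformBelow x.toNat).support,
    (Data.num n).size ≤ k) (F : Data → ℝ≥0∞) :
    ev (uniformBelow x.toNat) (fun n => F (Data.num n)) ≤ wp (1 + x.size + k) .sample x F := by
  show _ ≤ twp (StateT.lift (OptionT.lift (uniformBelow x.toNat)) >>= _) _ _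
  rw [twp_bind, twp_lift]
  refine ev_mono_of_support fun n hn => ?_
  rw [twp_bind, twp_tick, if_pos (by have := hk n hn; omega), twp_pure]

/-- Reading and writing cost time, so outputs (and inputs) longer than the budget contribute
nothing. -/
theorem size_le_of_wp_ne_zero {k : ℕ} {c : Prog} {x : Data} {F : Data → ℝ≥0∞}
    (h : wp k c x F ≠ 0) : ∃ y, F y ≠ 0 ∧ y.size ≤ k ∧ x.size ≤ k := by
  by_contra hn
  push Not at hn
  refine h (Always.run c x k _ fun y r hr => ?_)
  by_contra hF
  have := hn y hF (by omega)
  omega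

theorem size_le_of_mem_support_output {k : ℕ} {c : Prog} {x y : Data}
    (h : some y ∈ (c.output k x).support) : y.size ≤ k := by
  classical
  have h1 : wp k c x (fun z => if some z = some y then 1 else 0) ≠ 0 := by
    rw [← ev_output c k x (fun o => if o = some y then 1 else 0) (by simp), ← apply_eq_ev]
    exact h
  obtain ⟨z, hz, hk, -⟩ := size_le_of_wp_ne_zero h1
  have : z = y := by
    by_contra hne
    simp [hne] at hz
  exact this ▸ hk

/-! ### Sizes of numbers and of the results of elementary operations -/

namespace Data

theorem foldr_bit_bits (n : ℕ) : n.bits.foldr Nat.bit 0 = n := by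
  induction n using Nat.binaryRec' with
  | zero => simp
  | bit b n h ih => rw [Nat.bits_append_bit n b h, List.foldr_cons, ih]

@[simp] theorem toNat_num (n : ℕ) : (num n).toNat = n := foldr_bit_bits n

theorem num_injective : Function.Injective num := fun a b h => by
  rw [← toNat_num a, h, toNat_num]

@[simp] theorem num_inj {a b : ℕ} : num a = num b ↔ a = b := num_injective.eq_iff

theorem size_num (n : ℕ) : (num n).size = n.size + 1 := by
  simp [num, size, Nat.size_eq_bits_len]

theorem size_num_le_of_lt_two_pow {n k : ℕ} (h : n < 2 ^ k) : (num n).size ≤ k + 1 := by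
  rw [size_num]
  have := Nat.size_le.2 h
  omega

theorem size_num_mono {a b : ℕ} (h : a ≤ b) : (num a).size ≤ (num b).size := by
  rw [size_num, size_num]
  have := Nat.size_le_size h
  omega

theorem toNat_lt_two_pow (d : Data) : d.toNat < 2 ^ (d.size - 1) := by
  cases d with
  | str s =>
    simp only [toNat, size, Nat.add_sub_cancel]
    induction s with
    | nil => simp
    | cons b s ih =>
      simp only [List.foldr_cons, List.length_cons, pow_succ]
      cases b <;> simp [Nat.bit] <;> omega
  | pair a b => simp [toNat]

theorem one_le_size (d : Data) : 1 ≤ d.size := by cases d <;> simp [size]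

theorem size_ofBool_le (b : Bool) : (ofBool b).size ≤ 2 := by cases b <;> simp [ofBool, size, bot]

theorem size_ones (n : ℕ) : (ones n).size = n + 1 := by simp [ones, size]

theorem length_lt_size_ofList (l : List Data) :
    l.length < (Data.ofList l).size := by
  induction l with
  | nil => simp [Data.ofList, Data.bot, Data.size]
  | cons a l ih =>
    simp only [Data.ofList, Data.size, List.length_cons]
    have := a.one_le_size
    omega

theorem size_ofList_drop_le (l : List Data) (j : ℕ) :
    (Data.ofList (l.drop j)).size ≤ (Data.ofList l).size := by
  induction l generalizing j with
  | nil => simp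
  | cons a l ih =>
    cases j with
    | zero => simp
    | succ j =>
      have := ih j
      simp only [List.drop_succ_cons, Data.ofList, Data.size]
      omega

end Data

/-- The extreme case is the product, where the lengths of the factors add up; but the argument is a
pair, whose length already contains both. So one operation lengthens its argument by a constant at
most. -/
theorem Op.size_eval_le (o : Op) (x : Data) : (o.eval x).size ≤ x.size + 2 := by
  have hb : Data.bot.size = 1 := rfl
  have key : ∀ (a b : Data) (n : ℕ), n < 2 ^ (a.size + b.size) →
      (Data.num n).size ≤ (Data.pair a b).size + 2 := fun a b n hn => by
    have := Data.size_num_le_of_lt_two_pow hn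
    simp only [Data.size]; omega
  have mono : ∀ (a : Data) (k : ℕ), a.toNat < 2 ^ (a.size + k) := fun a k =>
    (Data.toNat_lt_two_pow a).trans_le (Nat.pow_le_pow_right (by norm_num) (by omega))
  rcases x with s | ⟨a, b⟩
  · cases o <;> rcases s with _ | ⟨c, s⟩ <;> simp [Op.eval, Data.size, hb]
    have := Data.size_ofBool_le c
    omega
  · have h1 := Data.toNat_lt_two_pow a
    have h2 := Data.toNat_lt_two_pow b
    have h3 := Data.one_le_size a
    have h4 := Data.one_le_size b
    cases o
    case add =>
      refine key a b _ ?_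
      have e1 := mono a 0
      have : (2 : ℕ) ^ (a.size - 1) ≤ 2 ^ (a.size + b.size - 1) :=
        Nat.pow_le_pow_right (by norm_num) (by omega)
      have h5 : (2 : ℕ) ^ (b.size - 1) ≤ 2 ^ (a.size + b.size - 1) :=
        Nat.pow_le_pow_right (by norm_num) (by omega)
      have h6 : (2 : ℕ) ^ (a.size + b.size) = 2 * 2 ^ (a.size + b.size - 1) := by
        rw [← pow_succ']; congr 1; omega
      omega
    case sub => exact key a b _ ((Nat.sub_le _ _).trans_lt (mono a _))
    case mul =>
      refine key a b _ ?_
      rw [pow_add]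
      exact Nat.mul_lt_mul'' (mono a 0) (mono b 0)
    case div => exact key a b _ ((Nat.div_le_self _ _).trans_lt (mono a _))
    case mod => exact key a b _ ((Nat.mod_le _ _).trans_lt (mono a _))
    case lt =>
      have := Data.size_ofBool_le (decide (a.toNat < b.toNat))
      simp only [Op.eval, Data.size]; convert this.trans _ using 2; omega
    case eq =>
      simp only [Op.eval, Data.size]
      exact (Data.size_ofBool_le _).trans (by omega)
    case isPair =>
      simp only [Op.eval, Data.size]
      exact (Data.size_ofBool_le _).trans (by omega)
    case cons =>
      rcases b with s | ⟨b, b'⟩ <;> (simp [Op.eval, Data.size, hb]; try omega)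
    all_goals simp [Op.eval, Data.size, hb]; try omega

theorem eval_nat_mono (r : Polynomial ℕ) {m n : ℕ} (h : m ≤ n) : r.eval m ≤ r.eval n := by
  induction r using Polynomial.induction_on' with
  | add p q hp hq => simpa using add_le_add hp hq
  | monomial k a => simpa using Nat.mul_le_mul_left a (Nat.pow_le_pow_left h k)

/-! ### Certain outputs -/

/-- With time budget `k`, the program `c` certainly outputs `y` on `x`. -/
def Surely (c : Prog) (x y : Data) (k : ℕ) : Prop := ∀ F : Data → ℝ≥0∞, F y ≤ wp k c x F

theorem Surely.mono {c : Prog} {x y : Data} {k k' : ℕ} (h : Surely c x y k) (hk : k ≤ k') :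
    Surely c x y k' := fun F => (h F).trans (wp_mono_budget hk c x F)

/-- A time bound is at the same time a length bound for input and output. Thus reading costs can be
charged to a bound for a subprogram on the same input. -/
theorem Surely.size_le {c : Prog} {x y : Data} {k : ℕ} (h : Surely c x y k) :
    y.size ≤ k ∧ x.size ≤ k := by
  classical
  have h1 : wp k c x (fun z => if z = y then 1 else 0) ≠ 0 := fun h0 => by
    have := h fun z => if z = y then 1 else 0
    simp [h0] at this
  obtain ⟨z, hz, hk, hx⟩ := size_le_of_wp_ne_zero h1
  have : z = y := by
    by_contra hne
    simp [hne] at hz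
  exact ⟨this ▸ hk, hx⟩

theorem Surely.of_output {c : Prog} {x y : Data} {k : ℕ}
    (h : c.output k x = PMF.pure (some y)) : Surely c x y k := fun F => by
  have := ev_output c k x (fun o => o.elim 0 F) rfl
  rw [h, ev_pure] at this
  exact this.le

theorem Surely.seq {f g : Prog} {x y z : Data} {k j : ℕ} (hf : Surely f x y k)
    (hg : Surely g y z j) : Surely (.seq f g) x z (k + j) := fun F =>
  (hg F).trans ((hf fun y => wp j g y F).trans (wp_seq k j f g x F))

theorem Surely.fork {f g : Prog} {x y z : Data} {k j : ℕ} (hf : Surely f x y k)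
    (hg : Surely g x z j) : Surely (.fork f g) x (.pair y z) (1 + x.size + (k + j)) := fun F =>
  (hg fun z => F (.pair y z)).trans ((hf fun y => wp j g x fun z => F (.pair y z)).trans
    (wp_fork k j f g x F))

theorem Surely.cond_true {t f g : Prog} {x c y : Data} {k j : ℕ} (ht : Surely t x c k)
    (hc : c ≠ Data.bot) (hf : Surely f x y j) :
    Surely (.cond t f g) x y (1 + x.size + (k + j)) := fun F => by
  refine (hf F).trans (le_trans ?_ (wp_cond k j t f g x F))
  refine le_trans (le_of_eq ?_) (ht _)
  rw [if_neg hc]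

theorem Surely.cond_false {t f g : Prog} {x y : Data} {k j : ℕ} (ht : Surely t x Data.bot k)
    (hg : Surely g x y j) : Surely (.cond t f g) x y (1 + x.size + (k + j)) := fun F => by
  refine (hg F).trans (le_trans ?_ (wp_cond k j t f g x F))
  refine le_trans (le_of_eq ?_) (ht _)
  rw [if_pos rfl]

/-- There are `N + 1` tests and `N` bodies. In each round, `1 + k` pays for reading the state, whose
length is at most `k` because the test reads it within time `k`; the last round pays for an unneeded
body. -/
theorem Surely.loop {t f : Prog} {k j : ℕ} (s : ℕ → Data) : ∀ N : ℕ,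
    (∀ i < N, ∃ c ≠ Data.bot, Surely t (s i) c k) → (∀ i < N, Surely f (s i) (s (i + 1)) j) →
    Surely t (s N) Data.bot k →
    Surely (.loop t f) (s 0) (s N) ((N + 1) * (1 + k + (k + j)))
  | 0, _, _, h => fun F => by
    have hs := h.size_le.2
    refine le_trans ?_ (wp_mono_budget (show 1 + (s 0).size + (k + (0 + 0)) ≤ _ by
      simp only [zero_add, one_mul]; omega) _ _ _)
    refine le_trans (le_trans (le_of_eq ?_) (h _)) (wp_loop k 0 0 t f (s 0) F)
    rw [if_pos rfl]
  | N + 1, h1, h2, h3 => fun F => by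
    have ih := Surely.loop (fun i => s (i + 1)) N (fun i hi => h1 (i + 1) (by omega))
      (fun i hi => h2 (i + 1) (by omega)) h3
    obtain ⟨c, hc, hs⟩ := h1 0 (by omega)
    have hs' := hs.size_le.2
    refine le_trans ?_ (wp_mono_budget (show 1 + (s 0).size +
      (k + (j + (N + 1) * (1 + k + (k + j)))) ≤ _ by
        rw [add_mul (N + 1) 1]; omega) _ _ _)
    refine le_trans ?_ (wp_loop k j _ t f (s 0) F)
    refine le_trans ?_ (hs _)
    rw [if_neg hc]
    exact (ih F).trans (h2 0 (by omega) _)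

/-! ### Families of data with polynomially bounded length, and polynomial-time maps between them -/

section Comp

variable {ι κ : Type*} {S S' : Set ι} {μ μ' : ι → ℕ} {x y z : ι → Data}

/-- The length of `x i` is polynomial in `μ i`, for `i ∈ S`. -/
def Bdd (S : Set ι) (μ : ι → ℕ) (x : ι → Data) : Prop :=
  ∃ r : Polynomial ℕ, ∀ i ∈ S, (x i).size ≤ r.eval (μ i)

/-- A program computes `y i` from `x i` in time polynomial in `μ i`, for `i ∈ S`. -/
def Comp (S : Set ι) (μ : ι → ℕ) (x y : ι → Data) : Prop :=
  ∃ (c : Prog) (r : Polynomial ℕ), ∀ i ∈ S, Surely c (x i) (y i) (r.eval (μ i))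

theorem Bdd.mono (h : Bdd S μ x) (hS : S' ⊆ S) : Bdd S' μ x := by
  obtain ⟨r, hr⟩ := h
  exact ⟨r, fun i hi => hr i (hS hi)⟩

theorem Bdd.pair (hx : Bdd S μ x) (hy : Bdd S μ y) : Bdd S μ fun i => .pair (x i) (y i) := by
  obtain ⟨r, hr⟩ := hx
  obtain ⟨s, hs⟩ := hy
  refine ⟨r + s + 1, fun i hi => ?_⟩
  have := hr i hi
  have := hs i hi
  simp only [Data.size, Polynomial.eval_add, Polynomial.eval_one]
  omega

theorem Bdd.reindex {T : Set κ} {ν : κ → ℕ} {x' : κ → Data} (h : Bdd S μ x)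
    (hT : ∀ j ∈ T, ∃ i ∈ S, x i = x' j ∧ μ i ≤ ν j) : Bdd T ν x' := by
  obtain ⟨r, hr⟩ := h
  refine ⟨r, fun j hj => ?_⟩
  obtain ⟨i, hi, h1, h2⟩ := hT j hj
  exact h1 ▸ (hr i hi).trans (eval_nat_mono r h2)

theorem Bdd.of_size_le (h : ∀ i ∈ S, (x i).size ≤ μ i) : Bdd S μ x :=
  ⟨Polynomial.X, fun i hi => by simpa using h i hi⟩

namespace Comp

theorem bdd (h : Comp S μ x y) : Bdd S μ y := by
  obtain ⟨c, r, hr⟩ := h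
  exact ⟨r, fun i hi => (hr i hi).size_le.1⟩

theorem bdd_input (h : Comp S μ x y) : Bdd S μ x := by
  obtain ⟨c, r, hr⟩ := h
  exact ⟨r, fun i hi => (hr i hi).size_le.2⟩

theorem congr {y' : ι → Data} (h : Comp S μ x y) (hy : ∀ i ∈ S, y i = y' i) : Comp S μ x y' := by
  obtain ⟨c, r, hr⟩ := h
  exact ⟨c, r, fun i hi => hy i hi ▸ hr i hi⟩

theorem mono (h : Comp S μ x y) (hS : S' ⊆ S) : Comp S' μ x y := by
  obtain ⟨c, r, hr⟩ := h
  exact ⟨c, r, fun i hi => hr i (hS hi)⟩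

/-- A program sees the data and not the index, and its time bound is monotone. So a family may be
replaced by any other whose data occur in it with no larger measure. -/
theorem reindex {T : Set κ} {ν : κ → ℕ} {x' y' : κ → Data} (h : Comp S μ x y)
    (hT : ∀ j ∈ T, ∃ i ∈ S, x i = x' j ∧ y i = y' j ∧ μ i ≤ ν j) : Comp T ν x' y' := by
  obtain ⟨c, r, hr⟩ := h
  refine ⟨c, r, fun j hj => ?_⟩
  obtain ⟨i, hi, h1, h2, h3⟩ := hT j hj
  exact h1 ▸ h2 ▸ (hr i hi).mono (eval_nat_mono r h3)

theorem trans (hy : Comp S μ x y) (hz : Comp S μ y z) : Comp S μ x z := by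
  obtain ⟨c, r, hr⟩ := hy
  obtain ⟨d, s, hs⟩ := hz
  refine ⟨.seq c d, r + s, fun i hi => ?_⟩
  rw [Polynomial.eval_add]
  exact (hr i hi).seq (hs i hi)

theorem pair (hy : Comp S μ x y) (hz : Comp S μ x z) :
    Comp S μ x fun i => .pair (y i) (z i) := by
  obtain ⟨c, r, hr⟩ := hy
  obtain ⟨d, s, hs⟩ := hz
  refine ⟨.fork c d, 1 + r + (r + s), fun i hi => ?_⟩
  have := (hr i hi).size_le.2
  refine ((hr i hi).fork (hs i hi)).mono ?_
  simp only [Polynomial.eval_add, Polynomial.eval_one]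
  omega

theorem op (o : Op) (hy : Comp S μ x y) : Comp S μ x fun i => o.eval (y i) := by
  refine hy.trans ?_
  obtain ⟨r, hr⟩ := hy.bdd
  refine ⟨.op o, 1 + r + (r + 2), fun i hi F => ?_⟩
  refine (wp_op o (y i) F).ge.trans (wp_mono_budget ?_ _ _ _)
  have := hr i hi
  have := o.size_eval_le (y i)
  simp only [Polynomial.eval_add, Polynomial.eval_one, Polynomial.eval_ofNat]
  omega

theorem id (hx : Bdd S μ x) : Comp S μ x x := by
  obtain ⟨r, hr⟩ := hx
  refine ⟨.op .id, 1 + r + r, fun i hi F => ?_⟩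
  refine (wp_op .id (x i) F).ge.trans (wp_mono_budget ?_ _ _ _)
  have := hr i hi
  have h : Op.id.eval (x i) = x i := by cases x i <;> rfl
  simp only [Polynomial.eval_add, Polynomial.eval_one, h]
  omega

theorem const (hx : Bdd S μ x) (d : Data) : Comp S μ x fun _ => d := by
  obtain ⟨r, hr⟩ := hx
  refine ⟨.const d, 1 + r + (d.size : Polynomial ℕ), fun i hi F => ?_⟩
  refine (wp_const d (x i) F).ge.trans (wp_mono_budget ?_ _ _ _)
  have := hr i hi
  simp only [Polynomial.eval_add, Polynomial.eval_one, Polynomial.eval_natCast, Nat.cast_id]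
  omega

theorem fst (h : Comp S μ x fun i => .pair (y i) (z i)) : Comp S μ x y := h.op .fst

theorem snd (h : Comp S μ x fun i => .pair (y i) (z i)) : Comp S μ x z := h.op .snd

end Comp

open Classical in
/-- The truth value of a proposition as a datum. -/
noncomputable def truth (P : Prop) : Data := Data.ofBool (decide P)

theorem truth_of {P : Prop} (h : P) : truth P = .str [true] := by simp [truth, h, Data.ofBool]

theorem truth_of_not {P : Prop} (h : ¬ P) : truth P = Data.bot := by simp [truth, h, Data.ofBool]

theorem truth_eq_bot {P : Prop} : truth P = Data.bot ↔ ¬ P := by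
  by_cases h : P <;> simp [truth, h, Data.ofBool, Data.bot]

namespace Comp

/-- Definition by cases, with the result given as a single family. -/
theorem ite' {P : ι → Prop} (ht : Comp S μ x fun i => truth (P i))
    (hy : Comp (S ∩ {i | P i}) μ x y) (hz : Comp (S ∩ {i | ¬ P i}) μ x y) : Comp S μ x y := by
  obtain ⟨t, q, hq⟩ := ht
  obtain ⟨c, r, hr⟩ := hy
  obtain ⟨d, s, hs⟩ := hz
  refine ⟨.cond t c d, 1 + q + (q + (r + s)), fun i hi => ?_⟩
  have h1 : Surely t (x i) (truth (P i)) (q.eval (μ i)) := hq i hi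
  have := h1.size_le.2
  by_cases h : P i
  · refine (h1.cond_true (by rw [Ne, truth_eq_bot]; exact not_not.2 h) (hr i ⟨hi, h⟩)).mono ?_
    simp only [Polynomial.eval_add, Polynomial.eval_one]
    omega
  · rw [truth_of_not h] at h1
    refine (h1.cond_false (hs i ⟨hi, h⟩)).mono ?_
    simp only [Polynomial.eval_add, Polynomial.eval_one]
    omega

theorem ite {P : ι → Prop} [∀ i, Decidable (P i)] (ht : Comp S μ x fun i => truth (P i))
    (hy : Comp (S ∩ {i | P i}) μ x y) (hz : Comp (S ∩ {i | ¬ P i}) μ x z) :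
    Comp S μ x fun i => if P i then y i else z i :=
  ht.ite' (hy.congr fun i hi => (if_pos (show P i from hi.2)).symm)
    (hz.congr fun i hi => (if_neg (show ¬ P i from hi.2)).symm)

theorem eq (hy : Comp S μ x y) (hz : Comp S μ x z) : Comp S μ x fun i => truth (y i = z i) :=
  (hy.pair hz).op .eq

theorem not {P : ι → Prop} (h : Comp S μ x fun i => truth (P i)) :
    Comp S μ x fun i => truth (¬ P i) :=
  h.ite' ((const (h.bdd_input.mono Set.inter_subset_left) Data.bot).congr fun i hi =>
      (truth_of_not (not_not.2 (show P i from hi.2))).symm)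
    ((const (h.bdd_input.mono Set.inter_subset_left) (.str [true])).congr fun i hi =>
      (truth_of (show ¬ P i from hi.2)).symm)

/-- The second condition has to be decided only where the first one holds, since otherwise it is not
evaluated. -/
theorem and {P Q : ι → Prop} (h : Comp S μ x fun i => truth (P i))
    (h' : Comp (S ∩ {i | P i}) μ x fun i => truth (Q i)) :
    Comp S μ x fun i => truth (P i ∧ Q i) :=
  h.ite' (h'.congr fun i hi => by congr 1; simp [show P i from hi.2])
    ((const (h.bdd_input.mono Set.inter_subset_left) Data.bot).congr fun i hi =>
      (truth_of_not (fun h => hi.2 h.1)).symm)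

theorem or {P Q : ι → Prop} (h : Comp S μ x fun i => truth (P i))
    (h' : Comp S μ x fun i => truth (Q i)) :
    Comp S μ x fun i => truth (P i ∨ Q i) :=
  (h.not.and (h'.not.mono Set.inter_subset_left)).not.congr fun i _ => by congr 1; simp; tauto

theorem truth_congr {P Q : ι → Prop} (h : Comp S μ x fun i => truth (P i))
    (hPQ : ∀ i ∈ S, (P i ↔ Q i)) : Comp S μ x fun i => truth (Q i) :=
  h.congr fun i hi => by rw [propext (hPQ i hi)]

section arithmetic

variable {a b : ι → ℕ}

theorem num_const (hx : Bdd S μ x) (n : ℕ) : Comp S μ x fun _ => Data.num n := const hx _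

theorem add (ha : Comp S μ x fun i => Data.num (a i)) (hb : Comp S μ x fun i => Data.num (b i)) :
    Comp S μ x fun i => Data.num (a i + b i) :=
  ((ha.pair hb).op .add).congr fun i _ => by simp [Op.eval]

theorem sub (ha : Comp S μ x fun i => Data.num (a i)) (hb : Comp S μ x fun i => Data.num (b i)) :
    Comp S μ x fun i => Data.num (a i - b i) :=
  ((ha.pair hb).op .sub).congr fun i _ => by simp [Op.eval]

theorem mul (ha : Comp S μ x fun i => Data.num (a i)) (hb : Comp S μ x fun i => Data.num (b i)) :
    Comp S μ x fun i => Data.num (a i * b i) :=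
  ((ha.pair hb).op .mul).congr fun i _ => by simp [Op.eval]

theorem mod (ha : Comp S μ x fun i => Data.num (a i)) (hb : Comp S μ x fun i => Data.num (b i)) :
    Comp S μ x fun i => Data.num (a i % b i) :=
  ((ha.pair hb).op .mod).congr fun i _ => by simp [Op.eval]

theorem lt (ha : Comp S μ x fun i => Data.num (a i)) (hb : Comp S μ x fun i => Data.num (b i)) :
    Comp S μ x fun i => truth (a i < b i) :=
  ((ha.pair hb).op .lt).congr fun i _ => by
    simp only [Op.eval, truth, Data.toNat_num]; congr!

theorem toNat (h : Comp S μ x y) : Comp S μ x fun i => Data.num (y i).toNat :=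
  ((h.pair (const h.bdd_input Data.bot)).op .add).congr fun i _ => by
    simp [Op.eval, Data.bot, Data.toNat]

theorem num_eq (ha : Comp S μ x fun i => Data.num (a i))
    (hb : Comp S μ x fun i => Data.num (b i)) : Comp S μ x fun i => truth (a i = b i) :=
  (ha.eq hb).congr fun i _ => by simp

theorem polynomial_eval (ha : Comp S μ x fun i => Data.num (a i)) (P : Polynomial ℕ) :
    Comp S μ x fun i => Data.num (P.eval (a i)) := by
  induction P using Polynomial.induction_on with
  | C c => simpa using num_const ha.bdd_input c
  | add p q hp hq => simpa using hp.add hq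
  | monomial n c h =>
    refine (h.mul ha).congr fun i _ => ?_
    simp only [Polynomial.eval_mul, Polynomial.eval_C, Polynomial.eval_pow, Polynomial.eval_X,
      pow_succ, mul_assoc]

end arithmetic

/-! #### Loops -/

section loops

variable {N : ι → ℕ}

/-- The states of all loops form one family indexed by pairs `(i, j)`, with the measure of `i`
alone. Hence the time of a round is bounded independently of the round, and polynomially many rounds
take polynomial time. The counter `j` need not be visible: the test has to be computable from the
state. -/
theorem iterate {s : ι → ℕ → Data} (hN : ∃ r : Polynomial ℕ, ∀ i ∈ S, N i ≤ r.eval (μ i))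
    (ht : Comp {p : ι × ℕ | p.1 ∈ S ∧ p.2 ≤ N p.1} (fun p => μ p.1) (fun p => s p.1 p.2)
      fun p => truth (p.2 < N p.1))
    (hf : Comp {p : ι × ℕ | p.1 ∈ S ∧ p.2 < N p.1} (fun p => μ p.1) (fun p => s p.1 p.2)
      fun p => s p.1 (p.2 + 1)) :
    Comp S μ (fun i => s i 0) fun i => s i (N i) := by
  obtain ⟨q, hq⟩ := hN
  obtain ⟨t, r, hr⟩ := ht
  obtain ⟨f, r', hr'⟩ := hf
  refine ⟨.loop t f, (q + 1) * (1 + r + (r + r')), fun i hi => ?_⟩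
  refine Surely.mono (Surely.loop (k := r.eval (μ i)) (j := r'.eval (μ i)) (s i) (N i)
    (fun j hj => ⟨_, ?_, hr (i, j) ⟨hi, hj.le⟩⟩) (fun j hj => hr' (i, j) ⟨hi, hj⟩) ?_) ?_
  · rw [Ne, truth_eq_bot]; exact not_not.2 hj
  · have : Surely t (s i (N i)) (truth (N i < N i)) (r.eval (μ i)) := hr (i, N i) ⟨hi, le_rfl⟩
    rwa [truth_of_not (lt_irrefl _)] at this
  · have := hq i hi
    simp only [Polynomial.eval_add, Polynomial.eval_one, Polynomial.eval_mul]
    gcongr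

/-- A computation that does not use the first components of its input. -/
theorem weaken {T : Set κ} {f : κ → ι} {u v : κ → Data} {ν : κ → ℕ} (h : Comp S μ x y)
    (hf : ∀ p ∈ T, f p ∈ S ∧ μ (f p) ≤ ν p)
    (hx : Comp T ν u fun p => x (f p)) (hv : ∀ p ∈ T, y (f p) = v p) : Comp T ν u v :=
  hx.trans (h.reindex fun p hp => ⟨f p, (hf p hp).1, rfl, hv p hp, (hf p hp).2⟩)

/-- The loop state is `(rest, (acc, x))`: what is still to be read, the accumulator, and the
original input as a context for the body. The part `rest` alone decides when to stop. The
accumulators need a length bound that is uniform in the round, as an iteration could otherwise let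
them grow exponentially. -/
theorem foldGen {rest elem acc : ι → ℕ → Data}
    (hN : ∃ r : Polynomial ℕ, ∀ i ∈ S, N i ≤ r.eval (μ i))
    (h0 : Comp S μ x fun i => rest i 0) (ha0 : Comp S μ x fun i => acc i 0)
    (hrest : Bdd {p : ι × ℕ | p.1 ∈ S ∧ p.2 ≤ N p.1} (fun p => μ p.1) fun p => rest p.1 p.2)
    (hacc : Bdd {p : ι × ℕ | p.1 ∈ S ∧ p.2 ≤ N p.1} (fun p => μ p.1) fun p => acc p.1 p.2)
    (ht : Comp {p : ι × ℕ | p.1 ∈ S ∧ p.2 ≤ N p.1} (fun p => μ p.1) (fun p => rest p.1 p.2)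
      fun p => truth (p.2 < N p.1))
    (he : Comp {p : ι × ℕ | p.1 ∈ S ∧ p.2 < N p.1} (fun p => μ p.1) (fun p => rest p.1 p.2)
      fun p => elem p.1 p.2)
    (hn : Comp {p : ι × ℕ | p.1 ∈ S ∧ p.2 < N p.1} (fun p => μ p.1) (fun p => rest p.1 p.2)
      fun p => rest p.1 (p.2 + 1))
    (hb : Comp {p : ι × ℕ | p.1 ∈ S ∧ p.2 < N p.1} (fun p => μ p.1)
      (fun p => .pair (elem p.1 p.2) (.pair (acc p.1 p.2) (x p.1))) fun p => acc p.1 (p.2 + 1)) :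
    Comp S μ x fun i => acc i (N i) := by
  have hx : Bdd {p : ι × ℕ | p.1 ∈ S ∧ p.2 ≤ N p.1} (fun p => μ p.1) fun p => x p.1 :=
    h0.bdd_input.reindex fun p hp => ⟨p.1, hp.1, rfl, le_rfl⟩
  have hst := id (hrest.pair (hacc.pair hx))
  have hlt : {p : ι × ℕ | p.1 ∈ S ∧ p.2 < N p.1} ⊆ {p : ι × ℕ | p.1 ∈ S ∧ p.2 ≤ N p.1} :=
    fun p hp => ⟨hp.1, hp.2.le⟩
  have hst' := hst.mono hlt
  have hfin : Comp S μ (fun i => Data.pair (rest i 0) (.pair (acc i 0) (x i))) fun i =>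
      Data.pair (rest i (N i)) (.pair (acc i (N i)) (x i)) := by
    refine iterate (s := fun i j => Data.pair (rest i j) (.pair (acc i j) (x i))) hN
      (hst.fst.trans ht) ?_
    exact (hst'.fst.trans hn).pair
      ((((hst'.fst.trans he).pair hst'.snd).trans hb).pair hst'.snd.snd)
  exact ((h0.pair (ha0.pair (id h0.bdd_input))).trans hfin).snd.fst

end loops

theorem foldList {l : ι → List Data} {acc : ι → ℕ → Data}
    (hl : Comp S μ x fun i => Data.ofList (l i)) (ha0 : Comp S μ x fun i => acc i 0)
    (hacc : Bdd {p : ι × ℕ | p.1 ∈ S ∧ p.2 ≤ (l p.1).length} (fun p => μ p.1)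
      fun p => acc p.1 p.2)
    (hb : Comp {p : ι × ℕ | p.1 ∈ S ∧ p.2 < (l p.1).length} (fun p => μ p.1)
      (fun p => .pair ((l p.1).getD p.2 Data.bot) (.pair (acc p.1 p.2) (x p.1)))
      fun p => acc p.1 (p.2 + 1)) :
    Comp S μ x fun i => acc i (l i).length := by
  obtain ⟨r, hr⟩ := hl.bdd
  have hrest : Bdd {p : ι × ℕ | p.1 ∈ S ∧ p.2 ≤ (l p.1).length} (fun p => μ p.1)
      fun p => Data.ofList ((l p.1).drop p.2) :=
    ⟨r, fun p hp => (Data.size_ofList_drop_le (l p.1) p.2).trans (hr p.1 hp.1)⟩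
  have hlt : {p : ι × ℕ | p.1 ∈ S ∧ p.2 < (l p.1).length} ⊆
      {p : ι × ℕ | p.1 ∈ S ∧ p.2 ≤ (l p.1).length} := fun p hp => ⟨hp.1, hp.2.le⟩
  have hst := (id hrest).mono hlt
  have hcons : ∀ p ∈ {p : ι × ℕ | p.1 ∈ S ∧ p.2 < (l p.1).length},
      Data.ofList ((l p.1).drop p.2) = .pair ((l p.1).getD p.2 Data.bot)
        (Data.ofList ((l p.1).drop (p.2 + 1))) := fun p hp => by
    rw [List.drop_eq_getElem_cons hp.2, Data.ofList, List.getD_eq_getElem _ _ hp.2]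
  refine foldGen (rest := fun i j => Data.ofList ((l i).drop j))
    (elem := fun i j => (l i).getD j Data.bot)
    ⟨r, fun i hi => (Data.length_lt_size_ofList (l i)).le.trans (hr i hi)⟩ (by simpa using hl) ha0
    hrest hacc ?_ ?_ ?_ hb
  · refine ((id hrest).op .isPair).congr fun p hp => ?_
    by_cases h : p.2 < (l p.1).length
    · rw [hcons p ⟨hp.1, h⟩, truth_of h]; rfl
    · rw [truth_of_not h, List.drop_eq_nil_of_le (by omega)]; rfl
  · exact (hst.congr hcons).fst
  · exact (hst.congr hcons).snd

theorem foldStr {s : ι → List Bool} {acc : ι → ℕ → Data}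
    (hl : Comp S μ x fun i => Data.str (s i)) (ha0 : Comp S μ x fun i => acc i 0)
    (hacc : Bdd {p : ι × ℕ | p.1 ∈ S ∧ p.2 ≤ (s p.1).length} (fun p => μ p.1)
      fun p => acc p.1 p.2)
    (hb : Comp {p : ι × ℕ | p.1 ∈ S ∧ p.2 < (s p.1).length} (fun p => μ p.1)
      (fun p => .pair (truth ((s p.1).getD p.2 false = true)) (.pair (acc p.1 p.2) (x p.1)))
      fun p => acc p.1 (p.2 + 1)) :
    Comp S μ x fun i => acc i (s i).length := by
  obtain ⟨r, hr⟩ := hl.bdd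
  have hrest : Bdd {p : ι × ℕ | p.1 ∈ S ∧ p.2 ≤ (s p.1).length} (fun p => μ p.1)
      fun p => Data.str ((s p.1).drop p.2) :=
    ⟨r, fun p hp => le_trans (by simp [Data.size]) (hr p.1 hp.1)⟩
  have hlt : {p : ι × ℕ | p.1 ∈ S ∧ p.2 < (s p.1).length} ⊆
      {p : ι × ℕ | p.1 ∈ S ∧ p.2 ≤ (s p.1).length} := fun p hp => ⟨hp.1, hp.2.le⟩
  have hst := (id hrest).mono hlt
  have hcons : ∀ p ∈ {p : ι × ℕ | p.1 ∈ S ∧ p.2 < (s p.1).length},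
      (s p.1).drop p.2 = (s p.1).getD p.2 false :: (s p.1).drop (p.2 + 1) := fun p hp => by
    rw [List.drop_eq_getElem_cons hp.2, List.getD_eq_getElem _ _ hp.2]
  refine foldGen (rest := fun i j => Data.str ((s i).drop j))
    (elem := fun i j => truth ((s i).getD j false = true))
    ⟨r, fun i hi => le_trans (by simp [Data.size]) (hr i hi)⟩ (by simpa using hl) ha0
    hrest hacc ?_ ?_ ?_ hb
  · refine ((id hrest).eq (const hrest Data.bot)).not.truth_congr fun p hp => ?_
    simp [Data.bot]
  · refine (hst.op .head).congr fun p hp => ?_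
    rw [hcons p hp]
    simp [Op.eval, truth]
  · refine (hst.op .tail).congr fun p hp => ?_
    rw [hcons p hp]
    rfl

end Comp

end Comp

/-! ### Association lists -/

open Classical in
/-- The first value with key `q`. -/
noncomputable def assoc {α β : Type*} (q : α) : List (α × β) → Option β
  | [] => none
  | e :: l => if e.1 = q then some e.2 else assoc q l

/-- An optional datum as a datum. -/
def encOption {β : Type*} (f : β → Data) : Option β → Data
  | none => Data.bot
  | some b => .pair Data.bot (f b)

section assoc

variable {α β : Type*}

open Classical in
theorem assoc_append (q : α) (l l' : List (α × β)) :
    assoc q (l ++ l') = (assoc q l).or (assoc q l') := by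
  induction l with
  | nil => simp [assoc]
  | cons e l ih =>
    simp only [List.cons_append, assoc]
    split_ifs <;> simp [ih]

theorem assoc_cons_self (q : α) (v : β) (l : List (α × β)) : assoc q ((q, v) :: l) = some v := by
  simp [assoc]

theorem assoc_cons_of_ne {q q' : α} (h : q' ≠ q) (v : β) (l : List (α × β)) :
    assoc q ((q', v) :: l) = assoc q l := by
  simp [assoc, h]

theorem mem_of_assoc_eq_some {q : α} {v : β} {l : List (α × β)} (h : assoc q l = some v) :
    (q, v) ∈ l := by
  induction l with
  | nil => simp [assoc] at h
  | cons e l ih =>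
    rw [assoc] at h
    split_ifs at h with he
    · obtain rfl := Option.some.inj h
      subst he
      simp
    · exact List.mem_cons_of_mem _ (ih h)

theorem exists_assoc_of_mem {q : α} {v : β} {l : List (α × β)} (h : (q, v) ∈ l) :
    ∃ v', assoc q l = some v' := by
  induction l with
  | nil => simp at h
  | cons e l ih =>
    rw [assoc]
    split_ifs with he
    · exact ⟨_, rfl⟩
    · refine ih ((List.mem_cons.1 h).resolve_left fun h' => he ?_)
      rw [← h']

theorem assoc_map {γ : Type*} (f : α → β → γ) (q : α) (l : List (α × β)) :
    assoc q (l.map fun e => (e.1, f e.1 e.2)) = (assoc q l).map (f q) := by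
  induction l with
  | nil => rfl
  | cons e l ih =>
    simp only [List.map_cons, assoc]
    split_ifs with h
    · simp [h]
    · exact ih

theorem size_encOption_assoc_take_le (ek : α → Data) (f : β → Data) (q : α) (l : List (α × β))
    (j : ℕ) : (encOption f (assoc q (l.take j))).size ≤
      (Data.ofList (l.map fun e => .pair (ek e.1) (f e.2))).size := by
  induction l generalizing j with
  | nil => simp [assoc, encOption, Data.ofList]
  | cons e l ih =>
    simp only [List.map_cons, Data.ofList, Data.size]
    cases j with
    | zero => simp [assoc, encOption, Data.bot, Data.size]
    | succ j =>
      have h1 := ih j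
      have h2 := (ek e.1).one_le_size
      have h3 := (Data.ofList (l.map fun e => .pair (ek e.1) (f e.2))).one_le_size
      rw [List.take_succ_cons, assoc]
      split_ifs
      · simp only [encOption, Data.size, Data.bot, List.length_nil]
        omega
      · omega

end assoc

theorem size_truth_le (P : Prop) : (truth P).size ≤ 2 := Data.size_ofBool_le _

/-! ### Table lookup, lengths, unary numbers and powers in polynomial time -/

namespace Comp

variable {ι κ : Type*} {S : Set ι} {μ : ι → ℕ} {x y z : ι → Data}

/-- Looking up a key in an association list. -/
theorem assoc {α β : ι → Type*} {ek : ∀ i, α i → Data} {f : ∀ i, β i → Data}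
    (hek : ∀ i, Function.Injective (ek i)) {q : ∀ i, α i} {L : ∀ i, List (α i × β i)}
    (hq : Comp S μ x fun i => ek i (q i))
    (hL : Comp S μ x fun i => Data.ofList ((L i).map fun e => .pair (ek i e.1) (f i e.2))) :
    Comp S μ x fun i => encOption (f i) (assoc (q i) (L i)) := by
  have hx := hq.bdd_input
  obtain ⟨r, hr⟩ := hL.bdd
  have hlen : ∀ i, ((L i).map fun e => Data.pair (ek i e.1) (f i e.2)).length = (L i).length :=
    fun i => by simp
  -- The accumulator after `j` entries is the result of the lookup among the first `j` entries.
  -- Since a found value is coded as a pair, `⊥` means "not found yet", and an entry is compared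
  -- with the key only in this case.
  refine Comp.congr (foldList (acc := fun i j => encOption (f i) (SynchAgg.assoc (q i) ((L i).take j)))
    hL ((const hx Data.bot).congr fun i _ => by simp [SynchAgg.assoc, encOption])
    ⟨r, fun p hp => (size_encOption_assoc_take_le (ek p.1) (f p.1) _ _ _).trans (hr p.1 hp.1)⟩ ?_)
    fun i _ => by rw [hlen, List.take_of_length_le le_rfl]
  set T : Set (ι × ℕ) := {p | p.1 ∈ S ∧
    p.2 < ((L p.1).map fun e => Data.pair (ek p.1 e.1) (f p.1 e.2)).length}
  have hT : ∀ p ∈ T, p.2 < (L p.1).length := fun p hp => by simpa [T] using hp.2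
  have hbd : Bdd T (fun p => μ p.1) fun p => Data.pair
      (((L p.1).map fun e => Data.pair (ek p.1 e.1) (f p.1 e.2)).getD p.2 Data.bot)
      (.pair (encOption (f p.1) (SynchAgg.assoc (q p.1) ((L p.1).take p.2))) (x p.1)) := by
    refine Bdd.pair ⟨r, fun p hp => le_trans ?_ (hr p.1 hp.1)⟩ (Bdd.pair ⟨r, fun p hp =>
      (size_encOption_assoc_take_le (ek p.1) (f p.1) _ _ _).trans (hr p.1 hp.1)⟩
      (hx.reindex fun p hp => ⟨p.1, hp.1, rfl, le_rfl⟩))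
    have h1 := Data.size_ofList_drop_le ((L p.1).map fun e => Data.pair (ek p.1 e.1) (f p.1 e.2)) p.2
    rw [List.drop_eq_getElem_cons hp.2, ← List.getD_eq_getElem _ Data.bot hp.2] at h1
    simp only [Data.ofList, Data.size] at h1
    dsimp only
    omega
  have hid := Comp.id hbd
  have hkey : Comp T (fun p => μ p.1) (fun p => Data.pair
      (((L p.1).map fun e => Data.pair (ek p.1 e.1) (f p.1 e.2)).getD p.2 Data.bot)
      (.pair (encOption (f p.1) (SynchAgg.assoc (q p.1) ((L p.1).take p.2))) (x p.1)))
      fun p => ek p.1 (q p.1) :=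
    hq.weaken (f := Prod.fst) (fun p hp => ⟨hp.1, le_rfl⟩) hid.snd.snd fun _ _ => rfl
  have hel : ∀ p (hp : p ∈ T), ((L p.1).map fun e => Data.pair (ek p.1 e.1) (f p.1 e.2)).getD p.2
      Data.bot = Data.pair (ek p.1 ((L p.1)[p.2]'(hT p hp)).1) (f p.1 ((L p.1)[p.2]'(hT p hp)).2) :=
    fun p hp => by
      rw [List.getD_eq_getElem _ _ hp.2, List.getElem_map]
  have hstep : ∀ p (hp : p ∈ T), SynchAgg.assoc (q p.1) ((L p.1).take (p.2 + 1)) =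
      (SynchAgg.assoc (q p.1) ((L p.1).take p.2)).or
        (SynchAgg.assoc (q p.1) [(L p.1)[p.2]'(hT p hp)]) := fun p hp => by
    rw [← assoc_append, List.take_succ_eq_append_getElem (hT p hp)]
  refine ite' (P := fun p => encOption (f p.1) (SynchAgg.assoc (q p.1) ((L p.1).take p.2)) = Data.bot)
    (hid.snd.fst.eq (const hbd _)) ?_ ((hid.snd.fst.mono Set.inter_subset_left).congr ?_)
  · refine ite' (P := fun p => (Op.fst.eval (((L p.1).map fun e => Data.pair (ek p.1 e.1)
      (f p.1 e.2)).getD p.2 Data.bot) = ek p.1 (q p.1)))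
      (((hid.fst.op .fst).eq hkey).mono Set.inter_subset_left) ?_ ?_
    · refine Comp.congr (((const hbd Data.bot).pair (hid.fst.op .snd)).mono
        (Set.inter_subset_left.trans Set.inter_subset_left)) ?_
      rintro p ⟨⟨hp, h1⟩, h2⟩
      simp only [Set.mem_ofPred_eq] at h1 h2
      rw [hstep p hp]
      rw [hel p hp] at h2 ⊢
      cases hc : SynchAgg.assoc (q p.1) ((L p.1).take p.2) with
      | none => simp [SynchAgg.assoc, hek p.1 h2, encOption, Op.eval]
      | some v => rw [hc] at h1; simp [encOption, Data.bot] at h1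
    · refine Comp.congr (((const hbd Data.bot)).mono
        (Set.inter_subset_left.trans Set.inter_subset_left)) ?_
      rintro p ⟨⟨hp, h1⟩, h2⟩
      simp only [Set.mem_ofPred_eq] at h1 h2
      rw [hstep p hp]
      rw [hel p hp] at h2
      cases hc : SynchAgg.assoc (q p.1) ((L p.1).take p.2) with
      | none =>
        have : ((L p.1)[p.2]'(hT p hp)).1 ≠ q p.1 := fun h => h2 (by rw [h]; rfl)
        simp [SynchAgg.assoc, this, encOption]
      | some v => rw [hc] at h1; simp [encOption, Data.bot] at h1
  · rintro p ⟨hp, h1⟩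
    simp only [Set.mem_ofPred_eq] at h1
    rw [hstep p hp]
    cases hc : SynchAgg.assoc (q p.1) ((L p.1).take p.2) with
    | none => rw [hc] at h1; simp [encOption] at h1
    | some v => simp

theorem length {L : ι → List Data} (hL : Comp S μ x fun i => Data.ofList (L i)) :
    Comp S μ x fun i => Data.num (L i).length := by
  obtain ⟨r, hr⟩ := hL.bdd
  have hx := hL.bdd_input
  have hb : Bdd {p : ι × ℕ | p.1 ∈ S ∧ p.2 ≤ (L p.1).length} (fun p => μ p.1)
      fun p => Data.num p.2 := by
    refine ⟨r + 1, fun p hp => ?_⟩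
    have h1 := Data.length_lt_size_ofList (L p.1)
    have h2 := hr p.1 hp.1
    have h3 : p.2 ≤ _ := hp.2
    dsimp only at h2 ⊢
    have h4 := Data.size_num_le_of_lt_two_pow (n := p.2) (k := p.2) Nat.lt_two_pow_self
    simp only [Polynomial.eval_add, Polynomial.eval_one]
    omega
  refine foldList (acc := fun i j => Data.num j) hL (num_const hx 0) hb ?_
  have hbd : Bdd {p : ι × ℕ | p.1 ∈ S ∧ p.2 < (L p.1).length} (fun p => μ p.1) fun p =>
      Data.pair ((L p.1).getD p.2 Data.bot) (.pair (Data.num p.2) (x p.1)) := by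
    refine Bdd.pair ⟨r, fun p hp => le_trans ?_ (hr p.1 hp.1)⟩
      ((hb.mono fun p hp => ⟨hp.1, hp.2.le⟩).pair
        (hx.reindex fun p hp => ⟨p.1, hp.1, rfl, le_rfl⟩))
    have h1 := Data.size_ofList_drop_le (L p.1) p.2
    rw [List.drop_eq_getElem_cons hp.2, ← List.getD_eq_getElem _ Data.bot hp.2] at h1
    simp only [Data.ofList, Data.size] at h1
    dsimp only
    omega
  exact (id hbd).snd.fst.add (num_const hbd 1)

/-- The length of a string. -/
theorem strLength {s : ι → List Bool} (hs : Comp S μ x fun i => Data.str (s i)) :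
    Comp S μ x fun i => Data.num (s i).length := by
  obtain ⟨r, hr⟩ := hs.bdd
  have hx := hs.bdd_input
  have hb : Bdd {p : ι × ℕ | p.1 ∈ S ∧ p.2 ≤ (s p.1).length} (fun p => μ p.1)
      fun p => Data.num p.2 := by
    refine ⟨r + 1, fun p hp => ?_⟩
    have h2 := hr p.1 hp.1
    have h3 : p.2 ≤ _ := hp.2
    have h4 := Data.size_num_le_of_lt_two_pow (n := p.2) (k := p.2) Nat.lt_two_pow_self
    simp only [Data.size] at h2
    simp only [Polynomial.eval_add, Polynomial.eval_one]
    omega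
  refine foldStr (acc := fun i j => Data.num j) hs (num_const hx 0) hb ?_
  have hbd : Bdd {p : ι × ℕ | p.1 ∈ S ∧ p.2 < (s p.1).length} (fun p => μ p.1) fun p =>
      Data.pair (truth ((s p.1).getD p.2 false = true)) (.pair (Data.num p.2) (x p.1)) :=
    Bdd.pair ⟨2, fun p _ => by simpa using size_truth_le _⟩
      ((hb.mono fun p hp => ⟨hp.1, hp.2.le⟩).pair
        (hx.reindex fun p hp => ⟨p.1, hp.1, rfl, le_rfl⟩))
  exact (id hbd).snd.fst.add (num_const hbd 1)

/-- From binary to unary. -/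
theorem ones {a : ι → ℕ} (ha : Comp S μ x fun i => Data.num (a i))
    (hN : ∃ r : Polynomial ℕ, ∀ i ∈ S, a i ≤ r.eval (μ i)) :
    Comp S μ x fun i => Data.ones (a i) := by
  have hx := ha.bdd_input
  obtain ⟨r, hr⟩ := ha.bdd
  have hle : {p : ι × ℕ | p.1 ∈ S ∧ p.2 < a p.1} ⊆ {p : ι × ℕ | p.1 ∈ S ∧ p.2 ≤ a p.1} :=
    fun p hp => ⟨hp.1, hp.2.le⟩
  have hr1 : Bdd {p : ι × ℕ | p.1 ∈ S ∧ p.2 ≤ a p.1} (fun p => μ p.1)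
      fun p => Data.num (a p.1 - p.2) :=
    ⟨r, fun p hp => (Data.size_num_mono (Nat.sub_le _ _)).trans (hr p.1 hp.1)⟩
  have hb : Bdd {p : ι × ℕ | p.1 ∈ S ∧ p.2 ≤ a p.1} (fun p => μ p.1)
      fun p => Data.ones p.2 := by
    obtain ⟨q, hq⟩ := hN
    refine ⟨q + 1, fun p hp => ?_⟩
    have h2 := hq p.1 hp.1
    have h3 : p.2 ≤ _ := hp.2
    simp only [Data.size_ones, Polynomial.eval_add, Polynomial.eval_one]
    omega
  refine foldGen (N := a) (rest := fun i j => Data.num (a i - j)) (elem := fun i j => Data.bot)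
    (acc := fun i j => Data.ones j) hN (by simpa using ha) (const hx _) hr1 hb ?_
    (const (hr1.mono hle) _) ?_ ?_
  · refine ((id hr1).num_eq (num_const hr1 0)).not.truth_congr fun p hp => ?_
    omega
  · refine ((id (hr1.mono hle)).sub (num_const (hr1.mono hle) 1)).congr fun p hp => ?_
    congr 1
  · have hbd : Bdd {p : ι × ℕ | p.1 ∈ S ∧ p.2 < a p.1} (fun p => μ p.1) fun p =>
        Data.pair Data.bot (.pair (Data.ones p.2) (x p.1)) :=
      Bdd.pair ⟨1, fun p _ => by simp [Data.bot, Data.size]⟩ ((hb.mono hle).pair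
        (hx.reindex fun p hp => ⟨p.1, hp.1, rfl, le_rfl⟩))
    refine (((const hbd (.str [true])).pair (id hbd).snd.fst).op .cons).congr fun p _ => ?_
    simp [Op.eval, Data.ones, Data.bot, List.replicate_succ]

/-! #### Powers in monoids with computable multiplication -/

/-- Multiplication in the monoids `M i` is computable, with the help of the parameters `par i`. -/
def _root_.SynchAgg.MulComp {ι : Type*} (S : Set ι) (μ : ι → ℕ) {M : ι → Type} [∀ i, Mul (M i)]
    (enc : ∀ i, M i → Data) (par : ι → Data) : Prop :=
  ∃ (c : Prog) (r : Polynomial ℕ), ∀ i ∈ S, ∀ a b : M i,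
    Surely c (.pair (par i) (.pair (enc i a) (enc i b))) (enc i (a * b)) (r.eval (μ i))

variable {M : ι → Type} [∀ i, CommMonoid (M i)] {enc : ∀ i, M i → Data} {par : ι → Data}

theorem _root_.SynchAgg.MulComp.size_le (h : MulComp S μ enc par) :
    ∃ r : Polynomial ℕ, ∀ i ∈ S, ∀ a : M i, (enc i a).size ≤ r.eval (μ i) := by
  obtain ⟨c, r, hr⟩ := h
  refine ⟨r, fun i hi a => ?_⟩
  have := (hr i hi a 1).size_le.1
  rwa [mul_one] at this

theorem mulOf (h : MulComp S μ enc par) {T : Set κ} {ν : κ → ℕ} {f : κ → ι} {u : κ → Data}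
    (hf : ∀ p ∈ T, f p ∈ S ∧ μ (f p) ≤ ν p) {a b : ∀ p, M (f p)}
    (hp : Comp T ν u fun p => par (f p)) (ha : Comp T ν u fun p => enc (f p) (a p))
    (hb : Comp T ν u fun p => enc (f p) (b p)) : Comp T ν u fun p => enc (f p) (a p * b p) := by
  obtain ⟨c, r, hr⟩ := h
  exact (hp.pair (ha.pair hb)).trans ⟨c, r, fun p hp =>
    (hr (f p) (hf p hp).1 (a p) (b p)).mono (eval_nat_mono r (hf p hp).2)⟩

/-- Square and multiply from the least significant bit: after `j` bits the accumulator is `(a ^ (k %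
2 ^ j + 1), a ^ 2 ^ j)`. The exponent `k + 1` allows a start with `a` itself, so that no code of the
neutral element is needed; only products are supposed to be computable. -/
theorem pow (h : MulComp S μ enc par) {a : ∀ i, M i} {k : ι → ℕ} (hp : Comp S μ x par)
    (ha : Comp S μ x fun i => enc i (a i)) (hk : Comp S μ x fun i => Data.num (k i)) :
    Comp S μ x fun i => enc i (a i ^ (k i + 1)) := by
  obtain ⟨r, hr⟩ := h.size_le
  have hx := ha.bdd_input
  have hb : ∀ (T : Set (ι × ℕ)) (_ : ∀ p ∈ T, p.1 ∈ S), Bdd T (fun p => μ p.1) fun p =>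
      Data.pair (enc p.1 (a p.1 ^ (k p.1 % 2 ^ p.2 + 1))) (enc p.1 (a p.1 ^ 2 ^ p.2)) := fun T hT =>
    Bdd.pair ⟨r, fun p hp => hr p.1 (hT p hp) _⟩ ⟨r, fun p hp => hr p.1 (hT p hp) _⟩
  have key : Comp S μ x fun i => Data.pair
      (enc i (a i ^ (k i % 2 ^ (k i).bits.length + 1))) (enc i (a i ^ 2 ^ (k i).bits.length)) := by
    refine foldStr (s := fun i => (k i).bits)
      (acc := fun i j => Data.pair (enc i (a i ^ (k i % 2 ^ j + 1))) (enc i (a i ^ 2 ^ j))) hk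
      ((ha.pair ha).congr fun i _ => by simp [Nat.mod_one]) (hb _ fun p hp => hp.1) ?_
    set T : Set (ι × ℕ) := {p | p.1 ∈ S ∧ p.2 < (k p.1).bits.length}
    have hbd : Bdd T (fun p => μ p.1) fun p =>
        Data.pair (truth ((k p.1).bits.getD p.2 false = true)) (.pair (.pair
          (enc p.1 (a p.1 ^ (k p.1 % 2 ^ p.2 + 1))) (enc p.1 (a p.1 ^ 2 ^ p.2))) (x p.1)) :=
      Bdd.pair ⟨2, fun p _ => by simpa using size_truth_le _⟩
        ((hb T fun p hp => hp.1).pair (hx.reindex fun p hp => ⟨p.1, hp.1, rfl, le_rfl⟩))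
    have hid := id hbd
    have hf : ∀ p ∈ T, p.1 ∈ S ∧ μ p.1 ≤ μ p.1 := fun p hp => ⟨hp.1, le_rfl⟩
    have hpar := hp.weaken (f := Prod.fst) hf hid.snd.snd fun _ _ => rfl
    have h1 := mulOf h (f := Prod.fst) hf hpar hid.snd.fst.fst hid.snd.fst.snd
    have h2 := mulOf h (f := Prod.fst) hf hpar hid.snd.fst.snd hid.snd.fst.snd
    have hbit : ∀ p : ι × ℕ, (k p.1).bits.getD p.2 false = (k p.1).testBit p.2 := fun p => by
      rw [Nat.testBit_eq_inth]; rfl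
    refine pair (ite' hid.fst ((h1.mono Set.inter_subset_left).congr fun p hp' => ?_)
      ((hid.snd.fst.fst.mono Set.inter_subset_left).congr fun p hp' => ?_)) (h2.congr fun p _ => ?_)
    · have : (k p.1).testBit p.2 = true := (hbit p).symm.trans hp'.2
      rw [Nat.mod_pow_succ, ← Nat.toNat_testBit, this, ← pow_add]
      congr 2
      simp; ring
    · have : (k p.1).testBit p.2 = false := by
        rw [← hbit p]; simpa using hp'.2
      rw [Nat.mod_pow_succ, ← Nat.toNat_testBit, this]
      simp
    · rw [← pow_add]
      congr 2
      ring
  refine key.fst.congr fun i _ => ?_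
  rw [Nat.size_eq_bits_len, Nat.mod_eq_of_lt (Nat.lt_size_self _)]

/-! #### Arithmetic modulo `p` -/

section zmod

variable {p : ι → ℕ} {a b : ∀ i, ZMod (p i)}

theorem zmod_natCast {k : ι → ℕ} (hp : Comp S μ x fun i => Data.num (p i))
    (hk : Comp S μ x fun i => Data.num (k i)) :
    Comp S μ x fun i => Data.num ((k i : ZMod (p i))).val :=
  (hk.mod hp).congr fun i _ => by rw [ZMod.val_natCast]

theorem zmod_add [∀ i, NeZero (p i)] (hp : Comp S μ x fun i => Data.num (p i))
    (ha : Comp S μ x fun i => Data.num (a i).val)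
    (hb : Comp S μ x fun i => Data.num (b i).val) :
    Comp S μ x fun i => Data.num (a i + b i).val :=
  ((ha.add hb).mod hp).congr fun i _ => by rw [ZMod.val_add]

theorem zmod_mul (hp : Comp S μ x fun i => Data.num (p i))
    (ha : Comp S μ x fun i => Data.num (a i).val)
    (hb : Comp S μ x fun i => Data.num (b i).val) :
    Comp S μ x fun i => Data.num (a i * b i).val :=
  ((ha.mul hb).mod hp).congr fun i _ => by rw [ZMod.val_mul]

theorem zmod_neg [∀ i, NeZero (p i)] (hp : Comp S μ x fun i => Data.num (p i))
    (ha : Comp S μ x fun i => Data.num (a i).val) :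
    Comp S μ x fun i => Data.num (-a i).val :=
  ((hp.sub ha).mod hp).congr fun i _ => by
    rw [← ZMod.val_natCast, Nat.cast_sub (ZMod.val_lt _).le]
    simp

theorem zmod_sub [∀ i, NeZero (p i)] (hp : Comp S μ x fun i => Data.num (p i))
    (ha : Comp S μ x fun i => Data.num (a i).val)
    (hb : Comp S μ x fun i => Data.num (b i).val) :
    Comp S μ x fun i => Data.num (a i - b i).val := by
  simpa only [sub_eq_add_neg] using zmod_add hp ha (zmod_neg hp hb)

theorem zmod_mulComp [∀ i, NeZero (p i)] (hp : Bdd S μ fun i => Data.num (p i)) :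
    MulComp S μ (fun i (c : ZMod (p i)) => Data.num c.val) fun i => Data.num (p i) := by
  obtain ⟨r, hr⟩ := hp
  have hbd : Bdd {q : Σ i, ZMod (p i) × ZMod (p i) | q.1 ∈ S} (fun q => μ q.1) fun q =>
      Data.pair (Data.num (p q.1)) (.pair (Data.num q.2.1.val) (Data.num q.2.2.val)) :=
    Bdd.pair ⟨r, fun q hq => hr q.1 hq⟩ (Bdd.pair
      ⟨r, fun q hq => (Data.size_num_mono (ZMod.val_lt _).le).trans (hr q.1 hq)⟩
      ⟨r, fun q hq => (Data.size_num_mono (ZMod.val_lt _).le).trans (hr q.1 hq)⟩)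
  obtain ⟨c, s, hs⟩ := zmod_mul (id hbd).fst (id hbd).snd.fst (id hbd).snd.snd
  exact ⟨c, s, fun i hi u v => hs ⟨i, u, v⟩ hi⟩

/-- Fermat: the inverse is the power with exponent `p - 2`, and `pow` is applied to `p - 3` because
it adds one. For `p = 2` this would fail at `0`, where the power is `1` and the inverse is `0` by
convention. -/
theorem zmod_inv [∀ i, Fact (p i).Prime] (h3 : ∀ i ∈ S, p i ≠ 2)
    (hp : Comp S μ x fun i => Data.num (p i))
    (ha : Comp S μ x fun i => Data.num (a i).val) :
    Comp S μ x fun i => Data.num ((a i)⁻¹).val := by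
  refine (pow (zmod_mulComp hp.bdd) hp ha (hp.sub (num_const hp.bdd_input 3))).congr fun i hi => ?_
  have hi2 := (Fact.out : (p i).Prime).two_le
  have hi3 := h3 i hi
  congr 2
  rw [show p i - 3 + 1 = p i - 2 by omega]
  by_cases h0 : a i = 0
  · rw [h0, inv_zero, zero_pow (by omega)]
  · refine eq_inv_of_mul_eq_one_left ?_
    rw [← pow_succ, show p i - 2 + 1 = p i - 1 by omega, ZMod.pow_card_sub_one_eq_one h0]

end zmod

end Comp

/-! ### Exponentiation in groups of prime order -/

namespace PairingGroup

variable (𝒢 : PairingGroup)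

theorem pow_p (u : 𝒢.G) : u ^ 𝒢.p = 1 := by rw [← 𝒢.card_G]; exact pow_card_eq_one'

/-- The exponent matters modulo `p` only, as the group has order `p`. This reduces the laws of `exp`
to those of powers with natural exponents. -/
theorem exp_natCast (u : 𝒢.G) (m : ℕ) : 𝒢.exp u (m : ZMod 𝒢.p) = u ^ m := by
  rw [exp, ZMod.val_natCast]
  conv_rhs => rw [← Nat.mod_add_div m 𝒢.p, pow_add, pow_mul, pow_p, one_pow, mul_one]

theorem exists_natCast (a : ZMod 𝒢.p) : ∃ m : ℕ, (m : ZMod 𝒢.p) = a :=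
  ⟨a.val, ZMod.natCast_zmod_val a⟩

theorem exp_add (u : 𝒢.G) (a b : ZMod 𝒢.p) : 𝒢.exp u (a + b) = 𝒢.exp u a * 𝒢.exp u b := by
  obtain ⟨m, rfl⟩ := 𝒢.exists_natCast a
  obtain ⟨k, rfl⟩ := 𝒢.exists_natCast b
  rw [← Nat.cast_add]
  simp only [exp_natCast, pow_add]

theorem exp_exp (u : 𝒢.G) (a b : ZMod 𝒢.p) : 𝒢.exp (𝒢.exp u a) b = 𝒢.exp u (a * b) := by
  obtain ⟨m, rfl⟩ := 𝒢.exists_natCast a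
  obtain ⟨k, rfl⟩ := 𝒢.exists_natCast b
  rw [← Nat.cast_mul]
  simp only [exp_natCast, pow_mul]

@[simp] theorem exp_zero (u : 𝒢.G) : 𝒢.exp u 0 = 1 := by
  have := 𝒢.exp_natCast u 0
  simpa using this

@[simp] theorem exp_one (u : 𝒢.G) : 𝒢.exp u 1 = u := by
  have := 𝒢.exp_natCast u 1
  simpa using this

theorem exp_injective {u : 𝒢.G} (hu : u ≠ 1) : Function.Injective (𝒢.exp u) := fun a b h => by
  have ho : orderOf u = 𝒢.p := orderOf_eq_prime (𝒢.pow_p u) hu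
  rw [exp, exp, pow_inj_mod, ho, Nat.mod_eq_of_lt (ZMod.val_lt a),
    Nat.mod_eq_of_lt (ZMod.val_lt b)] at h
  exact ZMod.val_injective _ h

/-- A nontrivial element generates a group of prime order; so a uniform exponent gives a uniform
group element, which lets the oracles be simulated by exponents. -/
theorem exp_bijective {u : 𝒢.G} (hu : u ≠ 1) : Function.Bijective (𝒢.exp u) := by
  rw [Fintype.bijective_iff_injective_and_card]
  refine ⟨𝒢.exp_injective hu, ?_⟩
  rw [ZMod.card, ← Nat.card_eq_fintype_card, 𝒢.card_G]

theorem exp_eq_one_iff {u : 𝒢.G} (hu : u ≠ 1) {a : ZMod 𝒢.p} : 𝒢.exp u a = 1 ↔ a = 0 := by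
  rw [← 𝒢.exp_zero u, (𝒢.exp_injective hu).eq_iff]

theorem encZ_injective : Function.Injective 𝒢.encZ := fun _ _ h =>
  ZMod.val_injective _ (Data.num_injective h)

end PairingGroup

/-! ### The simulation of the unforgeability game for the scheme of Lee et al. -/

namespace LLY

/-- Which of the three hash functions is queried. -/
def HashQuery.kind {T : ℕ} : HashQuery T → ℕ
  | .h1 _ => 1
  | .h2 _ => 2
  | .h3 _ _ => 3

/-- The period of a hash query. -/
def HashQuery.period {T : ℕ} : HashQuery T → Period T
  | .h1 t => t
  | .h2 t => t
  | .h3 t _ => t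

/-- Hash queries as data. -/
def encQuery {T : ℕ} : HashQuery T → Data
  | .h1 t => .pair (Data.num 1) (Data.num t.1)
  | .h2 t => .pair (Data.num 2) (Data.num t.1)
  | .h3 t m => .pair (Data.num 3) (.pair (Data.num t.1) (.str m))

theorem encQuery_injective {T : ℕ} : Function.Injective (encQuery (T := T)) := by
  rintro (t | t | ⟨t, m⟩) (t' | t' | ⟨t', m'⟩) h <;>
    simp only [encQuery, Data.pair.injEq, Data.num_inj, Data.str.injEq] at h <;>
    first | omega | (simp only [Subtype.ext_iff, HashQuery.h1.injEq, HashQuery.h2.injEq,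
      HashQuery.h3.injEq]; tauto)

/-- What the simulator knows or guesses in advance: the generator `γ`, the challenge key `vk`, the
element `h` whose power with the unknown signing key is to be found, the period `ts` of the forgery,
the place `js` in the table of hash values of the message that is signed in this period, and its hash
value `mh`; the value of `H₂(ts)` is `h ^ sh`. -/
structure SimParams (𝒢 : PairingGroup) (T : ℕ) : Type where
  γ : 𝒢.G
  vk : 𝒢.G
  h : 𝒢.G
  ts : Period T
  js : ℕ
  mh : ZMod 𝒢.p
  sh : ZMod 𝒢.p

/-- The tables of the simulator: exponents of hash values, certified key pairs, and the period. -/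
structure SimState (𝒢 : PairingGroup) (T : ℕ) : Type where
  tbl : List (HashQuery T × ZMod 𝒢.p)
  certs : List (𝒢.G × ZMod 𝒢.p)
  tctr : ℕ

section simulation

variable {𝒢 : PairingGroup} {T : ℕ}

open Classical in
/-- The hash value that corresponds to an entry `v` of the table. -/
noncomputable def simAnswer (P : SimParams 𝒢 T) (q : HashQuery T) (v : ZMod 𝒢.p) : Data :=
  if q.kind = 3 then 𝒢.encZ v
  else 𝒢.enc (if q.period = P.ts then
    (if q.kind = 1 then 𝒢.exp P.γ v * 𝒢.exp P.h (-(P.sh * P.mh)) else 𝒢.exp P.h v)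
    else 𝒢.exp P.γ v)

open Classical in
/-- The entry for a new query, from random `z` and `u ≠ 0`. -/
noncomputable def simFresh (P : SimParams 𝒢 T) (q : HashQuery T) (len : ℕ) (z u : ZMod 𝒢.p) :
    ZMod 𝒢.p :=
  if q.kind = 2 then (if q.period = P.ts then P.sh else u)
  else if q.kind = 3 ∧ q.period = P.ts ∧ len = P.js then P.mh else z

/-- The entry that answers a query. -/
noncomputable def simValue (P : SimParams 𝒢 T) (q : HashQuery T) (z u : ZMod 𝒢.p)
    (l : List (HashQuery T × ZMod 𝒢.p)) : ZMod 𝒢.p :=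
  (assoc q l).getD (simFresh P q l.length z u)

/-- The table after a query. -/
noncomputable def simTable (P : SimParams 𝒢 T) (q : HashQuery T) (z u : ZMod 𝒢.p)
    (l : List (HashQuery T × ZMod 𝒢.p)) : List (HashQuery T × ZMod 𝒢.p) :=
  if (assoc q l).isSome then l else (q, simFresh P q l.length z u) :: l

/-- A valid key pair, given as data. -/
def IsKeyPair (γ : 𝒢.G) (dvk dsk : Data) (x : ZMod 𝒢.p) : Prop :=
  x ≠ 0 ∧ dsk = 𝒢.encZ x ∧ dvk = 𝒢.enc (𝒢.exp γ x)

open Classical in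
/-- The answer of the certification oracle. -/
noncomputable def simCert (γ : 𝒢.G) (dvk dsk : Data) (certs : List (𝒢.G × ZMod 𝒢.p)) :
    Data × List (𝒢.G × ZMod 𝒢.p) :=
  if h : ∃ x, IsKeyPair γ dvk dsk x then
    (Data.ofBool true, (𝒢.exp γ h.choose, h.choose) :: certs)
  else (Data.ofBool false, certs)

/-- The tables after the three hash queries for a signature in period `t`. -/
noncomputable def signTable (P : SimParams 𝒢 T) (t : Period T) (m : Msg) (z1 z2 z3 : ZMod 𝒢.p)
    (l : List (HashQuery T × ZMod 𝒢.p)) : List (HashQuery T × ZMod 𝒢.p) :=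
  simTable P (.h2 t) z1 z3 (simTable P (.h1 t) z2 z3 (simTable P (.h3 t m) z1 z3 l))

open Classical in
/-- The simulated signature. -/
noncomputable def simSign (P : SimParams 𝒢 T) (t : Period T) (m : Msg) (z1 z2 z3 : ZMod 𝒢.p)
    (l : List (HashQuery T × ZMod 𝒢.p)) : 𝒢.G :=
  let l1 := simTable P (.h3 t m) z1 z3 l
  let l2 := simTable P (.h1 t) z2 z3 l1
  𝒢.exp P.vk (if t = P.ts then simValue P (.h1 t) z2 z3 l1 else
    simValue P (.h1 t) z2 z3 l1 + simValue P (.h2 t) z1 z3 l2 * simValue P (.h3 t m) z1 z3 l)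

/-- `h` to the power of the unknown signing key, from a forgery `E`, where `X` and `Y` are the sums
of the other signing keys and of their products with the hash values of the messages, `zs` is the hash
value of the message for the challenge key, and `r` is the entry for `H₁(ts)`. -/
noncomputable def extract (P : SimParams 𝒢 T) (E : 𝒢.G) (X Y zs r : ZMod 𝒢.p) : 𝒢.G :=
  𝒢.exp (E * 𝒢.exp P.γ (-(r * X)) * 𝒢.exp P.h (P.sh * (P.mh * X - Y)) * 𝒢.exp P.vk (-r))
    (P.sh * (zs - P.mh))⁻¹

open Classical in
/-- The shift in the solution of the 1-MSDH-2 problem. -/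
noncomputable def shift (γ vk : 𝒢.G) : ZMod 𝒢.p := if γ = 𝒢.exp vk (-1) then 2 else 1

/-- The solution of the 1-MSDH-2 problem. -/
noncomputable def solution (P : SimParams 𝒢 T) (R : 𝒢.G) : Data :=
  Data.ofList [𝒢.encZ (shift P.γ P.vk), .pair (𝒢.encZ 1) (𝒢.encZ 0), 𝒢.enc P.vk,
    𝒢.enc (P.h * 𝒢.exp R (shift P.γ P.vk))]

end simulation

/-- The states of the simulator: while the adversary is running, while its output is processed, and
at the end. -/
inductive SimConf (𝒢 : PairingGroup) (T : ℕ) : Type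
  | run (st ans : Data) (s : SimState 𝒢 T)
  | fin (E : 𝒢.G) (rest : List (𝒢.G × Msg)) (X Y zs : ZMod 𝒢.p) (s : SimState 𝒢 T)
  | done (o : Data)

/-- Actions of the adversary. -/
inductive Act (T : ℕ) : Type
  | hash (q : HashQuery T)
  | cert (vk sk : Data)
  | skip
  | sign (m : Msg)
  | output (f : Data)

/-- Actions as data. -/
def encAct {T : ℕ} : Act T → Data
  | .hash q => .pair (Data.num 0) (encQuery q)
  | .cert vk sk => .pair (Data.num 1) (.pair vk sk)
  | .skip => .pair (Data.num 2) Data.bot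
  | .sign m => .pair (Data.num 3) (.str m)
  | .output f => .pair (Data.num 4) f

theorem encAct_injective {T : ℕ} : Function.Injective (encAct (T := T)) := by
  rintro (q | ⟨v, s⟩ | _ | m | f) (q' | ⟨v', s'⟩ | _ | m' | f') h <;>
    simp only [encAct, Data.pair.injEq, Data.num_inj, Data.str.injEq] at h <;>
    first | omega | skip
  · rw [encQuery_injective h.2]
  · rw [h.2.1, h.2.2]
  · rfl
  · rw [h.2]
  · rw [h.2]

/-- Forgeries as data. -/
def encForgery (𝒢 : PairingGroup) {T : ℕ} (f : List (𝒢.G × Msg) × (𝒢.G × Period T)) : Data :=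
  .pair (Data.ofList (f.1.map fun x => .pair (𝒢.enc x.1) (.str x.2)))
    (.pair (𝒢.enc f.2.1) (Data.num f.2.2.1))

/-! ### One step of the simulator -/

section step

variable {𝒢 : PairingGroup} {T : ℕ}

open Classical in
/-- The reaction of the simulator to an action of the adversary. -/
noncomputable def simAct (P : SimParams 𝒢 T) (s : SimState 𝒢 T) (st : Data) (z1 z2 z3 : ZMod 𝒢.p) :
    Option (Act T) → Option (SimConf 𝒢 T)
  | none => some (.run st Data.bot s)
  | some (.hash q) => some (.run st (simAnswer P q (simValue P q z1 z3 s.tbl))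
      { s with tbl := simTable P q z1 z3 s.tbl })
  | some (.cert dvk dsk) => some (.run st (simCert P.γ dvk dsk s.certs).1
      { s with certs := (simCert P.γ dvk dsk s.certs).2 })
  | some .skip => some (.run st Data.bot
      (if 1 ≤ s.tctr ∧ s.tctr ≤ T then { s with tctr := s.tctr + 1 } else s))
  | some (.sign m) =>
    if ht : 1 ≤ s.tctr ∧ s.tctr ≤ T then
      some (.run st (.pair (𝒢.enc (simSign P ⟨s.tctr, ht⟩ m z1 z2 z3 s.tbl)) (Data.num s.tctr))
        { s with tbl := signTable P ⟨s.tctr, ht⟩ m z1 z2 z3 s.tbl, tctr := s.tctr + 1 })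
    else some (.run st Data.bot s)
  | some (.output d) =>
    match Data.decode (encForgery 𝒢 (T := T)) d with
    | none => none
    | some f => some (.fin f.2.1 f.1 0 0 0 s)

open Classical in
/-- A step of the simulator, with the output `out` of the adversary and random `z1`, `z2`, `z3`. -/
noncomputable def simStep (P : SimParams 𝒢 T) (out : Option Data) (z1 z2 z3 : ZMod 𝒢.p) :
    SimConf 𝒢 T → Option (SimConf 𝒢 T)
  | .run _ _ s =>
    match out with
    | some (.pair st act) => simAct P s st z1 z2 z3 (Data.decode encAct act)
    | _ => none
  | .fin E [] X Y zs s =>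
    some (.done (solution P (extract P E X Y zs (simValue P (.h1 P.ts) z2 z3 s.tbl))))
  | .fin E (e :: l) X Y zs s =>
    let z := simValue P (.h3 P.ts e.2) z1 z3 s.tbl
    let x := (assoc e.1 s.certs).getD 0
    let s' : SimState 𝒢 T := { s with tbl := simTable P (.h3 P.ts e.2) z1 z3 s.tbl }
    if e.1 = P.vk then some (.fin E l X Y z s') else some (.fin E l (X + x) (Y + x * z) zs s')
  | .done _ => none

end step

/-! #### The data on which the simulator works -/

section encoding

variable {𝒢 : PairingGroup} {T : ℕ}

/-- Tables of hash values as data. -/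
def encTable (l : List (HashQuery T × ZMod 𝒢.p)) : Data :=
  Data.ofList (l.map fun e => .pair (encQuery e.1) (𝒢.encZ e.2))

/-- Certified key pairs as data. -/
def encCerts (l : List (𝒢.G × ZMod 𝒢.p)) : Data :=
  Data.ofList (l.map fun e => .pair (𝒢.enc e.1) (𝒢.encZ e.2))

/-- States as data. -/
def encState (s : SimState 𝒢 T) : Data :=
  .pair (encTable s.tbl) (.pair (encCerts s.certs) (Data.num s.tctr))

/-- The parameters of the simulator as data; `dp` describes the group. -/
def encParams (dp : Data) (P : SimParams 𝒢 T) : Data :=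
  .pair dp (.pair (Data.num 𝒢.p) (.pair (𝒢.enc P.γ) (.pair (𝒢.enc P.vk) (.pair (𝒢.enc P.h)
    (.pair (Data.num P.ts.1) (.pair (Data.num P.js) (.pair (𝒢.encZ P.mh) (.pair (𝒢.encZ P.sh)
      (Data.num T)))))))))

/-- Keys and messages as data. -/
def encClaims (l : List (𝒢.G × Msg)) : Data :=
  Data.ofList (l.map fun x => .pair (𝒢.enc x.1) (.str x.2))

/-- The states of the simulator as data. -/
def encConf (dp : Data) (P : SimParams 𝒢 T) : SimConf 𝒢 T → Data
  | .run st ans s => .pair (.str [true]) (.pair (encParams dp P) (.pair (encState s) (.pair st ans)))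
  | .fin E l X Y zs s => .pair (.str [false]) (.pair (encParams dp P) (.pair (encState s)
      (.pair (𝒢.enc E) (.pair (encClaims l) (.pair (𝒢.encZ X) (.pair (𝒢.encZ Y) (𝒢.encZ zs)))))))
  | .done o => .pair Data.bot o

end encoding

end LLY

/-! ### Changing the parametrization of a family -/

namespace Comp

variable {ι κ : Type*} {S : Set ι} {μ : ι → ℕ} {x y z : ι → Data}

/-- It suffices to treat a parametrization of the family. -/
theorem of_param {T : Set κ} (f : κ → ι) (h : Comp T (fun j => μ (f j)) (fun j => x (f j))
    fun j => y (f j)) (hf : ∀ i ∈ S, ∃ j ∈ T, f j = i) : Comp S μ x y :=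
  h.reindex fun i hi => by
    obtain ⟨j, hj, rfl⟩ := hf i hi
    exact ⟨j, hj, rfl, rfl, le_rfl⟩

theorem param (h : Comp S μ x y) {T : Set κ} (f : κ → ι) (hf : ∀ j ∈ T, f j ∈ S) :
    Comp T (fun j => μ (f j)) (fun j => x (f j)) fun j => y (f j) :=
  h.reindex fun j hj => ⟨f j, hf j hj, rfl, rfl, le_rfl⟩

theorem ite_enc {α : ι → Type*} {enc : ∀ i, α i → Data} {P : ι → Prop} [∀ i, Decidable (P i)]
    {a b : ∀ i, α i} (ht : Comp S μ x fun i => truth (P i))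
    (ha : Comp (S ∩ {i | P i}) μ x fun i => enc i (a i))
    (hb : Comp (S ∩ {i | ¬ P i}) μ x fun i => enc i (b i)) :
    Comp S μ x fun i => enc i (if P i then a i else b i) :=
  ht.ite' (ha.congr fun i hi => by rw [if_pos (show P i from hi.2)])
    (hb.congr fun i hi => by rw [if_neg (show ¬ P i from hi.2)])

theorem cons {a : ι → Data} {l : ι → List Data} (ha : Comp S μ x a)
    (hl : Comp S μ x fun i => Data.ofList (l i)) :
    Comp S μ x fun i => Data.ofList (a i :: l i) := ha.pair hl

theorem nil (hx : Bdd S μ x) : Comp S μ x fun _ => Data.ofList [] := const hx _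

end Comp

/-! ### The formulas of the simulator in polynomial time -/

namespace LLY

variable {ι κ : Type} {Gen : BilinearGenerator} {S : Set ι} {μ : ι → ℕ} {x : ι → Data}

/-- The parameters and the tables of the simulator, and three random numbers. -/
structure SimPoint (Gen : BilinearGenerator) : Type where
  n : ℕ
  d : Data
  T : ℕ
  P : SimParams (Gen.grp d) T
  s : SimState (Gen.grp d) T
  z1 : ZMod (Gen.grp d).p
  z2 : ZMod (Gen.grp d).p
  z3 : ZMod (Gen.grp d).p

/-- The group of a simulation. -/
abbrev SimPoint.grp (D : SimPoint Gen) : PairingGroup := Gen.grp D.d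

/-- The description of the group of a simulation. -/
def SimPoint.dp (D : SimPoint Gen) : Data := Gen.params D.n D.d

/-- The simulator can read off its parameters, tables and random numbers from `x`. -/
structure Simulable (S : Set ι) (μ : ι → ℕ) (x : ι → Data) (D : ι → SimPoint Gen) : Prop where
  desc : ∀ i ∈ S, (D i).d ∈ (Gen.gen (D i).n).support
  le : ∀ i ∈ S, (D i).n ≤ μ i
  p_ne : ∀ i ∈ S, (D i).grp.p ≠ 2
  params : Comp S μ x fun i => encParams (D i).dp (D i).P
  state : Comp S μ x fun i => encState (D i).s
  z1 : Comp S μ x fun i => (D i).grp.encZ (D i).z1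
  z2 : Comp S μ x fun i => (D i).grp.encZ (D i).z2
  z3 : Comp S μ x fun i => (D i).grp.encZ (D i).z3

namespace Simulable

variable {D : ι → SimPoint Gen}

theorem param (h : Simulable S μ x D) {S' : Set κ} (f : κ → ι) (hf : ∀ j ∈ S', f j ∈ S) :
    Simulable S' (fun j => μ (f j)) (fun j => x (f j)) fun j => D (f j) :=
  ⟨fun j hj => h.desc _ (hf j hj), fun j hj => h.le _ (hf j hj), fun j hj => h.p_ne _ (hf j hj),
    h.params.param f hf, h.state.param f hf, h.z1.param f hf, h.z2.param f hf, h.z3.param f hf⟩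

section

variable (h : Simulable S μ x D)

include h

theorem bdd : Bdd S μ x := h.params.bdd_input

theorem const (d : Data) : Comp S μ x fun _ => d := Comp.const h.bdd d

theorem dp : Comp S μ x fun i => (D i).dp := h.params.fst

theorem p : Comp S μ x fun i => Data.num (D i).grp.p := h.params.snd.fst

theorem γ : Comp S μ x fun i => (D i).grp.enc (D i).P.γ := h.params.snd.snd.fst

theorem vk : Comp S μ x fun i => (D i).grp.enc (D i).P.vk := h.params.snd.snd.snd.fst

theorem h' : Comp S μ x fun i => (D i).grp.enc (D i).P.h := h.params.snd.snd.snd.snd.fst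

theorem ts : Comp S μ x fun i => Data.num (D i).P.ts.1 := h.params.snd.snd.snd.snd.snd.fst

theorem js : Comp S μ x fun i => Data.num (D i).P.js := h.params.snd.snd.snd.snd.snd.snd.fst

theorem mh : Comp S μ x fun i => (D i).grp.encZ (D i).P.mh :=
  h.params.snd.snd.snd.snd.snd.snd.snd.fst

theorem sh : Comp S μ x fun i => (D i).grp.encZ (D i).P.sh :=
  h.params.snd.snd.snd.snd.snd.snd.snd.snd.fst

theorem T : Comp S μ x fun i => Data.num (D i).T :=
  h.params.snd.snd.snd.snd.snd.snd.snd.snd.snd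

theorem tbl : Comp S μ x fun i => encTable (D i).s.tbl := h.state.fst

theorem certs : Comp S μ x fun i => encCerts (D i).s.certs := h.state.snd.fst

theorem tctr : Comp S μ x fun i => Data.num (D i).s.tctr := h.state.snd.snd

theorem mulComp : MulComp S μ (fun i => (D i).grp.enc) fun i => (D i).dp :=
  ⟨Gen.mulProg, Gen.bound, fun i hi a b =>
    (Surely.of_output (Gen.mul_spec (D i).n (D i).d (h.desc i hi) a b)).mono
      (eval_nat_mono _ (h.le i hi))⟩

section exponents

variable {a b : ∀ i, ZMod (D i).grp.p}

theorem zadd (ha : Comp S μ x fun i => (D i).grp.encZ (a i))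
    (hb : Comp S μ x fun i => (D i).grp.encZ (b i)) :
    Comp S μ x fun i => (D i).grp.encZ (a i + b i) := Comp.zmod_add h.p ha hb

theorem zmul (ha : Comp S μ x fun i => (D i).grp.encZ (a i))
    (hb : Comp S μ x fun i => (D i).grp.encZ (b i)) :
    Comp S μ x fun i => (D i).grp.encZ (a i * b i) := Comp.zmod_mul h.p ha hb

theorem zsub (ha : Comp S μ x fun i => (D i).grp.encZ (a i))
    (hb : Comp S μ x fun i => (D i).grp.encZ (b i)) :
    Comp S μ x fun i => (D i).grp.encZ (a i - b i) := Comp.zmod_sub h.p ha hb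

theorem zneg (ha : Comp S μ x fun i => (D i).grp.encZ (a i)) :
    Comp S μ x fun i => (D i).grp.encZ (-a i) := Comp.zmod_neg h.p ha

theorem zinv (ha : Comp S μ x fun i => (D i).grp.encZ (a i)) :
    Comp S μ x fun i => (D i).grp.encZ (a i)⁻¹ := Comp.zmod_inv h.p_ne h.p ha

theorem zcast {k : ι → ℕ} (hk : Comp S μ x fun i => Data.num (k i)) :
    Comp S μ x fun i => (D i).grp.encZ (k i : ZMod (D i).grp.p) := Comp.zmod_natCast h.p hk

theorem zone : Comp S μ x fun i => (D i).grp.encZ 1 := by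
  simpa using h.zcast (Comp.num_const h.bdd 1)

theorem zzero : Comp S μ x fun i => (D i).grp.encZ 0 := by
  simpa using h.zcast (Comp.num_const h.bdd 0)

variable {u v : ∀ i, (D i).grp.G}

theorem gmul (hu : Comp S μ x fun i => (D i).grp.enc (u i))
    (hv : Comp S μ x fun i => (D i).grp.enc (v i)) :
    Comp S μ x fun i => (D i).grp.enc (u i * v i) :=
  Comp.mulOf h.mulComp (f := _root_.id) (fun _ hi => ⟨hi, le_rfl⟩) h.dp hu hv

theorem gexp (hu : Comp S μ x fun i => (D i).grp.enc (u i))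
    (ha : Comp S μ x fun i => (D i).grp.encZ (a i)) :
    Comp S μ x fun i => (D i).grp.enc ((D i).grp.exp (u i) (a i)) := by
  -- `Comp.pow` raises to one more than the given number, so it is applied to the residue of `a -
  -- 1`; modulo `p` the sum is `a`, also for `a = 0`.
  refine (Comp.pow h.mulComp h.dp hu (h.zsub ha h.zone)).congr fun i _ => ?_
  rw [← PairingGroup.exp_natCast]
  congr 2
  simp

end exponents

/-! #### The steps of the simulator -/

omit h in
theorem kind {q : ∀ i, HashQuery (D i).T} (hq : Comp S μ x fun i => encQuery (q i)) :
    Comp S μ x fun i => Data.num (q i).kind :=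
  (hq.op .fst).congr fun i _ => by cases q i <;> rfl

theorem period {q : ∀ i, HashQuery (D i).T} (hq : Comp S μ x fun i => encQuery (q i)) :
    Comp S μ x fun i => Data.num (q i).period.1 :=
  Comp.ite' (P := fun i => (q i).kind = 3) ((kind hq).num_eq (Comp.num_const h.bdd 3))
    ((((hq.op .snd).op .fst).mono Set.inter_subset_left).congr fun i hi => by
      have hk : (q i).kind = 3 := hi.2
      revert hk
      cases q i <;> simp [HashQuery.kind, encQuery, Op.eval, HashQuery.period])
    (((hq.op .snd).mono Set.inter_subset_left).congr fun i hi => by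
      have hk : (q i).kind ≠ 3 := hi.2
      revert hk
      cases q i <;> simp [HashQuery.kind, encQuery, Op.eval, HashQuery.period])

omit h in
theorem period_eq {t t' : ∀ i, Period (D i).T} (ht : Comp S μ x fun i => Data.num (t i).1)
    (ht' : Comp S μ x fun i => Data.num (t' i).1) : Comp S μ x fun i => truth (t i = t' i) :=
  (ht.num_eq ht').truth_congr fun i _ => by rw [Subtype.ext_iff]

theorem answer {q : ∀ i, HashQuery (D i).T} {v : ∀ i, ZMod (D i).grp.p}
    (hq : Comp S μ x fun i => encQuery (q i)) (hv : Comp S μ x fun i => (D i).grp.encZ (v i)) :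
    Comp S μ x fun i => simAnswer (D i).P (q i) (v i) := by
  have hts := period_eq (h.period hq) h.ts
  refine Comp.ite ((kind hq).num_eq (Comp.num_const h.bdd 3)) (hv.mono Set.inter_subset_left)
    (Comp.mono ?_ Set.inter_subset_left)
  refine Comp.ite_enc (enc := fun i => (D i).grp.enc) hts (Comp.mono ?_ Set.inter_subset_left)
    ((h.gexp h.γ hv).mono Set.inter_subset_left)
  exact Comp.ite_enc (enc := fun i => (D i).grp.enc)
    ((kind hq).num_eq (Comp.num_const h.bdd 1))
    ((h.gmul (h.gexp h.γ hv) (h.gexp h.h' (h.zneg (h.zmul h.sh h.mh)))).mono Set.inter_subset_left)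
    ((h.gexp h.h' hv).mono Set.inter_subset_left)

theorem fresh {q : ∀ i, HashQuery (D i).T} {z u : ∀ i, ZMod (D i).grp.p} {k : ι → ℕ}
    (hq : Comp S μ x fun i => encQuery (q i)) (hk : Comp S μ x fun i => Data.num (k i))
    (hz : Comp S μ x fun i => (D i).grp.encZ (z i))
    (hu : Comp S μ x fun i => (D i).grp.encZ (u i)) :
    Comp S μ x fun i => (D i).grp.encZ (simFresh (D i).P (q i) (k i) (z i) (u i)) := by
  have hts := period_eq (h.period hq) h.ts
  refine Comp.ite_enc (enc := fun i => (D i).grp.encZ)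
    ((kind hq).num_eq (Comp.num_const h.bdd 2)) (Comp.mono ?_ Set.inter_subset_left)
    (Comp.mono ?_ Set.inter_subset_left)
  · exact Comp.ite_enc (enc := fun i => (D i).grp.encZ) hts (h.sh.mono Set.inter_subset_left)
      (hu.mono Set.inter_subset_left)
  · exact Comp.ite_enc (enc := fun i => (D i).grp.encZ)
      (((kind hq).num_eq (Comp.num_const h.bdd 3)).and
        ((hts.and ((hk.num_eq h.js).mono Set.inter_subset_left)).mono Set.inter_subset_left))
      (h.mh.mono Set.inter_subset_left) (hz.mono Set.inter_subset_left)

section tables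

variable {q : ∀ i, HashQuery (D i).T} {z u : ∀ i, ZMod (D i).grp.p}
  {l : ∀ i, List (HashQuery (D i).T × ZMod (D i).grp.p)}
  (hq : Comp S μ x fun i => encQuery (q i))
  (hz : Comp S μ x fun i => (D i).grp.encZ (z i)) (hu : Comp S μ x fun i => (D i).grp.encZ (u i))
  (hl : Comp S μ x fun i => encTable (l i))

include hq hz hu hl

theorem freshFor : Comp S μ x fun i =>
    (D i).grp.encZ (simFresh (D i).P (q i) (l i).length (z i) (u i)) :=
  h.fresh hq ((Comp.length hl).congr fun i _ => by rw [List.length_map]) hz hu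

omit h hz hu in
theorem lookup : Comp S μ x fun i => encOption (D i).grp.encZ (assoc (q i) (l i)) :=
  Comp.assoc (fun _ => encQuery_injective) hq hl

omit hz hu in
theorem lookup_isSome : Comp S μ x fun i => truth ((assoc (q i) (l i)).isSome) :=
  ((lookup hq hl).eq (h.const Data.bot)).not.truth_congr fun i _ => by
    cases assoc (q i) (l i) <;> simp [encOption, Data.bot]

theorem value : Comp S μ x fun i => (D i).grp.encZ (simValue (D i).P (q i) (z i) (u i) (l i)) := by
  refine Comp.ite' (h.lookup_isSome hq hl)
    ((((lookup hq hl).op .snd).mono Set.inter_subset_left).congr fun i hi => ?_)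
    (((h.freshFor hq hz hu hl).mono Set.inter_subset_left).congr fun i hi => ?_)
  · have h1 : (assoc (q i) (l i)).isSome := hi.2
    obtain ⟨v, hv⟩ := Option.isSome_iff_exists.1 h1
    simp [simValue, hv, encOption, Op.eval]
  · have h1 : ¬ (assoc (q i) (l i)).isSome := hi.2
    simp only [Option.not_isSome_iff_eq_none] at h1
    simp [simValue, h1]

theorem table : Comp S μ x fun i => encTable (simTable (D i).P (q i) (z i) (u i) (l i)) :=
  Comp.ite_enc (enc := fun _ => encTable) (h.lookup_isSome hq hl) (hl.mono Set.inter_subset_left)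
    ((Comp.cons (hq.pair (h.freshFor hq hz hu hl)) hl).mono Set.inter_subset_left)

end tables

theorem query_h1 {t : ∀ i, Period (D i).T} (ht : Comp S μ x fun i => Data.num (t i).1) :
    Comp S μ x fun i => encQuery (.h1 (t i)) := (Comp.num_const h.bdd 1).pair ht

theorem query_h2 {t : ∀ i, Period (D i).T} (ht : Comp S μ x fun i => Data.num (t i).1) :
    Comp S μ x fun i => encQuery (.h2 (t i)) := (Comp.num_const h.bdd 2).pair ht

theorem query_h3 {t : ∀ i, Period (D i).T} {m : ι → Msg}
    (ht : Comp S μ x fun i => Data.num (t i).1) (hm : Comp S μ x fun i => .str (m i)) :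
    Comp S μ x fun i => encQuery (.h3 (t i) (m i)) := (Comp.num_const h.bdd 3).pair (ht.pair hm)

section signing

variable {t : ∀ i, Period (D i).T} {m : ι → Msg} (ht : Comp S μ x fun i => Data.num (t i).1)
  (hm : Comp S μ x fun i => .str (m i))

include ht hm

theorem signTable : Comp S μ x fun i => encTable
    (LLY.signTable (D i).P (t i) (m i) (D i).z1 (D i).z2 (D i).z3 (D i).s.tbl) :=
  h.table (h.query_h2 ht) h.z1 h.z3 (h.table (h.query_h1 ht) h.z2 h.z3
    (h.table (h.query_h3 ht hm) h.z1 h.z3 h.tbl))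

theorem sign : Comp S μ x fun i => (D i).grp.enc
    (simSign (D i).P (t i) (m i) (D i).z1 (D i).z2 (D i).z3 (D i).s.tbl) := by
  have l1 := h.table (h.query_h3 ht hm) h.z1 h.z3 h.tbl
  have l2 := h.table (h.query_h1 ht) h.z2 h.z3 l1
  have hz := h.value (h.query_h3 ht hm) h.z1 h.z3 h.tbl
  have hr := h.value (h.query_h1 ht) h.z2 h.z3 l1
  have hb := h.value (h.query_h2 ht) h.z1 h.z3 l2
  exact h.gexp h.vk (Comp.ite_enc (enc := fun i => (D i).grp.encZ) (period_eq ht h.ts)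
    (hr.mono Set.inter_subset_left) ((h.zadd hr (h.zmul hb hz)).mono Set.inter_subset_left))

end signing

theorem extract {E : ∀ i, (D i).grp.G} {X Y zs r : ∀ i, ZMod (D i).grp.p}
    (hE : Comp S μ x fun i => (D i).grp.enc (E i)) (hX : Comp S μ x fun i => (D i).grp.encZ (X i))
    (hY : Comp S μ x fun i => (D i).grp.encZ (Y i))
    (hzs : Comp S μ x fun i => (D i).grp.encZ (zs i))
    (hr : Comp S μ x fun i => (D i).grp.encZ (r i)) :
    Comp S μ x fun i => (D i).grp.enc (LLY.extract (D i).P (E i) (X i) (Y i) (zs i) (r i)) :=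
  h.gexp (h.gmul (h.gmul (h.gmul hE (h.gexp h.γ (h.zneg (h.zmul hr hX))))
    (h.gexp h.h' (h.zmul h.sh (h.zsub (h.zmul h.mh hX) hY)))) (h.gexp h.vk (h.zneg hr)))
    (h.zinv (h.zmul h.sh (h.zsub hzs h.mh)))

theorem shift : Comp S μ x fun i => (D i).grp.encZ (LLY.shift (D i).P.γ (D i).P.vk) := by
  classical
  refine Comp.ite_enc (enc := fun i => (D i).grp.encZ)
    ((h.γ.eq (h.gexp h.vk (h.zneg h.zone))).truth_congr fun i _ =>
      (D i).grp.enc_injective.eq_iff) (Comp.mono ?_ Set.inter_subset_left)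
    (h.zone.mono Set.inter_subset_left)
  simpa using h.zcast (Comp.num_const h.bdd 2)

theorem solution {R : ∀ i, (D i).grp.G} (hR : Comp S μ x fun i => (D i).grp.enc (R i)) :
    Comp S μ x fun i => LLY.solution (D i).P (R i) :=
  h.shift.cons ((h.zone.pair h.zzero).cons (h.vk.cons
    ((h.gmul h.h' (h.gexp hR h.shift)).cons (Comp.nil h.bdd))))

end

end Simulable

end LLY

/-! ### Decoding, and the recognition of codes -/

theorem Data.decode_enc {α : Type} {enc : α → Data} (h : Function.Injective enc) (a : α) :
    Data.decode enc (enc a) = some a := by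
  have hex : ∃ b, enc b = enc a := ⟨a, rfl⟩
  rw [Data.decode, dif_pos hex, h hex.choose_spec]

theorem Data.decode_eq_some {α : Type} {enc : α → Data} (h : Function.Injective enc) {a : α}
    {d : Data} : Data.decode enc d = some a ↔ enc a = d := by
  constructor
  · intro hd
    unfold Data.decode at hd
    split_ifs at hd with hex
    rw [← Option.some.inj hd]
    exact hex.choose_spec
  · rintro rfl
    exact Data.decode_enc h a

theorem Data.decode_eq_none {α : Type} {enc : α → Data} {d : Data} :
    Data.decode enc d = none ↔ ∀ a, enc a ≠ d := by
  unfold Data.decode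
  split_ifs with h
  · obtain ⟨a, ha⟩ := h
    simp only [false_iff, not_forall, not_not]
    exact ⟨a, ha⟩
  · simpa using h

namespace Comp

variable {ι κ : Type*} {S : Set ι} {μ : ι → ℕ} {x y z : ι → Data}

theorem isPair (hy : Comp S μ x y) : Comp S μ x fun i => truth (∃ a b, y i = .pair a b) :=
  (hy.op .isPair).congr fun i _ => by
    cases h : y i with
    | str s => rw [truth_of_not (by simp)]; rfl
    | pair a b => rw [truth_of ⟨a, b, rfl⟩]; rfl

theorem isStr (hy : Comp S μ x y) : Comp S μ x fun i => truth (∃ s, y i = .str s) :=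
  hy.isPair.not.truth_congr fun i _ => by cases h : y i <;> simp

/-- A pair whose first component is a given datum and whose second component satisfies `Q`. -/
theorem isPairWith {Q : ι → Data → Prop} (hy : Comp S μ x y) (hz : Comp S μ x z)
    (hQ : Comp S μ x fun i => truth (Q i (Op.snd.eval (y i)))) :
    Comp S μ x fun i => truth (∃ b, y i = .pair (z i) b ∧ Q i b) :=
  (hy.isPair.and ((((hy.op .fst).eq hz).and (hQ.mono Set.inter_subset_left)).mono
    Set.inter_subset_left)).truth_congr fun i _ => by
      constructor
      · rintro ⟨⟨a, b, h⟩, h1, h2⟩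
        rw [h] at h1 h2
        exact ⟨b, by rw [h, ← h1]; rfl, h2⟩
      · rintro ⟨b, h, hb⟩
        rw [h]
        exact ⟨⟨_, _, rfl⟩, rfl, hb⟩

/-- Binary notation without superfluous bits is canonical: a datum codes a number exactly if it is
the code of the number that it denotes. Thus decoding reduces to an equality test and two
comparisons. -/
theorem isPeriod {T : ι → ℕ} (hy : Comp S μ x y) (hT : Comp S μ x fun i => Data.num (T i)) :
    Comp S μ x fun i => truth (∃ t : Period (T i), y i = Data.num t.1) :=
  ((hy.eq hy.toNat).and (((hy.toNat.lt (num_const hy.bdd_input 1)).not.and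
    ((hT.lt hy.toNat).not.mono Set.inter_subset_left)).mono Set.inter_subset_left)).truth_congr
    fun i _ => by
      constructor
      · rintro ⟨h1, h2, h3⟩
        exact ⟨⟨_, not_lt.1 h2, not_lt.1 h3⟩, h1⟩
      · rintro ⟨t, ht⟩
        rw [ht, Data.toNat_num]
        exact ⟨rfl, not_lt.2 t.2.1, not_lt.2 t.2.2⟩

theorem isQuery {T : ι → ℕ} (hy : Comp S μ x y) (hT : Comp S μ x fun i => Data.num (T i)) :
    Comp S μ x fun i => truth (∃ q : LLY.HashQuery (T i), y i = LLY.encQuery q) := by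
  have hp := (hy.op .snd).isPeriod hT
  have h1 := isPairWith (Q := fun i b => ∃ t : Period (T i), b = Data.num t.1) hy
    (num_const hy.bdd_input 1) hp
  have h2 := isPairWith (Q := fun i b => ∃ t : Period (T i), b = Data.num t.1) hy
    (num_const hy.bdd_input 2) hp
  have h3 := isPairWith (Q := fun i b => (∃ c d, b = .pair c d) ∧
      (∃ t : Period (T i), Op.fst.eval b = Data.num t.1) ∧ ∃ m, Op.snd.eval b = .str m) hy
    (num_const hy.bdd_input 3) ((hy.op .snd).isPair.and ((((((hy.op .snd).op .fst).isPeriod hT).and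
      (((hy.op .snd).op .snd).isStr.mono Set.inter_subset_left))).mono Set.inter_subset_left))
  refine (h1.or (h2.or h3)).truth_congr fun i _ => ?_
  constructor
  · rintro (⟨b, hb, t, ht⟩ | ⟨b, hb, t, ht⟩ | ⟨b, hb, ⟨c, d, hcd⟩, ⟨t, ht⟩, m, hm⟩)
    · exact ⟨.h1 t, by rw [hb, ht]; rfl⟩
    · exact ⟨.h2 t, by rw [hb, ht]; rfl⟩
    · subst hcd
      refine ⟨.h3 t m, ?_⟩
      rw [hb]
      simp only [Op.eval] at ht hm
      rw [ht, hm]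
      rfl
  · rintro ⟨t | t | ⟨t, m⟩, h⟩
    · exact .inl ⟨_, h, t, rfl⟩
    · exact .inr (.inl ⟨_, h, t, rfl⟩)
    · exact .inr (.inr ⟨_, h, ⟨_, _, rfl⟩, ⟨t, rfl⟩, m, rfl⟩)

end Comp

/-! ### The reaction to an action, and the evaluation of a forgery, in polynomial time -/

namespace LLY

theorem encForgery_injective {𝒢 : PairingGroup} {T : ℕ} :
    Function.Injective (encForgery 𝒢 (T := T)) := by
  have hl : ∀ l l' : List (𝒢.G × Msg),
      Data.ofList (l.map fun x => .pair (𝒢.enc x.1) (.str x.2)) =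
        Data.ofList (l'.map fun x => .pair (𝒢.enc x.1) (.str x.2)) → l = l' := by
    intro l
    induction l with
    | nil =>
      rintro (_ | ⟨e, l'⟩) h
      · rfl
      · simp [Data.ofList, Data.bot] at h
    | cons e l ih =>
      rintro (_ | ⟨e', l'⟩) h
      · simp [Data.ofList, Data.bot] at h
      · simp only [List.map_cons, Data.ofList, Data.pair.injEq, Data.str.injEq] at h
        rw [ih l' h.2, Prod.ext (𝒢.enc_injective h.1.1) h.1.2]
  rintro ⟨l, E, t⟩ ⟨l', E', t'⟩ h
  simp only [encForgery, Data.pair.injEq, Data.num_inj] at h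
  rw [hl l l' h.1, 𝒢.enc_injective h.2.1, Subtype.ext h.2.2]

/-- The exponent chosen in `simCert` is determined by the submitted secret key, because residues are
coded injectively. -/
theorem simCert_of_isKeyPair {𝒢 : PairingGroup} {γ : 𝒢.G} {dvk dsk : Data} {x : ZMod 𝒢.p}
    (h : IsKeyPair γ dvk dsk x) (certs : List (𝒢.G × ZMod 𝒢.p)) :
    simCert γ dvk dsk certs = (Data.ofBool true, (𝒢.exp γ x, x) :: certs) := by
  have hex : ∃ x, IsKeyPair γ dvk dsk x := ⟨x, h⟩
  have : hex.choose = x := 𝒢.encZ_injective (hex.choose_spec.2.1.symm.trans h.2.1)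
  rw [simCert, dif_pos hex, this]

theorem simCert_of_not {𝒢 : PairingGroup} {γ : 𝒢.G} {dvk dsk : Data}
    (h : ¬ ∃ x, IsKeyPair γ dvk dsk x) (certs : List (𝒢.G × ZMod 𝒢.p)) :
    simCert γ dvk dsk certs = (Data.ofBool false, certs) := by
  rw [simCert, dif_neg h]

variable {ι κ : Type} {Gen : BilinearGenerator} {S : Set ι} {μ : ι → ℕ} {x : ι → Data}

namespace Simulable

variable {D : ι → SimPoint Gen}

theorem run (h : Simulable S μ x D) {st ans : ι → Data} (hst : Comp S μ x st)
    (hans : Comp S μ x ans) {s : ∀ i, SimState (D i).grp (D i).T}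
    (hs : Comp S μ x fun i => encState (s i)) :
    Comp S μ x fun i => encConf (D i).dp (D i).P (.run (st i) (ans i) (s i)) :=
  (h.const _).pair (h.params.pair (hs.pair (hst.pair hans)))

theorem fin (h : Simulable S μ x D) {E : ∀ i, (D i).grp.G} {X Y zs : ∀ i, ZMod (D i).grp.p}
    {l : ∀ i, List ((D i).grp.G × Msg)} {s : ∀ i, SimState (D i).grp (D i).T}
    (hE : Comp S μ x fun i => (D i).grp.enc (E i)) (hl : Comp S μ x fun i => encClaims (l i))
    (hX : Comp S μ x fun i => (D i).grp.encZ (X i)) (hY : Comp S μ x fun i => (D i).grp.encZ (Y i))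
    (hzs : Comp S μ x fun i => (D i).grp.encZ (zs i)) (hs : Comp S μ x fun i => encState (s i)) :
    Comp S μ x fun i => encConf (D i).dp (D i).P (.fin (E i) (l i) (X i) (Y i) (zs i) (s i)) :=
  (h.const _).pair (h.params.pair (hs.pair (hE.pair (hl.pair (hX.pair (hY.pair hzs))))))

theorem act_hash (h : Simulable S μ x D) {st : ι → Data} {q : ∀ i, HashQuery (D i).T}
    (hst : Comp S μ x st) (hq : Comp S μ x fun i => encQuery (q i)) :
    Comp S μ x fun i => encConf (D i).dp (D i).P
      (.run (st i) (simAnswer (D i).P (q i) (simValue (D i).P (q i) (D i).z1 (D i).z3 (D i).s.tbl))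
        { (D i).s with tbl := simTable (D i).P (q i) (D i).z1 (D i).z3 (D i).s.tbl }) :=
  h.run hst (h.answer hq (h.value hq h.z1 h.z3 h.tbl))
    ((h.table hq h.z1 h.z3 h.tbl).pair (h.certs.pair h.tctr))

/-- The only candidate for the secret exponent is the residue of the number that `dsk` denotes. It
is accepted if it is nonzero and its code and the code of its power of `γ` are the submitted data.
-/
theorem act_cert (h : Simulable S μ x D) {st dvk dsk : ι → Data} (hst : Comp S μ x st)
    (hvk : Comp S μ x dvk) (hsk : Comp S μ x dsk) :
    Comp S μ x fun i => encConf (D i).dp (D i).P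
      (.run (st i) (simCert (D i).P.γ (dvk i) (dsk i) (D i).s.certs).1
        { (D i).s with certs := (simCert (D i).P.γ (dvk i) (dsk i) (D i).s.certs).2 }) := by
  have ha := h.zcast hsk.toNat
  have hv := h.gexp h.γ ha
  have hiff : ∀ i, IsKeyPair (D i).P.γ (dvk i) (dsk i) (((dsk i).toNat : ℕ) : ZMod (D i).grp.p) ↔
      ∃ x, IsKeyPair (D i).P.γ (dvk i) (dsk i) x := fun i => by
    refine ⟨fun h => ⟨_, h⟩, ?_⟩
    rintro ⟨x, hx⟩
    have : (((dsk i).toNat : ℕ) : ZMod (D i).grp.p) = x := by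
      rw [hx.2.1, PairingGroup.encZ, Data.toNat_num, ZMod.natCast_zmod_val]
    rwa [this]
  have ht : Comp S μ x fun i => truth (∃ x, IsKeyPair (D i).P.γ (dvk i) (dsk i) x) := by
    refine ((ha.eq h.zzero).not.and (((hsk.eq ha).and ((hvk.eq hv).mono
      Set.inter_subset_left)).mono Set.inter_subset_left)).truth_congr fun i _ => ?_
    rw [← hiff i, IsKeyPair, (D i).grp.encZ_injective.eq_iff]
  refine ht.ite' ?_ ?_
  · refine ((h.run hst (h.const (Data.ofBool true)) (s := fun i => { (D i).s with
        certs := ((D i).grp.exp (D i).P.γ (((dsk i).toNat : ℕ) : ZMod (D i).grp.p),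
          (((dsk i).toNat : ℕ) : ZMod (D i).grp.p)) :: (D i).s.certs })
      (h.tbl.pair (((hv.pair ha).cons h.certs).pair h.tctr))).mono
        Set.inter_subset_left).congr fun i hi => ?_
    rw [simCert_of_isKeyPair ((hiff i).2 hi.2)]
  · refine ((h.run hst (h.const (Data.ofBool false)) h.state).mono
      Set.inter_subset_left).congr fun i hi => ?_
    rw [simCert_of_not hi.2]

theorem act_sign (h : Simulable S μ x D) {st : ι → Data} {m : ι → Msg} (hst : Comp S μ x st)
    (hm : Comp S μ x fun i => .str (m i)) {t : ∀ i, Period (D i).T}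
    (ht : ∀ i, (t i).1 = (D i).s.tctr) :
    Comp S μ x fun i => encConf (D i).dp (D i).P
      (.run (st i) (.pair ((D i).grp.enc (simSign (D i).P (t i) (m i) (D i).z1 (D i).z2 (D i).z3
        (D i).s.tbl)) (Data.num (D i).s.tctr))
        { (D i).s with
          tbl := LLY.signTable (D i).P (t i) (m i) (D i).z1 (D i).z2 (D i).z3 (D i).s.tbl
          tctr := (D i).s.tctr + 1 }) := by
  have ht' : Comp S μ x fun i => Data.num (t i).1 := h.tctr.congr fun i _ => by rw [ht]
  exact h.run hst ((h.sign ht' hm).pair h.tctr)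
    ((h.signTable ht' hm).pair (h.certs.pair (h.tctr.add (Comp.num_const h.bdd 1))))

/-- The reaction of the simulator to an action is computable. -/
theorem act (h : Simulable S μ x D) {st a : ι → Data} (hst : Comp S μ x st) (ha : Comp S μ x a)
    {c : ∀ i, SimConf (D i).grp (D i).T}
    (hc : ∀ i ∈ S, simAct (D i).P (D i).s (st i) (D i).z1 (D i).z2 (D i).z3
      (Data.decode encAct (a i)) = some (c i)) :
    Comp S μ x fun i => encConf (D i).dp (D i).P (c i) := by
  refine Comp.ite' (P := fun i => ∃ b, a i = .pair (Data.num 0) b ∧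
      ∃ q : HashQuery (D i).T, b = encQuery q)
    (Comp.isPairWith (Q := fun i b => ∃ q : HashQuery (D i).T, b = encQuery q) ha
      (Comp.num_const h.bdd 0) ((ha.op .snd).isQuery h.T)) ?_ ?_
  -- The decoded query becomes part of the index of the family, which makes it available as an
  -- object; the program itself still works on the code. The other kinds of actions with arguments
  -- are treated alike.
  · refine Comp.of_param (T := {p : Σ i, HashQuery (D i).T | p.1 ∈ S ∧
      a p.1 = encAct (.hash p.2)}) Sigma.fst ?_ ?_
    · have hp := h.param (S' := {p : Σ i, HashQuery (D i).T | p.1 ∈ S ∧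
        a p.1 = encAct (.hash p.2)}) Sigma.fst fun p hp => hp.1
      refine Comp.congr (hp.act_hash (q := Sigma.snd) (hst.param Sigma.fst fun p hp => hp.1)
        (((ha.param Sigma.fst fun p hp => hp.1).op .snd).congr fun p hp => ?_)) fun p hp => ?_
      · rw [hp.2]; rfl
      · have := hc p.1 hp.1
        rw [hp.2, Data.decode_enc encAct_injective] at this
        rw [← Option.some.inj this]
    · rintro i ⟨hi, b, hb, q, rfl⟩
      exact ⟨⟨i, q⟩, ⟨hi, hb⟩, rfl⟩
  refine Comp.ite' (P := fun i => ∃ b, a i = .pair (Data.num 1) b ∧ ∃ u v, b = .pair u v)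
    ((Comp.isPairWith (Q := fun i b => ∃ u v, b = .pair u v) ha
      (Comp.num_const h.bdd 1) (ha.op .snd).isPair).mono Set.inter_subset_left) ?_ ?_
  · refine Comp.of_param (T := {p : ι × Data × Data | p.1 ∈ S ∧
      a p.1 = encAct (T := (D p.1).T) (.cert p.2.1 p.2.2)}) Prod.fst ?_ ?_
    · have hp := h.param (S' := {p : ι × Data × Data | p.1 ∈ S ∧
        a p.1 = encAct (T := (D p.1).T) (.cert p.2.1 p.2.2)}) Prod.fst fun p hp => hp.1
      have hsnd := (ha.param (T := {p : ι × Data × Data | p.1 ∈ S ∧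
        a p.1 = encAct (T := (D p.1).T) (.cert p.2.1 p.2.2)}) Prod.fst fun p hp => hp.1).op .snd
      refine Comp.congr (hp.act_cert (dvk := fun p => p.2.1) (dsk := fun p => p.2.2)
        (hst.param Prod.fst fun p hp => hp.1) ((hsnd.op .fst).congr fun p hp => ?_)
        ((hsnd.op .snd).congr fun p hp => ?_)) fun p hp => ?_
      · rw [hp.2]; rfl
      · rw [hp.2]; rfl
      · have := hc p.1 hp.1
        rw [hp.2, Data.decode_enc encAct_injective] at this
        rw [← Option.some.inj this]
    · rintro i ⟨⟨hi, -⟩, b, hb, u, v, rfl⟩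
      exact ⟨⟨i, u, v⟩, ⟨hi, hb⟩, rfl⟩
  refine Comp.ite' (P := fun i => a i = .pair (Data.num 2) Data.bot)
    ((ha.eq (h.const _)).mono (Set.inter_subset_left.trans Set.inter_subset_left)) ?_ ?_
  · have hin := ((h.tctr.lt (Comp.num_const h.bdd 1)).not.and
      ((h.T.lt h.tctr).not.mono Set.inter_subset_left)).truth_congr (Q := fun i =>
        1 ≤ (D i).s.tctr ∧ (D i).s.tctr ≤ (D i).T) fun i _ => by rw [not_lt, not_lt]
    have hs : Comp S μ x fun i => encState (if 1 ≤ (D i).s.tctr ∧ (D i).s.tctr ≤ (D i).T then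
        { (D i).s with tctr := (D i).s.tctr + 1 } else (D i).s) :=
      Comp.ite_enc (enc := fun i => encState) hin
        ((h.tbl.pair (h.certs.pair (h.tctr.add (Comp.num_const h.bdd 1)))).mono
          Set.inter_subset_left) (h.state.mono Set.inter_subset_left)
    refine ((h.run hst (h.const Data.bot) hs).mono (Set.inter_subset_left.trans
      (Set.inter_subset_left.trans Set.inter_subset_left))).congr ?_
    rintro i ⟨⟨⟨hi, -⟩, -⟩, hs⟩
    have := hc i hi
    rw [show a i = encAct (T := (D i).T) .skip from hs, Data.decode_enc encAct_injective] at this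
    rw [← Option.some.inj this]
  refine Comp.ite' (P := fun i => ∃ b, a i = .pair (Data.num 3) b ∧ ∃ m, b = .str m)
    ((Comp.isPairWith (Q := fun i b => ∃ m, b = .str m) ha
      (Comp.num_const h.bdd 3) (ha.op .snd).isStr).mono (Set.inter_subset_left.trans
        (Set.inter_subset_left.trans Set.inter_subset_left))) ?_ ?_
  · have hin := ((h.tctr.lt (Comp.num_const h.bdd 1)).not.and
      ((h.T.lt h.tctr).not.mono Set.inter_subset_left)).truth_congr (Q := fun i =>
        1 ≤ (D i).s.tctr ∧ (D i).s.tctr ≤ (D i).T) fun i _ => by rw [not_lt, not_lt]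
    refine Comp.ite' (hin.mono (Set.inter_subset_left.trans (Set.inter_subset_left.trans
      (Set.inter_subset_left.trans Set.inter_subset_left)))) ?_ ?_
    · set κ' := {p : ι × Msg // 1 ≤ (D p.1).s.tctr ∧ (D p.1).s.tctr ≤ (D p.1).T}
      set U : Set κ' := {p | p.1.1 ∈ S ∧ a p.1.1 = encAct (T := (D p.1.1).T) (.sign p.1.2)}
      refine Comp.of_param (T := U) (fun p => p.1.1) ?_ ?_
      · have hp := h.param (S' := U) (fun p => p.1.1) fun p hp => hp.1
        refine Comp.congr (hp.act_sign (m := fun p => p.1.2) (t := fun p => ⟨_, p.2⟩)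
          (hst.param _ fun p hp => hp.1)
          (((ha.param (T := U) (fun p => p.1.1) fun p hp => hp.1).op .snd).congr fun p hp => ?_)
          fun p => rfl) fun p hp => ?_
        · rw [hp.2]; rfl
        · have := hc p.1.1 hp.1
          rw [hp.2, Data.decode_enc encAct_injective] at this
          simp only [simAct, dif_pos p.2] at this
          rw [← Option.some.inj this]
      · rintro i ⟨⟨⟨⟨⟨hi, -⟩, -⟩, -⟩, b, hb, m, rfl⟩, ht⟩
        exact ⟨⟨(i, m), ht⟩, ⟨hi, hb⟩, rfl⟩
    · refine ((h.run hst (h.const Data.bot) h.state).mono (Set.inter_subset_left.trans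
        (Set.inter_subset_left.trans (Set.inter_subset_left.trans
          (Set.inter_subset_left.trans Set.inter_subset_left))))).congr ?_
      rintro i ⟨⟨⟨⟨⟨hi, -⟩, -⟩, -⟩, b, hb, m, rfl⟩, ht⟩
      have := hc i hi
      rw [show a i = encAct (T := (D i).T) (.sign m) from hb,
        Data.decode_enc encAct_injective] at this
      simp only [simAct, dif_neg (show ¬ (1 ≤ (D i).s.tctr ∧ (D i).s.tctr ≤ (D i).T) from ht)]
        at this
      rw [← Option.some.inj this]
  refine Comp.ite' (P := fun i => ∃ b, a i = .pair (Data.num 4) b ∧ True)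
    ((Comp.isPairWith (Q := fun i b => True) ha
      (Comp.num_const h.bdd 4) ((h.const (.str [true])).congr fun i _ => by
        rw [truth_of trivial])).mono (Set.inter_subset_left.trans (Set.inter_subset_left.trans
        (Set.inter_subset_left.trans Set.inter_subset_left)))) ?_ ?_
  · set κ' := Σ i, List ((D i).grp.G × Msg) × (D i).grp.G × Period (D i).T
    set U : Set κ' := {p | p.1 ∈ S ∧
      a p.1 = encAct (T := (D p.1).T) (.output (encForgery (D p.1).grp p.2))}
    refine Comp.of_param (T := U) Sigma.fst ?_ ?_
    · have hp := h.param (S' := U) Sigma.fst fun p hp => hp.1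
      have hsnd := (ha.param (T := U) Sigma.fst fun p hp => hp.1).op .snd
      refine Comp.congr (hp.fin (E := fun p => p.2.2.1) (l := fun p => p.2.1)
        ((((hsnd.op .snd).op .fst)).congr fun p hp => ?_) ((hsnd.op .fst).congr fun p hp => ?_)
        hp.zzero hp.zzero hp.zzero hp.state) fun p hp => ?_
      · rw [hp.2]; rfl
      · rw [hp.2]; rfl
      · have := hc p.1 hp.1
        rw [hp.2, Data.decode_enc encAct_injective] at this
        simp only [simAct, Data.decode_enc encForgery_injective] at this
        rw [← Option.some.inj this]
    · rintro i ⟨⟨⟨⟨⟨hi, -⟩, -⟩, -⟩, -⟩, b, hb, -⟩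
      have := hc i hi
      rw [show a i = encAct (T := (D i).T) (.output b) from hb,
        Data.decode_enc encAct_injective] at this
      -- An output that does not code a forgery has no next state, which contradicts `hc`; the
      -- program may do anything there.
      cases hd : Data.decode (encForgery (D i).grp (T := (D i).T)) b with
      | none => simp only [simAct, hd] at this; cases this
      | some f =>
        rw [Data.decode_eq_some encForgery_injective] at hd
        exact ⟨⟨i, f⟩, ⟨hi, hb.trans (by rw [← hd]; rfl)⟩, rfl⟩
  · refine ((h.run hst (h.const Data.bot) h.state).mono (Set.inter_subset_left.trans
      (Set.inter_subset_left.trans (Set.inter_subset_left.trans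
        (Set.inter_subset_left.trans Set.inter_subset_left))))).congr ?_
    rintro i ⟨⟨⟨⟨⟨hi, h0⟩, h1⟩, h2⟩, h3⟩, h4⟩
    have hn : Data.decode (encAct (T := (D i).T)) (a i) = none := by
      rw [Data.decode_eq_none]
      rintro (q | ⟨u, v⟩ | _ | m | d) hq
      · exact h0 ⟨_, hq.symm, q, rfl⟩
      · exact h1 ⟨_, hq.symm, u, v, rfl⟩
      · exact h2 hq.symm
      · exact h3 ⟨_, hq.symm, m, rfl⟩
      · exact h4 ⟨_, hq.symm, trivial⟩
    have := hc i hi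
    rw [hn] at this
    rw [← Option.some.inj this]

theorem fin_nil (h : Simulable S μ x D) {E : ∀ i, (D i).grp.G}
    {X Y zs : ∀ i, ZMod (D i).grp.p} (hE : Comp S μ x fun i => (D i).grp.enc (E i))
    (hX : Comp S μ x fun i => (D i).grp.encZ (X i)) (hY : Comp S μ x fun i => (D i).grp.encZ (Y i))
    (hzs : Comp S μ x fun i => (D i).grp.encZ (zs i)) :
    Comp S μ x fun i => encConf (D i).dp (D i).P (.done (LLY.solution (D i).P
      (LLY.extract (D i).P (E i) (X i) (Y i) (zs i)
        (simValue (D i).P (.h1 (D i).P.ts) (D i).z2 (D i).z3 (D i).s.tbl)))) :=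
  (h.const Data.bot).pair (h.solution (h.extract hE hX hY hzs
    (h.value (h.query_h1 h.ts) h.z2 h.z3 h.tbl)))

theorem fin_cons (h : Simulable S μ x D) {E : ∀ i, (D i).grp.G} {e : ∀ i, (D i).grp.G × Msg}
    {l : ∀ i, List ((D i).grp.G × Msg)} {X Y zs : ∀ i, ZMod (D i).grp.p}
    (hE : Comp S μ x fun i => (D i).grp.enc (E i)) (he : Comp S μ x fun i => (D i).grp.enc (e i).1)
    (he' : Comp S μ x fun i => .str (e i).2) (hl : Comp S μ x fun i => encClaims (l i))
    (hX : Comp S μ x fun i => (D i).grp.encZ (X i)) (hY : Comp S μ x fun i => (D i).grp.encZ (Y i))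
    (hzs : Comp S μ x fun i => (D i).grp.encZ (zs i)) {c : ∀ i, SimConf (D i).grp (D i).T}
    {out : ι → Option Data}
    (hc : ∀ i ∈ S, simStep (D i).P (out i) (D i).z1 (D i).z2 (D i).z3
      (.fin (E i) (e i :: l i) (X i) (Y i) (zs i) (D i).s) = some (c i)) :
    Comp S μ x fun i => encConf (D i).dp (D i).P (c i) := by
  have hq := h.query_h3 h.ts he'
  have hz := h.value hq h.z1 h.z3 h.tbl
  have hs := (h.table hq h.z1 h.z3 h.tbl).pair (h.certs.pair h.tctr)
  have hx : Comp S μ x fun i => (D i).grp.encZ ((assoc (e i).1 (D i).s.certs).getD 0) := by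
    have ho : Comp S μ x fun i => encOption (D i).grp.encZ (assoc (e i).1 (D i).s.certs) :=
      Comp.assoc (fun i => (D i).grp.enc_injective) he h.certs
    refine Comp.ite' ((ho.eq (h.const Data.bot)))
      ((h.zzero.mono Set.inter_subset_left).congr fun i hi => ?_)
      (((ho.op .snd).mono Set.inter_subset_left).congr fun i hi => ?_)
    · have h1 : encOption (D i).grp.encZ (assoc (e i).1 (D i).s.certs) = Data.bot := hi.2
      cases h2 : assoc (e i).1 (D i).s.certs with
      | none => rfl
      | some v => rw [h2] at h1; simp [encOption, Data.bot] at h1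
    · have h1 : encOption (D i).grp.encZ (assoc (e i).1 (D i).s.certs) ≠ Data.bot := hi.2
      cases h2 : assoc (e i).1 (D i).s.certs with
      | none => rw [h2] at h1; simp [encOption] at h1
      | some v => rfl
  refine Comp.ite' (P := fun i => (e i).1 = (D i).P.vk) ((he.eq h.vk).truth_congr fun i _ =>
    (D i).grp.enc_injective.eq_iff)
    (((h.fin (s := fun i => { (D i).s with
        tbl := simTable (D i).P (.h3 (D i).P.ts (e i).2) (D i).z1 (D i).z3 (D i).s.tbl })
      hE hl hX hY hz hs).mono Set.inter_subset_left).congr fun i hi => ?_)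
    (((h.fin (s := fun i => { (D i).s with
        tbl := simTable (D i).P (.h3 (D i).P.ts (e i).2) (D i).z1 (D i).z3 (D i).s.tbl })
      hE hl (h.zadd hX hx) (h.zadd hY (h.zmul hx hz)) hzs hs).mono
        Set.inter_subset_left).congr fun i hi => ?_)
  · have := hc i hi.1
    simp only [simStep, if_pos (show (e i).1 = (D i).P.vk from hi.2)] at this
    rw [← Option.some.inj this]
  · have := hc i hi.1
    simp only [simStep, if_neg (show ¬ (e i).1 = (D i).P.vk from hi.2)] at this
    rw [← Option.some.inj this]

end Simulable

end LLY

/-! ### Sampling -/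

theorem ev_uniformBelow_eq_zmod {p : ℕ} [NeZero p] (f : ℕ → ℝ≥0∞) :
    ev (uniformBelow p) f = ev (PMF.uniformOfFintype (ZMod p)) fun z => f z.val := by
  rw [ev_uniformBelow (Nat.pos_of_ne_zero (NeZero.ne p)), ev_uniformOfFintype, ZMod.card]
  congr 1
  refine Finset.sum_bij' (fun i _ => (i : ZMod p)) (fun z _ => z.val) (fun _ _ => Finset.mem_univ _)
    (fun z _ => Finset.mem_range.2 z.val_lt) (fun i hi => ?_) (fun z _ => ZMod.natCast_zmod_val z)
    fun i hi => ?_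
  · exact ZMod.val_cast_of_lt (Finset.mem_range.1 hi)
  · rw [ZMod.val_cast_of_lt (Finset.mem_range.1 hi)]

theorem ev_uniformBelow_eq_units {p : ℕ} [hp : Fact p.Prime] (f : ℕ → ℝ≥0∞) :
    ev (uniformBelow (p - 1)) (fun i => f (i + 1)) =
      ev (PMF.uniformOfFintype (ZMod p)ˣ) fun z => f (z : ZMod p).val := by
  have h2 := hp.out.two_le
  rw [ev_uniformBelow (by omega), ev_uniformOfFintype, ZMod.card_units]
  congr 1
  have hpos : ∀ z : (ZMod p)ˣ, (z : ZMod p).val ≠ 0 := fun z h =>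
    z.ne_zero ((ZMod.val_eq_zero _).1 h)
  have hu : ∀ i < p - 1, (((i + 1 : ℕ) : ZMod p)).val = i + 1 := fun i hi =>
    ZMod.val_cast_of_lt (by omega)
  have hne : ∀ i < p - 1, ((i + 1 : ℕ) : ZMod p) ≠ 0 := fun i hi h => by
    have := hu i hi
    rw [h, ZMod.val_zero] at this
    omega
  refine Finset.sum_bij' (fun i hi => Units.mk0 _ (hne i (Finset.mem_range.1 hi)))
    (fun z _ => (z : ZMod p).val - 1) (fun _ _ => Finset.mem_univ _)
    (fun z _ => Finset.mem_range.2 ?_) (fun i hi => ?_) (fun z _ => ?_) fun i hi => ?_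
  · have := (z : ZMod p).val_lt
    have := hpos z
    omega
  · simp only [Units.val_mk0, hu i (Finset.mem_range.1 hi)]
    omega
  · ext
    have := hpos z
    rw [Units.val_mk0, Nat.sub_add_cancel (by omega), ZMod.natCast_zmod_val]
  · simp only [Units.val_mk0, hu i (Finset.mem_range.1 hi)]

/-- Sampling, in a family of data with polynomially bounded length. -/
theorem exists_wp_sample {ι : Type*} {S : Set ι} {μ : ι → ℕ} {x : ι → Data} {a : ι → ℕ}
    (ha : Comp S μ x fun i => Data.num (a i)) : ∃ (c : Prog) (r : Polynomial ℕ), ∀ i ∈ S,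
      ∀ F : Data → ℝ≥0∞, ev (uniformBelow (a i)) (fun k => F (Data.num k)) ≤
        wp (r.eval (μ i)) c (x i) F := by
  obtain ⟨r, hr⟩ := ha.bdd
  obtain ⟨c, q, hc⟩ := ha
  refine ⟨.seq c .sample, q + (1 + r + r), fun i hi F => ?_⟩
  rw [Polynomial.eval_add]
  refine le_trans ?_ (wp_seq _ _ c .sample (x i) F)
  refine le_trans ?_ (hc i hi _)
  have hs : (Data.num (a i)).size ≤ r.eval (μ i) := hr i hi
  have hsup : ∀ k ∈ (uniformBelow (a i)).support, (Data.num k).size ≤ r.eval (μ i) :=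
    fun k hk => by
      refine (Data.size_num_mono ?_).trans hs
      rw [uniformBelow, PMF.mem_support_uniformOfFinset_iff, Finset.mem_insert,
        Finset.mem_range] at hk
      omega
  have := wp_sample (Data.num (a i)) (r.eval (μ i)) (by rwa [Data.toNat_num]) F
  rw [Data.toNat_num] at this
  refine this.trans (wp_mono_budget ?_ _ _ _)
  simp only [Polynomial.eval_add, Polynomial.eval_one]
  omega

namespace LLY

/-! ### The value of the simulation -/

section value

variable {𝒢 : PairingGroup} {T : ℕ}

/-- The expected value of `f` at a random exponent. -/
noncomputable def evZ (𝒢 : PairingGroup) (f : ZMod 𝒢.p → ℝ≥0∞) : ℝ≥0∞ :=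
  ev (PMF.uniformOfFintype (ZMod 𝒢.p)) f

/-- The expected value of `f` at a random nonzero exponent. -/
noncomputable def evU (𝒢 : PairingGroup) (f : ZMod 𝒢.p → ℝ≥0∞) : ℝ≥0∞ :=
  ev (PMF.uniformOfFintype (ZMod 𝒢.p)ˣ) fun z => f z

/-- The expected value of `f` after a step of the simulator with random `z1`, `z2`, `z3`. -/
noncomputable def evStep (P : SimParams 𝒢 T) (c : SimConf 𝒢 T) (f : SimConf 𝒢 T → ℝ≥0∞)
    (out : Option Data) : ℝ≥0∞ :=
  evZ 𝒢 fun z1 => evZ 𝒢 fun z2 => evU 𝒢 fun z3 => (simStep P out z1 z2 z3 c).elim 0 f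

/-- The expected value of `pay` at the output of the simulation with adversary `A`, stopped after
less than `k` steps. -/
noncomputable def simVal (A : Prog) (b : ℕ) (P : SimParams 𝒢 T) (pay : Data → ℝ≥0∞) :
    ℕ → SimConf 𝒢 T → ℝ≥0∞
  | 0, _ => 0
  | _ + 1, .done o => pay o
  | k + 1, .run st ans s => ev (A.output b (.pair st ans))
      (evStep P (.run st ans s) (simVal A b P pay k))
  | k + 1, .fin E l X Y zs s => evStep P (.fin E l X Y zs s) (simVal A b P pay k) none

end value

/-! ### The simulator as a program -/

variable {Gen : BilinearGenerator}

theorem size_enc_le {n : ℕ} {d : Data} (hd : d ∈ (Gen.gen n).support) (u : (Gen.grp d).G) :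
    ((Gen.grp d).enc u).size ≤ Gen.bound.eval n := by
  have := (Surely.of_output (Gen.mul_spec n d hd u 1)).size_le.1
  rwa [mul_one] at this

theorem size_encZ_le {n : ℕ} {d : Data} (hd : d ∈ (Gen.gen n).support)
    (z : ZMod (Gen.grp d).p) : ((Gen.grp d).encZ z).size ≤ Gen.bound.eval n :=
  (Data.size_num_mono z.val_lt.le).trans (Gen.size_p n d hd)

theorem size_ofList_le {l : List Data} {k : ℕ} (h : ∀ a ∈ l, a.size ≤ k) :
    (Data.ofList l).size ≤ l.length * (k + 1) + 1 := by
  induction l with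
  | nil => simp [Data.ofList, Data.bot, Data.size]
  | cons a l ih =>
    have h1 := ih fun b hb => h b (List.mem_cons_of_mem _ hb)
    have h2 := h a List.mem_cons_self
    simp only [Data.ofList, Data.size, List.length_cons, add_mul, one_mul]
    omega

/-- A state of the simulator and a bound for the length of its parts. -/
structure LoopPoint (Gen : BilinearGenerator) : Type where
  N : ℕ
  n : ℕ
  b : ℕ
  d : Data
  T : ℕ
  P : SimParams (Gen.grp d) T
  c : SimConf (Gen.grp d) T

/-- Bounds for the tables that allow for `k` more steps. -/
structure StateBdd {𝒢 : PairingGroup} {T : ℕ} (N k : ℕ) (s : SimState 𝒢 T) : Prop where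
  tbl : s.tbl.length + 3 * k ≤ N
  query : ∀ e ∈ s.tbl, (encQuery e.1).size ≤ N
  certs : s.certs.length + k ≤ N
  tctr : s.tctr + k ≤ N

/-- Bounds for the state that allow for `k` more steps. -/
def ConfBdd {𝒢 : PairingGroup} {T : ℕ} (P : SimParams 𝒢 T) (N b k : ℕ) : SimConf 𝒢 T → Prop
  | .run st ans s => st.size ≤ N ∧ ans.size ≤ N ∧ StateBdd N k s
  | .fin _ l _ _ _ s => (encClaims l).size ≤ b ∧ StateBdd N k s
  | .done o => ∃ R, o = solution P R

namespace LoopPoint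

/-- The group is generated, and the bound is large enough. -/
structure Good (L : LoopPoint Gen) (k : ℕ) : Prop where
  desc : L.d ∈ (Gen.gen L.n).support
  p_ne : (Gen.grp L.d).p ≠ 2
  le : L.n + Gen.bound.eval L.n + L.T + L.b + 20 ≤ L.N
  js : L.P.js ≤ L.N
  conf : ConfBdd L.P L.N L.b k L.c

/-- The state as data. -/
def data (L : LoopPoint Gen) : Data := encConf (Gen.params L.n L.d) L.P L.c

theorem Good.mono {L : LoopPoint Gen} {k j : ℕ} (h : L.Good k) (hj : j ≤ k) : L.Good j := by
  refine ⟨h.desc, h.p_ne, h.le, h.js, ?_⟩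
  have hc := h.conf
  have hs : ∀ s : SimState (Gen.grp L.d) L.T, StateBdd L.N k s → StateBdd L.N j s := fun s hs =>
    ⟨by have := hs.tbl; omega, hs.query, by have := hs.certs; omega, by have := hs.tctr; omega⟩
  cases hL : L.c with
  | run st ans s => rw [hL] at hc; exact ⟨hc.1, hc.2.1, hs _ hc.2.2⟩
  | fin E l X Y zs s => rw [hL] at hc; exact ⟨hc.1, hs _ hc.2⟩
  | done o => rw [hL] at hc; exact hc

end LoopPoint

section bounds

variable {ι : Type*} {S : Set ι} {L : ι → LoopPoint Gen}

theorem bdd_num {a : ι → ℕ} (h : ∀ i ∈ S, a i ≤ (L i).N) :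
    Bdd S (fun i => (L i).N) fun i => Data.num (a i) :=
  ⟨Polynomial.X + 1, fun i hi => by
    have h1 := h i hi
    have := Data.size_num_le_of_lt_two_pow (n := a i) (k := a i) Nat.lt_two_pow_self
    simp only [Polynomial.eval_add, Polynomial.eval_X, Polynomial.eval_one]
    omega⟩

variable (h : ∀ i ∈ S, (L i).Good 0)

include h

theorem bdd_enc (u : ∀ i, (Gen.grp (L i).d).G) :
    Bdd S (fun i => (L i).N) fun i => (Gen.grp (L i).d).enc (u i) :=
  Bdd.of_size_le fun i hi => (size_enc_le (h i hi).desc _).trans (by have := (h i hi).le; omega)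

theorem bdd_encZ (z : ∀ i, ZMod (Gen.grp (L i).d).p) :
    Bdd S (fun i => (L i).N) fun i => (Gen.grp (L i).d).encZ (z i) :=
  Bdd.of_size_le fun i hi => (size_encZ_le (h i hi).desc _).trans (by have := (h i hi).le; omega)

theorem bdd_params : Bdd S (fun i => (L i).N) fun i =>
    encParams (Gen.params (L i).n (L i).d) (L i).P := by
  have hle := fun i hi => (h i hi).le
  have hp : Bdd S (fun i => (L i).N) fun i => Data.num (Gen.grp (L i).d).p :=
    Bdd.of_size_le fun i hi => (Gen.size_p _ _ (h i hi).desc).trans (by have := hle i hi; omega)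
  have h1 : Bdd S (fun i => (L i).N) fun i => Data.ones (L i).n :=
    Bdd.of_size_le fun i hi => by rw [Data.size_ones]; have := hle i hi; omega
  have h2 : Bdd S (fun i => (L i).N) fun i => (L i).d :=
    Bdd.of_size_le fun i hi => (Gen.size_desc _ _ (h i hi).desc).trans (by have := hle i hi; omega)
  have h3 : Bdd S (fun i => (L i).N) fun _ => Data.bot :=
    Bdd.of_size_le fun i hi => by have := hle i hi; simp only [Data.bot, Data.size, List.length_nil]; omega
  exact Bdd.pair (h1.pair (hp.pair (h2.pair h3))) (hp.pair ((bdd_enc h _).pair ((bdd_enc h _).pair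
    ((bdd_enc h _).pair ((bdd_num fun i hi => by
      have := (L i).P.ts.2.2; have := hle i hi; omega).pair
      ((bdd_num fun i hi => (h i hi).js).pair ((bdd_encZ h _).pair ((bdd_encZ h _).pair
        (bdd_num fun i hi => by have := hle i hi; omega)))))))))

theorem bdd_state {s : ∀ i, SimState (Gen.grp (L i).d) (L i).T}
    (hs : ∀ i ∈ S, StateBdd (L i).N 0 (s i)) :
    Bdd S (fun i => (L i).N) fun i => encState (s i) := by
  have hle := fun i hi => (h i hi).le
  refine Bdd.pair ⟨.X * (.X + .X + 1 + 1) + 1, fun i hi => ?_⟩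
    (Bdd.pair ⟨.X * (.X + .X + 1 + 1) + 1, fun i hi => ?_⟩
    (bdd_num fun i hi => (hs i hi).tctr))
  · refine (size_ofList_le (k := (L i).N + (L i).N + 1) fun a ha => ?_).trans ?_
    · obtain ⟨e, he, rfl⟩ := List.mem_map.1 ha
      have h1 := (hs i hi).query e he
      have h2 := size_encZ_le (h i hi).desc e.2
      have := hle i hi
      simp only [Data.size]
      omega
    · have := (hs i hi).tbl
      simp only [List.length_map, Polynomial.eval_add, Polynomial.eval_mul, Polynomial.eval_X,
        Polynomial.eval_one]
      gcongr
      omega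
  · refine (size_ofList_le (k := (L i).N + (L i).N + 1) fun a ha => ?_).trans ?_
    · obtain ⟨e, he, rfl⟩ := List.mem_map.1 ha
      have h1 := size_enc_le (h i hi).desc e.1
      have h2 := size_encZ_le (h i hi).desc e.2
      have := hle i hi
      simp only [Data.size]
      omega
    · have := (hs i hi).certs
      simp only [List.length_map, Polynomial.eval_add, Polynomial.eval_mul, Polynomial.eval_X,
        Polynomial.eval_one]
      gcongr
      omega

end bounds

/-- Tables have at most `N` entries of length linear in `N`, hence quadratic length. For a final
state the length is bounded because its output is always of the shape `solution`, with a fixed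
number of group elements and residues. -/
theorem bdd_data : Bdd {L : LoopPoint Gen | L.Good 0} (fun L => L.N) fun L => L.data := by
  have h0 : ∀ L ∈ {L : LoopPoint Gen | L.Good 0}, L.Good 0 := fun L hL => hL
  obtain ⟨r1, hr1⟩ := bdd_params h0
  have hs : Bdd {p : Σ L : LoopPoint Gen, SimState (Gen.grp L.d) L.T |
      p.1.Good 0 ∧ StateBdd p.1.N 0 p.2} (fun p => p.1.N) fun p => encState p.2 :=
    bdd_state (L := Sigma.fst) (fun p hp => hp.1) fun p hp => hp.2
  obtain ⟨r2, hr2⟩ := hs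
  refine ⟨2 + 1 + (r1 + (r2 + (1 + .X * 7 + 7) + 1) + 1) + (.X * 10 + 20), fun L hL => ?_⟩
  have h1 := hr1 L hL
  have hc := hL.conf
  have hle := hL.le
  have hg := size_enc_le hL.desc
  have hz := size_encZ_le hL.desc
  simp only [Polynomial.eval_add, Polynomial.eval_mul, Polynomial.eval_X,
        Polynomial.eval_one, Polynomial.eval_ofNat]
  unfold LoopPoint.data
  cases hLc : L.c with
  | run st ans s =>
    rw [hLc] at hc
    have h2 := hr2 ⟨L, s⟩ ⟨hL, hc.2.2⟩
    have := hc.1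
    have := hc.2.1
    simp only [encConf, Data.size, List.length_cons, List.length_nil] at *
    omega
  | fin E l X Y zs s =>
    rw [hLc] at hc
    have h2 := hr2 ⟨L, s⟩ ⟨hL, hc.2⟩
    have := hc.1
    have := hg E
    have := hz X
    have := hz Y
    have := hz zs
    simp only [encConf, Data.size, List.length_cons, List.length_nil] at *
    omega
  | done o =>
    rw [hLc] at hc
    obtain ⟨R, rfl⟩ := hc
    have a1 := hz (shift L.P.γ L.P.vk)
    have a2 := hz 0
    have a3 := hz 1
    have a4 := hg L.P.vk
    have a5 := hg (L.P.h * (Gen.grp L.d).exp R (shift L.P.γ L.P.vk))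
    simp only [encConf, solution, Data.ofList, Data.bot, Data.size, List.length_nil] at *
    omega

/-- A state of the simulator that is not final, random numbers, the output of the adversary, and the
next state. -/
structure StepPoint (Gen : BilinearGenerator) : Type where
  L : LoopPoint Gen
  z1 : ZMod (Gen.grp L.d).p
  z2 : ZMod (Gen.grp L.d).p
  z3 : ZMod (Gen.grp L.d).p
  out : Option Data
  c : SimConf (Gen.grp L.d) L.T

namespace StepPoint

/-- The input of the program that computes the next state. -/
def data (Q : StepPoint Gen) : Data :=
  .pair (Q.out.getD Data.bot) (.pair ((Gen.grp Q.L.d).encZ Q.z1) (.pair ((Gen.grp Q.L.d).encZ Q.z2)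
    (.pair ((Gen.grp Q.L.d).encZ Q.z3) Q.L.data)))

/-- The step is possible. -/
structure Valid (Q : StepPoint Gen) : Prop where
  good : Q.L.Good 0
  out : ∀ d, Q.out = some d → d.size ≤ Q.L.b
  step : simStep Q.L.P Q.out Q.z1 Q.z2 Q.z3 Q.L.c = some Q.c

end StepPoint

theorem bdd_step : Bdd {Q : StepPoint Gen | Q.Valid} (fun Q => Q.L.N) fun Q => Q.data := by
  have h0 : ∀ Q ∈ {Q : StepPoint Gen | Q.Valid}, Q.L.Good 0 := fun Q hQ => hQ.good
  refine Bdd.pair (Bdd.of_size_le fun Q hQ => ?_) ((bdd_encZ h0 _).pair ((bdd_encZ h0 _).pair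
    ((bdd_encZ h0 _).pair (bdd_data.reindex fun Q hQ => ⟨Q.L, hQ.good, rfl, le_rfl⟩))))
  have := hQ.good.le
  cases h : Q.out with
  | none => simp only [Option.getD_none, Data.bot, Data.size, List.length_nil]; omega
  | some d =>
    have := StepPoint.Valid.out hQ d h
    rw [Option.getD_some]
    omega

/-- The next state of the simulator is computable. -/
theorem comp_step : Comp {Q : StepPoint Gen | Q.Valid} (fun Q => Q.L.N) (fun Q => Q.data) fun Q =>
    encConf (Gen.params Q.L.n Q.L.d) Q.L.P Q.c := by
  have hid := Comp.id (bdd_step (Gen := Gen))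
  have htag := hid.snd.snd.snd.snd.op .fst
  -- Running states and states that process a forgery both have the parameters and the tables at the
  -- same positions behind the tag, so one extraction serves all the parametrizations used below.
  have hsim : ∀ {κ : Type} (U : Set κ) (f : κ → StepPoint Gen) (hf : ∀ j ∈ U, (f j).Valid)
      (s : ∀ j, SimState (Gen.grp (f j).L.d) (f j).L.T)
      (_ : ∀ j ∈ U, ∃ t r, (f j).L.data = .pair t (.pair (encParams (Gen.params (f j).L.n (f j).L.d)
        (f j).L.P) (.pair (encState (s j)) r))),
      Simulable U (fun j => (f j).L.N) (fun j => (f j).data) fun j =>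
        ⟨(f j).L.n, (f j).L.d, (f j).L.T, (f j).L.P, s j, (f j).z1, (f j).z2, (f j).z3⟩ := by
    intro κ U f hf s hs
    have h1 := hid.param f hf
    refine ⟨fun j hj => (hf j hj).good.desc, fun j hj => ?_, fun j hj => (hf j hj).good.p_ne,
      ((h1.snd.snd.snd.snd.op .snd).op .fst).congr fun j hj => ?_,
      (((h1.snd.snd.snd.snd.op .snd).op .snd).op .fst).congr fun j hj => ?_,
      h1.snd.fst, h1.snd.snd.fst, h1.snd.snd.snd.fst⟩
    · have := (hf j hj).good.le
      dsimp only
      omega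
    · obtain ⟨t, r, h⟩ := hs j hj
      rw [h]; rfl
    · obtain ⟨t, r, h⟩ := hs j hj
      rw [h]; rfl
  refine Comp.ite' (htag.eq (Comp.const hid.bdd (.str [true]))) ?_ ?_
  · -- the adversary is running
    set κ := Σ Q : StepPoint Gen, Data × Data × SimState (Gen.grp Q.L.d) Q.L.T × Data × Data
    set U : Set κ := {p | p.1.Valid ∧ p.1.L.c = .run p.2.1 p.2.2.1 p.2.2.2.1 ∧
      p.1.out = some (.pair p.2.2.2.2.1 p.2.2.2.2.2)}
    refine Comp.of_param (T := U) Sigma.fst ?_ ?_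
    · have h1 := hid.param (T := U) Sigma.fst fun p hp => hp.1
      have h := hsim U Sigma.fst (fun p hp => hp.1) (fun p => p.2.2.2.1) fun p hp => by
        unfold LoopPoint.data
        rw [hp.2.1]
        exact ⟨_, _, rfl⟩
      refine h.act (st := fun p => p.2.2.2.2.1) (a := fun p => p.2.2.2.2.2)
        ((h1.fst.op .fst).congr fun p hp => by rw [hp.2.2]; rfl)
        ((h1.fst.op .snd).congr fun p hp => by rw [hp.2.2]; rfl) (c := fun p => p.1.c) fun p hp => ?_
      have := hp.1.step
      rw [hp.2.1, hp.2.2] at this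
      exact this
    · rintro Q ⟨hQ, ht⟩
      have hst := StepPoint.Valid.step hQ
      cases hc : Q.L.c with
      | run st ans s =>
        rw [hc] at hst
        cases ho : Q.out with
        | none => rw [ho] at hst; cases hst
        | some o =>
          rw [ho] at hst
          cases o with
          | str s => cases hst
          | pair st' a => exact ⟨⟨Q, st, ans, s, st', a⟩, ⟨hQ, hc, ho⟩, rfl⟩
      | fin E l X Y zs s =>
        have : (Op.fst.eval Q.L.data) = Data.str [true] := ht
        unfold LoopPoint.data at this
        rw [hc] at this
        simp [encConf, Op.eval] at this
      | done o => rw [hc] at hst; cases hst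
  -- A final state has no successor and a running one has the tag `[true]`, so only the processing
  -- of a forgery is left.
  · have hfin : ∀ Q ∈ {Q : StepPoint Gen | Q.Valid} ∩ {Q | ¬ Op.fst.eval Q.L.data = .str [true]},
        ∃ E l X Y zs s, Q.L.c = .fin E l X Y zs s := by
      rintro Q ⟨hQ, ht⟩
      have hst := StepPoint.Valid.step hQ
      cases hc : Q.L.c with
      | run st ans s =>
        refine absurd ?_ ht
        show Op.fst.eval Q.L.data = Data.str [true]
        unfold LoopPoint.data
        rw [hc]
        rfl
      | fin E l X Y zs s => exact ⟨_, _, _, _, _, _, rfl⟩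
      | done o => rw [hc] at hst; cases hst
    have hrest := ((((hid.snd.snd.snd.snd.op .snd).op .snd).op .snd).op .snd).op .fst
    refine Comp.ite' ((hrest.eq (Comp.const hid.bdd Data.bot)).mono Set.inter_subset_left) ?_ ?_
    · set κ := Σ Q : StepPoint Gen, (Gen.grp Q.L.d).G × ZMod (Gen.grp Q.L.d).p ×
        ZMod (Gen.grp Q.L.d).p × ZMod (Gen.grp Q.L.d).p × SimState (Gen.grp Q.L.d) Q.L.T
      set U : Set κ := {p | p.1.Valid ∧
        p.1.L.c = .fin p.2.1 [] p.2.2.1 p.2.2.2.1 p.2.2.2.2.1 p.2.2.2.2.2}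
      refine Comp.of_param (T := U) Sigma.fst ?_ ?_
      · have h1 := hid.param (T := U) Sigma.fst fun p hp => hp.1
        have h := hsim U Sigma.fst (fun p hp => hp.1) (fun p => p.2.2.2.2.2) fun p hp => by
          unfold LoopPoint.data
          rw [hp.2]
          exact ⟨_, _, rfl⟩
        have hd : ∀ p ∈ U, p.1.L.data = encConf (Gen.params p.1.L.n p.1.L.d) p.1.L.P
            (.fin p.2.1 [] p.2.2.1 p.2.2.2.1 p.2.2.2.2.1 p.2.2.2.2.2) := fun p hp => by
          unfold LoopPoint.data
          rw [hp.2]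
        have h2 := (h1.snd.snd.snd.snd.congr hd).snd.snd.snd
        refine (h.fin_nil (E := fun p => p.2.1) h2.fst h2.snd.snd.fst h2.snd.snd.snd.fst
          h2.snd.snd.snd.snd).congr fun p hp => ?_
        have := hp.1.step
        rw [hp.2] at this
        rw [← Option.some.inj this]
        rfl
      · rintro Q ⟨hQ, hr⟩
        obtain ⟨E, l, X, Y, zs, s, hc⟩ := hfin Q hQ
        cases l with
        | nil => exact ⟨⟨Q, E, X, Y, zs, s⟩, ⟨hQ.1, hc⟩, rfl⟩
        | cons e l =>
          have : Op.fst.eval (Op.snd.eval (Op.snd.eval (Op.snd.eval (Op.snd.eval Q.L.data)))) =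
            Data.bot := hr
          unfold LoopPoint.data at this
          rw [hc] at this
          simp [encConf, Op.eval, encClaims, Data.ofList, Data.bot] at this
    · set κ := Σ Q : StepPoint Gen, (Gen.grp Q.L.d).G × ((Gen.grp Q.L.d).G × Msg) ×
        List ((Gen.grp Q.L.d).G × Msg) × ZMod (Gen.grp Q.L.d).p ×
        ZMod (Gen.grp Q.L.d).p × ZMod (Gen.grp Q.L.d).p × SimState (Gen.grp Q.L.d) Q.L.T
      set U : Set κ := {p | p.1.Valid ∧
        p.1.L.c = .fin p.2.1 (p.2.2.1 :: p.2.2.2.1) p.2.2.2.2.1 p.2.2.2.2.2.1 p.2.2.2.2.2.2.1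
          p.2.2.2.2.2.2.2}
      refine Comp.of_param (T := U) Sigma.fst ?_ ?_
      · have h1 := hid.param (T := U) Sigma.fst fun p hp => hp.1
        have h := hsim U Sigma.fst (fun p hp => hp.1) (fun p => p.2.2.2.2.2.2.2) fun p hp => by
          unfold LoopPoint.data
          rw [hp.2]
          exact ⟨_, _, rfl⟩
        have hd : ∀ p ∈ U, p.1.L.data = encConf (Gen.params p.1.L.n p.1.L.d) p.1.L.P
            (.fin p.2.1 (p.2.2.1 :: p.2.2.2.1) p.2.2.2.2.1 p.2.2.2.2.2.1 p.2.2.2.2.2.2.1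
              p.2.2.2.2.2.2.2) := fun p hp => by
          unfold LoopPoint.data
          rw [hp.2]
        have h2 := (h1.snd.snd.snd.snd.congr hd).snd.snd.snd
        have h3 : Comp U (fun p => p.1.L.N) (fun p => p.1.data) fun p =>
            Data.pair (.pair ((Gen.grp p.1.L.d).enc p.2.2.1.1) (.str p.2.2.1.2))
              (encClaims p.2.2.2.1) := h2.snd.fst
        refine h.fin_cons (E := fun p => p.2.1) (e := fun p => p.2.2.1) (l := fun p => p.2.2.2.1)
          h2.fst h3.fst.fst h3.fst.snd h3.snd
          h2.snd.snd.fst h2.snd.snd.snd.fst h2.snd.snd.snd.snd (c := fun p => p.1.c)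
          (out := fun p => p.1.out) fun p hp => ?_
        have := hp.1.step
        rw [hp.2] at this
        exact this
      · rintro Q ⟨hQ, hr⟩
        obtain ⟨E, l, X, Y, zs, s, hc⟩ := hfin Q hQ
        cases l with
        | nil =>
          refine absurd ?_ hr
          show Op.fst.eval (Op.snd.eval (Op.snd.eval (Op.snd.eval (Op.snd.eval Q.L.data)))) =
            Data.bot
          unfold LoopPoint.data
          rw [hc]
          rfl
        | cons e l => exact ⟨⟨Q, E, e, l, X, Y, zs, s⟩, ⟨hQ.1, hc⟩, rfl⟩

/-! ### Growth of the tables of the simulator -/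

section growth

variable {𝒢 : PairingGroup} {T : ℕ}

theorem length_simTable_le (P : SimParams 𝒢 T) (q : HashQuery T) (z u : ZMod 𝒢.p)
    (l : List (HashQuery T × ZMod 𝒢.p)) : (simTable P q z u l).length ≤ l.length + 1 := by
  unfold simTable
  split_ifs <;> simp

theorem size_query_simTable_le {P : SimParams 𝒢 T} {q : HashQuery T} {z u : ZMod 𝒢.p}
    {l : List (HashQuery T × ZMod 𝒢.p)} {N : ℕ} (hq : (encQuery q).size ≤ N)
    (hl : ∀ e ∈ l, (encQuery e.1).size ≤ N) :
    ∀ e ∈ simTable P q z u l, (encQuery e.1).size ≤ N := by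
  intro e he
  unfold simTable at he
  split_ifs at he
  · exact hl e he
  · rcases List.mem_cons.1 he with rfl | he
    · exact hq
    · exact hl e he

theorem size_num_le (n : ℕ) : (Data.num n).size ≤ n + 1 :=
  Data.size_num_le_of_lt_two_pow Nat.lt_two_pow_self

theorem length_simCert_le (γ : 𝒢.G) (dvk dsk : Data) (l : List (𝒢.G × ZMod 𝒢.p)) :
    (simCert γ dvk dsk l).2.length ≤ l.length + 1 := by
  unfold simCert
  split_ifs <;> simp

theorem size_simCert_le (γ : 𝒢.G) (dvk dsk : Data) (l : List (𝒢.G × ZMod 𝒢.p)) :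
    (simCert γ dvk dsk l).1.size ≤ 2 := by
  unfold simCert
  split_ifs
  · exact Data.size_ofBool_le true
  · exact Data.size_ofBool_le false

end growth

variable {Gen : BilinearGenerator}

theorem size_simAnswer_le {n : ℕ} {d : Data} (hd : d ∈ (Gen.gen n).support) {T : ℕ}
    (P : SimParams (Gen.grp d) T) (q : HashQuery T) (v : ZMod (Gen.grp d).p) :
    (simAnswer P q v).size ≤ Gen.bound.eval n := by
  unfold simAnswer
  split_ifs
  all_goals first | exact size_encZ_le hd _ | exact size_enc_le hd _

/-- A step asks at most three hash queries (for a signature), certifies at most one key and advances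
the period by at most one. The queries have bounded length because they come from an output of
length at most `b` of the adversary, or from a forgery contained in such an output. -/
theorem LoopPoint.Good.step {L : LoopPoint Gen} {k : ℕ} (h : L.Good (k + 1)) {out : Option Data}
    (hout : ∀ d, out = some d → d.size ≤ L.b) {z1 z2 z3 : ZMod (Gen.grp L.d).p}
    {c : SimConf (Gen.grp L.d) L.T} (hc : simStep L.P out z1 z2 z3 L.c = some c) :
    ({ L with c := c } : LoopPoint Gen).Good k := by
  refine ⟨h.desc, h.p_ne, h.le, h.js, ?_⟩
  have hle := h.le
  have hb := h.conf
  have hn1 := size_num_le 1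
  have hn2 := size_num_le 2
  have hn3 := size_num_le 3
  have hper : ∀ t : Period L.T, (Data.num t.1).size ≤ L.T + 1 := fun t => by
    have := size_num_le t.1
    have := t.2.2
    omega
  have hbot : Data.bot.size = 1 := rfl
  have hq3 : ∀ (t : Period L.T) (m : Msg), (Data.str m).size ≤ L.b →
      (encQuery (.h3 t m)).size ≤ L.N := fun t m hm => by
    have := hper t
    simp only [encQuery, Data.size] at *
    omega
  have hq1 : ∀ t : Period L.T, (encQuery (.h1 t)).size ≤ L.N := fun t => by
    have := hper t
    simp only [encQuery, Data.size] at *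
    omega
  have hq2 : ∀ t : Period L.T, (encQuery (.h2 t)).size ≤ L.N := fun t => by
    have := hper t
    simp only [encQuery, Data.size] at *
    omega
  show ConfBdd L.P L.N L.b k c
  cases hL : L.c with
  | run st ans s =>
    rw [hL] at hb hc
    have hs := hb.2.2
    have hs' : StateBdd L.N k s := ⟨by have := hs.tbl; omega, hs.query,
      by have := hs.certs; omega, by have := hs.tctr; omega⟩
    rcases out with _ | (w | ⟨st', a⟩)
    · cases hc
    · cases hc
    have ho := hout _ rfl
    simp only [Data.size] at ho
    replace hc : simAct L.P s st' z1 z2 z3 (Data.decode encAct a) = some c := hc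
    have hbotN : Data.bot.size ≤ L.N := by omega
    cases ha : Data.decode (encAct (T := L.T)) a with
    | none =>
      rw [ha] at hc
      rw [← Option.some.inj hc]
      exact ⟨by omega, hbotN, hs'⟩
    | some act =>
      rw [ha] at hc
      rw [Data.decode_eq_some encAct_injective] at ha
      subst ha
      cases act with
      | hash q =>
        rw [← Option.some.inj hc]
        refine ⟨by omega, (size_simAnswer_le h.desc _ _ _).trans (by omega), ?_, ?_, hs'.certs,
          hs'.tctr⟩
        · have h1 := length_simTable_le L.P q z1 z3 s.tbl
          have := hs.tbl
          show List.length (simTable L.P q z1 z3 s.tbl) + _ ≤ _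
          omega
        · refine size_query_simTable_le ?_ hs.query
          simp only [encAct, Data.size] at ho
          omega
      | cert v w =>
        rw [← Option.some.inj hc]
        refine ⟨by omega, (size_simCert_le _ _ _ _).trans (by omega), hs'.tbl, hs'.query, ?_,
          hs'.tctr⟩
        have h1 := length_simCert_le L.P.γ v w s.certs
        have := hs.certs
        show List.length (simCert L.P.γ v w s.certs).2 + _ ≤ _
        omega
      | skip =>
        rw [← Option.some.inj hc]
        refine ⟨by omega, hbotN, ?_⟩
        split_ifs
        · exact ⟨hs'.tbl, hs'.query, hs'.certs, by have := hs.tctr; show _ + 1 + _ ≤ _; omega⟩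
        · exact hs'
      | sign m =>
        simp only [simAct] at hc
        split_ifs at hc with ht
        · rw [← Option.some.inj hc]
          have hm : (Data.str m).size ≤ L.b := by simp only [encAct, Data.size] at ho ⊢; omega
          refine ⟨by omega, ?_, ?_, ?_, hs'.certs, by have := hs.tctr; show _ + 1 + _ ≤ _; omega⟩
          · have h1 := size_enc_le h.desc (simSign L.P ⟨s.tctr, ht⟩ m z1 z2 z3 s.tbl)
            have h2 := hper ⟨s.tctr, ht⟩
            simp only [Data.size]
            dsimp only at h2
            omega
          · have := length_simTable_le L.P (.h3 ⟨s.tctr, ht⟩ m) z1 z3 s.tbl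
            have := length_simTable_le L.P (.h1 ⟨s.tctr, ht⟩) z2 z3
              (simTable L.P (.h3 ⟨s.tctr, ht⟩ m) z1 z3 s.tbl)
            have := length_simTable_le L.P (.h2 ⟨s.tctr, ht⟩) z1 z3 (simTable L.P (.h1 ⟨s.tctr, ht⟩)
              z2 z3 (simTable L.P (.h3 ⟨s.tctr, ht⟩ m) z1 z3 s.tbl))
            have := hs.tbl
            simp only [signTable]
            omega
          · exact size_query_simTable_le (hq2 _) (size_query_simTable_le (hq1 _)
              (size_query_simTable_le (hq3 _ m hm) hs.query))
        · rw [← Option.some.inj hc]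
          exact ⟨by omega, hbotN, hs'⟩
      | output d =>
        simp only [simAct] at hc
        split at hc
        · cases hc
        · next f hf =>
          rw [← Option.some.inj hc]
          rw [Data.decode_eq_some encForgery_injective] at hf
          subst hf
          refine ⟨?_, hs'⟩
          simp only [encAct, encForgery, Data.size] at ho
          unfold encClaims
          omega
  | fin E l X Y zs s =>
    rw [hL] at hb hc
    cases l with
    | nil =>
      rw [← Option.some.inj hc]
      exact ⟨_, rfl⟩
    | cons e l =>
      have hs := hb.2
      have hl := hb.1
      simp only [encClaims, List.map_cons, Data.ofList, Data.size] at hl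
      have hm : (Data.str e.2).size ≤ L.b := by simp only [Data.size]; omega
      have hs' : StateBdd L.N k { s with tbl := simTable L.P (.h3 L.P.ts e.2) z1 z3 s.tbl } := by
        refine ⟨?_, size_query_simTable_le (hq3 _ _ hm) hs.query,
          by have := hs.certs; show s.certs.length + k ≤ L.N; omega,
          by have := hs.tctr; show s.tctr + k ≤ L.N; omega⟩
        have h1 := length_simTable_le L.P (.h3 L.P.ts e.2) z1 z3 s.tbl
        have := hs.tbl
        show List.length (simTable L.P (.h3 L.P.ts e.2) z1 z3 s.tbl) + _ ≤ _
        omega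
      have hl' : (encClaims l).size ≤ L.b := by unfold encClaims; omega
      simp only [simStep] at hc
      split_ifs at hc
      · rw [← Option.some.inj hc]
        exact ⟨hl', hs'⟩
      · rw [← Option.some.inj hc]
        exact ⟨hl', hs'⟩
  | done o => rw [hL] at hc; cases hc

/-! ### The program of the simulator -/

/-- Nonzero residues are sampled as one plus a random number below `p - 1`; this is the final
increment. -/
theorem exists_incr : ∃ (c : Prog) (r : Polynomial ℕ), ∀ N k : ℕ, (Data.num k).size ≤ N →
    Surely c (Data.num k) (Data.num (k + 1)) (r.eval N) := by
  have hb : Bdd {i : ℕ × ℕ | (Data.num i.2).size ≤ i.1} (fun i => i.1) fun i => Data.num i.2 :=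
    Bdd.of_size_le fun i hi => hi
  obtain ⟨c, r, h⟩ := (Comp.id hb).add (Comp.num_const hb 1)
  exact ⟨c, r, fun N k hk => h (N, k) hk⟩

/-- The states that are not final. -/
def LoopPoint.active : Set (LoopPoint Gen) := {L | L.Good 0 ∧ ∀ o, L.c ≠ .done o}

theorem comp_p : Comp (LoopPoint.active (Gen := Gen)) (fun L => L.N) (fun L => L.data) fun L =>
    Data.num (Gen.grp L.d).p := by
  have hid := (Comp.id (bdd_data (Gen := Gen))).mono (S' := LoopPoint.active) fun L hL => hL.1
  refine ((((hid.op .snd).op .fst).op .snd).op .fst).congr fun L hL => ?_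
  have h2 := hL.2
  unfold LoopPoint.data
  cases hc : L.c with
  | done o => exact absurd hc (h2 o)
  | _ => rfl

theorem exists_sampleZ : ∃ (c : Prog) (r : Polynomial ℕ), ∀ L ∈ LoopPoint.active (Gen := Gen),
    ∀ F : Data → ℝ≥0∞, evZ (Gen.grp L.d) (fun z => F ((Gen.grp L.d).encZ z)) ≤
      wp (r.eval L.N) c L.data F := by
  obtain ⟨c, r, h⟩ := exists_wp_sample (comp_p (Gen := Gen))
  refine ⟨c, r, fun L hL F => le_trans (le_of_eq ?_) (h L hL F)⟩
  rw [ev_uniformBelow_eq_zmod]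
  rfl

theorem exists_sampleU : ∃ (c : Prog) (r : Polynomial ℕ), ∀ L ∈ LoopPoint.active (Gen := Gen),
    ∀ F : Data → ℝ≥0∞, evU (Gen.grp L.d) (fun z => F ((Gen.grp L.d).encZ z)) ≤
      wp (r.eval L.N) c L.data F := by
  have hp := comp_p (Gen := Gen)
  obtain ⟨c, r, h⟩ := exists_wp_sample (hp.sub (Comp.num_const hp.bdd_input 1))
  obtain ⟨e, s, he⟩ := exists_incr
  refine ⟨.seq c e, r + s, fun L hL F => ?_⟩
  rw [Polynomial.eval_add]
  refine le_trans ?_ (wp_seq _ _ c e L.data F)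
  refine le_trans ?_ (h L hL _)
  have hu := ev_uniformBelow_eq_units (p := (Gen.grp L.d).p) fun k => F (Data.num k)
  refine hu.symm.le.trans (ev_mono_of_support fun k hk => he _ _ ?_ F)
  have h2 := (Gen.grp L.d).prime.two_le
  rw [uniformBelow, PMF.mem_support_uniformOfFinset_iff, Finset.mem_insert,
    Finset.mem_range] at hk
  refine (Data.size_num_mono (show k ≤ (Gen.grp L.d).p by omega)).trans
    ((Gen.size_p _ _ hL.1.desc).trans ?_)
  have := hL.1.le
  omega

/-- The expected value of `f` at the output of the adversary, or at `none` if it is not running. -/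
noncomputable def evOut (A : Prog) (b : ℕ) {𝒢 : PairingGroup} {T : ℕ} (f : Option Data → ℝ≥0∞) :
    SimConf 𝒢 T → ℝ≥0∞
  | .run st ans _ => ev (A.output b (.pair st ans)) f
  | .fin _ _ _ _ _ _ => f none
  | .done _ => 0

/-- The tag of the state decides whether the adversary is run; if not, `⊥` stands for the missing
output. An adversary that exceeds its time yields no value in `wp`, so `f none = 0` is required
while it is running. -/
theorem exists_adversary (A : Prog) : ∃ (c : Prog) (r : Polynomial ℕ),
    ∀ L ∈ LoopPoint.active (Gen := Gen), ∀ f : Option Data → ℝ≥0∞,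
      ((∃ st ans s, L.c = .run st ans s) → f none = 0) → ∀ F : Data → ℝ≥0∞,
      (∀ o, f o ≤ F (o.getD Data.bot)) → evOut A L.b f L.c ≤ wp (r.eval L.N) c L.data F := by
  have hid := (Comp.id (bdd_data (Gen := Gen))).mono (S' := LoopPoint.active) fun L hL => hL.1
  obtain ⟨t, q, ht⟩ := (hid.op .fst).eq (Comp.const hid.bdd (.str [true]))
  obtain ⟨g, r, hg⟩ := ((hid.op .snd).op .snd).op .snd
  obtain ⟨e, s, he⟩ := Comp.const hid.bdd Data.bot
  refine ⟨.cond t (.seq g A) e, 1 + q + (q + (r + .X + s)), fun L hL f hf F hF => ?_⟩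
  have htL : Surely t L.data (truth (Op.fst.eval L.data = .str [true])) (q.eval L.N) := ht L hL
  have hsz := htL.size_le.2
  have hle := hL.1.le
  have hL2 := hL.2
  refine le_trans ?_ (wp_mono_budget (show 1 + L.data.size + (q.eval L.N +
    ((r.eval L.N + L.b) + s.eval L.N)) ≤ _ by
      simp only [Polynomial.eval_add, Polynomial.eval_one, Polynomial.eval_X]; omega) _ _ _)
  refine le_trans ?_ (wp_cond _ _ t _ _ _ F)
  refine le_trans ?_ (htL _)
  cases hc : L.c with
  | run st ans s' =>
    have hd : L.data = encConf (Gen.params L.n L.d) L.P (.run st ans s') := by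
      unfold LoopPoint.data; rw [hc]
    rw [truth_of (by rw [hd]; rfl), if_neg (by simp [Data.bot])]
    refine le_trans ?_ (wp_mono_budget (Nat.le_add_right _ _) _ _ _)
    refine le_trans ?_ (wp_seq _ _ g A _ F)
    refine le_trans ?_ (hg L hL _)
    have : Op.snd.eval (Op.snd.eval (Op.snd.eval L.data)) = .pair st ans := by rw [hd]; rfl
    show _ ≤ wp L.b A (Op.snd.eval (Op.snd.eval (Op.snd.eval L.data))) F
    rw [this]
    have := ev_output A L.b (.pair st ans) f (hf ⟨_, _, _, hc⟩)
    exact this.le.trans (wp_mono fun y => hF (some y))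
  | fin E l X Y zs s' =>
    have hd : L.data = encConf (Gen.params L.n L.d) L.P (.fin E l X Y zs s') := by
      unfold LoopPoint.data; rw [hc]
    rw [truth_of_not (by rw [hd]; simp [encConf, Op.eval]), if_pos rfl]
    refine le_trans ?_ (wp_mono_budget (Nat.le_add_left _ _) _ _ _)
    exact (hF none).trans (he L hL F)
  | done o => exact absurd hc (hL2 o)

theorem evZ_mono {𝒢 : PairingGroup} {f g : ZMod 𝒢.p → ℝ≥0∞} (h : ∀ z, f z ≤ g z) :
    evZ 𝒢 f ≤ evZ 𝒢 g := ev_mono h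

theorem evU_mono {𝒢 : PairingGroup} {f g : ZMod 𝒢.p → ℝ≥0∞} (h : ∀ z, z ≠ 0 → f z ≤ g z) :
    evU 𝒢 f ≤ evU 𝒢 g := ev_mono fun z => h z z.ne_zero

/-- One round of the simulation as a program. -/
theorem exists_round (A : Prog) : ∃ (c : Prog) (r : Polynomial ℕ),
    ∀ L ∈ LoopPoint.active (Gen := Gen), ∀ (f : SimConf (Gen.grp L.d) L.T → ℝ≥0∞)
      (F : Data → ℝ≥0∞), (∀ z1 z2 z3 out c', (∀ d, out = some d → d.size ≤ L.b) →
        simStep L.P out z1 z2 z3 L.c = some c' → f c' ≤ F (encConf (Gen.params L.n L.d) L.P c')) →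
      evOut A L.b (evStep L.P L.c f) L.c ≤ wp (r.eval L.N) c L.data F := by
  classical
  obtain ⟨ca, ra, ha⟩ := exists_adversary (Gen := Gen) A
  obtain ⟨cz, rz, hz⟩ := exists_sampleZ (Gen := Gen)
  obtain ⟨cu, ru, hu⟩ := exists_sampleU (Gen := Gen)
  obtain ⟨ci, ri, hi⟩ := Comp.id (bdd_data (Gen := Gen))
  obtain ⟨cs, rs, hs⟩ := comp_step (Gen := Gen)
  -- In every round an output and three random exponents are prepared, whether used or not, in the
  -- order that `StepPoint.data` prescribes for the step program.
  refine ⟨.seq (.fork ca (.fork cz (.fork cz (.fork cu ci)))) cs,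
    1 + ri + (ra + (1 + ri + (rz + (1 + ri + (rz + (1 + ri + (ru + ri))))))) + rs,
    fun L hL f F hF => ?_⟩
  have hsz : L.data.size ≤ ri.eval L.N := (hi L hL.1).size_le.2
  set G : Data → ℝ≥0∞ := fun y => wp (rs.eval L.N) cs y F with hG
  simp only [Polynomial.eval_add, Polynomial.eval_one]
  refine le_trans ?_ (wp_seq _ _ _ cs L.data F)
  refine le_trans ?_ (wp_mono_budget (show 1 + L.data.size + (ra.eval L.N + (1 + L.data.size +
    (rz.eval L.N + (1 + L.data.size + (rz.eval L.N + (1 + L.data.size +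
      (ru.eval L.N + ri.eval L.N))))))) ≤ _ by omega) _ _ _)
  refine le_trans ?_ (wp_fork _ _ _ _ _ _)
  -- The step program is guaranteed to work for outputs of length at most `L.b` only. Longer ones
  -- cannot be produced within time `L.b`, so their value may be replaced by `0`.
  set f' : Option Data → ℝ≥0∞ := fun o =>
    if ∀ d, o = some d → d.size ≤ L.b then evStep L.P L.c f o else 0 with hf'
  have hev : evOut A L.b (evStep L.P L.c f) L.c ≤ evOut A L.b f' L.c := by
    cases hc : L.c with
    | run st ans s =>
      refine ev_mono_of_support fun o ho => ?_
      rw [hf']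
      dsimp only
      rw [if_pos, hc]
      rintro d rfl
      exact size_le_of_mem_support_output ho
    | fin E l X Y zs s =>
      show _ ≤ f' none
      rw [hf']
      dsimp only
      rw [if_pos (by simp)]
      rw [hc]
      rfl
    | done o => exact le_rfl
  refine hev.trans (ha L hL f' ?_ _ ?_)
  · rintro ⟨st, ans, s, hc⟩
    rw [hf']
    dsimp only
    rw [if_pos (by simp), hc]
    simp [evStep, simStep, evZ, evU]
  · intro o
    rw [hf']
    dsimp only
    split_ifs with ho
    swap
    · exact zero_le
    refine le_trans ?_ (wp_fork _ _ _ _ _ _)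
    refine le_trans ?_ (hz L hL _)
    refine evZ_mono fun z1 => ?_
    refine le_trans ?_ (wp_fork _ _ _ _ _ _)
    refine le_trans ?_ (hz L hL _)
    refine evZ_mono fun z2 => ?_
    refine le_trans ?_ (wp_fork _ _ _ _ _ _)
    refine le_trans ?_ (hu L hL _)
    refine evU_mono fun z3 _ => ?_
    refine le_trans ?_ (hi L hL.1 _)
    cases hc : simStep L.P o z1 z2 z3 L.c with
    | none => exact zero_le
    | some c' =>
      exact (hF z1 z2 z3 o c' ho hc).trans (hs ⟨L, z1, z2, z3, o, c'⟩ ⟨hL.1, ho, hc⟩ F)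

theorem simVal_succ_of_active (A : Prog) (b : ℕ) {𝒢 : PairingGroup} {T : ℕ} (P : SimParams 𝒢 T)
    (pay : Data → ℝ≥0∞) (k : ℕ) {c : SimConf 𝒢 T} (hc : ∀ o, c ≠ .done o) :
    simVal A b P pay (k + 1) c = evOut A b (evStep P c (simVal A b P pay k)) c := by
  cases c with
  | done o => exact absurd rfl (hc o)
  | _ => rfl

/-- The simulation as a program. -/
theorem exists_simulator (A : Prog) : ∃ (c : Prog) (r : Polynomial ℕ),
    ∀ (k : ℕ) (L : LoopPoint Gen), L.Good k → ∀ F : Data → ℝ≥0∞,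
      simVal A L.b L.P (fun o => F (.pair Data.bot o)) k L.c ≤
        wp (k * r.eval L.N) c L.data F := by
  -- The tag of a state is `⊥` exactly for final states, so reading the tag is already the test of
  -- the loop.
  obtain ⟨ct, rt, ht⟩ := (Comp.id (bdd_data (Gen := Gen))).op .fst
  obtain ⟨cb, rb, hb⟩ := exists_round (Gen := Gen) A
  refine ⟨.loop ct cb, 1 + rt + (rt + rb), fun k => ?_⟩
  induction k with
  | zero => intro L _ F; exact zero_le
  | succ k ih =>
    intro L hL F
    have hL0 := hL.mono (Nat.zero_le _)
    have htL : Surely ct L.data (Op.fst.eval L.data) (rt.eval L.N) := ht L hL0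
    have hsz := htL.size_le.2
    refine le_trans ?_ (wp_mono_budget (show 1 + L.data.size + (rt.eval L.N + (rb.eval L.N +
      k * (1 + rt + (rt + rb)).eval L.N)) ≤ _ by
        simp only [Polynomial.eval_add, Polynomial.eval_one, add_mul, one_mul]; omega) _ _ _)
    refine le_trans ?_ (wp_loop _ _ _ ct cb L.data F)
    refine le_trans ?_ (htL _)
    by_cases hd : ∃ o, L.c = .done o
    · obtain ⟨o, ho⟩ := hd
      have : L.data = .pair Data.bot o := by unfold LoopPoint.data; rw [ho]; rfl
      rw [this, if_pos (show Op.fst.eval (Data.pair Data.bot o) = Data.bot from rfl), ho]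
      exact le_rfl
    · have hd' : ∀ o, L.c ≠ .done o := fun o ho => hd ⟨o, ho⟩
      rw [if_neg, simVal_succ_of_active _ _ _ _ _ hd']
      · refine hb L ⟨hL0, hd'⟩ _ _ fun z1 z2 z3 out c' hout hc' => ?_
        exact ih { L with c := c' } (hL.step hout hc') F
      · unfold LoopPoint.data
        cases hc : L.c with
        | done o => exact absurd hc (hd' o)
        | run => simp [encConf, Op.eval, Data.bot]
        | fin => simp [encConf, Op.eval, Data.bot]

end LLY

open Classical in
/-- The indicator of a proposition. -/
noncomputable def ind (P : Prop) : ℝ≥0∞ := if P then 1 else 0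

theorem ind_of {P : Prop} (h : P) : ind P = 1 := if_pos h

theorem ind_of_not {P : Prop} (h : ¬ P) : ind P = 0 := if_neg h

theorem ind_le_one (P : Prop) : ind P ≤ 1 := by unfold ind; split_ifs <;> simp

theorem ind_le_iff {P : Prop} {c : ℝ≥0∞} : ind P ≤ c ↔ (P → 1 ≤ c) := by
  by_cases h : P
  · simp [ind, h]
  · simp [ind, h]

namespace LLY

/-! ### The unforgeability game on exponents -/

section game

variable {𝒢 : PairingGroup} {T : ℕ}

/-- The expected value of `f` at a fresh answer to the query `q`, given by its exponent. -/
noncomputable def evAns (𝒢 : PairingGroup) (q : HashQuery T) (f : ZMod 𝒢.p → ℝ≥0∞) : ℝ≥0∞ :=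
  if q.kind = 2 then evU 𝒢 f else evZ 𝒢 f

/-- The expected value of `K` at the answer to the query `q` and the new table. -/
noncomputable def ask (q : HashQuery T) (l : List (HashQuery T × ZMod 𝒢.p))
    (K : ZMod 𝒢.p → List (HashQuery T × ZMod 𝒢.p) → ℝ≥0∞) : ℝ≥0∞ :=
  match assoc q l with
  | some v => K v l
  | none => evAns 𝒢 q fun v => K v ((q, v) :: l)

/-- The expected value of `K` at the answers to several queries and the new table. -/
noncomputable def askMany : List (HashQuery T) → List (HashQuery T × ZMod 𝒢.p) →
    (List (ZMod 𝒢.p) → List (HashQuery T × ZMod 𝒢.p) → ℝ≥0∞) → ℝ≥0∞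
  | [], l, K => K [] l
  | q :: qs, l, K => ask q l fun v l' => askMany qs l' fun vs l'' => K (v :: vs) l''

/-- The table `l'` is the table `l` after the query `q` with answer `v`. -/
structure Asked (q : HashQuery T) (l : List (HashQuery T × ZMod 𝒢.p)) (v : ZMod 𝒢.p)
    (l' : List (HashQuery T × ZMod 𝒢.p)) : Prop where
  assoc_eq : assoc q l' = some v
  eq_or : l' = l ∨ (assoc q l = none ∧ l' = (q, v) :: l ∧ (q.kind = 2 → v ≠ 0))

theorem Asked.length_le {q : HashQuery T} {l l' : List (HashQuery T × ZMod 𝒢.p)} {v : ZMod 𝒢.p}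
    (h : Asked q l v l') : l'.length ≤ l.length + 1 := by
  rcases h.eq_or with rfl | ⟨-, rfl, -⟩ <;> simp

theorem Asked.assoc_of_some {q : HashQuery T} {l l' : List (HashQuery T × ZMod 𝒢.p)}
    {v : ZMod 𝒢.p} (h : Asked q l v l') {q' : HashQuery T} {v' : ZMod 𝒢.p}
    (h' : assoc q' l = some v') : assoc q' l' = some v' := by
  rcases h.eq_or with rfl | ⟨h0, rfl, -⟩
  · exact h'
  · rwa [assoc_cons_of_ne]
    rintro rfl
    rw [h0] at h'
    cases h'

theorem evAns_mono {q : HashQuery T} {f g : ZMod 𝒢.p → ℝ≥0∞}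
    (h : ∀ v, (q.kind = 2 → v ≠ 0) → f v ≤ g v) : evAns 𝒢 q f ≤ evAns 𝒢 q g := by
  unfold evAns
  split_ifs with hq
  · exact evU_mono fun z hz => h z fun _ => hz
  · exact evZ_mono fun z => h z fun h' => absurd h' hq

theorem evAns_const (q : HashQuery T) (c : ℝ≥0∞) : evAns 𝒢 q (fun _ => c) = c := by
  unfold evAns evU evZ
  split_ifs <;> simp

theorem evAns_add (q : HashQuery T) (f g : ZMod 𝒢.p → ℝ≥0∞) :
    evAns 𝒢 q (fun v => f v + g v) = evAns 𝒢 q f + evAns 𝒢 q g := by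
  unfold evAns evU evZ
  split_ifs <;> rw [ev_add]

theorem ask_mono {q : HashQuery T} {l : List (HashQuery T × ZMod 𝒢.p)}
    {K K' : ZMod 𝒢.p → List (HashQuery T × ZMod 𝒢.p) → ℝ≥0∞}
    (h : ∀ v l', Asked q l v l' → K v l' ≤ K' v l') : ask q l K ≤ ask q l K' := by
  unfold ask
  cases hq : assoc q l with
  | some v => exact h v l ⟨hq, Or.inl rfl⟩
  | none => exact evAns_mono fun v hv => h v _ ⟨assoc_cons_self q v l, Or.inr ⟨hq, rfl, hv⟩⟩

theorem ask_const (q : HashQuery T) (l : List (HashQuery T × ZMod 𝒢.p)) (c : ℝ≥0∞) :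
    ask q l (fun _ _ => c) = c := by
  unfold ask
  split
  · rfl
  · exact evAns_const q c

theorem ask_add (q : HashQuery T) (l : List (HashQuery T × ZMod 𝒢.p))
    (K K' : ZMod 𝒢.p → List (HashQuery T × ZMod 𝒢.p) → ℝ≥0∞) :
    ask q l (fun v l' => K v l' + K' v l') = ask q l K + ask q l K' := by
  unfold ask
  split
  · rfl
  · exact evAns_add q _ _

theorem askMany_add (qs : List (HashQuery T)) (l : List (HashQuery T × ZMod 𝒢.p))
    (K K' : List (ZMod 𝒢.p) → List (HashQuery T × ZMod 𝒢.p) → ℝ≥0∞) :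
    askMany qs l (fun v l' => K v l' + K' v l') = askMany qs l K + askMany qs l K' := by
  induction qs generalizing l K K' with
  | nil => rfl
  | cons q qs ih => simp only [askMany, ih, ask_add]

theorem askMany_const (qs : List (HashQuery T)) (l : List (HashQuery T × ZMod 𝒢.p)) (c : ℝ≥0∞) :
    askMany qs l (fun _ _ => c) = c := by
  induction qs generalizing l with
  | nil => rfl
  | cons q qs ih => simp only [askMany, ih, ask_const]

/-- What is recorded in the game: exponents of hash values, certified key pairs, for each signature
its period, its message and the place of the hash value in the table, and the current period. -/
structure Ghost (𝒢 : PairingGroup) (T : ℕ) : Type where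
  tbl : List (HashQuery T × ZMod 𝒢.p)
  certs : List (𝒢.G × ZMod 𝒢.p)
  slog : List (Period T × Msg × ℕ)
  tctr : ℕ

/-- A value for a forgery, the hash values that occur in its verification, and the final state. -/
abbrev Payoff (𝒢 : PairingGroup) (T : ℕ) : Type :=
  List (𝒢.G × Msg) × (𝒢.G × Period T) → List (ZMod 𝒢.p) → ZMod 𝒢.p → ZMod 𝒢.p → Ghost 𝒢 T → ℝ≥0∞

/-- The place of the entry for `q` in the table, counted from its end. -/
noncomputable def place (q : HashQuery T) : List (HashQuery T × ZMod 𝒢.p) → ℕ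
  | [] => 0
  | e :: l => open Classical in if e.1 = q then l.length else place q l

/-- The expected payoff after the verification of a forgery. -/
noncomputable def finish (J : Payoff 𝒢 T) (S : Ghost 𝒢 T)
    (f : List (𝒢.G × Msg) × (𝒢.G × Period T)) : ℝ≥0∞ :=
  askMany (f.1.map fun e => .h3 f.2.2 e.2) S.tbl fun zs l1 =>
    ask (.h1 f.2.2) l1 fun r l2 => ask (.h2 f.2.2) l2 fun s l3 => J f zs r s { S with tbl := l3 }

/-- The answer to a hash query with exponent `v`. -/
noncomputable def answer (γ : 𝒢.G) (q : HashQuery T) (v : ZMod 𝒢.p) : Data :=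
  if q.kind = 3 then 𝒢.encZ v else 𝒢.enc (𝒢.exp γ v)

open Classical in
/-- The expected payoff after an action of the adversary, where `V` is the value of the game that
follows. -/
noncomputable def react (γ vk : 𝒢.G) (J : Payoff 𝒢 T) (V : Data → Data → Ghost 𝒢 T → ℝ≥0∞)
    (S : Ghost 𝒢 T) (st : Data) : Option (Act T) → ℝ≥0∞
  | none => V st Data.bot S
  | some (.hash q) => ask q S.tbl fun v l => V st (answer γ q v) { S with tbl := l }
  | some (.cert dvk dsk) => V st (simCert γ dvk dsk S.certs).1
      { S with certs := (simCert γ dvk dsk S.certs).2 }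
  | some .skip => V st Data.bot
      (if 1 ≤ S.tctr ∧ S.tctr ≤ T then { S with tctr := S.tctr + 1 } else S)
  | some (.sign m) =>
    if ht : 1 ≤ S.tctr ∧ S.tctr ≤ T then
      ask (.h3 ⟨S.tctr, ht⟩ m) S.tbl fun z l1 => ask (.h1 ⟨S.tctr, ht⟩) l1 fun r l2 =>
        ask (.h2 ⟨S.tctr, ht⟩) l2 fun s l3 =>
          V st (.pair (𝒢.enc (𝒢.exp vk (r + s * z))) (Data.num S.tctr))
            { S with
              tbl := l3
              slog := (⟨S.tctr, ht⟩, m, place (.h3 ⟨S.tctr, ht⟩ m) l3) :: S.slog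
              tctr := S.tctr + 1 }
    else V st Data.bot S
  | some (.output d) =>
    match Data.decode (encForgery 𝒢 (T := T)) d with
    | none => 0
    | some f => finish J S f

/-- The expected payoff after an output of the adversary. -/
noncomputable def round (γ vk : 𝒢.G) (J : Payoff 𝒢 T) (V : Data → Data → Ghost 𝒢 T → ℝ≥0∞)
    (S : Ghost 𝒢 T) : Option Data → ℝ≥0∞
  | some (.pair st act) => react γ vk J V S st (Data.decode encAct act)
  | _ => 0

/-- The expected payoff of the game with at most `k` more activations of the adversary. -/
noncomputable def gameVal (A : Prog) (b : ℕ) (γ vk : 𝒢.G) (J : Payoff 𝒢 T) :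
    ℕ → Data → Data → Ghost 𝒢 T → ℝ≥0∞
  | 0, _, _, _ => 0
  | k + 1, st, ans, S => ev (A.output b (.pair st ans)) (round γ vk J (gameVal A b γ vk J k) S)

variable {A : Prog} {b : ℕ} {γ vk : 𝒢.G}

theorem finish_add (J J' : Payoff 𝒢 T) (S : Ghost 𝒢 T)
    (f : List (𝒢.G × Msg) × (𝒢.G × Period T)) :
    finish (fun f zs r s S => J f zs r s S + J' f zs r s S) S f =
      finish J S f + finish J' S f := by
  simp only [finish, ask_add, askMany_add]

/-- The course of the game does not depend on the payoff. Therefore the union bound over guesses and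
collisions can be taken inside the payoff and the summands treated separately. -/
theorem gameVal_add (J J' : Payoff 𝒢 T) (k : ℕ) (st ans : Data) (S : Ghost 𝒢 T) :
    gameVal A b γ vk (fun f zs r s S => J f zs r s S + J' f zs r s S) k st ans S =
      gameVal A b γ vk J k st ans S + gameVal A b γ vk J' k st ans S := by
  induction k generalizing st ans S with
  | zero => simp [gameVal]
  | succ k ih =>
    simp only [gameVal]
    rw [← ev_add]
    congr 1
    funext out
    rcases out with _ | (_ | ⟨st', act⟩)
    · simp [round]
    · simp [round]
    · simp only [round]
      generalize Data.decode encAct act = o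
      rcases o with _ | (_ | _ | _ | _ | d)
      · exact ih _ _ _
      · simp only [react, ih, ask_add]
      · exact ih _ _ _
      · exact ih _ _ _
      · simp only [react]
        split_ifs
        · simp only [ih, ask_add]
        · exact ih _ _ _
      · simp only [react]
        split
        · simp
        · exact finish_add J J' _ _

theorem gameVal_zero (k : ℕ) (st ans : Data) (S : Ghost 𝒢 T) :
    gameVal A b γ vk (fun _ _ _ _ _ => 0) k st ans S = 0 := by
  induction k generalizing st ans S with
  | zero => rfl
  | succ k ih =>
    simp only [gameVal]
    refine (ev_mono (g := fun _ => 0) fun out => ?_).antisymm (by simp) |>.trans (ev_const _ _)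
    rcases out with _ | (_ | ⟨st', act⟩)
    · simp [round]
    · simp [round]
    · simp only [round]
      generalize Data.decode encAct act = o
      rcases o with _ | (_ | _ | _ | _ | d)
      · exact (ih _ _ _).le
      · simp only [react, ih, ask_const, le_refl]
      · exact (ih _ _ _).le
      · exact (ih _ _ _).le
      · simp only [react]
        split_ifs
        · simp only [ih, ask_const, le_refl]
        · exact (ih _ _ _).le
      · simp only [react]
        split
        · simp
        · simp only [finish, ask_const, askMany_const, le_refl]

theorem gameVal_sum {ι : Type*} (s : Finset ι) (J : ι → Payoff 𝒢 T) (k : ℕ) (st ans : Data)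
    (S : Ghost 𝒢 T) :
    gameVal A b γ vk (fun f zs r s' S => ∑ i ∈ s, J i f zs r s' S) k st ans S =
      ∑ i ∈ s, gameVal A b γ vk (J i) k st ans S := by
  classical
  induction s using Finset.induction_on with
  | empty => simpa using gameVal_zero k st ans S
  | insert i s hi ih => simp only [Finset.sum_insert hi, gameVal_add, ih]

/-! ### Collisions -/

/-- Two messages have the same hash value in some period. -/
def Collision (l : List (HashQuery T × ZMod 𝒢.p)) : Prop :=
  ∃ (t : Period T) (m m' : Msg) (z : ZMod 𝒢.p), m ≠ m' ∧ (HashQuery.h3 t m, z) ∈ l ∧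
    (HashQuery.h3 t m', z) ∈ l

/-- A new collision involves the new entry, because the two messages differ and the new entry covers
only one of them; then its value occurs already in the old table. A value of `H₂` never takes part.
-/
theorem Collision.of_cons {q : HashQuery T} {v : ZMod 𝒢.p} {l : List (HashQuery T × ZMod 𝒢.p)}
    (h : Collision ((q, v) :: l)) : Collision l ∨ (q.kind ≠ 2 ∧ v ∈ l.map Prod.snd) := by
  obtain ⟨t, m, m', z, hm, h1, h2⟩ := h
  rcases List.mem_cons.1 h1 with h1 | h1 <;> rcases List.mem_cons.1 h2 with h2 | h2
  · rw [Prod.mk.injEq] at h1 h2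
    have := h1.1.trans h2.1.symm
    simp only [HashQuery.h3.injEq, true_and] at this
    exact absurd this hm
  · rw [Prod.mk.injEq] at h1
    refine Or.inr ⟨by rw [← h1.1]; simp [HashQuery.kind], List.mem_map.2 ⟨_, h2, h1.2⟩⟩
  · rw [Prod.mk.injEq] at h2
    refine Or.inr ⟨by rw [← h2.1]; simp [HashQuery.kind], List.mem_map.2 ⟨_, h1, h2.2⟩⟩
  · exact Or.inl ⟨t, m, m', z, hm, h1, h2⟩

theorem evZ_mem_le (l : List (ZMod 𝒢.p)) :
    evZ 𝒢 (fun v => ind (v ∈ l)) ≤ (l.length : ℝ≥0∞) * (𝒢.p : ℝ≥0∞)⁻¹ := by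
  classical
  rw [evZ, ev_uniformOfFintype, ZMod.card, mul_comm]
  gcongr
  rw [← Finset.sum_subset (Finset.subset_univ l.toFinset) fun v _ hv => ind_of_not (by simpa using hv)]
  refine (Finset.sum_le_card_nsmul _ _ 1 fun v _ => ind_le_one _).trans ?_
  rw [nsmul_one, Nat.cast_le]
  exact l.toFinset_card_le

/-- A fresh value hits one of at most `N` earlier values with probability at most `N / p`. The
constant `c` collects the contributions of later queries, so that the estimate can be chained. -/
theorem ask_collision_le {q : HashQuery T} {l : List (HashQuery T × ZMod 𝒢.p)} {N : ℕ}
    (hl : l.length ≤ N) {K : ZMod 𝒢.p → List (HashQuery T × ZMod 𝒢.p) → ℝ≥0∞} {c : ℝ≥0∞}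
    (h : ∀ v l', l'.length ≤ l.length + 1 → K v l' ≤ ind (Collision l') + c) :
    ask q l K ≤ ind (Collision l) + (N * (𝒢.p : ℝ≥0∞)⁻¹ + c) := by
  refine (ask_mono (K' := fun _ l' => ind (Collision l') + c) fun v l' hl' =>
    h v l' hl'.length_le).trans ?_
  rw [ask_add, ask_const, ← add_assoc]
  gcongr
  unfold ask
  cases hq : assoc q l with
  | some v => exact le_self_add
  | none =>
    dsimp only
    unfold evAns
    split_ifs with h2
    · refine (evU_mono (g := fun _ => ind (Collision l)) fun v _ => ?_).trans ?_
      · refine ind_le_iff.2 fun hc => (ind_of (hc.of_cons.resolve_right fun h' => h'.1 h2)).ge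
      · rw [evU, ev_const]
        exact le_self_add
    · refine (evZ_mono (g := fun v => ind (Collision l) + ind (v ∈ l.map Prod.snd))
        fun v => ind_le_iff.2 fun hc => ?_).trans ?_
      · rcases hc.of_cons with h' | h'
        · exact (ind_of h').ge.trans le_self_add
        · exact (ind_of h'.2).ge.trans le_add_self
      · rw [evZ, ev_add, ev_const]
        gcongr
        refine (evZ_mem_le _).trans ?_
        rw [List.length_map]
        gcongr

theorem askMany_collision_le {N : ℕ} {c : ℝ≥0∞} (qs : List (HashQuery T))
    {l : List (HashQuery T × ZMod 𝒢.p)} (hl : l.length + qs.length ≤ N)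
    {K : List (ZMod 𝒢.p) → List (HashQuery T × ZMod 𝒢.p) → ℝ≥0∞}
    (h : ∀ v l', l'.length ≤ l.length + qs.length → K v l' ≤ ind (Collision l') + c) :
    askMany qs l K ≤ ind (Collision l) + (qs.length * (N * (𝒢.p : ℝ≥0∞)⁻¹) + c) := by
  induction qs generalizing l K with
  | nil => simpa [askMany] using h [] l (by simp)
  | cons q qs ih =>
    rw [List.length_cons] at hl
    simp only [askMany]
    refine (ask_collision_le (N := N) (by omega) (c := qs.length * (N * (𝒢.p : ℝ≥0∞)⁻¹) + c)
      fun v l' hl' => ih (by omega) fun vs l'' hl'' => h _ _ (by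
        rw [List.length_cons]; omega)).trans ?_
    rw [List.length_cons, Nat.cast_add, Nat.cast_one]
    refine add_le_add le_rfl (le_of_eq ?_)
    ring

theorem length_le_size_encForgery (f : List (𝒢.G × Msg) × (𝒢.G × Period T)) :
    f.1.length ≤ (encForgery 𝒢 f).size := by
  have := Data.length_lt_size_ofList (f.1.map fun x => Data.pair (𝒢.enc x.1) (.str x.2))
  rw [List.length_map] at this
  simp only [encForgery, Data.size]
  omega

/-- A collision occurs with small probability only. -/
theorem gameVal_collision_le {N : ℕ} (k : ℕ) (st ans : Data) (S : Ghost 𝒢 T)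
    (hN : S.tbl.length + 3 * k + b + 3 ≤ N) :
    gameVal A b γ vk (fun _ _ _ _ S => ind (Collision S.tbl)) k st ans S ≤
      ind (Collision S.tbl) + (3 * k + b : ℕ) * (N * (𝒢.p : ℝ≥0∞)⁻¹) := by
  set δ : ℝ≥0∞ := N * (𝒢.p : ℝ≥0∞)⁻¹ with hδ
  have hmono : ∀ {i j : ℕ}, i ≤ j → (i : ℝ≥0∞) * δ ≤ j * δ := fun h => by gcongr
  induction k generalizing st ans S with
  | zero => exact zero_le
  | succ k ih =>
    simp only [gameVal]
    refine (ev_mono_of_support (g := fun _ => _) fun out hout => ?_).trans (ev_const _ _).le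
    rcases out with _ | (_ | ⟨st', act⟩)
    · exact zero_le
    · exact zero_le
    have hsz := size_le_of_mem_support_output hout
    simp only [Data.size] at hsz
    have hstep : ∀ st ans (S' : Ghost 𝒢 T), S'.tbl = S.tbl →
        gameVal A b γ vk (fun _ _ _ _ S => ind (Collision S.tbl)) k st ans S' ≤
        ind (Collision S.tbl) + (3 * (k + 1) + b : ℕ) * δ := fun st ans S' hS => by
      rw [← hS]
      refine (ih st ans S' (by rw [hS]; omega)).trans ?_
      gcongr
      omega
    simp only [round]
    cases ho : Data.decode (encAct (T := T)) act with
    | none => exact hstep _ _ _ rfl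
    | some a =>
      rw [Data.decode_eq_some encAct_injective] at ho
      subst ho
      cases a with
      | hash q =>
        simp only [react]
        refine (ask_collision_le (N := N) (by omega) fun v l' hl' => ih _ _ _ ?_).trans ?_
        · show l'.length + 3 * k + b + 3 ≤ N
          omega
        · gcongr
          have := hmono (show 1 + (3 * k + b) ≤ 3 * (k + 1) + b by omega)
          rw [Nat.cast_add, Nat.cast_one, add_mul, one_mul] at this
          exact this
      | cert v w => exact hstep _ _ _ rfl
      | skip =>
        refine hstep _ _ _ ?_
        split_ifs <;> rfl
      | sign m =>
        simp only [react]
        split_ifs with ht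
        · refine (ask_collision_le (N := N) (by omega) fun z l1 h1 =>
            ask_collision_le (N := N) (by omega) fun r l2 h2 =>
            ask_collision_le (N := N) (by omega) fun s l3 h3 => ih _ _ _ ?_).trans ?_
          · show l3.length + 3 * k + b + 3 ≤ N
            omega
          · refine add_le_add le_rfl (le_of_eq ?_)
            -- One contribution `δ` for each of the three hash queries of a signature; the summand
            -- `b` is kept for the verification of the forgery.
            rw [show 3 * (k + 1) + b = 1 + (1 + (1 + (3 * k + b))) by omega]
            push_cast
            ring
        · exact hstep _ _ _ rfl
      | output d =>
        simp only [react]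
        split
        · exact zero_le
        · next f hf =>
          rw [Data.decode_eq_some encForgery_injective] at hf
          subst hf
          have hlen := length_le_size_encForgery f
          simp only [encAct, Data.size] at hsz
          -- The verification asks `H₃` once per message, at most `b` times by the length of the
          -- forgery, and then `H₁` and `H₂`, which account for the two terms in `c`.
          refine (askMany_collision_le (N := N) (c := δ + (δ + 0)) _ (by
            rw [List.length_map]; omega) fun zs l1 h1 => ?_).trans ?_
          · rw [List.length_map] at h1
            exact ask_collision_le (N := N) (by omega) fun r l2 h2 =>
              ask_collision_le (N := N) (by omega) fun s l3 h3 => le_self_add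
          · gcongr
            rw [List.length_map]
            have := hmono (show f.1.length + (1 + 1) ≤ 3 * (k + 1) + b by omega)
            rw [Nat.cast_add, add_mul] at this
            refine le_trans (le_of_eq ?_) this
            push_cast
            ring

end game

/-! ### Averages over random exponents -/

section expectation

variable {𝒢 : PairingGroup} {T : ℕ}

theorem evZ_const (c : ℝ≥0∞) : evZ 𝒢 (fun _ => c) = c := ev_const _ _

theorem evU_const (c : ℝ≥0∞) : evU 𝒢 (fun _ => c) = c := ev_const _ _

theorem evZ_add_right (a : ZMod 𝒢.p) (f : ZMod 𝒢.p → ℝ≥0∞) :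
    evZ 𝒢 (fun z => f (z + a)) = evZ 𝒢 f :=
  ev_uniform_equiv (Equiv.addRight a) f

theorem evU_mul_right {a : ZMod 𝒢.p} (ha : a ≠ 0) (f : ZMod 𝒢.p → ℝ≥0∞) :
    evU 𝒢 (fun z => f (z * a)) = evU 𝒢 f :=
  ev_uniform_equiv (Equiv.mulRight (Units.mk0 a ha)) fun z : (ZMod 𝒢.p)ˣ => f z

theorem evAns_mul_left (q : HashQuery T) (c : ℝ≥0∞) (f : ZMod 𝒢.p → ℝ≥0∞) :
    evAns 𝒢 q (fun v => c * f v) = c * evAns 𝒢 q f := by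
  unfold evAns evU evZ
  split_ifs <;> rw [ev_mul_left]

theorem ask_mul_left (q : HashQuery T) (l : List (HashQuery T × ZMod 𝒢.p)) (c : ℝ≥0∞)
    (K : ZMod 𝒢.p → List (HashQuery T × ZMod 𝒢.p) → ℝ≥0∞) :
    ask q l (fun v l' => c * K v l') = c * ask q l K := by
  unfold ask
  split
  · rfl
  · exact evAns_mul_left q c _

theorem evAns_comm {α : Type*} (μ : PMF α) (q : HashQuery T) (F : α → ZMod 𝒢.p → ℝ≥0∞) :
    evAns 𝒢 q (fun v => ev μ fun a => F a v) = ev μ fun a => evAns 𝒢 q (F a) := by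
  unfold evAns evU evZ
  split_ifs
  · rw [ev_comm]
  · rw [ev_comm]

/-- A random exponent differs from a given one with probability at least `1 / 2`. -/
theorem one_le_two_mul_evZ (z : ZMod 𝒢.p) : 1 ≤ 2 * evZ 𝒢 fun v => ind (v ≠ z) := by
  have h1 : evZ 𝒢 (fun v => ind (v ≠ z)) + evZ 𝒢 (fun v => ind (v ∈ [z])) = 1 := by
    rw [evZ, evZ, ← ev_add]
    refine Eq.trans ?_ (ev_const (PMF.uniformOfFintype (ZMod 𝒢.p)) 1)
    congr 1
    funext v
    by_cases h : v = z <;> simp [h, ind]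
  have h2 := evZ_mem_le [z]
  rw [List.length_singleton, Nat.cast_one, one_mul] at h2
  have h3 : (𝒢.p : ℝ≥0∞)⁻¹ ≤ 2⁻¹ :=
    ENNReal.inv_le_inv.2 (by exact_mod_cast 𝒢.prime.two_le)
  have h4 : 1 ≤ evZ 𝒢 (fun v => ind (v ≠ z)) + 2⁻¹ := h1.symm.le.trans (by gcongr; exact h2.trans h3)
  have h5 : (1 : ℝ≥0∞) - 2⁻¹ ≤ evZ 𝒢 (fun v => ind (v ≠ z)) := tsub_le_iff_right.2 h4
  rw [ENNReal.one_sub_inv_two] at h5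
  calc (1 : ℝ≥0∞) = 2 * 2⁻¹ := (ENNReal.mul_inv_cancel (by norm_num) (by norm_num)).symm
    _ ≤ _ := by gcongr

end expectation

/-! ### The simulation is faithful if the guesses are right -/

section faithful

variable {𝒢 : PairingGroup} {T : ℕ}

open Classical in
/-- The hash value at the place `js` of the table, if it is there and of a message in period `ts`. -/
noncomputable def marked (ts : Period T) (js : ℕ) : List (HashQuery T × ZMod 𝒢.p) → Option (ZMod 𝒢.p)
  | [] => none
  | e :: l => if l.length = js then (if e.1.kind = 3 ∧ e.1.period = ts then some e.2 else none)
    else marked ts js l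

theorem marked_eq_none {ts : Period T} {js : ℕ} {l : List (HashQuery T × ZMod 𝒢.p)}
    (h : l.length ≤ js) : marked ts js l = none := by
  induction l with
  | nil => rfl
  | cons e l ih =>
    rw [List.length_cons] at h
    rw [marked, if_neg (by omega), ih (by omega)]

/-- Places are counted from the end of the list, so a new entry in front does not move the old ones;
the marked value changes only when the new entry itself lands on the place `js` and is of the right
kind. -/
theorem marked_cons_of_not {ts : Period T} {js : ℕ} {l : List (HashQuery T × ZMod 𝒢.p)}
    {q : HashQuery T} (h : ¬ (q.kind = 3 ∧ q.period = ts ∧ l.length = js)) (v : ZMod 𝒢.p) :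
    marked ts js ((q, v) :: l) = marked ts js l := by
  rw [marked]
  split_ifs with h1 h2
  · exact absurd ⟨h2.1, h2.2, h1⟩ h
  · exact (marked_eq_none h1.le).symm
  · rfl

theorem place_lt {q : HashQuery T} {l : List (HashQuery T × ZMod 𝒢.p)} {z : ZMod 𝒢.p}
    (h : assoc q l = some z) : place q l < l.length := by
  induction l with
  | nil => simp [assoc] at h
  | cons e l ih =>
    rw [assoc] at h
    rw [place, List.length_cons]
    split_ifs at h ⊢ with he
    · omega
    · have := ih h; omega

theorem marked_place {ts : Period T} {js : ℕ} {q : HashQuery T}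
    {l : List (HashQuery T × ZMod 𝒢.p)} {z : ZMod 𝒢.p} (hk : q.kind = 3) (hp : q.period = ts)
    (h : assoc q l = some z) (hj : place q l = js) : marked ts js l = some z := by
  induction l with
  | nil => simp [assoc] at h
  | cons e l ih =>
    rw [assoc] at h
    rw [place] at hj
    rw [marked]
    split_ifs at h hj with he
    · rw [if_pos hj, if_pos ⟨he ▸ hk, he ▸ hp⟩]
      exact h
    · have := place_lt h
      rw [if_neg (by omega), ih h hj]

/-- The expected value of `f` at the guesses `mh` and `sh` that fit to the table. -/
noncomputable def evGuess (η : ZMod 𝒢.p) (ts : Period T) (js : ℕ)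
    (l : List (HashQuery T × ZMod 𝒢.p)) (f : ZMod 𝒢.p → ZMod 𝒢.p → ℝ≥0∞) : ℝ≥0∞ :=
  ev ((marked ts js l).elim (PMF.uniformOfFintype (ZMod 𝒢.p)) PMF.pure) fun mh =>
    ev ((assoc (.h2 ts) l).elim ((PMF.uniformOfFintype (ZMod 𝒢.p)ˣ).map Units.val)
      fun s => PMF.pure (s * η⁻¹)) fun sh => f mh sh

open Classical in
/-- The entry of the simulator for an exponent `v`. -/
noncomputable def conceal (η : ZMod 𝒢.p) (ts : Period T) (mh sh : ZMod 𝒢.p) (q : HashQuery T)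
    (v : ZMod 𝒢.p) : ZMod 𝒢.p :=
  if q.period = ts then (if q.kind = 1 then v + η * (sh * mh) else if q.kind = 2 then v * η⁻¹ else v)
  else v

/-- The table of the simulator. -/
noncomputable def concealTable (η : ZMod 𝒢.p) (ts : Period T) (mh sh : ZMod 𝒢.p)
    (l : List (HashQuery T × ZMod 𝒢.p)) : List (HashQuery T × ZMod 𝒢.p) :=
  l.map fun e => (e.1, conceal η ts mh sh e.1 e.2)

variable {γ vk h : 𝒢.G} {η sk : ZMod 𝒢.p} {ts : Period T} {js : ℕ}

theorem evGuess_mono {l : List (HashQuery T × ZMod 𝒢.p)} {f g : ZMod 𝒢.p → ZMod 𝒢.p → ℝ≥0∞}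
    (hfg : ∀ mh sh, (∀ z, marked ts js l = some z → mh = z) →
      (∀ s, assoc (.h2 ts) l = some s → sh = s * η⁻¹) → f mh sh ≤ g mh sh) :
    evGuess η ts js l f ≤ evGuess η ts js l g := by
  refine ev_mono_of_support fun mh hmh => ev_mono_of_support fun sh hsh => hfg mh sh ?_ ?_
  · intro z hz
    rw [hz] at hmh
    simpa using hmh
  · intro s hs
    rw [hs] at hsh
    simpa using hsh

theorem evAns_evGuess (q : HashQuery T) (l : List (HashQuery T × ZMod 𝒢.p))
    (F : ZMod 𝒢.p → ZMod 𝒢.p → ZMod 𝒢.p → ℝ≥0∞) :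
    evAns 𝒢 q (fun v => evGuess η ts js l fun mh sh => F mh sh v) =
      evGuess η ts js l fun mh sh => evAns 𝒢 q (F mh sh) := by
  unfold evGuess
  rw [evAns_comm]
  simp only [evAns_comm]

theorem ev_evGuess {α : Type*} (μ : PMF α) (l : List (HashQuery T × ZMod 𝒢.p))
    (F : ZMod 𝒢.p → ZMod 𝒢.p → α → ℝ≥0∞) :
    ev μ (fun a => evGuess η ts js l fun mh sh => F mh sh a) =
      evGuess η ts js l fun mh sh => ev μ (F mh sh) := by
  unfold evGuess
  rw [ev_comm]
  simp only [ev_comm μ]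

/-- The hash queries of the simulator are answered as in the game. -/
theorem ask_evGuess (hη : η ≠ 0) (q : HashQuery T) (l : List (HashQuery T × ZMod 𝒢.p))
    (G : ZMod 𝒢.p → ZMod 𝒢.p → ZMod 𝒢.p → List (HashQuery T × ZMod 𝒢.p) → ℝ≥0∞) :
    ask q l (fun v l' => evGuess η ts js l' fun mh sh =>
      G mh sh (conceal η ts mh sh q v) (concealTable η ts mh sh l')) =
    evGuess η ts js l fun mh sh => evAns 𝒢 q fun w =>
      G mh sh (simValue ⟨γ, vk, h, ts, js, mh, sh⟩ q w w (concealTable η ts mh sh l))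
        (simTable ⟨γ, vk, h, ts, js, mh, sh⟩ q w w (concealTable η ts mh sh l)) := by
  have hassoc : ∀ mh sh, assoc q (concealTable η ts mh sh l) =
    (assoc q l).map (conceal η ts mh sh q) := fun mh sh => assoc_map _ q l
  have hlen : ∀ mh sh, (concealTable η ts mh sh l).length = l.length := fun mh sh =>
    List.length_map _
  unfold ask
  cases hq : assoc q l with
  | some v =>
    simp only [simValue, simTable, hassoc, hq, Option.map_some, Option.getD_some, Option.isSome_some,
      if_true, evAns_const]
  | none =>
    simp only [simValue, simTable, hassoc, hq, Option.map_none, Option.getD_none,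
      Option.isSome_none, Bool.false_eq_true, if_false, hlen]
    set H : ZMod 𝒢.p → ZMod 𝒢.p → ZMod 𝒢.p → ℝ≥0∞ := fun mh sh v =>
      G mh sh v ((q, v) :: concealTable η ts mh sh l) with hH
    change evAns 𝒢 q (fun v => evGuess η ts js ((q, v) :: l) fun mh sh =>
      H mh sh (conceal η ts mh sh q v)) = evGuess η ts js l fun mh sh => evAns 𝒢 q fun w =>
        H mh sh (simFresh ⟨γ, vk, h, ts, js, mh, sh⟩ q l.length w w)
    -- First case, the query that fixes `sh`: the exponent `v` of the game is uniform and nonzero,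
    -- hence so is `sh = v * η⁻¹`, which the simulator has drawn before.
    by_cases h2 : q = .h2 ts
    · subst h2
      have h1 : ∀ v, evGuess η ts js ((HashQuery.h2 ts, v) :: l) (fun mh sh =>
          H mh sh (conceal η ts mh sh (.h2 ts) v)) =
          ev ((marked ts js l).elim (PMF.uniformOfFintype (ZMod 𝒢.p)) PMF.pure) fun mh =>
            H mh (v * η⁻¹) (v * η⁻¹) := fun v => by
        unfold evGuess
        rw [marked_cons_of_not (by simp [HashQuery.kind])]
        simp [assoc_cons_self, conceal, HashQuery.kind, HashQuery.period]
      simp only [h1]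
      rw [evAns_comm]
      unfold evGuess
      congr 1
      funext mh
      rw [hq]
      simp only [Option.elim]
      rw [ev_map]
      simp only [evAns, HashQuery.kind, if_true, simFresh, HashQuery.period, evU_const]
      exact evU_mul_right (inv_ne_zero hη) fun s => H mh s s
    -- Second case, the query that fixes `mh`: the fresh value of the game becomes the planted
    -- value, and both are uniform.
    by_cases h3 : q.kind = 3 ∧ q.period = ts ∧ l.length = js
    · obtain ⟨hk, hp, hl⟩ := h3
      have h1 : ∀ v, evGuess η ts js ((q, v) :: l) (fun mh sh =>
          H mh sh (conceal η ts mh sh q v)) =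
          ev ((assoc (.h2 ts) l).elim ((PMF.uniformOfFintype (ZMod 𝒢.p)ˣ).map Units.val)
            fun s => PMF.pure (s * η⁻¹)) fun sh => H v sh v := fun v => by
        unfold evGuess
        rw [marked, if_pos hl, if_pos ⟨hk, hp⟩, assoc_cons_of_ne h2]
        simp [conceal, hk]
      simp only [h1]
      unfold evGuess
      rw [marked_eq_none hl.le]
      simp only [evAns, hk, simFresh, hp, hl, Option.elim]
      simp [evZ]
    -- Otherwise the guesses are unaffected by the answer, and the simulator answers with fresh
    -- randomness. Its entry is the exponent of the game itself or, for `H₁(ts)`, a translate of it,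
    -- and translation preserves the uniform distribution.
    · have h1 : ∀ v, evGuess η ts js ((q, v) :: l) (fun mh sh => H mh sh (conceal η ts mh sh q v)) =
          evGuess η ts js l fun mh sh => H mh sh (conceal η ts mh sh q v) := fun v => by
        unfold evGuess
        rw [marked_cons_of_not h3, assoc_cons_of_ne h2]
      simp only [h1]
      rw [evAns_evGuess]
      congr 1
      funext mh sh
      have h4 : ¬ (q.kind = 2 ∧ q.period = ts) := by
        rintro ⟨hk, hp⟩
        cases q with
        | h2 t => exact h2 (by rw [← hp]; rfl)
        | _ => simp [HashQuery.kind] at hk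
      have h5 : ∀ w, simFresh (⟨γ, vk, h, ts, js, mh, sh⟩ : SimParams 𝒢 T) q l.length w w = w := by
        intro w
        unfold simFresh
        split_ifs with a b
        · exact absurd ⟨a, b⟩ h4
        · rfl
        · rfl
      simp only [h5]
      by_cases h6 : q.period = ts ∧ q.kind = 1
      · simp only [conceal, h6.1, h6.2, if_true, evAns]
        exact evZ_add_right _ (H mh sh)
      · have h7 : ∀ v, conceal η ts mh sh q v = v := fun v => by
          unfold conceal
          split_ifs with a b c
          · exact absurd ⟨a, b⟩ h6
          · exact absurd ⟨c, a⟩ h4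
          · rfl
          · rfl
        simp only [h7]

theorem conceal_h3 (t : Period T) (m : Msg) (mh sh v : ZMod 𝒢.p) :
    conceal η ts mh sh (.h3 t m) v = v := by
  simp [conceal, HashQuery.kind]

/-- With `h = γ ^ η` the factor `h ^ (-sh * mh)` cancels the shift `η * sh * mh` of the entry for
`H₁(ts)`, and `h` to the power `v / η` is `γ ^ v` for `H₂(ts)`. So the adversary sees the same group
elements in both worlds. -/
theorem simAnswer_conceal (hh : h = 𝒢.exp γ η) (hη : η ≠ 0) (mh sh : ZMod 𝒢.p) (q : HashQuery T)
    (v : ZMod 𝒢.p) : simAnswer ⟨γ, vk, h, ts, js, mh, sh⟩ q (conceal η ts mh sh q v) =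
      answer γ q v := by
  unfold simAnswer answer conceal
  subst hh
  by_cases h3 : q.kind = 3
  · simp [h3]
  · rw [if_neg h3, if_neg h3]
    by_cases hp : q.period = ts
    · rw [if_pos hp, if_pos hp]
      by_cases h1 : q.kind = 1
      · rw [if_pos h1, if_pos h1, 𝒢.exp_exp, ← 𝒢.exp_add]
        congr 2
        ring
      · have h2 : q.kind = 2 := by cases q <;> simp_all [HashQuery.kind]
        rw [if_neg h1, if_neg h1, if_pos h2, 𝒢.exp_exp]
        congr 2
        field_simp
    · rw [if_neg hp, if_neg hp]

theorem simValue_of_kind_ne {P : SimParams 𝒢 T} {q : HashQuery T} (hq : q.kind ≠ 2)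
    (l : List (HashQuery T × ZMod 𝒢.p)) (z u : ZMod 𝒢.p) :
    simValue P q z u l = simValue P q z z l := by
  simp [simValue, simFresh, hq]

theorem simValue_of_kind_eq {P : SimParams 𝒢 T} {q : HashQuery T} (hq : q.kind = 2)
    (l : List (HashQuery T × ZMod 𝒢.p)) (z u : ZMod 𝒢.p) :
    simValue P q z u l = simValue P q u u l := by
  simp [simValue, simFresh, hq]

theorem simTable_of_kind_ne {P : SimParams 𝒢 T} {q : HashQuery T} (hq : q.kind ≠ 2)
    (l : List (HashQuery T × ZMod 𝒢.p)) (z u : ZMod 𝒢.p) :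
    simTable P q z u l = simTable P q z z l := by
  simp [simTable, simFresh, hq]

theorem simTable_of_kind_eq {P : SimParams 𝒢 T} {q : HashQuery T} (hq : q.kind = 2)
    (l : List (HashQuery T × ZMod 𝒢.p)) (z u : ZMod 𝒢.p) :
    simTable P q z u l = simTable P q u u l := by
  simp [simTable, simFresh, hq]

/-- A query uses `z` or `u` according to its kind, never both, and the unused one is averaged out.
This turns the random numbers of a simulator step into a single fresh answer. -/
theorem evZ_simValue (P : SimParams 𝒢 T) (q : HashQuery T) (l : List (HashQuery T × ZMod 𝒢.p))
    (F : ZMod 𝒢.p → List (HashQuery T × ZMod 𝒢.p) → ℝ≥0∞) :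
    (evZ 𝒢 fun z => evU 𝒢 fun u => F (simValue P q z u l) (simTable P q z u l)) =
      evAns 𝒢 q fun w => F (simValue P q w w l) (simTable P q w w l) := by
  unfold evAns
  split_ifs with hq
  · refine Eq.trans ?_ (evZ_const (𝒢 := 𝒢) _)
    exact congrArg (evZ 𝒢) (funext fun z => congrArg (evU 𝒢) (funext fun u => by
      rw [simValue_of_kind_eq hq, simTable_of_kind_eq hq]))
  · refine congrArg (evZ 𝒢) (funext fun z => Eq.trans ?_ (evU_const (𝒢 := 𝒢) _))
    exact congrArg (evU 𝒢) (funext fun u => by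
      rw [simValue_of_kind_ne hq, simTable_of_kind_ne hq])

/-! ### The end of the game -/

open Classical in
/-- The sums of the other signing keys and of their products with the hash values of the messages,
and the hash value of the message for the challenge key. -/
noncomputable def claims (vk : 𝒢.G) (certs : List (𝒢.G × ZMod 𝒢.p)) : List (𝒢.G × Msg) →
    List (ZMod 𝒢.p) → ZMod 𝒢.p → ZMod 𝒢.p → ZMod 𝒢.p → ZMod 𝒢.p × ZMod 𝒢.p × ZMod 𝒢.p
  | e :: l, z :: zs, X, Y, z0 => if e.1 = vk then claims vk certs l zs X Y z else
      claims vk certs l zs (X + (assoc e.1 certs).getD 0) (Y + (assoc e.1 certs).getD 0 * z) z0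
  | _, _, X, Y, z0 => (X, Y, z0)

/-- The forgery is as it has to be, and `zs` is not the hash value that is guessed. -/
def Extractable (γ : 𝒢.G) (sk : ZMod 𝒢.p) (ts : Period T) (js : ℕ) (E : 𝒢.G)
    (c : ZMod 𝒢.p × ZMod 𝒢.p × ZMod 𝒢.p) (r s : ZMod 𝒢.p)
    (l : List (HashQuery T × ZMod 𝒢.p)) : Prop :=
  E = 𝒢.exp γ (r * (sk + c.1) + s * (sk * c.2.2 + c.2.1)) ∧ marked ts js l ≠ some c.2.2

/-- In powers of `γ`, the entry for `H₁(ts)` is `r + η * sh * mh` and `s = sh * η`. The three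
correction factors remove `r * (sk + X)`, the part of the other signers in `H₂` and the shift of
`r`; what remains is `η * sk * sh * (z - mh)`. The last two factors are invertible, which is where
`s ≠ 0` and `mh ≠ z` are used. -/
theorem extract_eq (hh : h = 𝒢.exp γ η) (hvk : vk = 𝒢.exp γ sk) {mh sh : ZMod 𝒢.p} (hη : η ≠ 0)
    {E : 𝒢.G} {X Y z r s : ZMod 𝒢.p}
    (hE : E = 𝒢.exp γ (r * (sk + X) + s * (sk * z + Y))) (hsh : sh = s * η⁻¹) (hs : s ≠ 0)
    (hz : mh ≠ z) : extract ⟨γ, vk, h, ts, js, mh, sh⟩ E X Y z (conceal η ts mh sh (.h1 ts) r) =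
      𝒢.exp h sk := by
  have hs' : s = sh * η := by rw [hsh]; field_simp
  have hsh0 : sh ≠ 0 := by rw [hsh]; exact mul_ne_zero hs (inv_ne_zero hη)
  have hz' : z - mh ≠ 0 := sub_ne_zero.2 hz.symm
  unfold extract
  simp only [conceal, HashQuery.period, HashQuery.kind, if_true]
  subst hE hh hvk
  simp only [𝒢.exp_exp, ← 𝒢.exp_add]
  congr 1
  rw [hs']
  field_simp
  ring

/-- The tables in which the value of `H₂(ts)` is not trivial. -/
def Nontriv (ts : Period T) (l : List (HashQuery T × ZMod 𝒢.p)) : Prop :=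
  ∀ s, assoc (.h2 ts) l = some s → s ≠ 0

theorem Nontriv.of_asked {q : HashQuery T} {l l' : List (HashQuery T × ZMod 𝒢.p)} {v : ZMod 𝒢.p}
    (hl : Nontriv ts l) (h : Asked q l v l') : Nontriv ts l' := by
  rcases h.eq_or with rfl | ⟨-, rfl, hv⟩
  · exact hl
  · intro s hs
    by_cases hq : q = .h2 ts
    · subst hq
      rw [assoc_cons_self] at hs
      rw [← Option.some.inj hs]
      exact hv rfl
    · rw [assoc_cons_of_ne hq] at hs
      exact hl s hs

/-- If the place `js` is marked, then `mh` is the marked value, which differs from `z` by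
hypothesis, and the extraction succeeds. If it is not marked, `mh` is still uniform given everything
else and misses `z` with probability at least `1 / 2`; this is the factor `2`. -/
theorem ind_extractable_le (hh : h = 𝒢.exp γ η) (hvk : vk = 𝒢.exp γ sk) (hη : η ≠ 0)
    {pay : 𝒢.G → ℝ≥0∞} (hpay : 1 ≤ pay (𝒢.exp h sk)) {E : 𝒢.G} {X Y z r s : ZMod 𝒢.p}
    {l : List (HashQuery T × ZMod 𝒢.p)} (hs : assoc (.h2 ts) l = some s) (hs0 : s ≠ 0) :
    ind (Extractable γ sk ts js E (X, Y, z) r s l) ≤ 2 * evGuess η ts js l fun mh sh =>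
      pay (extract ⟨γ, vk, h, ts, js, mh, sh⟩ E X Y z (conceal η ts mh sh (.h1 ts) r)) := by
  refine ind_le_iff.2 fun hE => ?_
  unfold evGuess
  rw [hs]
  simp only [Option.elim, ev_pure]
  have hone : ∀ mh, mh ≠ z → 1 ≤ pay (extract ⟨γ, vk, h, ts, js, mh, s * η⁻¹⟩ E X Y z
      (conceal η ts mh (s * η⁻¹) (.h1 ts) r)) := fun mh hmh => by
    rw [extract_eq hh hvk hη hE.1 rfl hs0 hmh]
    exact hpay
  cases hm : marked ts js l with
  | some z' =>
    simp only [ev_pure]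
    refine (hone z' fun h0 => hE.2 ?_).trans ?_
    · rw [hm, h0]
    · exact le_mul_of_one_le_left zero_le one_le_two
  | none =>
    refine (one_le_two_mul_evZ z).trans ?_
    gcongr
    exact ev_mono fun mh => ind_le_iff.2 (hone mh)

end faithful

/-! ### The value of the simulation compared with the value of the game -/

section main

variable {𝒢 : PairingGroup} {T : ℕ} {A : Prog} {b : ℕ} {γ vk h : 𝒢.G} {η sk : ZMod 𝒢.p}
  {ts : Period T} {js : ℕ} {pay : Data → ℝ≥0∞}

open Classical in
theorem evStep_fin_cons (P : SimParams 𝒢 T) (E : 𝒢.G) (e : 𝒢.G × Msg) (l : List (𝒢.G × Msg))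
    (X Y z : ZMod 𝒢.p) (s : SimState 𝒢 T) (f : SimConf 𝒢 T → ℝ≥0∞) :
    evStep P (.fin E (e :: l) X Y z s) f none = evAns 𝒢 (.h3 P.ts e.2) fun w =>
      if e.1 = P.vk then
        f (.fin E l X Y (simValue P (.h3 P.ts e.2) w w s.tbl)
          { s with tbl := simTable P (.h3 P.ts e.2) w w s.tbl })
      else f (.fin E l (X + (assoc e.1 s.certs).getD 0)
        (Y + (assoc e.1 s.certs).getD 0 * simValue P (.h3 P.ts e.2) w w s.tbl) z
        { s with tbl := simTable P (.h3 P.ts e.2) w w s.tbl }) := by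
  rw [← evZ_simValue P (.h3 P.ts e.2) s.tbl fun v tbl => if e.1 = P.vk then
    f (.fin E l X Y v { s with tbl := tbl })
    else f (.fin E l (X + (assoc e.1 s.certs).getD 0) (Y + (assoc e.1 s.certs).getD 0 * v) z
        { s with tbl := tbl })]
  unfold evStep
  refine congrArg (evZ 𝒢) (funext fun z1 => Eq.trans ?_ (evZ_const (𝒢 := 𝒢) _))
  refine congrArg (evZ 𝒢) (funext fun z2 => congrArg (evU 𝒢) (funext fun z3 => ?_))
  simp only [simStep]
  split_ifs <;> rfl

theorem evStep_fin_nil (P : SimParams 𝒢 T) (E : 𝒢.G) (X Y z : ZMod 𝒢.p) (s : SimState 𝒢 T)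
    (f : SimConf 𝒢 T → ℝ≥0∞) :
    evStep P (.fin E [] X Y z s) f none = evAns 𝒢 (.h1 P.ts) fun w =>
      f (.done (solution P (extract P E X Y z (simValue P (.h1 P.ts) w w s.tbl)))) := by
  rw [← evZ_simValue P (.h1 P.ts) s.tbl fun v _ => f (.done (solution P (extract P E X Y z v)))]
  exact evZ_const (𝒢 := 𝒢) (evZ 𝒢 fun z2 => evU 𝒢 fun z3 =>
    f (.done (solution P (extract P E X Y z (simValue P (.h1 P.ts) z2 z3 s.tbl)))))

/-- The simulator processes the claims one by one, asking `H₃` in the same order as the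
verification, so the coupling `ask_evGuess` applies to each query. Apart from one step per claim it
needs one step for the extraction and one for the output, whence `l.length + 2`. -/
theorem finish_le (hh : h = 𝒢.exp γ η) (hvk : vk = 𝒢.exp γ sk) (hη : η ≠ 0)
    (hpay : ∀ mh sh, 1 ≤ pay (solution ⟨γ, vk, h, ts, js, mh, sh⟩ (𝒢.exp h sk)))
    (certs : List (𝒢.G × ZMod 𝒢.p)) (tctr : ℕ) (E : 𝒢.G) (l : List (𝒢.G × Msg)) (X Y z : ZMod 𝒢.p)
    (tbl : List (HashQuery T × ZMod 𝒢.p)) (htbl : Nontriv ts tbl) (j : ℕ) (hj : l.length + 2 ≤ j) :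
    (askMany (l.map fun e => .h3 ts e.2) tbl fun zs l1 => ask (.h1 ts) l1 fun r l2 =>
      ask (.h2 ts) l2 fun s l3 => ind (Extractable γ sk ts js E (claims vk certs l zs X Y z) r s l3)) ≤
    2 * evGuess η ts js tbl fun mh sh => simVal A b ⟨γ, vk, h, ts, js, mh, sh⟩ pay j
      (.fin E l X Y z ⟨concealTable η ts mh sh tbl, certs, tctr⟩) := by
  obtain ⟨j, rfl⟩ : ∃ i, j = i + 1 := ⟨j - 1, by omega⟩
  induction l generalizing X Y z tbl j with
  | nil =>
    obtain ⟨j, rfl⟩ : ∃ i, j = i + 1 := ⟨j - 1, by simp only [List.length_nil] at hj; omega⟩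
    simp only [List.map_nil, askMany, claims, simVal, evStep_fin_nil]
    have hp : ∀ (mh sh : ZMod 𝒢.p) (R : 𝒢.G),
      solution (⟨γ, vk, h, ts, js, mh, sh⟩ : SimParams 𝒢 T) R =
        solution ⟨γ, vk, h, ts, js, 0, 0⟩ R := fun _ _ _ => rfl
    refine (ask_mono fun r l2 h2 => ask_mono fun s l3 h3 =>
      ind_extractable_le hh hvk hη (pay := fun R => pay (solution ⟨γ, vk, h, ts, js, 0, 0⟩ R))
        (hpay 0 0) h3.assoc_eq (((htbl.of_asked h2).of_asked h3) _ h3.assoc_eq)).trans ?_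
    simp only [ask_mul_left]
    gcongr
    refine le_of_eq ?_
    -- The verification asks `H₂(ts)`, the simulator does not, since it knows this value as `h ^ sh`
    -- in advance. As the payoff ignores the answer and the new table of the simulator, this query
    -- is averaged out on its side.
    have e2 := fun (r : ZMod 𝒢.p) (l2 : List (HashQuery T × ZMod 𝒢.p)) =>
      ask_evGuess (γ := γ) (vk := vk) (h := h) (js := js) (ts := ts) hη (.h2 ts) l2 fun mh sh _ _ =>
        pay (solution ⟨γ, vk, h, ts, js, 0, 0⟩ (extract ⟨γ, vk, h, ts, js, mh, sh⟩ E X Y z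
          (conceal η ts mh sh (.h1 ts) r)))
    simp only [e2, evAns_const]
    exact ask_evGuess (γ := γ) (vk := vk) (h := h) (js := js) (ts := ts) hη (.h1 ts) tbl
      fun mh sh r _ => pay (solution ⟨γ, vk, h, ts, js, 0, 0⟩
        (extract ⟨γ, vk, h, ts, js, mh, sh⟩ E X Y z r))
  | cons e l ih =>
    obtain ⟨j, rfl⟩ : ∃ i, j = i + 1 := ⟨j - 1, by simp only [List.length_cons] at hj; omega⟩
    simp only [List.length_cons] at hj
    simp only [List.map_cons, askMany, claims, simVal, evStep_fin_cons]
    by_cases he : e.1 = vk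
    · simp only [he, if_true]
      refine (ask_mono fun v l' h' => ih X Y v l' (htbl.of_asked h') j (by omega)).trans ?_
      rw [ask_mul_left]
      gcongr
      have := ask_evGuess (γ := γ) (vk := vk) (h := h) (js := js) (ts := ts) hη (.h3 ts e.2) tbl
        fun mh sh v l' => simVal A b ⟨γ, vk, h, ts, js, mh, sh⟩ pay (j + 1)
          (.fin E l X Y v ⟨l', certs, tctr⟩)
      simp only [conceal_h3] at this
      exact this.le
    · simp only [he, if_false]
      refine (ask_mono fun v l' h' => ih (X + (assoc e.1 certs).getD 0)
        (Y + (assoc e.1 certs).getD 0 * v) z l' (htbl.of_asked h') j (by omega)).trans ?_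
      rw [ask_mul_left]
      gcongr
      have := ask_evGuess (γ := γ) (vk := vk) (h := h) (js := js) (ts := ts) hη (.h3 ts e.2) tbl
        fun mh sh v l' => simVal A b ⟨γ, vk, h, ts, js, mh, sh⟩ pay (j + 1)
          (.fin E l (X + (assoc e.1 certs).getD 0) (Y + (assoc e.1 certs).getD 0 * v) z
            ⟨l', certs, tctr⟩)
      simp only [conceal_h3] at this
      exact this.le

/-- The signature in the period `ts` is on the message at the place `js`. -/
def Alive (ts : Period T) (js : ℕ) (S : Ghost 𝒢 T) : Prop := ∀ e ∈ S.slog, e.1 = ts → e.2.2 = js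

open Classical in
/-- The payoff for a forgery when the guesses are `ts` and `js`. -/
noncomputable def guessPay (γ vk : 𝒢.G) (sk : ZMod 𝒢.p) (ts : Period T) (js : ℕ) : Payoff 𝒢 T :=
  fun f zs r s S => if f.2.2 = ts then
    ind (Alive ts js S) * ind (Extractable γ sk ts js f.2.1 (claims vk S.certs f.1 zs 0 0 0) r s S.tbl)
    else 0

/-- The expected value of `f` after the reaction of the simulator to an action of the adversary. -/
noncomputable def simReact (P : SimParams 𝒢 T) (s : SimState 𝒢 T) (st : Data)
    (f : SimConf 𝒢 T → ℝ≥0∞) (o : Option (Act T)) : ℝ≥0∞ :=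
  evZ 𝒢 fun z1 => evZ 𝒢 fun z2 => evU 𝒢 fun z3 => (simAct P s st z1 z2 z3 o).elim 0 f

theorem simReact_const {P : SimParams 𝒢 T} {s : SimState 𝒢 T} {st : Data} {o : Option (Act T)}
    {c : SimConf 𝒢 T} (hc : ∀ z1 z2 z3, simAct P s st z1 z2 z3 o = some c)
    (f : SimConf 𝒢 T → ℝ≥0∞) : simReact P s st f o = f c := by
  simp only [simReact, hc, Option.elim, evZ_const, evU_const]

theorem simReact_hash (P : SimParams 𝒢 T) (s : SimState 𝒢 T) (st : Data)
    (f : SimConf 𝒢 T → ℝ≥0∞) (q : HashQuery T) :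
    simReact P s st f (some (.hash q)) = evAns 𝒢 q fun w =>
      f (.run st (simAnswer P q (simValue P q w w s.tbl)) { s with tbl := simTable P q w w s.tbl }) := by
  rw [← evZ_simValue P q s.tbl fun v tbl => f (.run st (simAnswer P q v) { s with tbl := tbl })]
  exact congrArg (evZ 𝒢) (funext fun z1 => evZ_const (𝒢 := 𝒢) (evU 𝒢 fun z3 =>
    f (.run st (simAnswer P q (simValue P q z1 z3 s.tbl))
      { s with tbl := simTable P q z1 z3 s.tbl })))

theorem evAns_h1 (t : Period T) (f : ZMod 𝒢.p → ℝ≥0∞) : evAns 𝒢 (.h1 t) f = evZ 𝒢 f := rfl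

theorem evAns_h2 (t : Period T) (f : ZMod 𝒢.p → ℝ≥0∞) : evAns 𝒢 (.h2 t) f = evU 𝒢 f := rfl

theorem evAns_h3 (t : Period T) (m : Msg) (f : ZMod 𝒢.p → ℝ≥0∞) :
    evAns 𝒢 (.h3 t m) f = evZ 𝒢 f := rfl

open Classical in
theorem simReact_sign (P : SimParams 𝒢 T) (s : SimState 𝒢 T) (st : Data)
    (f : SimConf 𝒢 T → ℝ≥0∞) (m : Msg) (ht : 1 ≤ s.tctr ∧ s.tctr ≤ T) :
    simReact P s st f (some (.sign m)) =
      evAns 𝒢 (.h3 ⟨s.tctr, ht⟩ m) fun w1 => evAns 𝒢 (.h1 ⟨s.tctr, ht⟩) fun w2 =>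
        evAns 𝒢 (.h2 ⟨s.tctr, ht⟩) fun w3 =>
        let l1 := simTable P (.h3 ⟨s.tctr, ht⟩ m) w1 w1 s.tbl
        let l2 := simTable P (.h1 ⟨s.tctr, ht⟩) w2 w2 l1
        f (.run st (.pair (𝒢.enc (𝒢.exp P.vk
            (if (⟨s.tctr, ht⟩ : Period T) = P.ts then simValue P (.h1 ⟨s.tctr, ht⟩) w2 w2 l1 else
              simValue P (.h1 ⟨s.tctr, ht⟩) w2 w2 l1 + simValue P (.h2 ⟨s.tctr, ht⟩) w3 w3 l2 *
                simValue P (.h3 ⟨s.tctr, ht⟩ m) w1 w1 s.tbl))) (Data.num s.tctr))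
          { s with tbl := simTable P (.h2 ⟨s.tctr, ht⟩) w3 w3 l2, tctr := s.tctr + 1 }) := by
  simp only [evAns_h1, evAns_h2, evAns_h3]
  refine congrArg (evZ 𝒢) (funext fun z1 => congrArg (evZ 𝒢) (funext fun z2 =>
    congrArg (evU 𝒢) (funext fun z3 => ?_)))
  have k1 : (HashQuery.h1 (⟨s.tctr, ht⟩ : Period T)).kind ≠ 2 := by simp [HashQuery.kind]
  have k3 : (HashQuery.h3 (⟨s.tctr, ht⟩ : Period T) m).kind ≠ 2 := by simp [HashQuery.kind]
  have k2 : (HashQuery.h2 (⟨s.tctr, ht⟩ : Period T)).kind = 2 := rfl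
  simp only [simAct, dif_pos ht, Option.elim, simSign, signTable]
  rw [simTable_of_kind_ne k3 _ z1 z3, simTable_of_kind_ne k1 _ z2 z3, simTable_of_kind_eq k2 _ z1 z3,
    simValue_of_kind_ne k3 _ z1 z3, simValue_of_kind_ne k1 _ z2 z3, simValue_of_kind_eq k2 _ z1 z3]

/-- Induction over the activations: each query is moved across the draw of the guesses by
`ask_evGuess`, and each answer agrees by `simAnswer_conceal`. The simulator gives a wrong signature
only if the message signed in period `ts` is not at the place `js`; such a run is no longer `Alive`
and pays nothing. The number of steps allows for `k` activations, at most `b` claims of a forgery,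
and two final steps. -/
theorem gameVal_guessPay_le (hh : h = 𝒢.exp γ η) (hvk : vk = 𝒢.exp γ sk) (hη : η ≠ 0)
    (hpay : ∀ mh sh, 1 ≤ pay (solution ⟨γ, vk, h, ts, js, mh, sh⟩ (𝒢.exp h sk)))
    (k : ℕ) (st ans : Data) (S : Ghost 𝒢 T) (hS : Nontriv ts S.tbl)
    (j : ℕ) (hj : k + b + 2 ≤ j) :
    gameVal A b γ vk (guessPay γ vk sk ts js) k st ans S ≤ ind (Alive ts js S) * 2 *
      evGuess η ts js S.tbl fun mh sh => simVal A b ⟨γ, vk, h, ts, js, mh, sh⟩ pay j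
        (.run st ans ⟨concealTable η ts mh sh S.tbl, S.certs, S.tctr⟩) := by
  induction k generalizing st ans S j with
  | zero => exact zero_le
  | succ k ih =>
    obtain ⟨j, rfl⟩ : ∃ i, j = i + 1 := ⟨j - 1, by omega⟩
    have hj' : k + b + 2 ≤ j := by omega
    set c := ind (Alive ts js S) * 2 with hc
    simp only [gameVal, simVal]
    rw [← ev_evGuess, ← ev_mul_left]
    refine ev_mono_of_support fun out hout => ?_
    rcases out with _ | (_ | ⟨st', act⟩)
    · exact zero_le
    · exact zero_le
    have hsz := size_le_of_mem_support_output hout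
    simp only [Data.size] at hsz
    show react γ vk _ _ S st' (Data.decode encAct act) ≤ c * evGuess η ts js S.tbl fun mh sh =>
      simReact ⟨γ, vk, h, ts, js, mh, sh⟩ ⟨concealTable η ts mh sh S.tbl, S.certs, S.tctr⟩ st'
        (simVal A b ⟨γ, vk, h, ts, js, mh, sh⟩ pay j) (Data.decode encAct act)
    have hconst : ∀ (o : Option (Act T)) (st ans : Data) (S' : Ghost 𝒢 T), S'.tbl = S.tbl →
        S'.slog = S.slog → (∀ mh sh z1 z2 z3,
          simAct ⟨γ, vk, h, ts, js, mh, sh⟩ ⟨concealTable η ts mh sh S.tbl, S.certs, S.tctr⟩ st'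
            z1 z2 z3 o = some (.run st ans ⟨concealTable η ts mh sh S'.tbl, S'.certs, S'.tctr⟩)) →
        gameVal A b γ vk (guessPay γ vk sk ts js) k st ans S' ≤
          c * evGuess η ts js S.tbl fun mh sh =>
          simReact ⟨γ, vk, h, ts, js, mh, sh⟩ ⟨concealTable η ts mh sh S.tbl, S.certs, S.tctr⟩ st'
            (simVal A b ⟨γ, vk, h, ts, js, mh, sh⟩ pay j) o := by
      intro o st ans S' h1 h2 h3
      have h4 := fun mh sh => simReact_const (h3 mh sh) (simVal A b ⟨γ, vk, h, ts, js, mh, sh⟩ pay j)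
      simp only [h4]
      have h5 := ih st ans S' (by rwa [h1]) j hj'
      unfold Alive at h5
      rw [h2] at h5
      rw [← h1]
      exact h5
    cases ho : Data.decode (encAct (T := T)) act with
    | none => exact hconst _ _ _ S rfl rfl fun _ _ _ _ _ => rfl
    | some a =>
      rw [Data.decode_eq_some encAct_injective] at ho
      subst ho
      cases a with
      | hash q =>
        simp only [react, simReact_hash]
        refine (ask_mono fun v l' h' => ih st' (answer γ q v) { S with tbl := l' }
          (hS.of_asked h') j hj').trans ?_
        have key := ask_evGuess (γ := γ) (vk := vk) (h := h) (js := js) (ts := ts) hη q S.tbl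
          fun mh sh v l' => simVal A b ⟨γ, vk, h, ts, js, mh, sh⟩ pay j
            (.run st' (simAnswer ⟨γ, vk, h, ts, js, mh, sh⟩ q v) ⟨l', S.certs, S.tctr⟩)
        simp only [simAnswer_conceal hh hη] at key
        rw [← key, ← ask_mul_left]
        exact le_rfl
      | cert v w => exact hconst _ _ _ { S with certs := _ } rfl rfl fun _ _ _ _ _ => rfl
      | skip =>
        refine hconst _ _ _ _ ?_ ?_ fun _ _ _ _ _ => ?_
        · split_ifs <;> rfl
        · split_ifs <;> rfl
        · simp only [simAct]
          split_ifs <;> rfl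
      | sign m =>
        by_cases ht : 1 ≤ S.tctr ∧ S.tctr ≤ T
        swap
        · rw [react, dif_neg ht]
          exact hconst _ _ _ S rfl rfl fun _ _ _ _ _ => by rw [simAct, dif_neg ht]
        rw [react, dif_pos ht]
        set t : Period T := ⟨S.tctr, ht⟩ with htdef
        set F : ZMod 𝒢.p → ZMod 𝒢.p → ZMod 𝒢.p → ZMod 𝒢.p → ZMod 𝒢.p →
            List (HashQuery T × ZMod 𝒢.p) → ℝ≥0∞ := fun mh sh z r s l =>
          simVal A b ⟨γ, vk, h, ts, js, mh, sh⟩ pay j (.run st' (.pair (𝒢.enc (𝒢.exp vk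
            (open Classical in if t = ts then r else r + s * z))) (Data.num S.tctr))
            ⟨l, S.certs, S.tctr + 1⟩) with hF
        refine (ask_mono fun z l1 h1 => ask_mono fun r l2 h2 => ask_mono
          (K' := fun s l3 => c * evGuess η ts js l3 fun mh sh => F mh sh
            (conceal η ts mh sh (.h3 t m) z) (conceal η ts mh sh (.h1 t) r)
            (conceal η ts mh sh (.h2 t) s) (concealTable η ts mh sh l3)) fun s l3 h3 => ?_).trans ?_
        · set S' : Ghost 𝒢 T := { S with
            tbl := l3
            slog := (t, m, place (.h3 t m) l3) :: S.slog
            tctr := S.tctr + 1 } with hS'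
          refine (ih st' _ S' (((hS.of_asked h1).of_asked h2).of_asked h3) j hj').trans ?_
          -- If the new signature refutes the guess `js`, the remaining value of the game is `0`,
          -- and it does not matter that the simulated signature is wrong.
          by_cases hal : Alive ts js S'
          swap
          · simp only [ind_of_not hal, zero_mul, zero_le]
          have hal' : Alive ts js S := fun e he => hal e (List.mem_cons_of_mem _ he)
          rw [hc, ind_of hal, ind_of hal']
          gcongr
          refine evGuess_mono fun mh sh hmh hsh => le_of_eq ?_
          simp only [hF]
          congr 5
          -- In the guessed period the signed message is at the place `js`, so `mh = z`, and `sh = s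
          -- * η⁻¹`. Then the entry `r + η * sh * mh` of the simulator equals `r + s * z`, the
          -- exponent of the genuine signature.
          by_cases hts : t = ts
          · have hz := hmh z (marked_place (q := .h3 t m) rfl hts (h3.assoc_of_some (h2.assoc_of_some h1.assoc_eq))
              (hal _ List.mem_cons_self hts))
            have hs := hsh s (by rw [← hts]; exact h3.assoc_eq)
            rw [if_pos hts]
            simp only [conceal, HashQuery.kind, HashQuery.period, hts, if_true, hz, hs]
            field_simp
          · rw [if_neg hts]
            simp only [conceal, HashQuery.period, hts, if_false]
        · simp only [ask_mul_left]
          gcongr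
          have e3 := fun (z r : ZMod 𝒢.p) (l2 : List (HashQuery T × ZMod 𝒢.p)) =>
            ask_evGuess (γ := γ) (vk := vk) (h := h) (js := js) (ts := ts) hη (.h2 t) l2
              fun mh sh s l3 => F mh sh (conceal η ts mh sh (.h3 t m) z)
                (conceal η ts mh sh (.h1 t) r) s l3
          simp only [e3]
          have e2 := fun (z : ZMod 𝒢.p) (l1 : List (HashQuery T × ZMod 𝒢.p)) =>
            ask_evGuess (γ := γ) (vk := vk) (h := h) (js := js) (ts := ts) hη (.h1 t) l1
              fun mh sh r l2 => evAns 𝒢 (.h2 t) fun w => F mh sh (conceal η ts mh sh (.h3 t m) z) r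
                (simValue ⟨γ, vk, h, ts, js, mh, sh⟩ (.h2 t) w w l2)
                (simTable ⟨γ, vk, h, ts, js, mh, sh⟩ (.h2 t) w w l2)
          simp only [e2]
          have e1 := ask_evGuess (γ := γ) (vk := vk) (h := h) (js := js) (ts := ts) hη (.h3 t m) S.tbl
              fun mh sh z l1 => evAns 𝒢 (.h1 t) fun w2 => evAns 𝒢 (.h2 t) fun w => F mh sh z
                (simValue ⟨γ, vk, h, ts, js, mh, sh⟩ (.h1 t) w2 w2 l1)
                (simValue ⟨γ, vk, h, ts, js, mh, sh⟩ (.h2 t) w w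
                  (simTable ⟨γ, vk, h, ts, js, mh, sh⟩ (.h1 t) w2 w2 l1))
                (simTable ⟨γ, vk, h, ts, js, mh, sh⟩ (.h2 t) w w
                  (simTable ⟨γ, vk, h, ts, js, mh, sh⟩ (.h1 t) w2 w2 l1))
          refine e1.le.trans (le_of_eq ?_)
          congr 1
          funext mh sh
          exact (simReact_sign ⟨γ, vk, h, ts, js, mh, sh⟩
            ⟨concealTable η ts mh sh S.tbl, S.certs, S.tctr⟩ st' _ m ht).symm
      | output d =>
        simp only [react]
        split
        · exact zero_le
        · next f hf =>
          have hsim := fun mh sh => simReact_const (P := ⟨γ, vk, h, ts, js, mh, sh⟩)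
            (s := ⟨concealTable η ts mh sh S.tbl, S.certs, S.tctr⟩) (st := st')
            (o := some (.output d)) (c := .fin f.2.1 f.1 0 0 0
              ⟨concealTable η ts mh sh S.tbl, S.certs, S.tctr⟩)
            (fun _ _ _ => by simp only [simAct, hf])
            (simVal A b ⟨γ, vk, h, ts, js, mh, sh⟩ pay j)
          simp only [hsim]
          rw [Data.decode_eq_some encForgery_injective] at hf
          subst hf
          have hlen := length_le_size_encForgery f
          simp only [encAct, Data.size] at hsz
          by_cases hts : f.2.2 = ts
          swap
          · simp only [finish, guessPay, if_neg hts, ask_const, askMany_const]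
            exact zero_le
          have := finish_le (A := A) (b := b) hh hvk hη hpay S.certs S.tctr f.2.1 f.1 0 0 0 S.tbl hS
            j (by omega)
          have hl : ∀ l, Alive ts js { S with tbl := l } = Alive ts js S := fun _ => rfl
          simp only [finish, guessPay, if_pos hts, hc, mul_assoc, hl]
          by_cases hal : Alive ts js S
          · simp only [ind_of hal, one_mul, hts]
            exact this
          · simp only [ind_of_not hal, zero_mul, ask_const, askMany_const, le_refl]

end main

end LLY

/-! ### The random oracles, and the exponents of their answers -/

theorem ev_bind_apply {α β : Type} (μ : PMF α) (k : α → PMF β) (f : β → ℝ≥0∞) :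
    ev (μ >>= k) f = ev μ fun a => ev (k a) f := ev_bind μ k f

theorem ev_pure_apply {α : Type} (a : α) (f : α → ℝ≥0∞) : ev (pure a : PMF α) f = f a := ev_pure a f

theorem ev_ro_bind {H : HashFamily} {α β : Type} (x : H.RO α) (k : α → H.RO β) (tab : H.Table)
    (f : β × H.Table → ℝ≥0∞) :
    ev ((x >>= k) tab) f = ev (x tab) fun r => ev (k r.1 r.2) f := ev_bind _ _ f

theorem ev_ro_pure {H : HashFamily} {α : Type} (a : α) (tab : H.Table)
    (f : α × H.Table → ℝ≥0∞) : ev ((pure a : H.RO α) tab) f = f (a, tab) := ev_pure _ f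

theorem ev_query_of_some {H : HashFamily} {q : H.Query} {tab : H.Table} {a : H.Ans q}
    (h : tab q = some a) (F : H.Ans q × H.Table → ℝ≥0∞) : ev (H.query q tab) F = F (a, tab) := by
  unfold HashFamily.query
  rw [h]
  exact ev_pure _ _

open Classical in
theorem ev_query_of_none {H : HashFamily} {q : H.Query} {tab : H.Table}
    (h : tab q = none) (F : H.Ans q × H.Table → ℝ≥0∞) :
    ev (H.query q tab) F = ev (H.dist q) fun a => F (a, Function.update tab q (some a)) := by
  unfold HashFamily.query
  rw [h]
  refine (ev_bind _ _ _).trans (congrArg _ (funext fun a => ?_))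
  exact ev_pure _ _

namespace LLY

section tables

variable {𝒢 : PairingGroup} {T : ℕ}

/-- The hash value `a` for the query `q` has the exponent `v`. -/
def Denotes (γ : 𝒢.G) : (q : HashQuery T) → HashAns 𝒢 q → ZMod 𝒢.p → Prop
  | .h1 _, u, v => u = 𝒢.exp γ v
  | .h2 _, u, v => u.1 = 𝒢.exp γ v
  | .h3 _ _, z, v => z = v

/-- The list of exponents `l` represents the table of hash values `tab`. -/
def Represents (γ : 𝒢.G) (tab : (hash 𝒢 T).Table) (l : List (HashQuery T × ZMod 𝒢.p)) : Prop :=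
  ∀ q : HashQuery T, (tab q = none ∧ assoc q l = none) ∨
    ∃ (a : HashAns 𝒢 q) (v : ZMod 𝒢.p), tab q = some a ∧ assoc q l = some v ∧ Denotes γ q a v

theorem encAns_eq {γ : 𝒢.G} {q : HashQuery T} {a : HashAns 𝒢 q} {v : ZMod 𝒢.p}
    (h : Denotes γ q a v) : (hash 𝒢 T).encAns q a = answer γ q v := by
  cases q with
  | h1 t => cases h; rfl
  | h2 t => exact congrArg 𝒢.enc h
  | h3 t m => cases h; rfl

/-- Exponentiation with base `γ` is a bijection from `ℤ_p` onto the group and from the units onto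
its nontrivial elements, so uniform hash values are the same as uniform exponents. -/
theorem ev_dist_le {γ : 𝒢.G} (hγ : γ ≠ 1) (q : HashQuery T) {F : HashAns 𝒢 q → ℝ≥0∞}
    {K : ZMod 𝒢.p → ℝ≥0∞}
    (h : ∀ a v, Denotes γ q a v → (q.kind = 2 → v ≠ 0) → F a ≤ K v) :
    ev ((hash 𝒢 T).dist q) F ≤ evAns 𝒢 q K := by
  cases q with
  | h1 t =>
    refine (ev_uniform_equiv (Equiv.ofBijective _ (𝒢.exp_bijective hγ)) F).symm.le.trans
      (evZ_mono fun v => h _ v rfl (by simp [HashQuery.kind]))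
  | h2 t =>
    have hb : Function.Bijective fun u : (ZMod 𝒢.p)ˣ =>
        (⟨𝒢.exp γ u, fun h => u.ne_zero ((𝒢.exp_eq_one_iff hγ).1 h)⟩ : 𝒢.Gstar) := by
      constructor
      · intro u u' h
        exact Units.ext (𝒢.exp_injective hγ (Subtype.ext_iff.1 h))
      · rintro ⟨a, ha⟩
        obtain ⟨v, rfl⟩ := (𝒢.exp_bijective hγ).2 a
        have hv : v ≠ 0 := fun h => ha ((𝒢.exp_eq_one_iff hγ).2 h)
        exact ⟨Units.mk0 v hv, rfl⟩
    refine (ev_uniform_equiv (Equiv.ofBijective _ hb) F).symm.le.trans ?_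
    exact evU_mono (f := fun v => K v) (g := K) (fun v _ => le_rfl) |>.trans' (ev_mono fun u =>
      h _ _ rfl fun _ => u.ne_zero)
  | h3 t m => exact evZ_mono fun v => h v v rfl (by simp [HashQuery.kind])

/-- Both tables are filled lazily and in parallel: an old query finds corresponding entries, a fresh
one gets a group element here and its exponent there. -/
theorem ev_query_le {γ : 𝒢.G} (hγ : γ ≠ 1) (q : HashQuery T) {tab : (hash 𝒢 T).Table}
    {l : List (HashQuery T × ZMod 𝒢.p)} (hr : Represents γ tab l)
    {F : HashAns 𝒢 q × (hash 𝒢 T).Table → ℝ≥0∞}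
    {K : ZMod 𝒢.p → List (HashQuery T × ZMod 𝒢.p) → ℝ≥0∞}
    (h : ∀ a v tab' l', Denotes γ q a v → Asked q l v l' → Represents γ tab' l' →
      F (a, tab') ≤ K v l') :
    ev ((hash 𝒢 T).query q tab) F ≤ ask q l K := by
  classical
  unfold ask
  rcases hr q with ⟨h1, h2⟩ | ⟨a, v, h1, h2, h3⟩
  · rw [h2]
    refine (ev_query_of_none (H := hash 𝒢 T) (q := q) h1 F).le.trans ?_
    refine ev_dist_le hγ q fun a v hv hv0 => ?_
    refine h a v _ _ hv ⟨assoc_cons_self _ _ _, Or.inr ⟨h2, rfl, hv0⟩⟩ fun q' => ?_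
    by_cases hq : q' = q
    · subst hq
      exact Or.inr ⟨a, v, Function.update_self .., assoc_cons_self _ _ _, hv⟩
    · rw [assoc_cons_of_ne (Ne.symm hq)]
      have : Function.update tab q (some a) q' = tab q' := Function.update_of_ne hq _ _
      rw [this]
      exact hr q'
  · rw [h2]
    refine (ev_query_of_some (H := hash 𝒢 T) (q := q) h1 F).le.trans ?_
    exact h a v tab l h3 ⟨h2, Or.inl rfl⟩ hr

/-- The table `l'` extends the table `l`. -/
structure Extends (l l' : List (HashQuery T × ZMod 𝒢.p)) : Prop where
  assoc : ∀ q v, assoc q l = some v → assoc q l' = some v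
  marked : ∀ ts js z, marked ts js l = some z → marked ts js l' = some z

theorem Extends.refl (l : List (HashQuery T × ZMod 𝒢.p)) : Extends l l :=
  ⟨fun _ _ h => h, fun _ _ _ h => h⟩

theorem Extends.trans {l l' l'' : List (HashQuery T × ZMod 𝒢.p)} (h : Extends l l')
    (h' : Extends l' l'') : Extends l l'' :=
  ⟨fun q v hq => h'.assoc q v (h.assoc q v hq), fun t j z hz => h'.marked t j z (h.marked t j z hz)⟩

theorem lt_of_marked {ts : Period T} {js : ℕ} {l : List (HashQuery T × ZMod 𝒢.p)} {z : ZMod 𝒢.p}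
    (h : marked ts js l = some z) : js < l.length := by
  by_contra h'
  rw [marked_eq_none (not_lt.1 h')] at h
  cases h

theorem Asked.extends {q : HashQuery T} {l l' : List (HashQuery T × ZMod 𝒢.p)} {v : ZMod 𝒢.p}
    (h : Asked q l v l') : Extends l l' := by
  refine ⟨fun q' v' => h.assoc_of_some, fun ts js z hz => ?_⟩
  rcases h.eq_or with rfl | ⟨-, rfl, -⟩
  · exact hz
  · have := lt_of_marked hz
    rwa [marked_cons_of_not fun h' => by omega]

theorem ev_mapM_le {γ : 𝒢.G} (hγ : γ ≠ 1) (t : Period T) (ys : List (𝒢.G × Msg))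
    {tab : (hash 𝒢 T).Table} {l : List (HashQuery T × ZMod 𝒢.p)} (hr : Represents γ tab l)
    {F : List (ZMod 𝒢.p) × (hash 𝒢 T).Table → ℝ≥0∞}
    {K : List (ZMod 𝒢.p) → List (HashQuery T × ZMod 𝒢.p) → ℝ≥0∞}
    (h : ∀ zs tab' l', List.Forall₂ (fun y z => assoc (.h3 t y.2) l' = some z) ys zs →
      Extends l l' → l'.length ≤ l.length + ys.length → Represents γ tab' l' →
      F (zs, tab') ≤ K zs l') :
    ev ((ys.mapM fun y => H3 𝒢 t y.2) tab) F ≤ askMany (ys.map fun y => .h3 t y.2) l K := by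
  induction ys generalizing tab l F K with
  | nil =>
    rw [List.mapM_nil, ev_ro_pure]
    exact h _ _ _ .nil (.refl l) (by simp) hr
  | cons y ys ih =>
    rw [List.mapM_cons, ev_ro_bind]
    refine ev_query_le hγ (.h3 t y.2) hr fun z v tab' l' hz ha hr' => ?_
    obtain rfl : z = v := hz
    rw [ev_ro_bind]
    refine ih hr' fun zs tab'' l'' h1 h2 h3 h4 => ?_
    rw [ev_ro_pure]
    refine h _ _ _ (.cons (h2.assoc _ _ ha.assoc_eq) h1) (ha.extends.trans h2) ?_ h4
    have := ha.length_le
    rw [List.length_cons]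
    omega

end tables

end LLY

/-- All pairings involved are powers of `e(γ, γ)`, which has order `p` by nondegeneracy; hence the
exponents agree modulo `p`. -/
theorem PairingGroup.eq_of_pairing {𝒢 : PairingGroup} {γ : 𝒢.G} (hγ : γ ≠ 1)
    {x r a s b : ZMod 𝒢.p} (h : 𝒢.e (𝒢.exp γ x) γ =
      𝒢.e (𝒢.exp γ r) (𝒢.exp γ a) * 𝒢.e (𝒢.exp γ s) (𝒢.exp γ b)) : x = r * a + s * b := by
  have ho : orderOf (𝒢.e γ γ) = 𝒢.p := by
    refine orderOf_eq_prime ?_ (𝒢.nondegenerate γ γ hγ hγ)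
    rw [← 𝒢.card_GT]
    exact pow_card_eq_one'
  simp only [exp, 𝒢.bilinear] at h
  have h1 := 𝒢.bilinear γ γ x.val 1
  rw [pow_one] at h1
  rw [h1, ← pow_add, pow_inj_mod, ho] at h
  have h2 := (ZMod.natCast_eq_natCast_iff' _ _ _).2 h
  push_cast at h2
  simpa only [ZMod.natCast_val, ZMod.cast_id', id_eq, mul_one] using h2

/-! ### One activation of the adversary in the actual game -/

namespace SAS

variable {T : ℕ} (S : SAS T) (pp : S.PP) (vk : S.VK pp) (sk : S.SK pp)

/-- The expected value of `f` after an action of the adversary, where `V` is the expected value in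
the rest of the game. -/
noncomputable def reaction (V : Data → Data → S.GameState pp → ℝ≥0∞) (f : Bool → ℝ≥0∞)
    (s : S.GameState pp) (st : Data) : Option (S.Action pp) → ℝ≥0∞
  | none => V st Data.bot s
  | some (.hash q) => ev (S.hashOracle pp q s) fun r => V st r.1 r.2
  | some (.cert dvk dsk) => V st (S.certOracle pp dvk dsk s).1 (S.certOracle pp dvk dsk s).2
  | some .skip => V st (S.skipOracle pp s).1 (S.skipOracle pp s).2
  | some (.sign m) => ev (S.signOracle pp sk m s) fun r => V st r.1 r.2
  | some (.output d) => ev (S.judge pp vk d s) f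

theorem ev_interact_succ (A : Prog) (b k : ℕ) (st ans : Data) (s : S.GameState pp)
    (f : Bool → ℝ≥0∞) :
    ev (S.interact pp vk sk A b (k + 1) st ans s) f = ev (A.output b (.pair st ans)) fun out =>
      match out with
      | some (.pair st' act) => S.reaction pp vk sk
          (fun st ans s => ev (S.interact pp vk sk A b k st ans s) f) f s st'
          (Data.decode (S.encAction pp) act)
      | _ => f false := by
  rw [interact, ev_bind_apply]
  congr 1
  funext out
  rcases out with _ | (_ | ⟨st', act⟩)
  · exact ev_pure _ _
  · exact ev_pure _ _
  · dsimp only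
    rcases Data.decode (S.encAction pp) act with _ | (_ | _ | _ | _ | _)
    · rfl
    · exact ev_bind _ _ _
    · rfl
    · rfl
    · exact ev_bind _ _ _
    · rfl

end SAS

namespace LLY

/-! ### What a winning forgery implies -/

section win

variable {𝒢 : PairingGroup} {T : ℕ} {γ vk : 𝒢.G} {sk : ZMod 𝒢.p}

/-- Keys are pairwise distinct, so `vk` occurs at most once. The induction has to carry both
alternatives: up to the occurrence of `vk` the second one is used, and for the rest of the list
after it the first one, where the recorded hash value must stay unchanged. -/
theorem claims_spec (hvk : vk = 𝒢.exp γ sk) (certs : List (𝒢.G × ZMod 𝒢.p))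
    (ys : List (𝒢.G × Msg)) (zs : List (ZMod 𝒢.p)) (hlen : ys.length = zs.length)
    (hcert : ∀ y ∈ ys, y.1 ≠ vk → y.1 = 𝒢.exp γ ((assoc y.1 certs).getD 0))
    (hnd : (ys.map Prod.fst).Nodup) (X Y z0 : ZMod 𝒢.p) :
    ((∀ y ∈ ys, y.1 ≠ vk) →
      𝒢.exp γ X * (ys.map Prod.fst).prod = 𝒢.exp γ (claims vk certs ys zs X Y z0).1 ∧
      𝒢.exp γ Y * (List.zipWith (fun y z => 𝒢.exp y.1 z) ys zs).prod =
        𝒢.exp γ (claims vk certs ys zs X Y z0).2.1 ∧ (claims vk certs ys zs X Y z0).2.2 = z0) ∧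
    ((∃ y ∈ ys, y.1 = vk) →
      𝒢.exp γ X * (ys.map Prod.fst).prod = 𝒢.exp γ (sk + (claims vk certs ys zs X Y z0).1) ∧
      𝒢.exp γ Y * (List.zipWith (fun y z => 𝒢.exp y.1 z) ys zs).prod =
        𝒢.exp γ (sk * (claims vk certs ys zs X Y z0).2.2 + (claims vk certs ys zs X Y z0).2.1) ∧
      ∃ m, ((vk, m), (claims vk certs ys zs X Y z0).2.2) ∈ ys.zip zs) := by
  induction ys generalizing zs X Y z0 with
  | nil => simp [claims]
  | cons y ys ih =>
    rcases zs with _ | ⟨z, zs⟩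
    · simp at hlen
    rw [List.length_cons, List.length_cons, Nat.add_right_cancel_iff] at hlen
    rw [List.map_cons, List.nodup_cons] at hnd
    have hc := fun y' hy' => hcert y' (List.mem_cons_of_mem _ hy')
    by_cases hy : y.1 = vk
    · have hno : ∀ y' ∈ ys, y'.1 ≠ vk := fun y' hy' h' =>
        hnd.1 (List.mem_map.2 ⟨y', hy', h'.trans hy.symm⟩)
      have hcl : claims vk certs (y :: ys) (z :: zs) X Y z0 = claims vk certs ys zs X Y z := by
        rw [claims, if_pos hy]
      obtain ⟨h1, h2, h3⟩ := (ih zs hlen hc hnd.2 X Y z).1 hno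
      rw [hcl]
      refine ⟨fun h => absurd hy (h y List.mem_cons_self), fun _ => ⟨?_, ?_, y.2, ?_⟩⟩
      · rw [List.map_cons, List.prod_cons, mul_left_comm, h1, hy, 𝒢.exp_add, hvk]
      · rw [List.zipWith_cons_cons, List.prod_cons, mul_left_comm, h2, hy, 𝒢.exp_add, h3, hvk,
          𝒢.exp_exp]
      · rw [h3, ← hy]
        exact List.mem_cons_self
    · set x := (assoc y.1 certs).getD 0 with hx
      have hyx : y.1 = 𝒢.exp γ x := hcert y List.mem_cons_self hy
      have hcl : claims vk certs (y :: ys) (z :: zs) X Y z0 =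
          claims vk certs ys zs (X + x) (Y + x * z) z0 := by
        rw [claims, if_neg hy]
      have hX : 𝒢.exp γ X * ((y :: ys).map Prod.fst).prod =
          𝒢.exp γ (X + x) * (ys.map Prod.fst).prod := by
        rw [List.map_cons, List.prod_cons, 𝒢.exp_add, mul_assoc, ← hyx]
      have hY : 𝒢.exp γ Y * (List.zipWith (fun y z => 𝒢.exp y.1 z) (y :: ys) (z :: zs)).prod =
          𝒢.exp γ (Y + x * z) * (List.zipWith (fun y z => 𝒢.exp y.1 z) ys zs).prod := by
        rw [List.zipWith_cons_cons, List.prod_cons, 𝒢.exp_add, mul_assoc, ← 𝒢.exp_exp, ← hyx]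
      rw [hcl, hX, hY]
      obtain ⟨h1, h2⟩ := ih zs hlen hc hnd.2 (X + x) (Y + x * z) z0
      refine ⟨fun h => h1 fun y' hy' => h y' (List.mem_cons_of_mem _ hy'), fun h => ?_⟩
      obtain ⟨y', hy', he⟩ := h
      obtain ⟨a, b, m, c⟩ := h2 ⟨y', (List.mem_cons.1 hy').resolve_left fun h' => hy (h' ▸ he), he⟩
      exact ⟨a, b, m, List.mem_cons_of_mem _ c⟩

noncomputable instance : Fintype (Period T) :=
  Fintype.subtype (Finset.Icc 1 T) fun _ => Finset.mem_Icc

theorem card_period_le : Fintype.card (Period T) ≤ T := by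
  rw [Fintype.card_of_subtype (Finset.Icc 1 T) fun _ => Finset.mem_Icc]
  simp

/-- The payoff for a forgery that is covered by some guess, or for a collision. -/
noncomputable def unionPay (γ vk : 𝒢.G) (sk : ZMod 𝒢.p) (N : ℕ) : Payoff 𝒢 T := fun f zs r s S =>
  (∑ g ∈ (Finset.univ : Finset (Period T)) ×ˢ Finset.range N, guessPay γ vk sk g.1 g.2 f zs r s S) +
    ind (Collision S.tbl)

/-- Invariants of the game: the place of signed messages in the table is recorded, there is at most
one signature in each period, and certified keys are valid. -/
structure Invariant (γ : 𝒢.G) (S : Ghost 𝒢 T) : Prop where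
  lt : ∀ e ∈ S.slog, e.1.1 < S.tctr
  unique : ∀ e ∈ S.slog, ∀ e' ∈ S.slog, e.1 = e'.1 → e = e'
  signed : ∀ e ∈ S.slog, ∃ z, assoc (.h3 e.1 e.2.1) S.tbl = some z ∧ marked e.1 e.2.2 S.tbl = some z
  certs : ∀ e ∈ S.certs, e.1 = 𝒢.exp γ e.2

theorem Invariant.of_extends {S : Ghost 𝒢 T} (h : Invariant γ S)
    {l : List (HashQuery T × ZMod 𝒢.p)} (hl : Extends S.tbl l) : Invariant γ { S with tbl := l } :=
  ⟨h.lt, h.unique, fun e he => by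
    obtain ⟨z, h1, h2⟩ := h.signed e he
    exact ⟨z, hl.assoc _ _ h1, hl.marked _ _ _ h2⟩, h.certs⟩

/-- A forgery that wins the game is covered by some guess, or there is a collision. -/
theorem one_le_unionPay (hγ : γ ≠ 1) (hvk : vk = 𝒢.exp γ sk) {S : Ghost 𝒢 T} (hS : Invariant γ S)
    {N : ℕ} (hN : S.tbl.length < N) {f : List (𝒢.G × Msg) × (𝒢.G × Period T)}
    {zs : List (ZMod 𝒢.p)} {r s : ZMod 𝒢.p}
    (hzs : List.Forall₂ (fun y z => assoc (.h3 f.2.2 y.2) S.tbl = some z) f.1 zs)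
    (hnd : (f.1.map Prod.fst).Nodup)
    (he : 𝒢.e f.2.1 γ = 𝒢.e (𝒢.exp γ r) (f.1.map Prod.fst).prod *
      𝒢.e (𝒢.exp γ s) (List.zipWith (fun y z => 𝒢.exp y.1 z) f.1 zs).prod)
    (hc : ∀ y ∈ f.1, y.1 ≠ vk → ∃ x, (y.1, x) ∈ S.certs)
    (hf : ∃ y ∈ f.1, y.1 = vk ∧ ∀ e ∈ S.slog, e.2.1 ≠ y.2) :
    1 ≤ unionPay γ vk sk N f zs r s S := by
  obtain ⟨y, hy, hyvk, hyQ⟩ := hf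
  have hcert : ∀ y ∈ f.1, y.1 ≠ vk → y.1 = 𝒢.exp γ ((assoc y.1 S.certs).getD 0) :=
    fun y hy hne => by
      obtain ⟨x, hx⟩ := hc y hy hne
      obtain ⟨v, hv⟩ := exists_assoc_of_mem hx
      rw [hv, Option.getD_some]
      exact hS.certs _ (mem_of_assoc_eq_some hv)
  obtain ⟨h1, h2, m, h3⟩ := (claims_spec hvk S.certs f.1 zs hzs.length_eq hcert hnd 0 0 0).2
    ⟨y, hy, hyvk⟩
  rw [𝒢.exp_zero, one_mul] at h1 h2
  set c := claims vk S.certs f.1 zs 0 0 0 with hcdef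
  have hE : f.2.1 = 𝒢.exp γ (r * (sk + c.1) + s * (sk * c.2.2 + c.2.1)) := by
    obtain ⟨x, hx⟩ := (𝒢.exp_bijective hγ).2 f.2.1
    rw [← hx, h1, h2] at he
    rw [← hx, 𝒢.eq_of_pairing hγ he]
  -- The claim under `vk` is unique as the keys are distinct; so the hash value recorded by `claims`
  -- is that of the message which has never been signed.
  have hm : y.2 = m := by
    have := List.inj_on_of_nodup_map hnd hy (List.of_mem_zip h3).1 hyvk
    rw [this]
  have hz : assoc (.h3 f.2.2 m) S.tbl = some c.2.2 := by
    have := (List.forall₂_iff_zip.1 hzs).2 h3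
    exact this
  have hguess : ∀ js < N, Alive f.2.2 js S → marked f.2.2 js S.tbl ≠ some c.2.2 →
      1 ≤ unionPay γ vk sk N f zs r s S := fun js hjs ha hmk => by
    refine le_trans ?_ le_self_add
    refine le_trans (le_of_eq ?_) (Finset.single_le_sum
      (f := fun g : Period T × ℕ => guessPay γ vk sk g.1 g.2 f zs r s S) (fun _ _ => zero_le)
      (show (f.2.2, js) ∈ _ from
        Finset.mem_product.2 ⟨Finset.mem_univ f.2.2, Finset.mem_range.2 hjs⟩))
    have hex : Extractable γ sk f.2.2 js f.2.1 c r s S.tbl := ⟨hE, hmk⟩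
    simp only [guessPay, if_true, ind_of ha, one_mul]
    exact (ind_of hex).symm
  -- If a signature was issued in the period of the forgery, the right guess for `js` is the place
  -- of its hash value. The signed message differs from the forged one, so equal hash values are a
  -- collision, and different ones make the forgery extractable.
  by_cases hsig : ∃ e ∈ S.slog, e.1 = f.2.2
  · obtain ⟨e, he1, he2⟩ := hsig
    obtain ⟨z, hz1, hz2⟩ := hS.signed e he1
    rw [he2] at hz1 hz2
    by_cases hzz : z = c.2.2
    · refine le_trans (ind_of ?_).ge le_add_self
      refine ⟨f.2.2, m, e.2.1, c.2.2, ?_, mem_of_assoc_eq_some hz, mem_of_assoc_eq_some (hzz ▸ hz1)⟩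
      rw [← hm]
      exact (hyQ e he1).symm
    · refine hguess e.2.2 ((lt_of_marked hz2).trans hN) (fun e' he' h' => ?_) ?_
      · rw [hS.unique e' he' e he1 (h'.trans he2.symm)]
      · rw [hz2]
        exact fun h' => hzz (Option.some.inj h')
  -- Without a signature in this period every place is consistent with the guess; the one just
  -- behind the table is free, so nothing is planted.
  · refine hguess S.tbl.length hN (fun e he h' => absurd ⟨e, he, h'⟩ hsig) ?_
    rw [marked_eq_none le_rfl]
    exact fun h' => by cases h'

end win

/-! ### From the actual game to the game on exponents -/

section real

variable {Gen : BilinearGenerator} {n T : ℕ} {pp : PP Gen}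

/-- Actions of the adversary in the game. -/
def toAct : (sasLLY Gen n T).Action pp → Act T
  | .hash q => .hash q
  | .cert v w => .cert v w
  | .skip => .skip
  | .sign m => .sign m
  | .output d => .output d

theorem encAct_toAct (a : (sasLLY Gen n T).Action pp) :
    encAct (toAct a) = (sasLLY Gen n T).encAction pp a := by
  cases a with
  | hash q => cases q <;> rfl
  | _ => rfl

theorem toAct_injective : Function.Injective (toAct (Gen := Gen) (n := n) (T := T) (pp := pp)) := by
  intro a a' h
  cases a <;> cases a' <;> simp_all only [toAct, Act.cert.injEq, Act.sign.injEq, Act.output.injEq,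
    reduceCtorEq]
  exact congrArg SAS.Action.hash (Act.hash.inj h)

theorem toAct_surjective :
    Function.Surjective (toAct (Gen := Gen) (n := n) (T := T) (pp := pp)) := by
  intro a
  cases a with
  | hash q => exact ⟨.hash q, rfl⟩
  | cert v w => exact ⟨.cert v w, rfl⟩
  | skip => exact ⟨.skip, rfl⟩
  | sign m => exact ⟨.sign m, rfl⟩
  | output d => exact ⟨.output d, rfl⟩

theorem encAction_injective : Function.Injective ((sasLLY Gen n T).encAction pp) := by
  intro a a' h
  rw [← encAct_toAct, ← encAct_toAct] at h
  exact toAct_injective (encAct_injective h)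

theorem decode_encAction (d : Data) :
    (Data.decode ((sasLLY Gen n T).encAction pp) d).map toAct = Data.decode encAct d := by
  cases h : Data.decode ((sasLLY Gen n T).encAction pp) d with
  | none =>
    rw [Data.decode_eq_none] at h
    refine (Data.decode_eq_none.2 fun a ha => ?_).symm
    obtain ⟨a', rfl⟩ := toAct_surjective (Gen := Gen) (n := n) (pp := pp) a
    exact h a' (by rw [← encAct_toAct, ha])
  | some a =>
    rw [Data.decode_eq_some encAction_injective] at h
    exact ((Data.decode_eq_some encAct_injective).2 (by rw [encAct_toAct, h])).symm

/-- The state of the challenger is represented by the state of the game on exponents. -/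
structure Related (s : (sasLLY Gen n T).GameState pp) (S : Ghost (Gen.grp pp.1) T) : Prop where
  table : Represents pp.2.1 s.table S.tbl
  certs : ∀ X ∈ s.L, ∃ x, (X, x) ∈ S.certs
  signed : ∀ e ∈ S.slog, e.2.1 ∈ s.Q
  tctr : s.tctr = S.tctr

theorem mem_support_keyGen {𝒢 : PairingGroup} {γ X : 𝒢.G} {x : (ZMod 𝒢.p)ˣ} :
    (X, x) ∈ (keyGen 𝒢 γ).support ↔ X = 𝒢.exp γ x := by
  show (X, x) ∈ ((PMF.uniformOfFintype (ZMod 𝒢.p)ˣ).bind fun y =>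
    PMF.pure (𝒢.exp γ (y : ZMod 𝒢.p), y)).support ↔ _
  simp only [PMF.mem_support_bind_iff, PMF.mem_support_pure_iff, Prod.mk.injEq]
  constructor
  · rintro ⟨y, -, h1, rfl⟩; exact h1
  · exact fun h => ⟨x, PMF.mem_support_uniformOfFintype x, h, rfl⟩

theorem certOracle_of_isKeyPair {dvk dsk : Data} {x : ZMod (Gen.grp pp.1).p}
    (h : IsKeyPair pp.2.1 dvk dsk x) (s : (sasLLY Gen n T).GameState pp) :
    (sasLLY Gen n T).certOracle pp dvk dsk s =
      (Data.ofBool true, { s with L := insert ((Gen.grp pp.1).exp pp.2.1 x) s.L }) := by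
  have h1 : Data.decode ((sasLLY Gen n T).encVK pp) dvk = some ((Gen.grp pp.1).exp pp.2.1 x) :=
    (Data.decode_eq_some (Gen.grp pp.1).enc_injective).2 h.2.2.symm
  have h2 : Data.decode ((sasLLY Gen n T).encSK pp) dsk = some (Units.mk0 x h.1) :=
    (Data.decode_eq_some fun a b hab => Units.ext ((Gen.grp pp.1).encZ_injective hab)).2 h.2.1.symm
  unfold SAS.certOracle
  rw [h1, h2]
  have h3 : ((Gen.grp pp.1).exp pp.2.1 x, Units.mk0 x h.1) ∈
      (keyGen (Gen.grp pp.1) pp.2.1).support := mem_support_keyGen.2 rfl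
  exact if_pos h3

theorem certOracle_of_not {dvk dsk : Data} (h : ¬ ∃ x, IsKeyPair pp.2.1 dvk dsk x)
    (s : (sasLLY Gen n T).GameState pp) :
    (sasLLY Gen n T).certOracle pp dvk dsk s = (Data.ofBool false, s) := by
  unfold SAS.certOracle
  cases h1 : Data.decode ((sasLLY Gen n T).encVK pp) dvk with
  | none => rfl
  | some vk =>
    cases h2 : Data.decode ((sasLLY Gen n T).encSK pp) dsk with
    | none => rfl
    | some sk =>
      have h3 := (Data.decode_eq_some (Gen.grp pp.1).enc_injective (a := vk) (d := dvk)).1 h1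
      have h4 := (Data.decode_eq_some (fun a b hab => Units.ext ((Gen.grp pp.1).encZ_injective hab))
        (a := sk) (d := dsk)).1 h2
      refine if_neg fun hs => h ⟨_, Units.ne_zero sk, h4.symm, ?_⟩
      rw [← h3, (mem_support_keyGen (𝒢 := Gen.grp pp.1) (X := vk) (x := sk)).1 hs]

variable {A : Prog} {b : ℕ} {vk : (Gen.grp pp.1).G} {sk : (ZMod (Gen.grp pp.1).p)ˣ}

theorem ev_sign_le {𝒢 : PairingGroup} {γ : 𝒢.G} (hγ : γ ≠ 1) (sk : (ZMod 𝒢.p)ˣ) (t : Period T)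
    (m : Msg) {tab : (hash 𝒢 T).Table} {l : List (HashQuery T × ZMod 𝒢.p)}
    (hr : Represents γ tab l) {F : (𝒢.G × Period T) × (hash 𝒢 T).Table → ℝ≥0∞}
    {K : ZMod 𝒢.p → ZMod 𝒢.p → ZMod 𝒢.p → List (HashQuery T × ZMod 𝒢.p) → ℝ≥0∞}
    (h : ∀ z r s tab' l', assoc (.h3 t m) l' = some z → Extends l l' → l'.length ≤ l.length + 3 →
      Represents γ tab' l' →
      F ((𝒢.exp (𝒢.exp γ sk) (r + s * z), t), tab') ≤ K z r s l') :
    ev (sign 𝒢 sk t m tab) F ≤ ask (.h3 t m) l fun z l1 => ask (.h1 t) l1 fun r l2 =>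
      ask (.h2 t) l2 fun s l3 => K z r s l3 := by
  unfold sign
  rw [ev_ro_bind]
  refine ev_query_le hγ (.h3 t m) hr fun z v tab1 l1 hz h1 hr1 => ?_
  obtain rfl : z = v := hz
  rw [ev_ro_bind]
  refine ev_query_le hγ (.h1 t) hr1 fun R r tab2 l2 hR h2 hr2 => ?_
  obtain rfl : R = 𝒢.exp γ r := hR
  rw [ev_ro_bind]
  refine ev_query_le hγ (.h2 t) hr2 fun B s tab3 l3 hB h3 hr3 => ?_
  have hB' : B.1 = 𝒢.exp γ s := hB
  rw [ev_ro_pure]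
  have := h z r s tab3 l3 (h3.assoc_of_some (h2.assoc_of_some h1.assoc_eq))
    ((h1.extends.trans h2.extends).trans h3.extends)
    (by have := h1.length_le; have := h2.length_le; have := h3.length_le; omega) hr3
  refine le_trans (le_of_eq ?_) this
  congr 3
  dsimp only
  rw [hB']
  simp only [𝒢.exp_exp, ← 𝒢.exp_add]
  congr 1
  ring

theorem ev_aggVerify_le {𝒢 : PairingGroup} {γ : 𝒢.G} (hγ : γ ≠ 1)
    (f : List (𝒢.G × Msg) × (𝒢.G × Period T)) {tab : (hash 𝒢 T).Table} {S : Ghost 𝒢 T}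
    (hr : Represents γ tab S.tbl) {F : Bool × (hash 𝒢 T).Table → ℝ≥0∞} {J : Payoff 𝒢 T}
    (hF : ∀ tab, F (false, tab) = 0)
    (h : ∀ zs r s tab' l', List.Forall₂ (fun y z => assoc (.h3 f.2.2 y.2) l' = some z) f.1 zs →
      Extends S.tbl l' → l'.length ≤ S.tbl.length + f.1.length + 2 → (f.1.map Prod.fst).Nodup →
      𝒢.e f.2.1 γ = 𝒢.e (𝒢.exp γ r) (f.1.map Prod.fst).prod *
        𝒢.e (𝒢.exp γ s) (List.zipWith (fun y z => 𝒢.exp y.1 z) f.1 zs).prod →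
      F (true, tab') ≤ J f zs r s { S with tbl := l' }) :
    ev (aggVerify 𝒢 γ f.1 f.2 tab) F ≤ finish J S f := by
  classical
  unfold aggVerify
  by_cases hnd : (f.1.map fun y => y.1).Nodup
  swap
  · rw [if_pos hnd, ev_ro_pure, hF]
    exact zero_le
  rw [if_neg (not_not.2 hnd), ev_ro_bind]
  refine ev_mapM_le hγ f.2.2 f.1 hr fun zs tab1 l1 hzs h1 hlen hr1 => ?_
  rw [ev_ro_bind]
  refine ev_query_le hγ (.h1 f.2.2) hr1 fun R r tab2 l2 hR h2 hr2 => ?_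
  obtain rfl : R = 𝒢.exp γ r := hR
  rw [ev_ro_bind]
  refine ev_query_le hγ (.h2 f.2.2) hr2 fun B s tab3 l3 hB h3 hr3 => ?_
  have hB' : B.1 = 𝒢.exp γ s := hB
  rw [ev_ro_pure]
  dsimp only
  rw [hB']
  by_cases he : 𝒢.e f.2.1 γ = 𝒢.e (𝒢.exp γ r) (f.1.map Prod.fst).prod *
        𝒢.e (𝒢.exp γ s) (List.zipWith (fun y z => 𝒢.exp y.1 z) f.1 zs).prod
  · rw [decide_eq_true he]
    refine h zs r s tab3 l3 (hzs.imp fun y z hyz => h3.assoc_of_some (h2.assoc_of_some hyz))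
      ((h1.trans h2.extends).trans h3.extends) ?_ hnd he
    have := h2.length_le
    have := h3.length_le
    omega
  · rw [decide_eq_false he, hF]
    exact zero_le

/-- The two games run in parallel under the relation `Related`, and `Invariant` is kept up on the
side of the exponents. At the end the winning condition is turned into the payoff by
`one_le_unionPay`. The bound `N` exceeds the length of the table at any time, so that all places
that may have to be guessed lie below `N`. -/
theorem ev_interact_le (hvk : vk = (Gen.grp pp.1).exp pp.2.1 sk) {N : ℕ} (k : ℕ) (st ans : Data)
    (s : (sasLLY Gen n T).GameState pp) (S : Ghost (Gen.grp pp.1) T) (hs : Related s S)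
    (hS : Invariant pp.2.1 S) (hN : S.tbl.length + 3 * k + b + 3 ≤ N) :
    ev ((sasLLY Gen n T).interact pp vk sk A b k st ans s) (fun r => ind (r = true)) ≤
      gameVal A b pp.2.1 vk (unionPay pp.2.1 vk sk N) k st ans S := by
  have hγ := pp.2.2
  induction k generalizing st ans s S with
  | zero =>
    refine (ev_pure _ _).le.trans ?_
    simp [ind]
  | succ k ih =>
    refine ((sasLLY Gen n T).ev_interact_succ pp vk sk A b k st ans s _).le.trans ?_
    refine ev_mono_of_support fun out hout => ?_
    rcases out with _ | (_ | ⟨st', act⟩)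
    · simp [ind]
    · simp [ind]
    have hsz := size_le_of_mem_support_output hout
    simp only [Data.size] at hsz
    simp only [round]
    rw [← decode_encAction (Gen := Gen) (n := n) (pp := pp)]
    have hN' : S.tbl.length + 3 * k + b + 3 ≤ N := by omega
    cases ho : Data.decode ((sasLLY Gen n T).encAction pp) act with
    | none => exact ih st' Data.bot s S hs hS hN'
    | some a =>
      rw [Data.decode_eq_some encAction_injective] at ho
      subst ho
      cases a with
      | hash q =>
        refine (ev_bind_apply _ _ _).le.trans ?_
        let q' : HashQuery T := q
        show _ ≤ ask q' S.tbl fun v l => gameVal A b pp.2.1 vk (unionPay pp.2.1 vk sk N) k st'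
          (answer pp.2.1 q' v) { S with tbl := l }
        show ev ((hash (Gen.grp pp.1) T).query q s.table) _ ≤ _
        refine ev_query_le hγ q hs.table fun a v tab' l' ha hl' hr' => ?_
        refine (ev_pure_apply _ _).le.trans ?_
        refine le_trans (le_of_eq ?_) (ih st' (answer pp.2.1 q v) { s with table := tab' }
          { S with tbl := l' } ⟨hr', hs.certs, hs.signed, hs.tctr⟩ (hS.of_extends hl'.extends)
          (by have := hl'.length_le; dsimp only; omega))
        rw [← encAns_eq ha]
        rfl
      | cert v w =>
        show ev ((sasLLY Gen n T).interact pp vk sk A b k st' ((sasLLY Gen n T).certOracle pp v w s).1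
          ((sasLLY Gen n T).certOracle pp v w s).2) _ ≤ gameVal A b pp.2.1 vk _ k st'
            (simCert pp.2.1 v w S.certs).1 { S with certs := (simCert pp.2.1 v w S.certs).2 }
        by_cases hx : ∃ x, IsKeyPair pp.2.1 v w x
        · obtain ⟨x, hx⟩ := hx
          rw [certOracle_of_isKeyPair hx, simCert_of_isKeyPair hx]
          refine ih _ _ _ _ ⟨hs.table, ?_, hs.signed, hs.tctr⟩ ⟨hS.lt, hS.unique, hS.signed, ?_⟩ hN'
          · rintro X (rfl | hX)
            · exact ⟨x, List.mem_cons_self⟩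
            · obtain ⟨y, hy⟩ := hs.certs X hX
              exact ⟨y, List.mem_cons_of_mem _ hy⟩
          · intro e he
            rcases List.mem_cons.1 he with rfl | he
            · rfl
            · exact hS.certs e he
        · rw [certOracle_of_not hx, simCert_of_not hx]
          exact ih _ _ _ _ hs hS hN'
      | skip =>
        show ev ((sasLLY Gen n T).interact pp vk sk A b k st' ((sasLLY Gen n T).skipOracle pp s).1
          ((sasLLY Gen n T).skipOracle pp s).2) _ ≤ gameVal A b pp.2.1 vk _ k st' Data.bot
            (if 1 ≤ S.tctr ∧ S.tctr ≤ T then { S with tctr := S.tctr + 1 } else S)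
        unfold SAS.skipOracle
        rw [hs.tctr]
        split_ifs with ht
        · refine ih _ _ _ _ ⟨hs.table, hs.certs, hs.signed, rfl⟩
            ⟨fun e he => (hS.lt e he).trans (Nat.lt_succ_self _), hS.unique, hS.signed, hS.certs⟩ hN'
        · exact ih _ _ _ _ hs hS hN'
      | sign m =>
        show ev ((sasLLY Gen n T).signOracle pp sk m s) _ ≤ react pp.2.1 vk _ _ S st' (some (.sign m))
        obtain ⟨tab, L, Q, tctr⟩ := s
        obtain rfl : tctr = S.tctr := hs.tctr
        unfold SAS.signOracle
        by_cases ht : 1 ≤ S.tctr ∧ S.tctr ≤ T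
        swap
        · rw [dif_neg ht, react, dif_neg ht]
          refine (ev_pure _ _).le.trans ?_
          exact ih _ _ _ _ hs hS hN'
        · rw [dif_pos ht, react, dif_pos ht]
          refine (ev_bind_apply _ _ _).le.trans ?_
          show ev (sign (Gen.grp pp.1) sk ⟨S.tctr, ht⟩ m tab) _ ≤ _
          refine ev_sign_le hγ sk ⟨S.tctr, ht⟩ m hs.table fun z r s' tab' l' hz hext hlen hr' => ?_
          refine (ev_pure_apply _ _).le.trans ?_
          have hinv := hS.of_extends hext
          refine le_trans (le_of_eq (by rw [hvk]; rfl)) (ih st'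
            (.pair ((Gen.grp pp.1).enc ((Gen.grp pp.1).exp vk (r + s' * z))) (Data.num S.tctr))
            { table := tab', L := L, Q := insert m Q, tctr := S.tctr + 1 }
            { S with
              tbl := l'
              slog := (⟨S.tctr, ht⟩, m, place (.h3 ⟨S.tctr, ht⟩ m) l') :: S.slog
              tctr := S.tctr + 1 } ⟨hr', hs.certs, ?_, rfl⟩ ⟨?_, ?_, ?_, hS.certs⟩ ?_)
          · intro e he
            rcases List.mem_cons.1 he with rfl | he
            · exact Set.mem_insert _ _
            · exact Set.mem_insert_of_mem _ (hs.signed e he)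
          · intro e he
            rcases List.mem_cons.1 he with rfl | he
            · exact Nat.lt_succ_self _
            · exact (hS.lt e he).trans (Nat.lt_succ_self _)
          -- The counter advances with every signature, so earlier signatures belong to strictly
          -- earlier periods; this gives the uniqueness on which the planting of a single hash value
          -- depends.
          · have hne : ∀ e ∈ S.slog, e.1 ≠ ⟨S.tctr, ht⟩ := fun e he h' => by
              have := hS.lt e he
              rw [h'] at this
              exact lt_irrefl _ this
            intro e he e' he' hee
            rcases List.mem_cons.1 he with rfl | he <;> rcases List.mem_cons.1 he' with rfl | he'
            · rfl
            · exact absurd hee.symm (hne e' he')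
            · exact absurd hee (hne e he)
            · exact hS.unique e he e' he' hee
          · intro e he
            rcases List.mem_cons.1 he with rfl | he
            · exact ⟨z, hz, marked_place (q := .h3 ⟨S.tctr, ht⟩ m) rfl rfl hz rfl⟩
            · exact hinv.signed e he
          · dsimp only
            omega
      | output d =>
        show ev ((sasLLY Gen n T).judge pp vk d s) _ ≤ react pp.2.1 vk _ _ S st' (some (.output d))
        unfold SAS.judge
        simp only [react]
        cases hf : Data.decode (encForgery (Gen.grp pp.1) (T := T)) d with
        | none =>
          have : Data.decode ((sasLLY Gen n T).encForgery pp) d = none := hf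
          rw [this]
          refine (ev_pure _ _).le.trans ?_
          simp [ind]
        | some f =>
          have h1 : Data.decode ((sasLLY Gen n T).encForgery pp) d = some f := hf
          rw [h1]
          rw [Data.decode_eq_some encForgery_injective] at hf
          subst hf
          have hlen := length_le_size_encForgery f
          refine (ev_bind_apply _ _ _).le.trans ?_
          refine ev_aggVerify_le hγ f hs.table ?_ ?_
          · intro tab
            exact (ev_pure_apply _ _).trans (ind_of_not fun hw => by
              simp only [decide_eq_true_eq] at hw
              exact Bool.false_ne_true hw.1)
          · intro zs r s' tab' l' hzs hext hl' hnd he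
            refine (ev_pure_apply _ _).le.trans (ind_le_iff.2 fun hw => ?_)
            simp only [decide_eq_true_eq] at hw
            obtain ⟨-, hc, y, hy, hyvk, hyQ⟩ := hw
            refine one_le_unionPay hγ hvk (hS.of_extends hext) ?_ hzs hnd he
              (fun y hy hne => hs.certs _ (hc y hy hne)) ⟨y, hy, hyvk, fun e he h' => hyQ ?_⟩
            · have hsz' : st'.size + (Data.pair (Data.num 4) (encForgery (Gen.grp pp.1) f)).size + 1 ≤ b :=
                hsz
              simp only [Data.size] at hsz'
              dsimp only
              omega
            · exact h' ▸ hs.signed e he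

end real

end LLY

/-! ### Programs that achieve an expected value -/

theorem wp_le_of_size {k : ℕ} {c : Prog} {x : Data} {F G : Data → ℝ≥0∞}
    (h : ∀ y, y.size ≤ k → F y ≤ G y) : wp k c x F ≤ wp k c x G := by
  have e1 := ev_output c k x (fun o => o.elim 0 F) rfl
  have e2 := ev_output c k x (fun o => o.elim 0 G) rfl
  refine e1.ge.trans ((ev_mono_of_support fun o ho => ?_).trans e2.le)
  cases o with
  | none => exact le_rfl
  | some y => exact h y (size_le_of_mem_support_output ho)

theorem wp_le_wp_seq_op (k : ℕ) (c : Prog) (o : Op) (x : Data) (F : Data → ℝ≥0∞) :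
    wp k c x (fun y => F (o.eval y)) ≤ wp (k + (1 + k + (k + 2))) (.seq c (.op o)) x F := by
  refine le_trans (wp_le_of_size fun y hy => ?_) (wp_seq _ _ c (.op o) x F)
  refine (wp_op o y F).ge.trans (wp_mono_budget ?_ _ _ _)
  have := o.size_eval_le y
  omega

section achieves

variable {ι : Type*} {S : Set ι} {μ : ι → ℕ} {x y : ι → Data} {V : ι → ℝ≥0∞} {F : ι → Data → ℝ≥0∞}

/-- A program with input `x i`, which runs in polynomial time, achieves at least the expected value
`V i` of `F i`, for `i ∈ S`. -/
def Achieves (S : Set ι) (μ : ι → ℕ) (x : ι → Data) (V : ι → ℝ≥0∞) (F : ι → Data → ℝ≥0∞) : Prop :=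
  ∃ (c : Prog) (r : Polynomial ℕ), ∀ i ∈ S, V i ≤ wp (r.eval (μ i)) c (x i) (F i)

theorem Achieves.comp (h : Achieves S μ y V F) (hy : Comp S μ x y) : Achieves S μ x V F := by
  obtain ⟨c, r, hc⟩ := h
  obtain ⟨e, s, he⟩ := hy
  refine ⟨.seq e c, s + r, fun i hi => ?_⟩
  rw [Polynomial.eval_add]
  exact (hc i hi).trans ((he i hi _).trans (wp_seq _ _ e c (x i) (F i)))

-- Wrong guesses are credited with value `0`. Hence the program need not recognize them, which
-- matters for conditions that it cannot compute, such as a right guess for `T`.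
open Classical in
theorem Achieves.dite {U : Set ι} {V : {i // i ∈ U} → ℝ≥0∞}
    (h : Achieves Set.univ (fun i : {i // i ∈ U} => μ i) (fun i => x i) V fun i => F i) :
    Achieves S μ x (fun i => if hi : i ∈ U then V ⟨i, hi⟩ else 0) F := by
  obtain ⟨c, r, hc⟩ := h
  refine ⟨c, r, fun i _ => ?_⟩
  dsimp only
  split_ifs with hi
  · exact hc ⟨i, hi⟩ trivial
  · exact zero_le

/-- The indices after sampling a number below `a i`. -/
def sampled (S : Set ι) (a : ι → ℕ) : Set (ι × ℕ) := {q | q.1 ∈ S ∧ q.2 ≤ a q.1}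

/-- The data after sampling a number. -/
def sampledData (x : ι → Data) (q : ι × ℕ) : Data := .pair (x q.1) (Data.num q.2)

variable {a : ι → ℕ}

theorem bdd_sampled (ha : Comp S μ x fun i => Data.num (a i)) :
    Bdd (sampled S a) (fun q => μ q.1) (sampledData x) := by
  obtain ⟨r, hr⟩ := ha.bdd
  obtain ⟨s, hs⟩ := ha.bdd_input
  exact Bdd.pair ⟨s, fun q hq => hs q.1 hq.1⟩
    ⟨r, fun q hq => (Data.size_num_mono hq.2).trans (hr q.1 hq.1)⟩

theorem comp_sampled (ha : Comp S μ x fun i => Data.num (a i)) (hy : Comp S μ x y) :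
    Comp (sampled S a) (fun p => μ p.1) (sampledData x) fun p => y p.1 :=
  hy.weaken (f := Prod.fst) (fun _ hp => ⟨hp.1, le_rfl⟩)
    (((Comp.id (bdd_sampled ha)).op .fst).congr fun _ _ => rfl) fun _ _ => rfl

theorem comp_sampled_snd (ha : Comp S μ x fun i => Data.num (a i)) :
    Comp (sampled S a) (fun p => μ p.1) (sampledData x) fun p => Data.num p.2 :=
  ((Comp.id (bdd_sampled ha)).op .snd).congr fun _ _ => rfl

/-- The sampled number is appended to the data, and what follows is a program for the enlarged
family; so nested random choices are treated one at a time. -/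
theorem Achieves.sample {V : ι × ℕ → ℝ≥0∞} (ha : Comp S μ x fun i => Data.num (a i))
    (h : Achieves (sampled S a) (fun p => μ p.1) (sampledData x) V fun p => F p.1) :
    Achieves S μ x (fun i => ev (uniformBelow (a i)) fun k => V (i, k)) F := by
  obtain ⟨c, r, hc⟩ := h
  obtain ⟨e, s, he⟩ := Comp.id ha.bdd_input
  obtain ⟨f, t, hf⟩ := exists_wp_sample ha
  refine ⟨.seq (.fork e f) c, (1 + s + (s + t)) + r, fun i hi => ?_⟩
  have hsz := (he i hi).size_le.2
  simp only [Polynomial.eval_add, Polynomial.eval_one]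
  refine le_trans ?_ (wp_seq _ _ _ c (x i) (F i))
  refine le_trans ?_ (wp_mono_budget (show 1 + (x i).size + (s.eval (μ i) + t.eval (μ i)) ≤ _ by
    omega) _ _ _)
  refine le_trans ?_ (wp_fork _ _ e f _ _)
  refine le_trans ?_ (he i hi _)
  refine le_trans (ev_mono_of_support fun k hk => ?_) (hf i hi _)
  refine hc (i, k) ⟨hi, ?_⟩
  rw [uniformBelow, PMF.mem_support_uniformOfFinset_iff, Finset.mem_insert, Finset.mem_range] at hk
  dsimp only
  omega

end achieves

namespace LLY

/-! ### The reduction -/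

/-- An instance of the 1-MSDH-2 problem. -/
structure Inst (Gen : BilinearGenerator) : Type where
  n : ℕ
  d : Data
  g : (Gen.grp d).Gstar
  α : (ZMod (Gen.grp d).p)ˣ
  β : (ZMod (Gen.grp d).p)ˣ
  ξ : (ZMod (Gen.grp d).p)ˣ

variable {Gen : BilinearGenerator}

namespace Inst

/-- The group of an instance. -/
abbrev grp (i : Inst Gen) : PairingGroup := Gen.grp i.d

/-- A power of the generator. -/
def pow (i : Inst Gen) (c : ZMod i.grp.p) : i.grp.G := i.grp.exp i.g.1 c

/-- The input of the adversary. -/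
def data (i : Inst Gen) : Data :=
  Data.ofList [Gen.params i.n i.d, i.grp.enc i.g.1, i.grp.enc (i.pow i.ξ),
    i.grp.enc (i.pow ((i.ξ : ZMod i.grp.p) ^ 2)), i.grp.enc (i.pow i.β),
    i.grp.enc (i.pow (i.β * i.ξ)), i.grp.enc (i.pow (i.β * (i.ξ : ZMod i.grp.p) ^ 2)),
    i.grp.enc (i.pow i.α), i.grp.enc (i.pow (i.α * i.β * i.ξ))]

/-- The instances that occur. -/
def valid (Gen : BilinearGenerator) : Set (Inst Gen) :=
  {i | i.d ∈ (Gen.gen i.n).support ∧ i.grp.p ≠ 2}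

/-- The indicator of the solutions. -/
noncomputable def pay (i : Inst Gen) (o : Data) : ℝ≥0∞ := ind (MSDHSolution i.grp i.α i.ξ o)

theorem bdd_data : Bdd (valid Gen) (fun i => i.n) data := by
  have he : ∀ u : ∀ i : Inst Gen, i.grp.G, Bdd (valid Gen) (fun i => i.n) fun i => i.grp.enc (u i) :=
    fun u => ⟨Gen.bound, fun i hi => size_enc_le hi.1 _⟩
  have h1 : Bdd (valid Gen) (fun i => i.n) fun i => Data.ones i.n :=
    ⟨.X + 1, fun i _ => by rw [Data.size_ones]; simp⟩
  have hbot : Bdd (valid Gen) (fun i => i.n) fun _ => Data.bot :=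
    ⟨1, fun i _ => by simp [Data.bot, Data.size]⟩
  have hpar : Bdd (valid Gen) (fun i => i.n) fun i => Gen.params i.n i.d :=
    h1.pair (Bdd.pair ⟨Gen.bound, fun i hi => Gen.size_p _ _ hi.1⟩
      (Bdd.pair ⟨Gen.bound, fun i hi => Gen.size_desc _ _ hi.1⟩ hbot))
  exact hpar.pair ((he _).pair ((he _).pair ((he _).pair ((he _).pair ((he _).pair
    ((he _).pair ((he _).pair ((he _).pair hbot))))))))

/-- The initial state of the simulator. -/
noncomputable def start (N b T : ℕ) (i : Inst Gen) (ts : Period T) (js : ℕ) (mh sh : ZMod i.grp.p) :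
    LoopPoint Gen where
  N := N
  n := i.n
  b := b
  d := i.d
  T := T
  P := ⟨i.pow i.ξ, i.g.1, i.pow i.α, ts, js, mh, sh⟩
  c := .run Data.bot (.pair (Data.ofList [Gen.params i.n i.d, Data.ones T, i.grp.enc (i.pow i.ξ)])
    (i.grp.enc i.g.1)) ⟨[], [], 1⟩

/-- The tables start empty, and `b + b + 2` steps add at most `3 * (b + b + 2)` hash values; the
remaining terms of `N` cover the lengths of the first message to the adversary. -/
theorem good_start {N b T : ℕ} {i : Inst Gen} (hi : i ∈ valid Gen)
    (hN : i.n + 4 * Gen.bound.eval i.n + T + 7 * b + 30 ≤ N) (ts : Period T) {js : ℕ}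
    (hjs : js ≤ N) (mh sh : ZMod i.grp.p) : (start N b T i ts js mh sh).Good (b + b + 2) := by
  have h1 : (i.grp.enc (i.pow i.ξ)).size ≤ _ := size_enc_le hi.1 _
  have h2 : (i.grp.enc i.g.1).size ≤ _ := size_enc_le hi.1 _
  have h3 : (Data.num i.grp.p).size ≤ _ := Gen.size_p _ _ hi.1
  have h3' : (Data.num (Gen.grp i.d).p).size ≤ _ := h3
  have h4 := Gen.size_desc _ _ hi.1
  refine ⟨hi.1, hi.2, ?_, hjs, ?_, ?_, ?_, ?_, ?_, ?_⟩
  · show i.n + Gen.bound.eval i.n + T + b + 20 ≤ N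
    omega
  · show 0 + 1 ≤ N
    omega
  · show (Data.pair (Data.ofList [Gen.params i.n i.d, Data.ones T, i.grp.enc (i.pow i.ξ)])
      (i.grp.enc i.g.1)).size ≤ N
    simp only [Data.ofList, BilinearGenerator.params, Data.size, Data.size_ones, Data.bot,
      List.length_nil]
    omega
  · show 0 + 3 * (b + b + 2) ≤ N
    omega
  · intro e he
    cases he
  · show 0 + (b + b + 2) ≤ N
    omega
  · show 1 + (b + b + 2) ≤ N
    omega

end Inst

theorem lt_of_mem_support_uniformBelow {n k : ℕ} (hn : 0 < n) (hk : k ∈ (uniformBelow n).support) :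
    k < n := by
  rw [uniformBelow, PMF.mem_support_uniformOfFinset_iff, Finset.mem_insert, Finset.mem_range] at hk
  omega

theorem evZ_eq (𝒢 : PairingGroup) (f : ZMod 𝒢.p → ℝ≥0∞) :
    evZ 𝒢 f = ev (uniformBelow 𝒢.p) fun m => f (m : ZMod 𝒢.p) := by
  rw [ev_uniformBelow_eq_zmod]
  simp only [ZMod.natCast_zmod_val]
  rfl

theorem evU_eq (𝒢 : PairingGroup) (f : ZMod 𝒢.p → ℝ≥0∞) :
    evU 𝒢 f = ev (uniformBelow (𝒢.p - 1)) fun m => f ((m + 1 : ℕ) : ZMod 𝒢.p) := by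
  have := ev_uniformBelow_eq_units (p := 𝒢.p) fun m => f (m : ZMod 𝒢.p)
  rw [this]
  simp only [ZMod.natCast_zmod_val]
  rfl

theorem _root_.SynchAgg.Comp.restrict {ι : Type*} {S U : Set ι} {μ : ι → ℕ} {x y : ι → Data}
    (h : Comp S μ x y) (hU : U ⊆ S) :
    Comp Set.univ (fun u : {i // i ∈ U} => μ u) (fun u => x u) fun u => y u :=
  h.reindex fun u _ => ⟨u.1, hU u.2, rfl, rfl, le_rfl⟩

variable {Gen : BilinearGenerator}

/-- The bound for the length of the objects in the simulation. -/
noncomputable def simBound (Gen : BilinearGenerator) (q P : Polynomial ℕ) : Polynomial ℕ :=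
  .X + 4 * Gen.bound + P + 7 * q + 30

theorem eval_simBound (q P : Polynomial ℕ) (n : ℕ) : (simBound Gen q P).eval n =
    n + 4 * Gen.bound.eval n + P.eval n + 7 * q.eval n + 30 := by
  simp [simBound]

/-- An instance with guesses for the number of periods, the period, the position, and two exponents. -/
abbrev Guess (Gen : BilinearGenerator) : Type := ((((Inst Gen × ℕ) × ℕ) × ℕ) × ℕ) × ℕ

/-- The guesses in the ranges from which they are sampled. -/
abbrev guesses (Gen : BilinearGenerator) (N : ℕ → ℕ) : Set (Guess Gen) :=
  sampled (sampled (sampled (sampled (sampled (Inst.valid Gen) fun i => N i.n)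
    fun u => N u.1.n) fun u => N u.1.1.n) fun u => u.1.1.1.grp.p) fun u => u.1.1.1.1.grp.p - 1

/-- The instance and the guesses as data. -/
abbrev Guess.data : Guess Gen → Data :=
  sampledData (sampledData (sampledData (sampledData (sampledData Inst.data))))

/-- The guesses with which the simulation is started. -/
def admissible (Gen : BilinearGenerator) (N T : ℕ → ℕ) : Set (Guess Gen) :=
  {u | u ∈ guesses Gen N ∧
    u.1.1.1.1.2 = T u.1.1.1.1.1.n ∧ 1 ≤ u.1.1.1.2 ∧ u.1.1.1.2 ≤ T u.1.1.1.1.1.n}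

/-- The initial state of the simulator for a guess. -/
noncomputable def Guess.start {N T : ℕ → ℕ} (b : ℕ → ℕ) (u : {u // u ∈ admissible Gen N T}) :
    LoopPoint Gen :=
  u.1.1.1.1.1.1.start (N u.1.1.1.1.1.1.n) (b u.1.1.1.1.1.1.n) (T u.1.1.1.1.1.1.n)
    ⟨u.1.1.1.1.2, u.2.2.2⟩ u.1.1.1.2 u.1.1.2 ((u.1.2 + 1 : ℕ))

/-- One program samples the number of periods, the period, the place and the two exponents, and then
runs the simulator. The number of periods is sampled because `T` is only bounded by a polynomial and
not supposed to be computable. Since one program serves all `ts` and `js`, each of the three guesses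
costs a factor `N`, whereas the exponents are meant to be random and cost nothing. -/
theorem exists_reduction (A : Prog) (q P : Polynomial ℕ) {T : ℕ → ℕ} (hT : ∀ n, T n ≤ P.eval n) :
    ∃ (B : Prog) (r : Polynomial ℕ), ∀ i ∈ Inst.valid Gen, ∀ ts : Period (T i.n),
      ∀ js < (simBound Gen q P).eval i.n,
      (evZ i.grp fun mh => evU i.grp fun sh => simVal A (q.eval i.n)
        (i.start ((simBound Gen q P).eval i.n) (q.eval i.n) (T i.n) ts js mh sh).P i.pay
        (q.eval i.n + q.eval i.n + 2)
        (i.start ((simBound Gen q P).eval i.n) (q.eval i.n) (T i.n) ts js mh sh).c) ≤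
      (((simBound Gen q P).eval i.n : ℕ) : ℝ≥0∞) ^ 3 * wp (r.eval i.n) B i.data i.pay := by
  set N : ℕ → ℕ := fun n => (simBound Gen q P).eval n with hN
  have hid := Comp.id (Inst.bdd_data (Gen := Gen))
  have h1 : Comp (Inst.valid Gen) (fun i => i.n) Inst.data fun i => Data.num i.n :=
    ((hid.op .fst).op .fst).strLength.congr fun i _ => by rw [List.length_replicate]
  have hp0 : Comp (Inst.valid Gen) (fun i => i.n) Inst.data fun i => Data.num i.grp.p :=
    (((hid.op .fst).op .snd).op .fst).congr fun i _ => rfl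
  have hN0 : Comp (Inst.valid Gen) (fun i => i.n) Inst.data fun i => Data.num (N i.n) :=
    h1.polynomial_eval _
  have hN1 := comp_sampled hN0 hN0
  have hN2 := comp_sampled hN1 hN1
  have hp3 := comp_sampled hN2 (comp_sampled hN1 (comp_sampled hN0 hp0))
  have hp4 := comp_sampled hp3 hp3
  have hq4 := hp4.sub (Comp.num_const hp4.bdd_input 1)
  obtain ⟨c, s, hc⟩ := exists_simulator (Gen := Gen) A
  have key : Achieves (Inst.valid Gen) (fun i => i.n) Inst.data _ Inst.pay :=
    Achieves.sample hN0 (Achieves.sample hN1 (Achieves.sample hN2 (Achieves.sample hp3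
      (Achieves.sample hq4 (Achieves.dite (U := admissible Gen N T)
        (V := fun u => simVal A (q.eval u.1.1.1.1.1.1.n) (Guess.start (fun n => q.eval n) u).P
          u.1.1.1.1.1.1.pay (q.eval u.1.1.1.1.1.1.n + q.eval u.1.1.1.1.1.1.n + 2)
          (Guess.start (fun n => q.eval n) u).c) ?_)))))
  · obtain ⟨B, r, hB⟩ := key
    refine ⟨B, r, fun i hi ts js hjs => ?_⟩
    have hpos : 0 < i.grp.p := i.grp.prime.pos
    have hpos' : 0 < i.grp.p - 1 := by
      have := i.grp.prime.two_le
      omega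
    have hle : T i.n < N i.n := by
      have := hT i.n
      have := eval_simBound (Gen := Gen) q P i.n
      simp only [hN]
      omega
    have hts := ts.2.2
    rw [pow_succ, pow_two, mul_assoc, mul_assoc]
    refine le_trans ?_ (mul_le_mul_right (mul_le_mul_right (mul_le_mul_right (hB i hi) _) _) _)
    -- The three guesses that have to be right, in the order of sampling: the number of periods, the
    -- period, the place.
    refine le_trans ?_ (mul_le_mul_right (mul_le_mul_right (le_ev_uniformBelow hle _) _) _)
    refine le_trans ?_ (mul_le_mul_right (le_ev_uniformBelow (hts.trans_lt hle) _) _)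
    refine le_trans ?_ (le_ev_uniformBelow hjs _)
    rw [evZ_eq]
    refine ev_mono_of_support fun m hm => ?_
    have hm' := lt_of_mem_support_uniformBelow hpos hm
    rw [evU_eq]
    refine ev_mono_of_support fun k hk => ?_
    have hk' := lt_of_mem_support_uniformBelow hpos' hk
    rw [dif_pos]
    · rfl
    · exact ⟨⟨⟨⟨⟨⟨hi, hle.le⟩, (hts.trans_lt hle).le⟩, hjs.le⟩, hm'.le⟩, hk'.le⟩, rfl, ts.2⟩
  · set μ : {u // u ∈ admissible Gen N T} → ℕ := fun u => u.1.1.1.1.1.1.n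
    have hp5 := comp_sampled hq4 hp4
    have hid5 := comp_sampled hq4 (comp_sampled hp3 (comp_sampled hN2 (comp_sampled hN1
      (comp_sampled hN0 hid))))
    have hT5 := comp_sampled hq4 (comp_sampled hp3 (comp_sampled hN2 (comp_sampled hN1
      (comp_sampled_snd hN0))))
    have hts5 := comp_sampled hq4 (comp_sampled hp3 (comp_sampled hN2 (comp_sampled_snd hN1)))
    have hjs5 := comp_sampled hq4 (comp_sampled hp3 (comp_sampled_snd hN2))
    have hm5 := comp_sampled hq4 (comp_sampled_snd hp3)
    have hk5 := comp_sampled_snd hq4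
    have hmh := Comp.zmod_natCast hp5 hm5
    have hsh := Comp.zmod_natCast hp5 (hk5.add (Comp.num_const hk5.bdd_input 1))
    have hsub : ∀ {y : Guess Gen → Data},
        Comp (guesses Gen N) (fun u => u.1.1.1.1.1.n) Guess.data y →
          Comp Set.univ μ (fun u => u.1.data) fun u => y u.1 :=
      fun hy => hy.restrict fun u hu => hu.1
    have hTn : Comp Set.univ μ (fun u => u.1.data) fun u : {u // u ∈ admissible Gen N T} =>
        Data.num (T u.1.1.1.1.1.1.n) := (hsub hT5).congr fun u _ => by rw [u.2.2.1]
    have htail := ((hsub hid5).op .snd).op .snd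
    have hpar := (hsub hid5).op .fst
    -- Of the instance only `g`, `g ^ ξ` and `g ^ α` are read, as challenge key, generator and
    -- target base.
    have hg := (hsub hid5).snd.op .fst
    have hγ := htail.op .fst
    have hh := ((((htail.op .snd).op .snd).op .snd).op .snd).op .snd |>.op .fst
    have hbot := Comp.const hg.bdd_input Data.bot
    -- The public parameters contain `T` in unary, which can be written in polynomial time because
    -- `T n ≤ P.eval n`.
    have hst := hbot.pair ((hpar.pair ((hTn.ones ⟨P, fun u _ => hT _⟩).pair (hγ.pair hbot))).pair hg)
    have hpp := hpar.pair ((hsub hp5).pair (hγ.pair (hg.pair (hh.pair ((hsub hts5).pair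
      ((hsub hjs5).pair ((hsub hmh).pair ((hsub hsh).pair hTn))))))))
    have hstart : Comp Set.univ μ (fun u => u.1.data) fun u => (Guess.start (fun n => q.eval n) u).data :=
      ((Comp.const hg.bdd_input (.str [true])).pair (hpp.pair
        ((hbot.pair (hbot.pair (Comp.num_const hg.bdd_input 1))).pair hst))).congr fun u _ => rfl
    -- The final projection strips the tag `⊥` of the final state from the solution.
    refine Achieves.comp ⟨.seq c (.op .snd), (2 * q + 2) * s.comp (simBound Gen q P) +
      (1 + (2 * q + 2) * s.comp (simBound Gen q P) +
        ((2 * q + 2) * s.comp (simBound Gen q P) + 2)), fun u _ => ?_⟩ hstart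
    have hgood : (Guess.start (fun n => q.eval n) u).Good _ :=
      Inst.good_start u.2.1.1.1.1.1.1 (by
        have := hT u.1.1.1.1.1.1.n
        have := eval_simBound (Gen := Gen) q P u.1.1.1.1.1.1.n
        simp only [hN]
        omega) _ u.2.1.1.1.2 _ _
    have hsim := hc _ _ hgood fun o => u.1.1.1.1.1.1.pay (Op.snd.eval o)
    refine hsim.trans ((wp_le_wp_seq_op _ c .snd _ _).trans (wp_mono_budget (le_of_eq ?_) _ _ _))
    simp only [Polynomial.eval_add, Polynomial.eval_mul, Polynomial.eval_comp, Polynomial.eval_one,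
      Polynomial.eval_ofNat, two_mul]
    rfl

/-! ### Solutions of the 1-MSDH-2 problem, and the bound for one instance -/

variable {Gen : BilinearGenerator}

theorem pairingGroup_two_ne_zero {𝒢 : PairingGroup} (h : 𝒢.p ≠ 2) : (2 : ZMod 𝒢.p) ≠ 0 := by
  intro h2
  have : ((2 : ℕ) : ZMod 𝒢.p) = 0 := by exact_mod_cast h2
  rw [ZMod.natCast_eq_zero_iff] at this
  exact h ((Nat.prime_dvd_prime_iff_eq 𝒢.prime Nat.prime_two).1 this)

theorem shift_ne_zero {𝒢 : PairingGroup} (h : 𝒢.p ≠ 2) (γ vk : 𝒢.G) : shift γ vk ≠ 0 := by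
  unfold shift
  split_ifs
  · exact pairingGroup_two_ne_zero h
  · exact one_ne_zero

/-- The shift `1` fails only if `x = -1`, which is visible in the group as `γ = vk ^ (-1)`; then the
shift `2` gives `x + 2 = 1`. It is nonzero because `p ≠ 2`. -/
theorem add_shift_ne_zero {𝒢 : PairingGroup} {g : 𝒢.G} (hg : g ≠ 1) (x : ZMod 𝒢.p) :
    x + shift (𝒢.exp g x) g ≠ 0 := by
  unfold shift
  split_ifs with h
  · rw [𝒢.exp_injective hg h]
    norm_num
  · intro hx
    exact h (by rw [eq_neg_of_add_eq_zero_left hx])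

/-- With the base `g ^ (x + w)` and `P = 1`, the first power is `g` itself and the second is `g ^ (a
* (x + w) / x)`, the product of `g ^ a` and the `w`-th power of `g ^ (a / x)`. The constant
polynomial `1` is relatively prime to everything. -/
theorem msdhSolution_solution {𝒢 : PairingGroup} (hp : 𝒢.p ≠ 2) {T : ℕ} {g : 𝒢.G} (hg : g ≠ 1)
    (a : ZMod 𝒢.p) {x : ZMod 𝒢.p} (hx : x ≠ 0) (ts : Period T) (js : ℕ) (mh sh : ZMod 𝒢.p) :
    MSDHSolution 𝒢 a x (solution ⟨𝒢.exp g x, g, 𝒢.exp g a, ts, js, mh, sh⟩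
      (𝒢.exp (𝒢.exp g a) x⁻¹)) := by
  have hw := add_shift_ne_zero hg x
  refine ⟨shift (𝒢.exp g x) g, 1, 𝒢.exp g (x + shift (𝒢.exp g x) g), shift_ne_zero hp _ _, ?_, ?_,
    isCoprime_one_right, hw, ?_, ?_⟩
  · exact Polynomial.degree_one_le.trans zero_le_one
  · rwa [Ne, 𝒢.exp_eq_one_iff hg]
  · simpa using hx
  · simp only [solution, Polynomial.coeff_one_zero, Polynomial.eval_one, mul_one,
      PairingGroup.exp_exp, mul_inv_cancel₀ hw, PairingGroup.exp_one, ← PairingGroup.exp_add]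
    rw [Polynomial.coeff_one, if_neg (by norm_num)]
    congr 6
    field_simp

/-- For `x = 1`, `w = 1` and the constant polynomial `P = 2`, both denominators are `2`; with the
base `g ^ 2` the required powers are `g` and `g ^ a`, which are part of the instance. -/
theorem msdhSolution_one {𝒢 : PairingGroup} (hp : 𝒢.p ≠ 2) {g : 𝒢.G} (hg : g ≠ 1)
    (a : ZMod 𝒢.p) : MSDHSolution 𝒢 a 1 (Data.ofList [Data.num 1, .pair (Data.num 2) (Data.num 0),
      𝒢.enc g, 𝒢.enc (𝒢.exp g a)]) := by
  have h2 := pairingGroup_two_ne_zero hp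
  have hlt : 2 < 𝒢.p := lt_of_le_of_ne 𝒢.prime.two_le (Ne.symm hp)
  have h1' : 𝒢.encZ 1 = Data.num 1 := by
    have : Fact (1 < 𝒢.p) := ⟨𝒢.prime.one_lt⟩
    rw [PairingGroup.encZ, ZMod.val_one]
  have h2' : 𝒢.encZ 2 = Data.num 2 := by
    rw [PairingGroup.encZ, show (2 : ZMod 𝒢.p) = ((2 : ℕ) : ZMod 𝒢.p) by norm_num,
      ZMod.val_natCast_of_lt hlt]
  refine ⟨1, Polynomial.C 2, 𝒢.exp g 2, one_ne_zero, ?_, ?_, ?_, ?_, ?_, ?_⟩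
  · exact Polynomial.degree_C_le.trans zero_le_one
  · rwa [Ne, 𝒢.exp_eq_one_iff hg]
  · exact ⟨0, Polynomial.C 2⁻¹, by rw [zero_mul, zero_add, ← Polynomial.C_mul, inv_mul_cancel₀ h2,
      Polynomial.C_1]⟩
  · norm_num [h2]
  · simpa using h2
  · simp only [Polynomial.coeff_C_zero, Polynomial.eval_C, one_mul, PairingGroup.exp_exp, h1', h2']
    rw [Polynomial.coeff_C, if_neg one_ne_zero, one_add_one_eq_two, mul_inv_cancel₀ h2,
      PairingGroup.exp_one, mul_comm a, mul_inv_cancel_left₀ h2]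
    simp [PairingGroup.encZ]

/-- The probability that `A` wins the game with public parameters `pp` and key pair `(vk, sk)`. -/
noncomputable def forgeVal (A : Prog) (n T b : ℕ) (pp : PP Gen) (vk : (Gen.grp pp.1).G)
    (sk : (ZMod (Gen.grp pp.1).p)ˣ) : ℝ≥0∞ :=
  ev ((sasLLY Gen n T).interact pp vk sk A b b Data.bot
    (.pair ((sasLLY Gen n T).encPP pp) ((sasLLY Gen n T).encVK pp vk))
    { table := fun _ => none, L := ∅, Q := ∅, tctr := 1 }) fun r => ind (r = true)

/-- The payoff is a sum over at most `T * N` pairs `(ts, js)` plus the collision term. Each pair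
contributes at most `2 * c`, and the `4 * b` possible queries collide with probability at most `N /
p` each. With the empty table of the beginning, `evGuess` is the unconditional choice of `mh` and
`sh`. -/
theorem forgeVal_le {A : Prog} {n T b N : ℕ} {pp : PP Gen} {vk h : (Gen.grp pp.1).G}
    {sk : (ZMod (Gen.grp pp.1).p)ˣ} {η : ZMod (Gen.grp pp.1).p} {pay : Data → ℝ≥0∞}
    (hvk : vk = (Gen.grp pp.1).exp pp.2.1 sk) (hh : h = (Gen.grp pp.1).exp pp.2.1 η) (hη : η ≠ 0)
    (hpay : ∀ (ts : Period T) (js : ℕ) mh sh,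
      1 ≤ pay (solution ⟨pp.2.1, vk, h, ts, js, mh, sh⟩ ((Gen.grp pp.1).exp h sk)))
    (hN : 4 * b + 3 ≤ N) {c : ℝ≥0∞}
    (hc : ∀ ts : Period T, ∀ js < N, (evZ (Gen.grp pp.1) fun mh => evU (Gen.grp pp.1) fun sh =>
      simVal A b ⟨pp.2.1, vk, h, ts, js, mh, sh⟩ pay (b + b + 2) (.run Data.bot
        (.pair ((sasLLY Gen n T).encPP pp) ((sasLLY Gen n T).encVK pp vk)) ⟨[], [], 1⟩)) ≤ c) :
    forgeVal A n T b pp vk sk ≤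
      (T * N * 2 : ℕ) * c + (4 * b * N : ℕ) * ((Gen.grp pp.1).p : ℝ≥0∞)⁻¹ := by
  set S : Ghost (Gen.grp pp.1) T := ⟨[], [], [], 1⟩ with hS
  have hlen : S.tbl.length + 3 * b + b + 3 ≤ N := by
    show 0 + 3 * b + b + 3 ≤ N
    omega
  have hrel : Related (Gen := Gen) (n := n) (T := T) (pp := pp)
      { table := fun _ => none, L := ∅, Q := ∅, tctr := 1 } S :=
    ⟨fun q => Or.inl ⟨rfl, rfl⟩, fun X hX => hX.elim, fun e he => (by cases he), rfl⟩
  have hinv : Invariant pp.2.1 S :=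
    ⟨fun e he => (by cases he), fun e he => (by cases he), fun e he => (by cases he),
      fun e he => by cases he⟩
  refine (ev_interact_le hvk b Data.bot _ _ S hrel hinv hlen).trans ?_
  unfold unionPay
  rw [gameVal_add, gameVal_sum]
  refine add_le_add ?_ ((gameVal_collision_le b Data.bot _ S hlen).trans ?_)
  · have hcard : ((Finset.univ : Finset (Period T)) ×ˢ Finset.range N).card ≤ T * N := by
      rw [Finset.card_product, Finset.card_range]
      exact Nat.mul_le_mul_right _ card_period_le
    refine (Finset.sum_le_card_nsmul _ _ (2 * c) fun g hg => ?_).trans ?_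
    · have hjs := Finset.mem_range.1 (Finset.mem_product.1 hg).2
      refine (gameVal_guessPay_le hh hvk hη (hpay g.1 g.2) b Data.bot _ S
        (fun s hs => by cases hs) (b + b + 2) le_rfl).trans ?_
      have halive : Alive g.1 g.2 S := fun e he => by cases he
      rw [ind_of halive, one_mul]
      refine mul_le_mul_right (le_trans (le_of_eq ?_) (hc g.1 g.2 hjs)) _
      show ev (PMF.uniformOfFintype _) _ = _
      refine congrArg _ (funext fun mh => ?_)
      show ev ((PMF.uniformOfFintype _).map _) _ = _
      rw [ev_map]
      rfl
    · rw [nsmul_eq_mul, ← mul_assoc, Nat.cast_mul (T * N)]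
      gcongr
      norm_num
  · have hcoll : ¬ Collision S.tbl := by
      rintro ⟨t, m, m', z, -, hm, -⟩
      cases hm
    rw [ind_of_not hcoll, zero_add, ← mul_assoc, ← Nat.cast_mul]
    gcongr
    omega

/-! ### The game that is embedded in an instance -/

namespace Inst

theorem pow_ne_one (i : Inst Gen) (c : (ZMod i.grp.p)ˣ) : i.pow c ≠ 1 := by
  rw [pow, Ne, i.grp.exp_eq_one_iff i.g.2]
  exact c.ne_zero

/-- The public parameters with generator `g ^ ξ`. -/
def pp (i : Inst Gen) : PP Gen := ⟨i.d, i.pow i.ξ, i.pow_ne_one i.ξ⟩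

/-- With the generator `γ = g ^ ξ` the key `g` belongs to the secret exponent `1 / ξ`, and `g ^ α =
γ ^ η` for `η = α / ξ ≠ 0`. The element to be extracted, `g ^ α` to the power of the signing key, is
then `g ^ (α / ξ)`. -/
theorem forgeVal_pp_le {A : Prog} {T b N : ℕ} (i : Inst Gen) (hi : i ∈ valid Gen)
    (hN : 4 * b + 3 ≤ N) {c : ℝ≥0∞} (hc : ∀ ts : Period T, ∀ js < N,
      (evZ i.grp fun mh => evU i.grp fun sh => simVal A b (i.start N b T ts js mh sh).P i.pay
        (b + b + 2) (i.start N b T ts js mh sh).c) ≤ c) :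
    forgeVal A i.n T b i.pp i.g.1 i.ξ⁻¹ ≤
      (T * N * 2 : ℕ) * c + (4 * b * N : ℕ) * (i.grp.p : ℝ≥0∞)⁻¹ := by
  have hsk : ((i.ξ⁻¹ : (ZMod i.grp.p)ˣ) : ZMod i.grp.p) = (i.ξ : ZMod i.grp.p)⁻¹ :=
    Units.val_inv_eq_inv_val _
  have hξ : (i.ξ : ZMod i.grp.p) ≠ 0 := i.ξ.ne_zero
  have hvk : i.g.1 = i.grp.exp (i.pow i.ξ) (i.ξ⁻¹ : (ZMod i.grp.p)ˣ) := by
    rw [hsk, pow, PairingGroup.exp_exp, mul_inv_cancel₀ hξ, PairingGroup.exp_one]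
  have hh : i.pow i.α = i.grp.exp (i.pow i.ξ) ((i.ξ⁻¹ * i.α : (ZMod i.grp.p)ˣ) : ZMod i.grp.p) := by
    rw [Units.val_mul, hsk, pow, pow, PairingGroup.exp_exp, mul_inv_cancel_left₀ hξ]
  have hpay : ∀ (ts : Period T) (js : ℕ) (mh sh : ZMod i.grp.p),
      1 ≤ i.pay (solution ⟨i.pow i.ξ, i.g.1, i.pow i.α, ts, js, mh, sh⟩
        (i.grp.exp (i.pow i.α) (i.ξ⁻¹ : (ZMod i.grp.p)ˣ))) := fun ts js mh sh => by
    rw [hsk]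
    exact (ind_of (msdhSolution_solution hi.2 i.g.2 (i.α : ZMod i.grp.p) hξ ts js mh sh)).ge
  exact forgeVal_le (pp := i.pp) hvk hh (Units.ne_zero _) hpay hN hc

end Inst

/-! ### Averaging over random instances -/

variable {Gen : BilinearGenerator}

/-- The expected value of `f` at a random instance. -/
noncomputable def evInst (Gen : BilinearGenerator) (n : ℕ) (f : Inst Gen → ℝ≥0∞) : ℝ≥0∞ :=
  ev (Gen.gen n) fun d => ev (PMF.uniformOfFintype (Gen.grp d).Gstar) fun g =>
    ev (PMF.uniformOfFintype (ZMod (Gen.grp d).p)ˣ) fun α =>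
      ev (PMF.uniformOfFintype (ZMod (Gen.grp d).p)ˣ) fun β =>
        ev (PMF.uniformOfFintype (ZMod (Gen.grp d).p)ˣ) fun ξ => f ⟨n, d, g, α, β, ξ⟩

theorem evInst_mono {n : ℕ} {f g : Inst Gen → ℝ≥0∞}
    (h : ∀ i, i.n = n → i.d ∈ (Gen.gen n).support → f i ≤ g i) :
    evInst Gen n f ≤ evInst Gen n g :=
  ev_mono_of_support fun _ hd => ev_mono fun _ => ev_mono fun _ => ev_mono fun _ => ev_mono fun _ =>
    h _ rfl hd

theorem evInst_add (n : ℕ) (f g : Inst Gen → ℝ≥0∞) :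
    evInst Gen n (fun i => f i + g i) = evInst Gen n f + evInst Gen n g := by
  simp only [evInst, ev_add]

theorem evInst_mul_left (n : ℕ) (c : ℝ≥0∞) (f : Inst Gen → ℝ≥0∞) :
    evInst Gen n (fun i => c * f i) = c * evInst Gen n f := by
  simp only [evInst, ev_mul_left]

theorem msdhGame_apply (n : ℕ) (B : Prog) (b : ℕ) :
    msdhGame Gen n B b true = evInst Gen n fun i => wp b B i.data i.pay := by
  classical
  rw [apply_eq_ev]
  unfold msdhGame
  simp only [ev_bind_apply]
  refine congrArg _ (funext fun d => congrArg _ (funext fun g => congrArg _ (funext fun α =>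
    congrArg _ (funext fun β => congrArg _ (funext fun ξ => ?_)))))
  refine Eq.trans ?_ (ev_output B b (Inst.data ⟨n, d, g, α, β, ξ⟩)
    (fun o => o.elim 0 (Inst.pay ⟨n, d, g, α, β, ξ⟩)) rfl)
  refine congrArg _ (funext fun o => ?_)
  cases o with
  | none => exact (ev_pure _ _).trans (by simp)
  | some o =>
    refine (ev_pure _ _).trans ?_
    simp [Inst.pay, ind]

theorem eufGame_apply (n T : ℕ) (A : Prog) (b : ℕ) :
    (sasLLY Gen n T).eufGame A b true = ev (Gen.gen n) fun d =>
      ev (PMF.uniformOfFintype (Gen.grp d).Gstar) fun γ =>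
        ev (PMF.uniformOfFintype (ZMod (Gen.grp d).p)ˣ) fun sk =>
          forgeVal A n T b ⟨d, γ⟩ ((Gen.grp d).exp γ.1 sk) sk := by
  classical
  rw [apply_eq_ev]
  unfold SAS.eufGame
  rw [ev_bind_apply]
  refine (ev_bind_apply (Gen.gen n) _ _).trans (congrArg _ (funext fun d => ?_))
  refine (ev_bind_apply (PMF.uniformOfFintype (Gen.grp d).Gstar) _ _).trans
    (congrArg _ (funext fun γ => ?_))
  refine (ev_pure_apply _ _).trans ((ev_bind_apply (keyGen (Gen.grp d) γ.1) _ _).trans ?_)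
  refine (ev_bind_apply (PMF.uniformOfFintype (ZMod (Gen.grp d).p)ˣ) _ _).trans
    (congrArg _ (funext fun sk => ?_))
  refine (ev_pure_apply _ _).trans (congrArg _ (funext fun r => ?_))
  cases r <;> simp [ind]

/-- Raising to a power is a permutation of `𝔾*`. -/
noncomputable def expEquiv (𝒢 : PairingGroup) (ξ : (ZMod 𝒢.p)ˣ) : 𝒢.Gstar ≃ 𝒢.Gstar where
  toFun g := ⟨𝒢.exp g.1 ξ, by rw [Ne, 𝒢.exp_eq_one_iff g.2]; exact ξ.ne_zero⟩
  invFun g := ⟨𝒢.exp g.1 (ξ⁻¹ : (ZMod 𝒢.p)ˣ), by rw [Ne, 𝒢.exp_eq_one_iff g.2]; exact Units.ne_zero _⟩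
  left_inv g := Subtype.ext (by simp only [PairingGroup.exp_exp, Units.mul_inv, PairingGroup.exp_one])
  right_inv g := Subtype.ext (by simp only [PairingGroup.exp_exp, Units.inv_mul, PairingGroup.exp_one])

/-- For uniform `g` and `ξ` the pair `(g ^ ξ, ξ⁻¹)` is again uniform, because raising to the power
`ξ` permutes `𝔾*` and inversion permutes the units. So the embedded game has exactly the
distribution of the real one. -/
theorem eufGame_apply_eq_evInst (n T : ℕ) (A : Prog) (b : ℕ) :
    (sasLLY Gen n T).eufGame A b true =
      evInst Gen n fun i => forgeVal A i.n T b i.pp i.g.1 i.ξ⁻¹ := by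
  rw [eufGame_apply]
  refine congrArg _ (funext fun d => ?_)
  rw [ev_comm]
  -- The embedded game does not depend on `α` and `β`, so averaging over them changes nothing; the
  -- values `1` are placeholders.
  have hconst : ∀ g : (Gen.grp d).Gstar, _ = _ := fun g =>
    (ev_const (PMF.uniformOfFintype (ZMod (Gen.grp d).p)ˣ) _).trans
      (ev_const (PMF.uniformOfFintype (ZMod (Gen.grp d).p)ˣ)
        (ev (PMF.uniformOfFintype (ZMod (Gen.grp d).p)ˣ) fun ξ =>
          forgeVal A n T b (Inst.pp ⟨n, d, g, 1, 1, ξ⟩) g.1 ξ⁻¹))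
  refine Eq.trans ?_ (congrArg _ (funext fun g => (hconst g).symm))
  refine Eq.trans ?_ (ev_comm _ _ _)
  rw [← ev_uniform_equiv (Equiv.inv (ZMod (Gen.grp d).p)ˣ)]
  refine congrArg _ (funext fun ξ => ?_)
  rw [← ev_uniform_equiv (expEquiv (Gen.grp d) ξ)]
  refine congrArg _ (funext fun g => ?_)
  have hg : (Gen.grp d).exp ((Gen.grp d).exp g.1 ξ) (ξ⁻¹ : (ZMod (Gen.grp d).p)ˣ) = g.1 := by
    rw [PairingGroup.exp_exp, Units.mul_inv, PairingGroup.exp_one]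
  show forgeVal A n T b ⟨d, expEquiv (Gen.grp d) ξ g⟩ ((Gen.grp d).exp ((Gen.grp d).exp g.1 ξ)
    (ξ⁻¹ : (ZMod (Gen.grp d).p)ˣ)) ξ⁻¹ = _
  rw [hg]
  rfl

theorem exists_guess_one : ∃ (B : Prog) (r : Polynomial ℕ), ∀ i ∈ Inst.valid Gen,
    ind (i.ξ = 1) ≤ wp (r.eval i.n) B i.data i.pay := by
  have hid := Comp.id (Inst.bdd_data (Gen := Gen))
  have hg := hid.snd.op .fst
  have hbot := Comp.const hg.bdd_input Data.bot
  have hnum := fun k => Comp.num_const hg.bdd_input k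
  have ha := ((((((hid.op .snd).op .snd).op .snd).op .snd).op .snd).op .snd).op .snd |>.op .fst
  obtain ⟨B, r, h⟩ := (hnum 1).pair (((hnum 2).pair (hnum 0)).pair (hg.pair (ha.pair hbot)))
  refine ⟨B, r, fun i hi => le_trans ?_ (h i hi i.pay)⟩
  refine ind_le_iff.2 fun hξ => ?_
  refine (ind_of ?_).ge
  have := msdhSolution_one hi.2 i.g.2 (i.α : ZMod i.grp.p)
  rw [hξ]
  exact this

theorem inv_le_ev_ind_one (p : ℕ) [hp : Fact p.Prime] :
    (p : ℝ≥0∞)⁻¹ ≤ ev (PMF.uniformOfFintype (ZMod p)ˣ) fun ξ => ind (ξ = 1) := by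
  classical
  have h : (PMF.uniformOfFintype (ZMod p)ˣ) 1 = _ := apply_eq_ev _ _
  refine le_trans ?_ (h.le.trans (le_of_eq (congrArg _ (funext fun ξ => ?_))))
  · rw [PMF.uniformOfFintype_apply, ZMod.card_units]
    refine ENNReal.inv_le_inv.2 ?_
    exact_mod_cast Nat.sub_le p 1
  · unfold ind
    congr

/-- The adversary always answers as if `ξ = 1`, which happens with probability `1 / (p - 1)`. In
this way the assumption itself makes the average of `1 / p` negligible, without any lower bound on
`p`. -/
theorem exists_inv_order_le (hp : ∀ n : ℕ, ∀ d ∈ (Gen.gen n).support, (Gen.grp d).p ≠ 2) :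
    ∃ (B : Prog) (r : Polynomial ℕ), ∀ n, (evInst Gen n fun i => (i.grp.p : ℝ≥0∞)⁻¹) ≤
      msdhGame Gen n B (r.eval n) true := by
  obtain ⟨B, r, h⟩ := exists_guess_one (Gen := Gen)
  refine ⟨B, r, fun n => ?_⟩
  rw [msdhGame_apply]
  refine le_trans ?_ (evInst_mono (n := n) (f := fun i : Inst Gen => ind (i.ξ = 1)) fun i hi hd => ?_)
  · unfold evInst
    refine ev_mono fun d => ev_mono fun g => ev_mono fun α => ev_mono fun β => ?_
    refine le_trans (le_of_eq ?_) (inv_le_ev_ind_one (Gen.grp d).p)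
    exact ev_const (PMF.uniformOfFintype (ZMod (Gen.grp d).p)ˣ) ((Gen.grp d).p : ℝ≥0∞)⁻¹
  · subst hi
    exact h i ⟨hd, hp _ _ hd⟩

/-- The winning probability is bounded by the success probabilities of two adversaries against the
1-MSDH-2 assumption. -/
theorem exists_eufGame_le (hp : ∀ n : ℕ, ∀ d ∈ (Gen.gen n).support, (Gen.grp d).p ≠ 2)
    {T : ℕ → ℕ} {P : Polynomial ℕ} (hT : ∀ n, T n ≤ P.eval n) (A : Prog) (q : Polynomial ℕ) :
    ∃ (B B' : Prog) (r r' K K' : Polynomial ℕ), ∀ n,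
      (sasLLY Gen n (T n)).eufGame A (q.eval n) true ≤
        (K.eval n : ℕ) * msdhGame Gen n B (r.eval n) true +
          (K'.eval n : ℕ) * msdhGame Gen n B' (r'.eval n) true := by
  obtain ⟨B, r, h⟩ := exists_reduction (Gen := Gen) A q P hT
  obtain ⟨B', r', h'⟩ := exists_inv_order_le hp
  set N := simBound Gen q P with hN
  -- `P * N` bounds the number of pairs `(ts, js)`, `2` is the loss for an unplanted `mh`, and `N ^
  -- 3` stands for the guesses of the reduction. The second factor comes from collisions among at
  -- most `4 * q` queries.
  refine ⟨B, B', r, r', P * N * 2 * N ^ 3, 4 * q * N, fun n => ?_⟩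
  refine le_trans ?_ (add_le_add_right (mul_le_mul_right (h' n) _) _)
  rw [eufGame_apply_eq_evInst, msdhGame_apply, ← evInst_mul_left, ← evInst_mul_left, ← evInst_add]
  refine evInst_mono fun i hi hd => ?_
  subst hi
  have hv : i ∈ Inst.valid Gen := ⟨hd, hp _ _ hd⟩
  refine (Inst.forgeVal_pp_le i hv (N := N.eval i.n) ?_ (h i hv)).trans ?_
  · rw [hN, eval_simBound]
    omega
  · rw [← mul_assoc]
    refine add_le_add (mul_le_mul_left ?_ _) (mul_le_mul_left ?_ _)
    · rw [← Nat.cast_pow, ← Nat.cast_mul, Nat.cast_le]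
      simp only [Polynomial.eval_mul, Polynomial.eval_pow, Polynomial.eval_ofNat]
      have := hT i.n
      gcongr
    · simp

end LLY

/-! ### Negligible functions -/

theorem toReal_apply_true_le {μ : PMF Bool} {ν ν' : PMF Bool} {k k' : ℕ}
    (h : μ true ≤ k * ν true + k' * ν' true) :
    (μ true).toReal ≤ k * (ν true).toReal + k' * (ν' true).toReal := by
  have h1 : (k : ℝ≥0∞) * ν true ≠ ⊤ := ENNReal.mul_ne_top (ENNReal.natCast_ne_top k) (ν.apply_ne_top _)
  have h2 : (k' : ℝ≥0∞) * ν' true ≠ ⊤ :=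
    ENNReal.mul_ne_top (ENNReal.natCast_ne_top k') (ν'.apply_ne_top _)
  have := ENNReal.toReal_mono (ENNReal.add_ne_top.2 ⟨h1, h2⟩) h
  rwa [ENNReal.toReal_add h1 h2, ENNReal.toReal_mul, ENNReal.toReal_mul, ENNReal.toReal_natCast,
    ENNReal.toReal_natCast] at this

theorem Negligible.polynomial_mul {f : ℕ → ℝ} (hf : Negligible f) (K : Polynomial ℕ) :
    Negligible fun n => (K.eval n : ℕ) * f n := by
  have := Asymptotics.SuperpolynomialDecay.polynomial_mul hf (K.map (Nat.castRingHom ℝ))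
  refine this.congr fun n => ?_
  simp

theorem Negligible.of_le {f g : ℕ → ℝ} (hg : Negligible g) (hf : ∀ n, 0 ≤ f n)
    (h : ∀ n, f n ≤ g n) : Negligible f :=
  Asymptotics.SuperpolynomialDecay.trans_abs_le hg fun n => by
    rw [abs_of_nonneg (hf n)]
    exact (h n).trans (le_abs_self _)

end SynchAgg

theorem corollary1 (Gen : SynchAgg.BilinearGenerator)
    (hp : ∀ n : ℕ, ∀ d ∈ (Gen.gen n).support, (Gen.grp d).p ≠ 2)
    (T : ℕ → ℕ) (hT : ∃ P : Polynomial ℕ, ∀ n : ℕ, T n ≤ P.eval n)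
    (h : SynchAgg.MSDH Gen) :
    SynchAgg.EUFCMA (fun n : ℕ => SynchAgg.sasLLY Gen n (T n)) := by
  obtain ⟨P, hP⟩ := hT
  intro A q
  obtain ⟨B, B', r, r', K, K', hle⟩ := SynchAgg.LLY.exists_eufGame_le hp hP A q
  refine SynchAgg.Negligible.of_le (Asymptotics.SuperpolynomialDecay.add
    (SynchAgg.Negligible.polynomial_mul (h B r) K) (SynchAgg.Negligible.polynomial_mul (h B' r') K'))
    (fun n => ENNReal.toReal_nonneg) fun n => SynchAgg.toReal_apply_true_le (hle n)
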